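/- A $k$-uniform hypergraph is a pair $H=(V,E)$ with $V$ a finite set and $E$ a set of $k$-element subsets (edges) of $V$. A set $S\subseteq V$ is (weakly) independent if no edge is contained in $S$, equivalently if every edge has at most $k-1$ vertices in $S$; the weak independence number $\alpha(H)$ is the largest cardinality of an independent set. For $p\in(0,1)$ the binomial random hypergraph $H(n,k,p)$ is the random $k$-uniform hypergraph on a fixed set of $n$ vertices in which each $k$-subset is an edge independently with probability $p$, i.e. $\mathbb P(H(n,k,p)=H')=p^{|E'|}(1-p)^{\binom nk-|E'|}$ for each $k$-uniform hypergraph $H'$ on these vertices with edge set $E'$. Theorem. Fix an integer $k\ge 2$ and a real $\varepsilon>0$, and let $p=p(n)$ satisfy, for all sufficiently large $n$, $0<p(n)<1$ and $$p(n)\ \ge\ n^{-\frac{(k-1)k}{k+1}+\varepsilon}.$$ Then $\alpha(H(n,k,p))$ is concentrated on two values: there is a sequence of integers $t=t(n)\ge 0$ such that $$\mathbb P\bigl(\alpha(H(n,k,p(n)))\in\{t(n),t(n)+1\}\bigr)\to 1\qquad(n\to\infty).$$ -/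

import Mathlib

open Filter Topology

/-- A set `S` of vertices is `j`-independent in `H` if every edge of `H` has at most `j` vertices
in common with `S`. -/
def Hypergraph.IsJIndep {V : Type*} (H : Hypergraph V) (j : ℕ) (S : Finset V) : Prop :=
  (S : Set V) ⊆ H.vertexSet ∧ ∀ A ∈ H.edgeSet, (A ∩ (S : Set V)).ncard ≤ j

/-- The `j`-independence number: the largest cardinality of a `j`-independent set
(the vertex set is finite in all uses, so the supremum is a maximum). -/
noncomputable def Hypergraph.jIndepNum {V : Type*} (H : Hypergraph V) (j : ℕ) : ℕ :=
  sSup {m : ℕ | ∃ S : Finset V, H.IsJIndep j S ∧ S.card = m}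

/-- The weak independence number of a `k`-uniform hypergraph: `k`-uniform means that every edge has
exactly `k` vertices, so a set is `(k - 1)`-independent iff it contains no edge. -/
noncomputable def Hypergraph.weakIndepNum {V : Type*} (k : ℕ) (H : Hypergraph V) : ℕ :=
  H.jIndepNum (k - 1)

/-- The hypergraph on the vertex set `{0, …, n - 1}` whose edges are the members of `E`. -/
def hypergraphOfEdges {n : ℕ} (E : Finset (Finset (Fin n))) : Hypergraph (Fin n) where
  vertexSet := Set.univ
  edgeSet := {A | ∃ e ∈ E, A = (e : Set (Fin n))}
  subset_vertexSet_of_mem_edgeSet' := fun A _ => Set.subset_univ A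

/-- The edge sets of the `k`-uniform hypergraphs on `n` vertices: all sets of `k`-subsets. -/
def uniformEdgeSets (n k : ℕ) : Finset (Finset (Finset (Fin n))) :=
  ((Finset.univ : Finset (Fin n)).powersetCard k).powerset

open Classical in
/-- The probability that the binomial random `k`-uniform hypergraph `H(n, k, p)` belongs to `A`,
where `P(H(n, k, p) = H') = p ^ |E(H')| * (1 - p) ^ (n.choose k - |E(H')|)` for every `k`-uniform
hypergraph `H'` on `n` labelled vertices. -/
noncomputable def binomialHypergraphProb (n k : ℕ) (p : ℝ) (A : Set (Hypergraph (Fin n))) : ℝ :=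
  ∑ E ∈ (uniformEdgeSets n k).filter (fun E => hypergraphOfEdges E ∈ A),
    p ^ E.card * (1 - p) ^ (n.choose k - E.card)

theorem binomialHypergraphProb_univ (n k : ℕ) (p : ℝ) :
    binomialHypergraphProb n k p Set.univ = 1 := by
  have h := Finset.sum_pow_mul_eq_add_pow p (1 - p)
    ((Finset.univ : Finset (Fin n)).powersetCard k)
  simpa [binomialHypergraphProb, uniformEdgeSets] using h

/-- The random variables `X n (H(n, k, p n))` are concentrated on `ℓ n` values: for some sequence
`t`, asymptotically almost surely `X n (H(n, k, p n)) ∈ {t n, t n + 1, …, t n + ℓ n - 1}`. -/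
def IsConcentratedOnValues (k : ℕ) (p : ℕ → ℝ) (X : (n : ℕ) → Hypergraph (Fin n) → ℕ)
    (ℓ : ℕ → ℕ) : Prop :=
  ∃ t : ℕ → ℕ, Tendsto
    (fun n => binomialHypergraphProb n k (p n) {H | X n H ∈ Set.Ico (t n) (t n + ℓ n)})
    atTop (𝓝 1)

/-! Write `d = k - 1`, and let `expIndep n d p s` be the expected number of independent sets of size
`s`. Near the size where this number passes 1, it falls by a power of `n` whenever `s` grows by one,
so two values are all that the independence number should take. If `p ≥ n ^ (-1/200)`, the relevant
sizes are at most `n ^ (1/100)`, and the first and second moments of the plain count prove this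
(`eventually_dense_two_point`).

For smaller `p` the plain count misleads, because independent sets of maximum size come in clusters:
a vertex outside `S` that lies in exactly one edge with vertices of `S` can be exchanged for any of
the `d` other vertices of this edge. If there are `r` such vertices and their edges are disjoint,
then `S` together with them is a set `T` whose inner edges form a matching of size `r`, and the
cluster consists of the `(d + 1) ^ r` sets `T \ R`, with `R` a transversal of the matching. So
clusters have to be counted. `setWt` gives an independent set one factor for each outside vertex: 0,
`1 / (d + 1)` or 1, according to whether the vertex has no, one or more edges into the set. The
weights of a cluster add up to about 1. As different outside vertices see disjoint sets of potential
edges, the expected total weight factorises as `expWeight = expIndep * meanWt ^ (n - s)`.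

Upper bound: if the largest independent sets have size `s`, enlarge one of them to a set `T` of size
`s + r` whose inner edges form a matching of size `r`, with the next size impossible. Then every
outside vertex has at least two edges into `T` (`IsMatched.two_le_deg`). Dividing by the number of
transversals gives `P(α = s) ≤ 4 * expWeight` (`SparseRegime.binExp_indepNum_eq_le`).

Lower bound: the second moment method is applied to the total weight of the sets with `Good`
surroundings. Pairs of near sets contribute at most the mean, since the weights near a good set sum
to at most 1 (`Good.sum_setWt_le_one`). Far pairs are almost independent
(`SparseRegime.far_pair_le`). For the remaining pairs the plain count is small enough
(`SparseRegime.sum_mid_le`).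

The exponent in the hypothesis comes from the far pairs. Two typical sets share about `s ^ 2 / n`
vertices, and about `p * (s ^ 2 / n) ^ (d + 1)` edges are expected among these. Since `p * s ^ d` is
of logarithmic order, this is `n * (s / n) ^ (d + 2)` up to logarithms, which is small exactly if
`p` exceeds `n ^ (-d (d + 1) / (d + 2))` by a power of `n`.

Finally, with `z` a small power of `n`, `expWeight` drops by a factor of at least `z ^ 3` per step.
If `t` satisfies `expWeight t ≥ z > expWeight (t + 1)`, then with high probability size `t` occurs
and size `t + 2` does not. -/

namespace BinomialHypergraph

set_option linter.unusedSectionVars false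

/-! ### Random subsets of a finite set: expectation and independence. -/

section

/-- The indicator of a proposition, as a real number. -/
noncomputable def ind (P : Prop) : ℝ := open Classical in if P then 1 else 0

theorem ind_of {P : Prop} (h : P) : ind P = 1 := by simp [ind, h]

theorem ind_of_not {P : Prop} (h : ¬P) : ind P = 0 := by simp [ind, h]

theorem ind_nonneg (P : Prop) : 0 ≤ ind P := by
  by_cases h : P <;> simp [ind, h]

theorem ind_le_one (P : Prop) : ind P ≤ 1 := by
  by_cases h : P <;> simp [ind, h]

theorem ind_and (P R : Prop) : ind (P ∧ R) = ind P * ind R := by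
  by_cases h : P <;> by_cases h' : R <;> simp [ind, h, h']

theorem ind_mono {P R : Prop} (h : P → R) : ind P ≤ ind R := by
  by_cases hP : P
  · rw [ind_of hP, ind_of (h hP)]
  · rw [ind_of_not hP]; exact ind_nonneg R

theorem ind_not (P : Prop) : ind (¬P) = 1 - ind P := by
  by_cases h : P <;> simp [ind, h]

theorem ind_or_le (P R : Prop) : ind (P ∨ R) ≤ ind P + ind R := by
  by_cases h : P <;> by_cases h' : R <;> simp [ind, h, h']

theorem ind_exists_le_sum {ι : Type*} (s : Finset ι) (P : ι → Prop) :
    ind (∃ i ∈ s, P i) ≤ ∑ i ∈ s, ind (P i) := by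
  by_cases h : ∃ i ∈ s, P i
  · obtain ⟨i, hi, hP⟩ := h
    rw [ind_of ⟨i, hi, hP⟩, ← ind_of hP]
    exact Finset.single_le_sum (f := fun i => ind (P i)) (fun i _ => ind_nonneg _) hi
  · rw [ind_of_not h]
    exact Finset.sum_nonneg fun i _ => ind_nonneg _

theorem ind_forall_eq_prod {ι : Type*} (s : Finset ι) (P : ι → Prop) :
    ind (∀ i ∈ s, P i) = ∏ i ∈ s, ind (P i) := by
  by_cases h : ∀ i ∈ s, P i
  · rw [ind_of h, Finset.prod_eq_one fun i hi => ind_of (h i hi)]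
  · rw [ind_of_not h]
    push Not at h
    obtain ⟨i, hi, hP⟩ := h
    exact (Finset.prod_eq_zero hi (ind_of_not hP)).symm

/-- The expectation of `f E` where `E` is the random subset of `U` that contains each element of
`U` independently with probability `p`. -/
noncomputable def binExp {α : Type*} (p : ℝ) (U : Finset α) (f : Finset α → ℝ) : ℝ :=
  ∑ E ∈ U.powerset, p ^ E.card * (1 - p) ^ (U.card - E.card) * f E

section binExp

variable {α : Type*} {p : ℝ} {U : Finset α}

theorem binExp_add (f g : Finset α → ℝ) :
    binExp p U (fun E => f E + g E) = binExp p U f + binExp p U g := by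
  simp [binExp, mul_add, Finset.sum_add_distrib]

theorem binExp_sub (f g : Finset α → ℝ) :
    binExp p U (fun E => f E - g E) = binExp p U f - binExp p U g := by
  simp [binExp, mul_sub, Finset.sum_sub_distrib]

theorem binExp_const_mul (c : ℝ) (f : Finset α → ℝ) :
    binExp p U (fun E => c * f E) = c * binExp p U f := by
  simp only [binExp, Finset.mul_sum]
  exact Finset.sum_congr rfl fun E _ => by ring

theorem binExp_mul_const (c : ℝ) (f : Finset α → ℝ) :
    binExp p U (fun E => f E * c) = binExp p U f * c := by
  simp only [mul_comm _ c, binExp_const_mul]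

theorem binExp_sum {ι : Type*} (s : Finset ι) (f : ι → Finset α → ℝ) :
    binExp p U (fun E => ∑ i ∈ s, f i E) = ∑ i ∈ s, binExp p U (f i) := by
  simp only [binExp, Finset.mul_sum]
  exact Finset.sum_comm

theorem binExp_congr {f g : Finset α → ℝ} (h : ∀ E ⊆ U, f E = g E) :
    binExp p U f = binExp p U g :=
  Finset.sum_congr rfl fun E hE => by rw [h E (Finset.mem_powerset.1 hE)]

theorem binExp_mono (hp : 0 ≤ p) (hp' : p ≤ 1) {f g : Finset α → ℝ} (h : ∀ E ⊆ U, f E ≤ g E) :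
    binExp p U f ≤ binExp p U g := by
  refine Finset.sum_le_sum fun E hE => ?_
  have : 0 ≤ 1 - p := by linarith
  exact mul_le_mul_of_nonneg_left (h E (Finset.mem_powerset.1 hE)) (by positivity)

theorem binExp_nonneg (hp : 0 ≤ p) (hp' : p ≤ 1) {f : Finset α → ℝ} (h : ∀ E ⊆ U, 0 ≤ f E) :
    0 ≤ binExp p U f := by
  have := binExp_mono (U := U) (f := fun _ => 0) hp hp' h
  simpa [binExp] using this

theorem binExp_apply_card (φ : ℕ → ℝ) :
    binExp p U (fun E => φ E.card) =
      ∑ m ∈ Finset.range (U.card + 1), U.card.choose m * (p ^ m * (1 - p) ^ (U.card - m) * φ m) := by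
  simpa [binExp, nsmul_eq_mul] using
    Finset.sum_powerset_apply_card (fun m => p ^ m * (1 - p) ^ (U.card - m) * φ m) (x := U)

theorem binExp_const (c : ℝ) : binExp p U (fun _ => c) = c := by
  have h := Finset.sum_pow_mul_eq_add_pow p (1 - p) U
  simp only [binExp, ← Finset.sum_mul, h]
  simp

theorem binExp_pow_card (a : ℝ) : binExp p U (fun E => a ^ E.card) = (p * a + (1 - p)) ^ U.card := by
  rw [← Finset.sum_pow_mul_eq_add_pow]
  refine Finset.sum_congr rfl fun E _ => ?_
  rw [mul_pow]; ring

/-- Conditioning on whether `a` is chosen. -/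
theorem binExp_insert [DecidableEq α] {a : α} (ha : a ∉ U) (f : Finset α → ℝ) :
    binExp p (insert a U) f =
      (1 - p) * binExp p U f + p * binExp p U (fun E => f (insert a E)) := by
  simp only [binExp, Finset.sum_powerset_insert ha, Finset.mul_sum]
  congr 1
  · refine Finset.sum_congr rfl fun E hE => ?_
    have h := Finset.card_le_card (Finset.mem_powerset.1 hE)
    rw [Finset.card_insert_of_notMem ha, Nat.sub_add_comm h, pow_succ]; ring
  · refine Finset.sum_congr rfl fun E hE => ?_
    have h' : a ∉ E := fun h => ha (Finset.mem_powerset.1 hE h)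
    rw [Finset.card_insert_of_notMem ha, Finset.card_insert_of_notMem h', Nat.add_sub_add_right,
      pow_succ]
    ring

variable [DecidableEq α]

/-- `f E` depends only on `E ∩ W`. -/
def LocalOn (W : Finset α) {β : Type*} (f : Finset α → β) : Prop := ∀ E, f E = f (E ∩ W)

theorem LocalOn.mono {β : Type*} {W W' : Finset α} {f : Finset α → β} (h : LocalOn W f)
    (hW : W ⊆ W') : LocalOn W' f := fun E => by
  rw [h E, h (E ∩ W'), Finset.inter_assoc, Finset.inter_eq_right.2 hW]

theorem LocalOn.comp {β γ : Type*} {W : Finset α} {f : Finset α → β} (h : LocalOn W f) (g : β → γ) :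
    LocalOn W (fun E => g (f E)) := fun E => by
  show g (f E) = g (f (E ∩ W))
  rw [← h E]

theorem LocalOn.map₂ {β γ δ : Type*} {W : Finset α} {f : Finset α → β} {g : Finset α → γ}
    (hf : LocalOn W f) (hg : LocalOn W g) (F : β → γ → δ) :
    LocalOn W (fun E => F (f E) (g E)) := fun E => by
  show F (f E) (g E) = F (f (E ∩ W)) (g (E ∩ W))
  rw [← hf E, ← hg E]

theorem LocalOn.mul {W : Finset α} {f g : Finset α → ℝ} (hf : LocalOn W f) (hg : LocalOn W g) :
    LocalOn W (fun E => f E * g E) := hf.map₂ hg (· * ·)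

theorem LocalOn.prod {ι : Type*} {W : Finset α} {s : Finset ι} {f : ι → Finset α → ℝ}
    (h : ∀ i ∈ s, LocalOn W (f i)) : LocalOn W (fun E => ∏ i ∈ s, f i E) := fun E =>
  Finset.prod_congr rfl fun i hi => h i hi E

theorem localOn_const {β : Type*} (W : Finset α) (b : β) : LocalOn W (fun _ => b) := fun _ => rfl

theorem localOn_inter {β : Type*} (W : Finset α) (f : Finset α → β) :
    LocalOn W (fun E => f (E ∩ W)) := fun E => by
  simp [Finset.inter_assoc]

/-- Independence of disjoint coordinates, by revealing the elements of `U₂` one at a time. -/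
theorem binExp_union {U₁ U₂ : Finset α} (h : Disjoint U₁ U₂) {f g : Finset α → ℝ}
    (hf : LocalOn U₁ f) (hg : LocalOn U₂ g) :
    binExp p (U₁ ∪ U₂) (fun E => f E * g E) = binExp p U₁ f * binExp p U₂ g := by
  induction U₂ using Finset.induction_on generalizing g with
  | empty =>
    have : ∀ E, g E = g ∅ := fun E => by rw [hg E, Finset.inter_empty]
    rw [Finset.union_empty, funext this, binExp_mul_const, binExp_const]
  | insert a s ha ih =>
    have hd : Disjoint U₁ s := h.mono_right (Finset.subset_insert _ _)
    have ha1 : a ∉ U₁ := fun h1 => Finset.disjoint_left.1 h h1 (Finset.mem_insert_self _ _)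
    have ha2 : a ∉ U₁ ∪ s := by simp [ha1, ha]
    have hfi : ∀ E, f (insert a E) = f E := fun E => by
      rw [hf (insert a E), hf E, Finset.insert_inter_of_notMem ha1]
    have key1 : binExp p (U₁ ∪ s) (fun E => f E * g E) = binExp p U₁ f * binExp p s g := by
      -- The function `g` is local only on `insert a s`. Restricting its argument to `s` makes it
      -- local on `s` and changes no value here, because `a ∉ E`.
      have := ih hd (g := fun E => g (E ∩ s)) (localOn_inter s g)
      rw [binExp_congr (U := s) (g := g)] at this
      · rw [← this]
        refine binExp_congr fun E hE => ?_
        rw [hg E]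
        congr 2
        ext x
        simp only [Finset.mem_inter, Finset.mem_insert]
        constructor
        · rintro ⟨hx, rfl | hx'⟩
          · exact absurd (hE hx) ha2
          · exact ⟨hx, hx'⟩
        · rintro ⟨hx, hx'⟩; exact ⟨hx, Or.inr hx'⟩
      · intro E hE
        rw [Finset.inter_eq_left.2 hE]
    have key2 : binExp p (U₁ ∪ s) (fun E => f (insert a E) * g (insert a E)) =
        binExp p U₁ f * binExp p s (fun E => g (insert a E)) := by
      have := ih hd (g := fun E => g (insert a (E ∩ s))) (localOn_inter s fun E => g (insert a E))
      rw [binExp_congr (U := s) (g := fun E => g (insert a E))] at this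
      · rw [← this]
        refine binExp_congr fun E hE => ?_
        rw [hfi, hg (insert a E)]
        congr 2
        ext x
        simp only [Finset.mem_inter, Finset.mem_insert]
        tauto
      · intro E hE
        rw [Finset.inter_eq_left.2 hE]
    rw [Finset.union_insert, binExp_insert ha2, binExp_insert ha, key1, key2]
    ring

/-- Functions that depend on disjoint parts of `U` are independent. -/
theorem binExp_mul {U₁ U₂ : Finset α} (h : Disjoint U₁ U₂) (h₁ : U₁ ⊆ U) (h₂ : U₂ ⊆ U)
    {f g : Finset α → ℝ} (hf : LocalOn U₁ f) (hg : LocalOn U₂ g) :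
    binExp p U (fun E => f E * g E) = binExp p U f * binExp p U g := by
  have hU : U₁ ∪ U \ U₁ = U := Finset.union_sdiff_of_subset h₁
  have hd : Disjoint U₁ (U \ U₁) := Finset.disjoint_sdiff
  have hg' : LocalOn (U \ U₁) g := hg.mono fun x hx =>
    Finset.mem_sdiff.2 ⟨h₂ hx, fun h1 => Finset.disjoint_left.1 h h1 hx⟩
  -- The product rule over `U₁` and `U \ U₁`, once as it stands and twice with one factor replaced
  -- by 1, expresses all three expectations over `U` through the two parts.
  have e1 := binExp_union (p := p) hd hf hg'
  have e2 := binExp_union (p := p) hd hf (localOn_const _ (1 : ℝ))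
  have e3 := binExp_union (p := p) hd (localOn_const _ (1 : ℝ)) hg'
  simp only [hU, mul_one, one_mul, binExp_const] at e1 e2 e3
  rw [e1, e2, e3]

theorem binExp_eq_of_localOn {W : Finset α} (hW : W ⊆ U) {f : Finset α → ℝ} (hf : LocalOn W f) :
    binExp p U f = binExp p W f := by
  have e2 := binExp_union (p := p) (Finset.disjoint_sdiff (s := W) (t := U)) hf
    (localOn_const _ (1 : ℝ))
  simpa only [Finset.union_sdiff_of_subset hW, mul_one, binExp_const] using e2

theorem binExp_prod {ι : Type*} (s : Finset ι) (W : ι → Finset α) (hW : ∀ i ∈ s, W i ⊆ U)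
    (hd : ∀ i ∈ s, ∀ j ∈ s, i ≠ j → Disjoint (W i) (W j)) {f : ι → Finset α → ℝ}
    (hf : ∀ i ∈ s, LocalOn (W i) (f i)) :
    binExp p U (fun E => ∏ i ∈ s, f i E) = ∏ i ∈ s, binExp p U (f i) := by
  classical
  induction s using Finset.induction_on with
  | empty => simp [binExp_const]
  | insert a s ha ih =>
    simp only [Finset.prod_insert ha]
    rw [binExp_mul (U₁ := W a) (U₂ := s.biUnion W) _ (hW a (by simp)) _ (hf a (by simp)), ih]
    · exact fun i hi => hW i (by simp [hi])
    · exact fun i hi j hj => hd i (by simp [hi]) j (by simp [hj])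
    · exact fun i hi => hf i (by simp [hi])
    · exact LocalOn.prod fun i hi => (hf i (by simp [hi])).mono (Finset.subset_biUnion_of_mem W hi)
    · rw [Finset.disjoint_biUnion_right]
      exact fun i hi => hd a (by simp) i (by simp [hi]) fun h => ha (h ▸ hi)
    · exact Finset.biUnion_subset.2 fun i hi => hW i (by simp [hi])

theorem binExp_inter {W : Finset α} (hW : W ⊆ U) (f : Finset α → ℝ) :
    binExp p U (fun E => f (E ∩ W)) = binExp p W f := by
  rw [binExp_eq_of_localOn hW (localOn_inter W f)]
  exact binExp_congr fun E hE => by rw [Finset.inter_eq_left.2 hE]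

theorem binExp_disjoint {W : Finset α} (hW : W ⊆ U) :
    binExp p U (fun E => ind (Disjoint E W)) = (1 - p) ^ W.card := by
  -- The indicator of `E ∩ W = ∅` is `0 ^ (E ∩ W).card`, so the generating function at 0 is the
  -- probability.
  have h := binExp_inter (p := p) hW (fun E => (0 : ℝ) ^ E.card)
  rw [binExp_pow_card, mul_zero, zero_add] at h
  rw [← h]
  refine binExp_congr fun E _ => ?_
  by_cases hd : Disjoint E W
  · simp [ind_of hd, Finset.disjoint_iff_inter_eq_empty.1 hd]
  · rw [ind_of_not hd, zero_pow]
    rwa [Ne, Finset.card_eq_zero, ← Finset.disjoint_iff_inter_eq_empty]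

theorem binExp_card_inter_eq {W : Finset α} (hW : W ⊆ U) (m : ℕ) :
    binExp p U (fun E => ind ((E ∩ W).card = m)) =
      W.card.choose m * (p ^ m * (1 - p) ^ (W.card - m)) := by
  rw [binExp_inter hW (fun E => ind (E.card = m)), binExp_apply_card (fun c => ind (c = m))]
  by_cases hm : m ∈ Finset.range (W.card + 1)
  · rw [Finset.sum_eq_single_of_mem m hm]
    · rw [ind_of rfl, mul_one]
    · intro b _ hb; rw [ind_of_not hb]; simp
  · rw [Finset.sum_eq_zero, Nat.choose_eq_zero_of_lt (by simpa using hm)]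
    · simp
    · intro b hb
      rw [ind_of_not (by rintro rfl; exact hm hb)]; simp

theorem binExp_subset_mul {F : Finset α} (hF : F ⊆ U) (g : Finset α → ℝ) (hg : LocalOn (U \ F) g) :
    binExp p U (fun E => ind (F ⊆ E) * g E) = p ^ F.card * binExp p U g := by
  have hl : LocalOn F (fun E => ind (F ⊆ E)) := fun E => by
    show ind (F ⊆ E) = ind (F ⊆ E ∩ F)
    simp only [Finset.subset_inter_iff, Finset.Subset.refl, and_true]
  rw [binExp_mul Finset.disjoint_sdiff hF Finset.sdiff_subset hl hg, binExp_eq_of_localOn hF hl]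
  congr 1
  rw [binExp, Finset.sum_eq_single_of_mem F (Finset.mem_powerset_self F)]
  · simp [ind_of]
  · intro E hE hne
    rw [ind_of_not, mul_zero]
    intro h
    exact hne (Finset.Subset.antisymm (Finset.mem_powerset.1 hE) h)

theorem binExp_subset {F : Finset α} (hF : F ⊆ U) :
    binExp p U (fun E => ind (F ⊆ E)) = p ^ F.card := by
  have := binExp_subset_mul (p := p) hF (fun _ => 1) (localOn_const _ _)
  simpa [binExp_const] using this

/-- Cauchy–Schwarz, in the form of the second moment method. -/
theorem sq_binExp_le (hp : 0 ≤ p) (hp' : p ≤ 1) (f : Finset α → ℝ) :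
    binExp p U f ^ 2 ≤ binExp p U (fun E => ind (f E ≠ 0)) * binExp p U (fun E => f E ^ 2) := by
  have hq : 0 ≤ 1 - p := by linarith
  refine Finset.sum_sq_le_sum_mul_sum_of_sq_le_mul _ (fun E _ => ?_) (fun E _ => ?_) fun E _ => ?_
  · have := ind_nonneg (f E ≠ 0); positivity
  · positivity
  · by_cases h : f E = 0
    · simp [h]
    · refine le_of_eq ?_
      simp only [ind_of (show f E ≠ 0 from h)]
      ring

end binExp

end

/-! ### Stars of outside vertices, weights of vertex sets, and the independence number. -/

section

section Star

variable {V : Type*} [DecidableEq V]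

/-- The potential edges that consist of `v` and `d` vertices of `S`. -/
def star (d : ℕ) (S : Finset V) (v : V) : Finset (Finset V) := (S.powersetCard d).image (insert v)

/-- The number of edges of `E` that consist of `v` and `d` vertices of `S`. -/
def deg (d : ℕ) (E : Finset (Finset V)) (S : Finset V) (v : V) : ℕ := (E ∩ star d S v).card

/-- `S` contains no edge of the `(d + 1)`-uniform hypergraph with edge set `E`. -/
def Indep (d : ℕ) (E : Finset (Finset V)) (S : Finset V) : Prop :=
  Disjoint E (S.powersetCard (d + 1))

theorem mem_star {d : ℕ} {S : Finset V} {v : V} {e : Finset V} :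
    e ∈ star d S v ↔ ∃ f ⊆ S, f.card = d ∧ insert v f = e := by
  simp [star, Finset.mem_powersetCard, and_assoc]

theorem mem_star_iff {d : ℕ} {S : Finset V} {v : V} (hv : v ∉ S) {e : Finset V} :
    e ∈ star d S v ↔ v ∈ e ∧ e.card = d + 1 ∧ e ⊆ insert v S := by
  rw [mem_star]
  constructor
  · rintro ⟨f, hf, hc, rfl⟩
    refine ⟨Finset.mem_insert_self _ _, ?_, Finset.insert_subset_insert _ hf⟩
    rw [Finset.card_insert_of_notMem (fun h => hv (hf h)), hc]
  · rintro ⟨hve, hc, hs⟩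
    refine ⟨e.erase v, ?_, ?_, Finset.insert_erase hve⟩
    · intro x hx
      exact (Finset.mem_insert.1 (hs (Finset.mem_of_mem_erase hx))).resolve_left
        (Finset.ne_of_mem_erase hx)
    · rw [Finset.card_erase_of_mem hve, hc]; rfl

theorem insert_injOn_powersetCard {d : ℕ} {S : Finset V} {v : V} (hv : v ∉ S) :
    Set.InjOn (insert v) (S.powersetCard d : Set (Finset V)) := by
  intro f hf g hg h
  have hf' := (Finset.mem_powersetCard.1 (Finset.mem_coe.1 hf)).1
  have hg' := (Finset.mem_powersetCard.1 (Finset.mem_coe.1 hg)).1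
  have h1 := congrArg (Finset.erase · v) h
  simpa [Finset.erase_insert (fun h => hv (hf' h)), Finset.erase_insert (fun h => hv (hg' h))]
    using h1

theorem card_star {d : ℕ} {S : Finset V} {v : V} (hv : v ∉ S) :
    (star d S v).card = S.card.choose d := by
  rw [star, Finset.card_image_of_injOn (insert_injOn_powersetCard hv), Finset.card_powersetCard]

/-- A common edge would contain `v`, although `v` is neither `u` nor in `S'`. Thus the degrees of
different outside vertices are independent; two different sets are allowed with a view to second
moments. -/
theorem disjoint_star {d : ℕ} {S S' : Finset V} {u v : V} (hv : v ∉ S') (huv : v ≠ u) :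
    Disjoint (star d S v) (star d S' u) := by
  rw [Finset.disjoint_left]
  intro e he he'
  obtain ⟨f, -, -, rfl⟩ := mem_star.1 he
  obtain ⟨g, hg, -, h⟩ := mem_star.1 he'
  have : v ∈ insert u g := h ▸ Finset.mem_insert_self _ _
  rcases Finset.mem_insert.1 this with h1 | h1
  · exact huv h1
  · exact hv (hg h1)

theorem disjoint_star_powersetCard {d m : ℕ} {S S' : Finset V} {v : V} (hv : v ∉ S') :
    Disjoint (star d S v) (S'.powersetCard m) := by
  rw [Finset.disjoint_left]
  intro e he he'
  obtain ⟨f, -, -, rfl⟩ := mem_star.1 he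
  exact hv ((Finset.mem_powersetCard.1 he').1 (Finset.mem_insert_self _ _))

theorem star_mono {d : ℕ} {S S' : Finset V} (h : S ⊆ S') (v : V) : star d S v ⊆ star d S' v :=
  Finset.image_subset_image (Finset.powersetCard_mono h)

theorem localOn_deg (d : ℕ) (S : Finset V) (v : V) :
    LocalOn (star d S v) (fun E => deg d E S v) :=
  localOn_inter _ Finset.card

theorem localOn_indep (d : ℕ) (S : Finset V) :
    LocalOn (S.powersetCard (d + 1)) (fun E => Indep d E S) := fun E => by
  simp only [Indep, Finset.disjoint_iff_inter_eq_empty, Finset.inter_assoc, Finset.inter_self]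

theorem indep_iff {d : ℕ} {E : Finset (Finset V)} {S : Finset V} :
    Indep d E S ↔ ∀ e ∈ E, e.card = d + 1 → ¬e ⊆ S := by
  simp only [Indep, Finset.disjoint_left, Finset.mem_powersetCard]
  tauto

theorem Indep.mono {d : ℕ} {E : Finset (Finset V)} {S S' : Finset V} (h : Indep d E S)
    (hS : S' ⊆ S) : Indep d E S' :=
  h.mono_right (Finset.powersetCard_mono hS)

/-- The probability that a random subset of an `m`-set is empty. -/
noncomputable def prob₀ (p : ℝ) (m : ℕ) : ℝ := (1 - p) ^ m

/-- The probability that a random subset of an `m`-set has exactly one element. -/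
noncomputable def prob₁ (p : ℝ) (m : ℕ) : ℝ := m * (p * (1 - p) ^ (m - 1))

/-- The weight of a vertex that is in `m` edges with a given independent set. -/
noncomputable def starWt (d m : ℕ) : ℝ := if m = 0 then 0 else if m = 1 then 1 / (d + 1) else 1

/-- The expected weight of a vertex that is in a random number of edges, out of `m` possible edges,
with a given independent set. -/
noncomputable def meanWt (d : ℕ) (p : ℝ) (m : ℕ) : ℝ :=
  1 - prob₀ p m - prob₁ p m + prob₁ p m / (d + 1)

theorem prob₀_nonneg {p : ℝ} (hp' : p ≤ 1) (m : ℕ) : 0 ≤ prob₀ p m :=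
  pow_nonneg (by linarith) _

theorem prob₁_nonneg {p : ℝ} (hp : 0 ≤ p) (hp' : p ≤ 1) (m : ℕ) : 0 ≤ prob₁ p m := by
  have : 0 ≤ 1 - p := by linarith
  unfold prob₁; positivity

theorem starWt_nonneg (d m : ℕ) : 0 ≤ starWt d m := by
  unfold starWt; split_ifs <;> positivity

theorem starWt_le_one (d m : ℕ) : starWt d m ≤ 1 := by
  unfold starWt
  split_ifs
  · norm_num
  · rw [div_le_one (by positivity)]; linarith [Nat.cast_nonneg (α := ℝ) d]
  · norm_num

/-- In this form the mean weight of a vertex is a linear combination of `prob₀` and `prob₁`. -/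
theorem starWt_eq (d m : ℕ) :
    starWt d m = 1 - ind (m = 0) - ind (m = 1) + ind (m = 1) / (d + 1) := by
  rcases m with _ | _ | m
  · simp [starWt, ind]
  · simp [starWt, ind]
  · simp [starWt, ind]

end Star

section Weight

variable {V : Type*} [Fintype V] [DecidableEq V]

/-- The potential edges of a `(d + 1)`-uniform hypergraph on `V`. -/
def edgeSpace (V : Type*) [Fintype V] (d : ℕ) : Finset (Finset V) :=
  (Finset.univ : Finset V).powersetCard (d + 1)

theorem mem_edgeSpace {d : ℕ} {e : Finset V} : e ∈ edgeSpace V d ↔ e.card = d + 1 := by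
  simp [edgeSpace, Finset.mem_powersetCard]

theorem star_subset_edgeSpace {d : ℕ} {S : Finset V} {v : V} (hv : v ∉ S) :
    star d S v ⊆ edgeSpace V d := fun _ he => mem_edgeSpace.2 ((mem_star_iff hv).1 he).2.1

theorem powersetCard_subset_edgeSpace (d : ℕ) (S : Finset V) :
    S.powersetCard (d + 1) ⊆ edgeSpace V d := Finset.powersetCard_mono (Finset.subset_univ _)

/-- The weight of a vertex set: independent sets that leave no vertex outside without an edge into
the set have a positive weight, such that the total weight of a cluster of such sets is about 1. -/
noncomputable def setWt (d : ℕ) (S : Finset V) (E : Finset (Finset V)) : ℝ :=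
  ind (Indep d E S) * ∏ v ∈ Sᶜ, starWt d (deg d E S v)

theorem setWt_nonneg (d : ℕ) (S : Finset V) (E : Finset (Finset V)) : 0 ≤ setWt d S E :=
  mul_nonneg (ind_nonneg _) (Finset.prod_nonneg fun _ _ => starWt_nonneg _ _)

theorem setWt_le_ind (d : ℕ) (S : Finset V) (E : Finset (Finset V)) :
    setWt d S E ≤ ind (Indep d E S) :=
  mul_le_of_le_one_right (ind_nonneg _)
    (Finset.prod_le_one (fun _ _ => starWt_nonneg _ _) fun _ _ => starWt_le_one _ _)

theorem localOn_starWt (d : ℕ) (S : Finset V) (v : V) :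
    LocalOn (star d S v) (fun E => starWt d (deg d E S v)) := (localOn_deg d S v).comp _

theorem binExp_deg_eq_zero {d : ℕ} {p : ℝ} {S : Finset V} {v : V} (hv : v ∉ S) :
    binExp p (edgeSpace V d) (fun E => ind (deg d E S v = 0)) = prob₀ p (S.card.choose d) := by
  have := binExp_card_inter_eq (p := p) (star_subset_edgeSpace (d := d) hv) 0
  rw [card_star hv] at this
  simpa only [deg, prob₀, Nat.choose_zero_right, Nat.cast_one, pow_zero, one_mul, Nat.sub_zero]
    using this

theorem binExp_deg_eq_one {d : ℕ} {p : ℝ} {S : Finset V} {v : V} (hv : v ∉ S) :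
    binExp p (edgeSpace V d) (fun E => ind (deg d E S v = 1)) = prob₁ p (S.card.choose d) := by
  have := binExp_card_inter_eq (p := p) (star_subset_edgeSpace (d := d) hv) 1
  rw [card_star hv] at this
  simpa only [deg, prob₁, Nat.choose_one_right, pow_one] using this

theorem binExp_starWt {d : ℕ} {p : ℝ} {S : Finset V} {v : V} (hv : v ∉ S) :
    binExp p (edgeSpace V d) (fun E => starWt d (deg d E S v)) =
      meanWt d p (S.card.choose d) := by
  simp only [starWt_eq, div_eq_mul_inv, binExp_add, binExp_sub, binExp_mul_const, binExp_const,
    binExp_deg_eq_zero hv, binExp_deg_eq_one hv, meanWt]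

theorem binExp_indep (d : ℕ) (p : ℝ) (S : Finset V) :
    binExp p (edgeSpace V d) (fun E => ind (Indep d E S)) =
      (1 - p) ^ S.card.choose (d + 1) := by
  have := binExp_disjoint (p := p) (powersetCard_subset_edgeSpace d S)
  rwa [Finset.card_powersetCard] at this

/-- Independence of `S` concerns the potential edges inside `S`. These and the stars of the vertices
of `A` are pairwise disjoint, so the expectation factorises. -/
theorem binExp_indep_mul_prod {d : ℕ} {p : ℝ} {S A : Finset V} (hA : Disjoint A S)
    {f : V → Finset (Finset V) → ℝ} (hf : ∀ v ∈ A, LocalOn (star d S v) (f v)) :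
    binExp p (edgeSpace V d) (fun E => ind (Indep d E S) * ∏ v ∈ A, f v E) =
      (1 - p) ^ S.card.choose (d + 1) * ∏ v ∈ A, binExp p (edgeSpace V d) (f v) := by
  have hAS : ∀ v ∈ A, v ∉ S := fun v hv => Finset.disjoint_left.1 hA hv
  rw [binExp_mul (U₁ := S.powersetCard (d + 1)) (U₂ := A.biUnion (star d S)) _
    (powersetCard_subset_edgeSpace d S) _ ((localOn_indep d S).comp ind) _, binExp_indep,
    binExp_prod A (star d S) (fun v hv => star_subset_edgeSpace (hAS v hv)) _ hf]
  · exact fun i hi j hj hij => disjoint_star (hAS i hi) hij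
  · rw [Finset.disjoint_biUnion_right]
    exact fun i hi => (disjoint_star_powersetCard (hAS i hi)).symm
  · exact Finset.biUnion_subset.2 fun i hi => star_subset_edgeSpace (hAS i hi)
  · exact LocalOn.prod fun i hi => (hf i hi).mono (Finset.subset_biUnion_of_mem _ hi)

theorem binExp_indep_mul_prod_starWt {d : ℕ} {p : ℝ} {S A : Finset V} (hA : Disjoint A S) :
    binExp p (edgeSpace V d) (fun E => ind (Indep d E S) * ∏ v ∈ A, starWt d (deg d E S v)) =
      (1 - p) ^ S.card.choose (d + 1) * meanWt d p (S.card.choose d) ^ A.card := by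
  rw [binExp_indep_mul_prod hA fun v _ => localOn_starWt d S v,
    Finset.prod_congr rfl fun v hv => binExp_starWt (Finset.disjoint_left.1 hA hv),
    Finset.prod_const]

theorem binExp_setWt (d : ℕ) (p : ℝ) (S : Finset V) :
    binExp p (edgeSpace V d) (setWt d S) =
      (1 - p) ^ S.card.choose (d + 1) *
        meanWt d p (S.card.choose d) ^ (Fintype.card V - S.card) := by
  rw [← Finset.card_compl]
  exact binExp_indep_mul_prod_starWt disjoint_compl_left

end Weight

section IndependenceNumber

variable {n d : ℕ}

theorem indep_iff_isJIndep {E : Finset (Finset (Fin n))} (hE : E ⊆ edgeSpace (Fin n) d)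
    (S : Finset (Fin n)) : Indep d E S ↔ (hypergraphOfEdges E).IsJIndep d S := by
  simp only [indep_iff, Hypergraph.IsJIndep, hypergraphOfEdges, Set.subset_univ, true_and,
    Set.mem_ofPred_eq]
  have key : ∀ e ∈ E, (¬ e ⊆ S ↔ ((e : Set (Fin n)) ∩ (S : Set (Fin n))).ncard ≤ d) := by
    intro e he
    have hc := mem_edgeSpace.1 (hE he)
    rw [← Finset.coe_inter, Set.ncard_coe_finset, ← Nat.lt_succ_iff, Nat.succ_eq_add_one, ← hc]
    constructor
    · intro h
      refine Finset.card_lt_card (Finset.inter_subset_left.ssubset_of_ne fun h' => h ?_)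
      exact Finset.inter_eq_left.1 h'
    · intro h h'
      rw [Finset.inter_eq_left.2 h'] at h
      exact lt_irrefl _ h
  constructor
  · rintro h _ ⟨e, he, rfl⟩
    exact (key e he).1 (h e he (mem_edgeSpace.1 (hE he)))
  · intro h e he _
    exact (key e he).2 (h _ ⟨e, he, rfl⟩)

/-- The independence number is at least `m` iff some set of size `m` is independent. -/
theorem le_weakIndepNum_iff {E : Finset (Finset (Fin n))} (hE : E ⊆ edgeSpace (Fin n) d) (m : ℕ) :
    m ≤ (hypergraphOfEdges E).weakIndepNum (d + 1) ↔
      ∃ S : Finset (Fin n), Indep d E S ∧ S.card = m := by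
  simp only [Hypergraph.weakIndepNum, Hypergraph.jIndepNum, Nat.add_sub_cancel,
    ← indep_iff_isJIndep hE]
  have hb : BddAbove {m : ℕ | ∃ S : Finset (Fin n), Indep d E S ∧ S.card = m} := by
    refine ⟨n, ?_⟩
    rintro _ ⟨S, -, rfl⟩
    simpa using Finset.card_le_univ S
  constructor
  · intro hm
    have hne : {m : ℕ | ∃ S : Finset (Fin n), Indep d E S ∧ S.card = m}.Nonempty := by
      refine ⟨0, ∅, ?_, rfl⟩
      rw [indep_iff]
      intro e _ hc h
      rw [Finset.subset_empty.1 h] at hc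
      simp at hc
    obtain ⟨S, hS, hc⟩ := Nat.sSup_mem hne hb
    rw [← hc] at hm
    obtain ⟨S', hS', hc'⟩ := Finset.exists_subset_card_eq hm
    exact ⟨S', hS.mono hS', hc'⟩
  · intro h
    exact le_csSup hb h

theorem binomialHypergraphProb_eq (p : ℝ) (P : Hypergraph (Fin n) → Prop) :
    binomialHypergraphProb n (d + 1) p {H | P H} =
      binExp p (edgeSpace (Fin n) d) (fun E => ind (P (hypergraphOfEdges E))) := by
  classical
  simp only [binomialHypergraphProb, binExp, uniformEdgeSets, edgeSpace, Finset.sum_filter,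
    Finset.card_powersetCard, Finset.card_univ, Fintype.card_fin, Set.mem_ofPred_eq]
  refine Finset.sum_congr rfl fun E _ => ?_
  by_cases h : P (hypergraphOfEdges E)
  · simp [h, ind]
  · simp [h, ind]

end IndependenceNumber

end

/-! ### Matchings inside a set and their transversals. -/

section

theorem sum_ind_eq_card {ι : Type*} (s : Finset ι) (P : ι → Prop) [DecidablePred P] :
    ∑ i ∈ s, ind (P i) = (s.filter P).card := by
  rw [Finset.card_filter, Nat.cast_sum]
  refine Finset.sum_congr rfl fun i _ => ?_
  by_cases h : P i <;> simp [ind, h]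

section Transversal

variable {V : Type*} [DecidableEq V]

/-- `R` consists of exactly one element of each member of `M`. -/
def IsTransversal (M : Finset (Finset V)) (R : Finset V) : Prop :=
  R ⊆ M.biUnion id ∧ ∀ e ∈ M, ∃ x, R ∩ e = {x}

variable {M : Finset (Finset V)}

theorem IsTransversal.card_eq (hM : (M : Set (Finset V)).PairwiseDisjoint id) {R : Finset V}
    (h : IsTransversal M R) : R.card = M.card := by
  have h1 : R = M.biUnion (fun e => R ∩ e) := by
    rw [← Finset.inter_biUnion]
    exact (Finset.inter_eq_left.2 h.1).symm
  rw [h1, Finset.card_biUnion]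
  · rw [Finset.card_eq_sum_ones]
    refine Finset.sum_congr rfl fun e he => ?_
    obtain ⟨x, hx⟩ := h.2 e he
    rw [hx, Finset.card_singleton]
  · intro e he e' he' hne
    exact (hM he he' hne).mono Finset.inter_subset_right Finset.inter_subset_right

/-- As the members of `M` are disjoint, an element chosen for one of them lies in no other. -/
theorem isTransversal_image (hM : (M : Set (Finset V)).PairwiseDisjoint id)
    (y : ∀ e ∈ M, V) (hy : ∀ e he, y e he ∈ e) :
    IsTransversal M (M.attach.image fun e => y e.1 e.2) ∧
      ∀ e (he : e ∈ M), (M.attach.image fun e => y e.1 e.2) ∩ e = {y e he} := by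
  have key : ∀ e (he : e ∈ M), (M.attach.image fun e => y e.1 e.2) ∩ e = {y e he} := by
    intro e he
    ext x
    simp only [Finset.mem_inter, Finset.mem_image, Finset.mem_attach, true_and, Subtype.exists,
      Finset.mem_singleton]
    constructor
    · rintro ⟨⟨e', he', rfl⟩, hx⟩
      have : e' = e := by
        by_contra hne
        exact Finset.disjoint_left.1 (hM he' he hne) (hy e' he') hx
      subst this; rfl
    · rintro rfl
      exact ⟨⟨e, he, rfl⟩, hy e he⟩
  refine ⟨⟨?_, fun e he => ⟨_, key e he⟩⟩, key⟩
  intro x hx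
  obtain ⟨e, -, rfl⟩ := Finset.mem_image.1 hx
  exact Finset.mem_biUnion.2 ⟨e.1, e.2, hy _ _⟩

theorem exists_isTransversal_mem (hM : (M : Set (Finset V)).PairwiseDisjoint id)
    (hne : ∀ e ∈ M, e.Nonempty) {e : Finset V} (he : e ∈ M) {x : V} (hx : x ∈ e) :
    ∃ R, IsTransversal M R ∧ x ∈ R := by
  classical
  let y : ∀ e ∈ M, V := fun e' he' => if e' = e then x else (hne e' he').choose
  have hy : ∀ e' he', y e' he' ∈ e' := by
    intro e' he'
    by_cases h : e' = e
    · subst h; simpa [y] using hx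
    · simpa [y, h] using (hne e' he').choose_spec
  obtain ⟨h1, h2⟩ := isTransversal_image hM y hy
  refine ⟨_, h1, ?_⟩
  have h3 := h2 e he
  have : x ∈ ({y e he} : Finset V) := by simp [y]
  rw [← h3] at this
  exact (Finset.mem_inter.1 this).1

theorem exists_isTransversal (hM : (M : Set (Finset V)).PairwiseDisjoint id)
    (hne : ∀ e ∈ M, e.Nonempty) : ∃ R, IsTransversal M R :=
  ⟨_, (isTransversal_image hM (fun e he => (hne e he).choose)
    fun e he => (hne e he).choose_spec).1⟩

-- Different choice functions have different images, because a transversal reveals the element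
-- chosen in each member.
open Classical in
theorem pow_le_card_isTransversal [Fintype V] (hM : (M : Set (Finset V)).PairwiseDisjoint id)
    {m : ℕ} (hm : ∀ e ∈ M, e.card = m) :
    m ^ M.card ≤ ((Finset.univ : Finset (Finset V)).filter (IsTransversal M)).card := by
  have h : (M.pi fun e => e).card = m ^ M.card := by
    rw [Finset.card_pi, Finset.prod_congr rfl hm, Finset.prod_const]
  rw [← h]
  refine Finset.card_le_card_of_injOn (fun y => M.attach.image fun e => y e.1 e.2) ?_ ?_
  · intro y hy
    have hy' : ∀ e he, y e he ∈ e := Finset.mem_pi.1 hy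
    simpa using (isTransversal_image hM y hy').1
  · intro y hy y' hy' hyy
    have h1 := (isTransversal_image hM y (Finset.mem_pi.1 hy)).2
    have h2 := (isTransversal_image hM y' (Finset.mem_pi.1 hy')).2
    funext e he
    have h3 := h1 e he
    simp only at hyy
    rw [hyy, h2 e he] at h3
    exact (Finset.singleton_injective h3).symm

end Transversal

section Matched

variable {V : Type*} [DecidableEq V] {d : ℕ} {E : Finset (Finset V)}

/-- The edges inside `T` form a matching of size `r`. -/
def IsMatched (d : ℕ) (E : Finset (Finset V)) (T : Finset V) (r : ℕ) : Prop :=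
  (E ∩ T.powersetCard (d + 1)).card = r ∧
    ((E ∩ T.powersetCard (d + 1) : Finset (Finset V)) : Set (Finset V)).PairwiseDisjoint id

/-- `S` is independent, and the vertices of `R` are in exactly one edge with vertices of `S`. -/
def IsExtension (d : ℕ) (E : Finset (Finset V)) (S R : Finset V) : Prop :=
  Indep d E S ∧ ∀ v ∈ R, deg d E S v = 1

variable {T R : Finset V} {r : ℕ}

theorem mem_inside {e : Finset V} :
    e ∈ E ∩ T.powersetCard (d + 1) ↔ e ∈ E ∧ e ⊆ T ∧ e.card = d + 1 := by
  rw [Finset.mem_inter, Finset.mem_powersetCard]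

theorem isTransversal_subset (hR : IsTransversal (E ∩ T.powersetCard (d + 1)) R) : R ⊆ T := by
  refine hR.1.trans (Finset.biUnion_subset.2 fun e he => ?_)
  exact (mem_inside.1 he).2.1

theorem inside_nonempty {e : Finset V} (he : e ∈ E ∩ T.powersetCard (d + 1)) : e.Nonempty := by
  rw [← Finset.card_pos, (mem_inside.1 he).2.2]; omega

theorem indep_sdiff_of_isTransversal (hR : IsTransversal (E ∩ T.powersetCard (d + 1)) R) :
    Indep d E (T \ R) := by
  rw [indep_iff]
  intro e he hc hs
  obtain ⟨x, hx⟩ := hR.2 e (mem_inside.2 ⟨he, hs.trans Finset.sdiff_subset, hc⟩)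
  have : x ∈ R ∩ e := hx ▸ Finset.mem_singleton_self x
  rw [Finset.mem_inter] at this
  exact (Finset.mem_sdiff.1 (hs this.2)).2 this.1

/-- The matching edge through `v ∈ R` is the only edge at `v` inside `T`, and it meets `R` in `v`
alone, so it survives as the single edge from `v` into `T \ R`. -/
theorem IsMatched.isExtension (hT : IsMatched d E T r)
    (hR : IsTransversal (E ∩ T.powersetCard (d + 1)) R) : IsExtension d E (T \ R) R := by
  refine ⟨indep_sdiff_of_isTransversal hR, fun v hv => ?_⟩
  obtain ⟨e, he, hve⟩ := Finset.mem_biUnion.1 (hR.1 hv)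
  simp only [id] at hve
  obtain ⟨x, hx⟩ := hR.2 e he
  have hvx : v = x := by
    have : v ∈ R ∩ e := Finset.mem_inter.2 ⟨hv, hve⟩
    rw [hx] at this; exact Finset.mem_singleton.1 this
  subst hvx
  have hvS : v ∉ T \ R := fun h => (Finset.mem_sdiff.1 h).2 hv
  rw [deg, Finset.card_eq_one]
  refine ⟨e, ?_⟩
  ext e'
  rw [Finset.mem_inter, mem_star_iff hvS, Finset.mem_singleton]
  constructor
  · rintro ⟨he'E, hve', hc, hs⟩
    have he' : e' ∈ E ∩ T.powersetCard (d + 1) := by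
      refine mem_inside.2 ⟨he'E, hs.trans (Finset.insert_subset ?_ Finset.sdiff_subset), hc⟩
      exact isTransversal_subset hR hv
    by_contra hne
    exact Finset.disjoint_left.1 (hT.2 he' he hne) hve' hve
  · rintro rfl
    obtain ⟨h1, h2, h3⟩ := mem_inside.1 he
    refine ⟨h1, hve, h3, fun y hy => ?_⟩
    by_cases hyR : y ∈ R
    · have : y ∈ R ∩ e' := Finset.mem_inter.2 ⟨hyR, hy⟩
      rw [hx] at this
      exact Finset.mem_insert.2 (Or.inl (Finset.mem_singleton.1 this))
    · exact Finset.mem_insert_of_mem (Finset.mem_sdiff.2 ⟨h2 hy, hyR⟩)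

/-- For every transversal `R` the set `insert u (T \ R)` has `s + 1` vertices, so it contains an
edge, and this edge goes through `u`. If `u` had just one edge `e₀` into `T`, then `e₀` would avoid
every transversal, hence every matching edge, and adding `u` to `T` would enlarge the matching,
against `hmax`. -/
theorem IsMatched.two_le_deg {s : ℕ} (hT : IsMatched d E T r) (hTc : T.card = s + r)
    (hs : ∀ S : Finset V, Indep d E S → S.card ≠ s + 1)
    (hmax : ∀ T' : Finset V, T'.card = s + (r + 1) → ¬ IsMatched d E T' (r + 1))
    {u : V} (hu : u ∉ T) : 2 ≤ deg d E T u := by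
  have hcard : ∀ R, IsTransversal (E ∩ T.powersetCard (d + 1)) R →
      (insert u (T \ R)).card = s + 1 := by
    intro R hR
    rw [Finset.card_insert_of_notMem (fun h => hu (Finset.mem_sdiff.1 h).1),
      Finset.card_sdiff_of_subset (isTransversal_subset hR), hR.card_eq hT.2, hTc, hT.1]
    omega
  have key : ∀ R, IsTransversal (E ∩ T.powersetCard (d + 1)) R →
      ∃ e ∈ E ∩ star d T u, e ⊆ insert u (T \ R) := by
    intro R hR
    have h1 : ¬ Indep d E (insert u (T \ R)) := fun h => hs _ h (hcard R hR)
    rw [indep_iff] at h1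
    push Not at h1
    obtain ⟨e, he, hc, hsub⟩ := h1
    refine ⟨e, Finset.mem_inter.2 ⟨he, (mem_star_iff hu).2 ⟨?_, hc, ?_⟩⟩, hsub⟩
    · by_contra hue
      have : e ⊆ T \ R := by rwa [← Finset.subset_insert_iff_of_notMem hue]
      exact indep_iff.1 (indep_sdiff_of_isTransversal hR) e he hc this
    · exact hsub.trans (Finset.insert_subset_insert _ Finset.sdiff_subset)
  have h0 : 0 < deg d E T u := by
    obtain ⟨R, hR⟩ := exists_isTransversal hT.2 fun e he => inside_nonempty he
    obtain ⟨e, he, -⟩ := key R hR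
    exact Finset.card_pos.2 ⟨e, he⟩
  by_contra hlt
  have h1 : deg d E T u = 1 := by omega
  obtain ⟨e₀, he₀⟩ := Finset.card_eq_one.1 h1
  have he₀' : e₀ ∈ E ∩ star d T u := by rw [he₀]; simp
  obtain ⟨he₀E, he₀s⟩ := Finset.mem_inter.1 he₀'
  obtain ⟨hue₀, hc₀, hs₀⟩ := (mem_star_iff hu).1 he₀s
  have hdisj : ∀ e ∈ E ∩ T.powersetCard (d + 1), Disjoint e₀ e := by
    intro e he
    rw [Finset.disjoint_left]
    intro y hy hye
    -- A transversal through the supposed common vertex `y` removes `y`, but the edge found in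
    -- `insert u (T \ R)` can only be `e₀`, which contains `y`.
    obtain ⟨R, hR, hyR⟩ := exists_isTransversal_mem hT.2 (fun e he => inside_nonempty he) he hye
    obtain ⟨e', he', hsub⟩ := key R hR
    rw [he₀, Finset.mem_singleton] at he'
    subst he'
    have hyT : y ∈ T := (mem_inside.1 he).2.1 hye
    rcases Finset.mem_insert.1 (hsub hy) with h | h
    · exact hu (h ▸ hyT)
    · exact (Finset.mem_sdiff.1 h).2 hyR
  have hins : E ∩ (insert u T).powersetCard (d + 1) =
      insert e₀ (E ∩ T.powersetCard (d + 1)) := by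
    ext e
    rw [Finset.mem_insert, mem_inside, mem_inside]
    constructor
    · rintro ⟨h1, h2, h3⟩
      by_cases hue : u ∈ e
      · have : e ∈ E ∩ star d T u := Finset.mem_inter.2 ⟨h1, (mem_star_iff hu).2 ⟨hue, h3, h2⟩⟩
        rw [he₀, Finset.mem_singleton] at this
        exact Or.inl this
      · exact Or.inr ⟨h1, by rwa [← Finset.subset_insert_iff_of_notMem hue], h3⟩
    · rintro (rfl | ⟨h1, h2, h3⟩)
      · exact ⟨he₀E, hs₀, hc₀⟩
      · exact ⟨h1, h2.trans (Finset.subset_insert _ _), h3⟩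
  have hnot : e₀ ∉ E ∩ T.powersetCard (d + 1) := fun h => hu ((mem_inside.1 h).2.1 hue₀)
  refine hmax (insert u T) ?_ ⟨?_, ?_⟩
  · rw [Finset.card_insert_of_notMem hu, hTc]; omega
  · rw [hins, Finset.card_insert_of_notMem hnot, hT.1]
  · rw [hins, Finset.coe_insert]
    refine hT.2.insert fun e he _ => hdisj e he

variable [Fintype V]

/-- The pairs of disjoint vertex sets of sizes `s` and `r`. -/
def pairSpace (V : Type*) [Fintype V] [DecidableEq V] (s r : ℕ) :
    Finset ((_ : Finset V) × Finset V) :=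
  ((Finset.univ : Finset V).powersetCard s).sigma fun S => Sᶜ.powersetCard r

/-- Each transversal `R` contributes the pair `(T \ R, R)`. The predicate `P` carries a property of
`T` along, since the two parts have union `T`. -/
theorem IsMatched.pow_le_sum {s : ℕ} (hT : IsMatched d E T r) (hTc : T.card = s + r)
    {P : Finset V → Prop} (hP : P T) :
    ((d : ℝ) + 1) ^ r ≤ ∑ q ∈ pairSpace V s r, ind (IsExtension d E q.1 q.2 ∧ P (q.1 ∪ q.2)) := by
  classical
  rw [sum_ind_eq_card]
  have h1 := pow_le_card_isTransversal hT.2 (m := d + 1) fun e he => (mem_inside.1 he).2.2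
  rw [hT.1] at h1
  have h2 : ((Finset.univ : Finset (Finset V)).filter
      (IsTransversal (E ∩ T.powersetCard (d + 1)))).card ≤
      ((pairSpace V s r).filter
        fun q => IsExtension d E q.1 q.2 ∧ P (q.1 ∪ q.2)).card := by
    refine Finset.card_le_card_of_injOn (fun R => ⟨T \ R, R⟩) ?_ ?_
    · intro R hR
      have hR' : IsTransversal (E ∩ T.powersetCard (d + 1)) R := by simpa using hR
      have hRT := isTransversal_subset hR'
      have hRc := hR'.card_eq hT.2
      rw [hT.1] at hRc
      simp only [pairSpace, Finset.coe_filter, Finset.mem_sigma, Finset.mem_powersetCard,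
        Finset.subset_univ, true_and, Set.mem_ofPred_eq, Finset.sdiff_union_of_subset hRT]
      refine ⟨⟨?_, ?_, hRc⟩, hT.isExtension hR', hP⟩
      · rw [Finset.card_sdiff_of_subset hRT, hTc, hRc]; omega
      · intro x hx
        simp [hx]
    · intro R _ R' _ h
      simpa using (Sigma.mk.inj h).2
  exact_mod_cast h1.trans h2

/-- If the largest independent sets have size `s`, then there are many pairs consisting of an
independent set of size `s` and an extension of it by `r` vertices. -/
theorem exists_pow_le_sum {s : ℕ} (hS : ∃ S : Finset V, Indep d E S ∧ S.card = s)
    (hs : ∀ S : Finset V, Indep d E S → S.card ≠ s + 1) (m : ℕ) :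
    (∃ r ∈ Finset.range m, ((d : ℝ) + 1) ^ r ≤ ∑ q ∈ pairSpace V s r,
      ind (IsExtension d E q.1 q.2 ∧ ∀ u ∉ q.1 ∪ q.2, 2 ≤ deg d E (q.1 ∪ q.2) u)) ∨
    ((d : ℝ) + 1) ^ m ≤ ∑ q ∈ pairSpace V s m, ind (IsExtension d E q.1 q.2) := by
  classical
  by_cases hm : ∃ T : Finset V, T.card = s + m ∧ IsMatched d E T m
  · obtain ⟨T, hTc, hT⟩ := hm
    right
    simpa using hT.pow_le_sum hTc (P := fun _ => True) trivial
  · left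
    have h0 : ∃ T : Finset V, T.card = s + 0 ∧ IsMatched d E T 0 := by
      obtain ⟨S, hS, hc⟩ := hS
      rw [Indep, Finset.disjoint_iff_inter_eq_empty] at hS
      exact ⟨S, hc, by simp [IsMatched, hS]⟩
    -- The first size of matching that is impossible is positive, since an independent set of size
    -- `s` has an empty matching inside. The size before it is possible and cannot be enlarged.
    have hex : ∃ m, ¬ ∃ T : Finset V, T.card = s + m ∧ IsMatched d E T m := ⟨m, hm⟩
    obtain ⟨r, hr⟩ : ∃ r, Nat.find hex = r + 1 := by
      refine Nat.exists_eq_succ_of_ne_zero fun h => ?_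
      exact (h ▸ Nat.find_spec hex) h0
    obtain ⟨T, hTc, hT⟩ := not_not.1 (Nat.find_min hex (show r < Nat.find hex by omega))
    have hmax : ∀ T' : Finset V, T'.card = s + (r + 1) → ¬ IsMatched d E T' (r + 1) := by
      intro T' h1 h2
      have := Nat.find_spec hex
      rw [hr] at this
      exact this ⟨T', h1, h2⟩
    refine ⟨r, ?_, hT.pow_le_sum hTc (P := fun T => ∀ u ∉ T, 2 ≤ deg d E T u)
      fun u hu => hT.two_le_deg hTc hs hmax hu⟩
    rw [Finset.mem_range]
    have := Nat.find_min' hex hm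
    omega

end Matched

end

/-! ### First moment bound for the probability that the independence number is `s`. -/

section

variable {V : Type*} [Fintype V] [DecidableEq V] {d : ℕ} {p : ℝ}

theorem binExp_isExtension {S R : Finset V} (hSR : Disjoint R S) :
    binExp p (edgeSpace V d) (fun E => ind (IsExtension d E S R)) =
      (1 - p) ^ S.card.choose (d + 1) * prob₁ p (S.card.choose d) ^ R.card := by
  have h := binExp_indep_mul_prod (p := p) (d := d) hSR
    (f := fun v E => ind (deg d E S v = 1)) fun v _ => (localOn_deg d S v).comp fun m => ind (m = 1)
  rw [Finset.prod_congr rfl fun v hv => binExp_deg_eq_one (Finset.disjoint_left.1 hSR hv),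
    Finset.prod_const] at h
  rw [← h]
  refine binExp_congr fun E _ => ?_
  rw [IsExtension, ind_and, ind_forall_eq_prod]

theorem localOn_isExtension (S R : Finset V) :
    LocalOn ((S ∪ R).powersetCard (d + 1) ∪ R.biUnion (star d S))
      (fun E => ind (IsExtension d E S R)) := by
  intro E
  simp only [IsExtension, ind_and, ind_forall_eq_prod]
  refine LocalOn.mul (f := fun E => ind (Indep d E S))
    (g := fun E => ∏ v ∈ R, ind (deg d E S v = 1)) ?_ ?_ E
  · exact ((localOn_indep d S).comp ind).mono ((Finset.powersetCard_mono
      Finset.subset_union_left).trans Finset.subset_union_left)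
  · refine LocalOn.prod fun v hv => ?_
    exact ((localOn_deg d S v).comp fun m => ind (m = 1)).mono
      ((Finset.subset_biUnion_of_mem _ hv).trans Finset.subset_union_right)

theorem binExp_two_le_deg {S : Finset V} {v : V} (hv : v ∉ S) :
    binExp p (edgeSpace V d) (fun E => ind (2 ≤ deg d E S v)) =
      1 - prob₀ p (S.card.choose d) - prob₁ p (S.card.choose d) := by
  rw [← binExp_deg_eq_zero hv, ← binExp_deg_eq_one hv, ← binExp_const (p := p)
    (U := edgeSpace V d) 1, ← binExp_sub, ← binExp_sub]
  refine binExp_congr fun E _ => ?_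
  generalize deg d E S v = m
  rcases m with _ | _ | m <;> simp [ind]

/-- Being an extension is decided by edges inside `S ∪ R`; the degrees of the other vertices into `S
∪ R` are decided by their stars, which are disjoint from these and from one another. -/
theorem binExp_isExtension_and {S R : Finset V} (hSR : Disjoint R S) :
    binExp p (edgeSpace V d)
      (fun E => ind (IsExtension d E S R ∧ ∀ u ∉ S ∪ R, 2 ≤ deg d E (S ∪ R) u)) =
      (1 - p) ^ S.card.choose (d + 1) * prob₁ p (S.card.choose d) ^ R.card *
        (1 - prob₀ p ((S.card + R.card).choose d) - prob₁ p ((S.card + R.card).choose d)) ^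
          (Fintype.card V - S.card - R.card) := by
  have hc : (S ∪ R).card = S.card + R.card := Finset.card_union_of_disjoint hSR.symm
  have hmem : ∀ u ∈ (S ∪ R)ᶜ, u ∉ S ∪ R := fun u hu => Finset.mem_compl.1 hu
  have hRS : ∀ v ∈ R, v ∉ S := fun v hv => Finset.disjoint_left.1 hSR hv
  have h : ∀ E, ind (IsExtension d E S R ∧ ∀ u ∉ S ∪ R, 2 ≤ deg d E (S ∪ R) u) =
      ind (IsExtension d E S R) * ∏ u ∈ (S ∪ R)ᶜ, ind (2 ≤ deg d E (S ∪ R) u) := by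
    intro E
    rw [ind_and, ← ind_forall_eq_prod]
    simp only [Finset.mem_compl]
  rw [funext h, binExp_mul (U₂ := (S ∪ R)ᶜ.biUnion (star d (S ∪ R))) _ _ _
    (localOn_isExtension S R), binExp_isExtension hSR, binExp_prod _ (star d (S ∪ R)),
    Finset.prod_congr rfl fun u hu => binExp_two_le_deg (hmem u hu), Finset.prod_const, hc,
    Finset.card_compl, hc, Nat.sub_sub]
  · exact fun u hu => star_subset_edgeSpace (hmem u hu)
  · exact fun i hi j hj hij => disjoint_star (hmem i hi) hij
  · exact fun u _ => (localOn_deg d (S ∪ R) u).comp fun m => ind (2 ≤ m)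
  · exact LocalOn.prod fun u hu => ((localOn_deg d (S ∪ R) u).comp fun m => ind (2 ≤ m)).mono
      (Finset.subset_biUnion_of_mem _ hu)
  · rw [Finset.disjoint_biUnion_right]
    intro u hu
    rw [Finset.disjoint_union_left, Finset.disjoint_biUnion_left]
    refine ⟨(disjoint_star_powersetCard (hmem u hu)).symm, fun v hv => ?_⟩
    refine (disjoint_star (fun h => hmem u hu (Finset.mem_union_left _ h)) ?_).symm
    rintro rfl
    exact hmem u hu (Finset.mem_union_right _ hv)
  · refine Finset.union_subset (powersetCard_subset_edgeSpace _ _) (Finset.biUnion_subset.2 ?_)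
    exact fun v hv => star_subset_edgeSpace (hRS v hv)
  · exact Finset.biUnion_subset.2 fun u hu => star_subset_edgeSpace (hmem u hu)

theorem sum_pairSpace_const (s r : ℕ) (c : ℝ) :
    ∑ _q ∈ pairSpace V s r, c =
      (Fintype.card V).choose s * (Fintype.card V - s).choose r * c := by
  rw [pairSpace, Finset.sum_sigma, Finset.sum_congr rfl fun S hS => by
    rw [Finset.sum_const, Finset.card_powersetCard, Finset.card_compl,
      (Finset.mem_powersetCard.1 hS).2], Finset.sum_const, Finset.card_powersetCard,
      Finset.card_univ]
  simp only [nsmul_eq_mul]; ring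

theorem mem_pairSpace {s r : ℕ} {q : (_ : Finset V) × Finset V} (hq : q ∈ pairSpace V s r) :
    q.1.card = s ∧ q.2.card = r ∧ Disjoint q.2 q.1 := by
  rw [pairSpace, Finset.mem_sigma, Finset.mem_powersetCard, Finset.mem_powersetCard] at hq
  exact ⟨hq.1.2, hq.2.2, Finset.disjoint_left.2 fun v hv => Finset.mem_compl.1 (hq.2.1 hv)⟩

/-- An upper bound for the probability that the independence number is `s`. -/
theorem binExp_indepNum_eq_le (hp : 0 ≤ p) (hp' : p ≤ 1) (s m : ℕ) :
    binExp p (edgeSpace V d) (fun E => ind ((∃ S : Finset V, Indep d E S ∧ S.card = s) ∧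
      ∀ S : Finset V, Indep d E S → S.card ≠ s + 1)) ≤
    (Fintype.card V).choose s * (1 - p) ^ s.choose (d + 1) *
      (∑ r ∈ Finset.range m, (Fintype.card V - s).choose r *
          (prob₁ p (s.choose d) / (d + 1)) ^ r *
          (1 - prob₀ p ((s + r).choose d) - prob₁ p ((s + r).choose d)) ^
            (Fintype.card V - s - r) +
        (Fintype.card V - s).choose m * (prob₁ p (s.choose d) / (d + 1)) ^ m) := by
  have hd : (0 : ℝ) < d + 1 := by positivity
  let P : Finset (Finset V) → (_ : Finset V) × Finset V → Prop := fun E q =>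
    IsExtension d E q.1 q.2 ∧ ∀ u ∉ q.1 ∪ q.2, 2 ≤ deg d E (q.1 ∪ q.2) u
  -- By `exists_pow_le_sum` the event makes one of these counts, divided by the size of the cluster,
  -- at least 1. Matchings are followed only up to size `m`; in the last term nothing is required of
  -- the vertices outside.
  have step : ∀ E, ind ((∃ S : Finset V, Indep d E S ∧ S.card = s) ∧
      ∀ S : Finset V, Indep d E S → S.card ≠ s + 1) ≤
      (∑ r ∈ Finset.range m, ∑ q ∈ pairSpace V s r, (1 / ((d : ℝ) + 1) ^ r) * ind (P E q)) +
        ∑ q ∈ pairSpace V s m, (1 / ((d : ℝ) + 1) ^ m) * ind (IsExtension d E q.1 q.2) := by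
    intro E
    have hnn1 : ∀ r, 0 ≤ ∑ q ∈ pairSpace V s r, (1 / ((d : ℝ) + 1) ^ r) * ind (P E q) :=
      fun r => Finset.sum_nonneg fun q _ => mul_nonneg (by positivity) (ind_nonneg _)
    have hnn2 : 0 ≤ ∑ q ∈ pairSpace V s m,
        (1 / ((d : ℝ) + 1) ^ m) * ind (IsExtension d E q.1 q.2) :=
      Finset.sum_nonneg fun q _ => mul_nonneg (by positivity) (ind_nonneg _)
    by_cases h : (∃ S : Finset V, Indep d E S ∧ S.card = s) ∧
      ∀ S : Finset V, Indep d E S → S.card ≠ s + 1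
    · rw [ind_of h]
      rcases exists_pow_le_sum h.1 h.2 m with ⟨r, hr, h1⟩ | h1
      · have h2 : 1 ≤ ∑ q ∈ pairSpace V s r, (1 / ((d : ℝ) + 1) ^ r) * ind (P E q) := by
          rw [← Finset.mul_sum, div_mul_eq_mul_div, one_mul, le_div_iff₀ (by positivity), one_mul]
          exact h1
        have h3 := Finset.single_le_sum (fun r _ => hnn1 r) hr
        linarith
      · have h2 : 1 ≤ ∑ q ∈ pairSpace V s m,
            (1 / ((d : ℝ) + 1) ^ m) * ind (IsExtension d E q.1 q.2) := by
          rw [← Finset.mul_sum, div_mul_eq_mul_div, one_mul, le_div_iff₀ (by positivity), one_mul]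
          exact h1
        have h3 := Finset.sum_nonneg fun r (_ : r ∈ Finset.range m) => hnn1 r
        linarith
    · rw [ind_of_not h]
      exact add_nonneg (Finset.sum_nonneg fun r _ => hnn1 r) hnn2
  refine (binExp_mono hp hp' fun E _ => step E).trans (le_of_eq ?_)
  simp only [binExp_add, binExp_sum, binExp_const_mul]
  rw [mul_add, Finset.mul_sum]
  congr 1
  · refine Finset.sum_congr rfl fun r _ => ?_
    rw [Finset.sum_congr rfl fun q hq => by
      obtain ⟨h1, h2, h3⟩ := mem_pairSpace hq
      rw [binExp_isExtension_and h3, h1, h2], sum_pairSpace_const, div_pow]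
    ring
  · rw [Finset.sum_congr rfl fun q hq => by
      obtain ⟨h1, h2, h3⟩ := mem_pairSpace hq
      rw [binExp_isExtension h3, h1, h2], sum_pairSpace_const, div_pow]
    ring

/-- The first moment bound for the existence of an independent set of size `s`. -/
theorem binExp_exists_indep_le (hp : 0 ≤ p) (hp' : p ≤ 1) (s : ℕ) :
    binExp p (edgeSpace V d) (fun E => ind (∃ S : Finset V, Indep d E S ∧ S.card = s)) ≤
      (Fintype.card V).choose s * (1 - p) ^ s.choose (d + 1) := by
  refine (binExp_mono hp hp' (g := fun E => ∑ S ∈ (Finset.univ : Finset V).powersetCard s,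
    ind (Indep d E S)) fun E _ => ?_).trans (le_of_eq ?_)
  · refine (ind_mono ?_).trans (ind_exists_le_sum _ _)
    rintro ⟨S, hS, hc⟩
    exact ⟨S, Finset.mem_powersetCard.2 ⟨Finset.subset_univ _, hc⟩, hS⟩
  · rw [binExp_sum, Finset.sum_congr rfl fun S hS => by
      rw [binExp_indep, (Finset.mem_powersetCard.1 hS).2], Finset.sum_const,
      Finset.card_powersetCard, Finset.card_univ, nsmul_eq_mul]

end

/-! ### Correlation of the weights of two vertex sets. -/

section

variable {V : Type*} [Fintype V] [DecidableEq V] {d : ℕ} {p : ℝ}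

/-- The probability that a random subset of an `m`-set has at most one element. -/
noncomputable def probLe (p : ℝ) (m : ℕ) : ℝ := prob₀ p m + prob₁ p m

theorem binExp_card_inter_le_one {α : Type*} [DecidableEq α] {U W : Finset α} (hW : W ⊆ U) :
    binExp p U (fun E => ind ((E ∩ W).card ≤ 1)) = probLe p W.card := by
  have h0 := binExp_card_inter_eq (p := p) hW 0
  have h1 := binExp_card_inter_eq (p := p) hW 1
  simp only [Nat.choose_zero_right, Nat.cast_one, pow_zero, one_mul, Nat.sub_zero] at h0
  simp only [Nat.choose_one_right, pow_one] at h1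
  rw [probLe, prob₀, prob₁, ← h0, ← h1, ← binExp_add]
  refine binExp_congr fun E _ => ?_
  generalize (E ∩ W).card = m
  rcases m with _ | _ | m <;> simp [ind]

theorem star_inter_star {S S' : Finset V} {v : V} (hv : v ∉ S) (hv' : v ∉ S') :
    star d S v ∩ star d S' v = star d (S ∩ S') v := by
  ext e
  have hvi : v ∉ S ∩ S' := fun h => hv (Finset.mem_inter.1 h).1
  rw [Finset.mem_inter, mem_star_iff hv, mem_star_iff hv', mem_star_iff hvi,
    Finset.insert_inter_distrib, Finset.subset_inter_iff]
  tauto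

theorem card_powersetCard_union (m : ℕ) (S S' : Finset V) :
    (S.powersetCard m ∪ S'.powersetCard m).card + (S ∩ S').card.choose m =
      S.card.choose m + S'.card.choose m := by
  have : S.powersetCard m ∩ S'.powersetCard m = (S ∩ S').powersetCard m := by
    ext e
    simp only [Finset.mem_inter, Finset.mem_powersetCard, Finset.subset_inter_iff]
    tauto
  rw [← Finset.card_powersetCard m (S ∩ S'), ← this, Finset.card_union_add_card_inter,
    Finset.card_powersetCard, Finset.card_powersetCard]

theorem indep_and_iff {E : Finset (Finset V)} {S S' : Finset V} :
    Indep d E S ∧ Indep d E S' ↔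
      Disjoint E (S.powersetCard (d + 1) ∪ S'.powersetCard (d + 1)) := by
  rw [Indep, Indep, Finset.disjoint_union_right]

theorem binExp_indep_and (S S' : Finset V) :
    binExp p (edgeSpace V d) (fun E => ind (Indep d E S ∧ Indep d E S')) =
      (1 - p) ^ (S.card.choose (d + 1) + S'.card.choose (d + 1) -
        (S ∩ S').card.choose (d + 1)) := by
  simp only [indep_and_iff]
  rw [binExp_disjoint (Finset.union_subset (powersetCard_subset_edgeSpace _ _)
    (powersetCard_subset_edgeSpace _ _)), ← card_powersetCard_union, Nat.add_sub_cancel]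

/-- Expand `a * b = a + b - 1 + (1 - a) * (1 - b)`. The defect of a weight is at most the indicator
of degree at most 1. Counting only the edges into `S'` that are not in the star of `S` makes the two
indicators independent, so the excess over the squared mean is a product of two small probabilities.
-/
theorem binExp_starWt_mul_le (hp : 0 ≤ p) (hp' : p ≤ 1) {S S' : Finset V} {v : V} (hv : v ∉ S)
    (hv' : v ∉ S') (hc : S.card = S'.card) :
    binExp p (edgeSpace V d) (fun E => starWt d (deg d E S v) * starWt d (deg d E S' v)) ≤
      meanWt d p (S.card.choose d) ^ 2 + probLe p (S.card.choose d) *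
        probLe p (S.card.choose d - (S ∩ S').card.choose d) := by
  have hcard : (star d S' v \ star d S v).card = S.card.choose d - (S ∩ S').card.choose d := by
    have hvi : v ∉ S' ∩ S := fun h => hv (Finset.mem_inter.1 h).2
    rw [← Finset.sdiff_inter_self_left, star_inter_star hv' hv,
      Finset.card_sdiff_of_subset (star_mono Finset.inter_subset_left v), card_star hv',
      card_star hvi, hc, Finset.inter_comm]
  have hpt : ∀ a b : ℕ, starWt d a * starWt d b ≤
      starWt d a + starWt d b - 1 + ind (a ≤ 1) * ind (b ≤ 1) := by
    have h1 : ∀ a, 1 - starWt d a ≤ ind (a ≤ 1) := by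
      intro a
      rcases a with _ | _ | a
      · simp [starWt, ind]
      · have := starWt_nonneg d 1
        simp only [zero_add, ind_of le_rfl]
        linarith
      · simp [starWt, ind]
    intro a b
    have := mul_le_mul (h1 a) (h1 b) (by linarith [starWt_le_one d b]) (ind_nonneg _)
    nlinarith
  have hle : ∀ E ⊆ edgeSpace V d, starWt d (deg d E S v) * starWt d (deg d E S' v) ≤
      starWt d (deg d E S v) + starWt d (deg d E S' v) - 1 +
        ind ((E ∩ star d S v).card ≤ 1) * ind ((E ∩ (star d S' v \ star d S v)).card ≤ 1) := by
    intro E _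
    refine (hpt _ _).trans (add_le_add le_rfl ?_)
    refine mul_le_mul_of_nonneg_left (ind_mono fun h => le_trans (Finset.card_le_card ?_) h)
      (ind_nonneg _)
    exact Finset.inter_subset_inter_left Finset.sdiff_subset
  refine (binExp_mono hp hp' hle).trans ?_
  have hsub : star d S' v \ star d S v ⊆ edgeSpace V d :=
    Finset.sdiff_subset.trans (star_subset_edgeSpace hv')
  rw [binExp_add, binExp_sub, binExp_add, binExp_starWt hv, binExp_starWt hv', binExp_const,
    binExp_mul (U₁ := star d S v) (U₂ := star d S' v \ star d S v) Finset.disjoint_sdiff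
    (star_subset_edgeSpace hv) hsub
    (localOn_inter _ fun E => ind (E.card ≤ 1)) (localOn_inter _ fun E => ind (E.card ≤ 1)),
    binExp_card_inter_le_one (star_subset_edgeSpace hv), binExp_card_inter_le_one hsub,
    card_star hv, hcard, ← hc]
  -- The linear part `2 * m - 1` is at most `m ^ 2`.
  nlinarith [sq_nonneg (1 - meanWt d p (S.card.choose d))]

/-- The correlation of the weights of two vertex sets. -/
theorem binExp_setWt_mul_le (hp : 0 ≤ p) (hp' : p ≤ 1) {S S' : Finset V}
    (hc : S.card = S'.card) :
    binExp p (edgeSpace V d) (fun E => setWt d S E * setWt d S' E) ≤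
      (1 - p) ^ (2 * S.card.choose (d + 1) - (S ∩ S').card.choose (d + 1)) *
        (meanWt d p (S.card.choose d) ^ 2 + probLe p (S.card.choose d) *
          probLe p (S.card.choose d - (S ∩ S').card.choose d)) ^
            (Fintype.card V - (S ∪ S').card) := by
  let f : V → Finset (Finset V) → ℝ := fun v E => starWt d (deg d E S v) * starWt d (deg d E S' v)
  have hle : ∀ E ⊆ edgeSpace V d, setWt d S E * setWt d S' E ≤
      ind (Indep d E S ∧ Indep d E S') * ∏ v ∈ (S ∪ S')ᶜ, f v E := by
    intro E _
    rw [setWt, setWt, mul_mul_mul_comm, ← ind_and]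
    refine mul_le_mul_of_nonneg_left ?_ (ind_nonneg _)
    -- Weights are at most 1, so the factors at vertices of `S ∪ S'` may be dropped. For the other
    -- vertices the pairs of stars are disjoint.
    have key : ∀ A B : Finset V, A ⊆ B →
        ∏ v ∈ Aᶜ, starWt d (deg d E A v) ≤ ∏ v ∈ Bᶜ, starWt d (deg d E A v) := by
      intro A B hAB
      exact Finset.prod_le_prod_of_subset_of_le_one (Finset.compl_subset_compl.2 hAB)
        (fun _ _ => starWt_nonneg _ _) fun _ _ _ => starWt_le_one _ _
    rw [Finset.prod_mul_distrib]
    exact mul_le_mul (key _ _ Finset.subset_union_left) (key _ _ Finset.subset_union_right)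
      (Finset.prod_nonneg fun _ _ => starWt_nonneg _ _)
      (Finset.prod_nonneg fun _ _ => starWt_nonneg _ _)
  refine (binExp_mono hp hp' hle).trans ?_
  have hmem : ∀ v ∈ (S ∪ S')ᶜ, v ∉ S ∧ v ∉ S' := fun v hv => by
    simpa only [Finset.mem_compl, Finset.mem_union, not_or] using hv
  have hloc : ∀ v ∈ (S ∪ S')ᶜ, LocalOn (star d S v ∪ star d S' v) (f v) := fun v _ =>
    ((localOn_starWt d S v).mono Finset.subset_union_left).mul
      ((localOn_starWt d S' v).mono Finset.subset_union_right)
  have hsub : ∀ v ∈ (S ∪ S')ᶜ, star d S v ∪ star d S' v ⊆ edgeSpace V d := fun v hv =>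
    Finset.union_subset (star_subset_edgeSpace (hmem v hv).1) (star_subset_edgeSpace (hmem v hv).2)
  rw [binExp_mul (U₁ := S.powersetCard (d + 1) ∪ S'.powersetCard (d + 1))
    (U₂ := (S ∪ S')ᶜ.biUnion fun v => star d S v ∪ star d S' v), binExp_indep_and,
    binExp_prod _ (fun v => star d S v ∪ star d S' v) hsub _ hloc]
  · rw [← hc, ← two_mul]
    have hq : 0 ≤ 1 - p := by linarith
    refine mul_le_mul_of_nonneg_left ?_ (pow_nonneg hq _)
    rw [← Finset.card_compl]
    rw [← Finset.prod_const]
    refine Finset.prod_le_prod (fun v _ => ?_) fun v hv => ?_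
    · exact binExp_nonneg hp hp' fun E _ => mul_nonneg (starWt_nonneg _ _) (starWt_nonneg _ _)
    · exact binExp_starWt_mul_le hp hp' (hmem v hv).1 (hmem v hv).2 hc
  · intro u hu v hv huv
    rw [Finset.disjoint_union_left, Finset.disjoint_union_right, Finset.disjoint_union_right]
    exact ⟨⟨disjoint_star (hmem u hu).1 huv, disjoint_star (hmem u hu).2 huv⟩,
      disjoint_star (hmem u hu).1 huv, disjoint_star (hmem u hu).2 huv⟩
  · rw [Finset.disjoint_biUnion_right]
    intro v hv
    rw [Finset.disjoint_union_left, Finset.disjoint_union_right, Finset.disjoint_union_right]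
    exact ⟨⟨(disjoint_star_powersetCard (hmem v hv).1).symm,
      (disjoint_star_powersetCard (hmem v hv).1).symm⟩,
      (disjoint_star_powersetCard (hmem v hv).2).symm,
      (disjoint_star_powersetCard (hmem v hv).2).symm⟩
  · exact Finset.union_subset (powersetCard_subset_edgeSpace _ _)
      (powersetCard_subset_edgeSpace _ _)
  · exact Finset.biUnion_subset.2 hsub
  · simp only [indep_and_iff]
    intro E
    simp only [Finset.disjoint_iff_inter_eq_empty, Finset.inter_assoc, Finset.inter_self]
  · exact LocalOn.prod fun v hv => (hloc v hv).mono
      (Finset.subset_biUnion_of_mem (fun v => star d S v ∪ star d S' v) hv)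

end

/-! ### The cluster of independent sets around a good set. -/

section

section TransversalCount

variable {V : Type*} [DecidableEq V] [Fintype V] {M : Finset (Finset V)}

-- A transversal is the union of its traces on the members of `M`, and each trace is a singleton.
open Classical in
theorem card_isTransversal_le {m : ℕ} (hm : ∀ e ∈ M, e.card = m) :
    ((Finset.univ : Finset (Finset V)).filter (IsTransversal M)).card ≤ m ^ M.card := by
  have h : (M.pi fun e => e.powersetCard 1).card = m ^ M.card := by
    rw [Finset.card_pi, Finset.prod_congr rfl fun e he => by
      rw [Finset.card_powersetCard, Nat.choose_one_right, hm e he], Finset.prod_const]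
  rw [← h]
  refine Finset.card_le_card_of_injOn (fun R e _ => R ∩ e) ?_ ?_
  · intro R hR
    have hR' : IsTransversal M R := by simpa using hR
    refine Finset.mem_coe.2 (Finset.mem_pi.2 fun e he => ?_)
    obtain ⟨x, hx⟩ := hR'.2 e he
    refine Finset.mem_powersetCard.2 ⟨Finset.inter_subset_right, ?_⟩
    simp only [hx, Finset.card_singleton]
  · intro R hR R' hR' hRR
    have hR1 : IsTransversal M R := by simpa using hR
    have hR2 : IsTransversal M R' := by simpa using hR'
    have key : ∀ e ∈ M, R ∩ e = R' ∩ e := fun e he => congrFun (congrFun hRR e) he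
    have hb : ∀ R, IsTransversal M R → R = M.biUnion fun e => R ∩ e := fun R hR => by
      rw [← Finset.inter_biUnion]
      exact (Finset.inter_eq_left.2 hR.1).symm
    rw [hb R hR1, hb R' hR2]
    exact Finset.biUnion_congr rfl key

end TransversalCount

variable {V : Type*} [Fintype V] [DecidableEq V] {d : ℕ}

/-- The vertices outside `S`, other than `v`, with at most `C` edges into `S`. -/
def lightVerts (d C : ℕ) (E : Finset (Finset V)) (S : Finset V) (v : V) : Finset V :=
  (Sᶜ.erase v).filter fun u => deg d E S u ≤ C

/-- The vertices in `S` that are covered by the edges of vertices other than `v` with at most `C`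
edges into `S`. -/
def lightCover (d C : ℕ) (E : Finset (Finset V)) (S : Finset V) (v : V) : Finset V :=
  (lightVerts d C E S v).biUnion fun u => (E ∩ star d S u).biUnion fun e => e ∩ S

/-- The edges that consist of `v` and vertices of `S`, some of them in `X`. -/
def edgesMeeting (d : ℕ) (E : Finset (Finset V)) (S : Finset V) (v : V) (X : Finset V) :
    Finset (Finset V) :=
  (E ∩ star d S v).filter fun e => (e ∩ X).Nonempty

/-- The edges of vertices with few edges into `S` are disjoint inside `S`. -/
def LightDisjoint (d C : ℕ) (E : Finset (Finset V)) (S : Finset V) : Prop :=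
  ∀ u ∉ S, ∀ v ∉ S, deg d E S u ≤ C → deg d E S v ≤ C →
    ∀ e ∈ E ∩ star d S u, ∀ e' ∈ E ∩ star d S v, e ≠ e' → Disjoint (e ∩ S) (e' ∩ S)

/-- No edge contains two vertices outside `S` if the vertices of the edge outside `S` are in just
one edge with vertices of `S`. -/
def NoLightEdge (d : ℕ) (E : Finset (Finset V)) (S : Finset V) : Prop :=
  ∀ e ∈ E, e.card = d + 1 → (∀ x ∈ e \ S, deg d E S x = 1) → (e \ S).card ≤ 1

/-- Every vertex has few edges that meet the edges of vertices with few edges into `S`. -/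
def FewMeetLight (d C C₁ : ℕ) (E : Finset (Finset V)) (S : Finset V) : Prop :=
  ∀ v ∉ S, (edgesMeeting d E S v (lightCover d C E S v)).card < C₁

/-- There is no small set of vertices outside `S` all of which have many edges into a set of the
same size in `S`. -/
def NoDense (d C₁ l : ℕ) (E : Finset (Finset V)) (S : Finset V) : Prop :=
  ∀ J L : Finset V, Disjoint J S → L ⊆ S → J.Nonempty → J.card ≤ l → L.card = J.card →
    ∃ v ∈ J, (edgesMeeting d E S v L).card < C₁

/-- The properties of the surroundings of an independent set by which the independent sets close to
it are known. -/
structure Good (d C₁ l : ℕ) (E : Finset (Finset V)) (S : Finset V) : Prop where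
  lightDisjoint : LightDisjoint d (2 * C₁) E S
  noLightEdge : NoLightEdge d E S
  fewMeetLight : FewMeetLight d (2 * C₁) C₁ E S
  noDense : NoDense d C₁ l E S

section Near

variable {C₁ l : ℕ} {E : Finset (Finset V)} {S S' : Finset V}

/-- The edge is not inside `S'`, and `v` is in `S'`, so the edge has lost one of its vertices in
`S`. -/
theorem inter_sdiff_nonempty (hS' : Indep d E S') {v : V} (hv : v ∈ S' \ S)
    {e : Finset V} (he : e ∈ E ∩ star d S v) : (e ∩ (S \ S')).Nonempty := by
  obtain ⟨heE, hes⟩ := Finset.mem_inter.1 he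
  obtain ⟨hvS', hvS⟩ := Finset.mem_sdiff.1 hv
  obtain ⟨hve, hc, hsub⟩ := (mem_star_iff hvS).1 hes
  have h1 := indep_iff.1 hS' e heE hc
  obtain ⟨x, hx, hxS'⟩ := Finset.not_subset.1 h1
  refine ⟨x, Finset.mem_inter.2 ⟨hx, Finset.mem_sdiff.2 ⟨?_, hxS'⟩⟩⟩
  rcases Finset.mem_insert.1 (hsub hx) with rfl | h
  · exact absurd hvS' hxS'
  · exact h

theorem edges_pairwiseDisjoint {A : Finset V} (hA : ∀ v ∈ A, v ∉ S) :
    (A : Set V).PairwiseDisjoint fun v => E ∩ star d S v := fun u hu _ _ huv =>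
  (disjoint_star (hA u hu) huv).mono Finset.inter_subset_right Finset.inter_subset_right

/-- The structure of the independent sets of the same size that are close to a good set. -/
theorem Good.near_structure (hG : Good d C₁ l E S) 
    (hpos : ∀ v ∉ S, 1 ≤ deg d E S v) (hS' : Indep d E S') (hc : S'.card = S.card)
    (hl : (S \ S').card ≤ l) :
    (∀ v ∈ S' \ S, deg d E S v = 1) ∧
      (∀ v ∈ S' \ S, ∀ e ∈ E ∩ star d S v, (e ∩ (S \ S')).card = 1) ∧
      ∀ x ∈ S \ S', ∃ v ∈ S' \ S, ∃ e ∈ E ∩ star d S v, x ∈ e := by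
  set L := S \ S' with hL
  set A := S' \ S with hA
  have hcard : A.card = L.card := Finset.card_sdiff_comm hc
  have hAS : ∀ v ∈ A, v ∉ S := fun v hv => (Finset.mem_sdiff.1 hv).2
  -- The new vertices are split into light and heavy ones. The threshold is `2 * C₁` because the
  -- edges of a heavy vertex will be covered by two families of fewer than `C₁` edges each.
  set A₁ := A.filter fun v => deg d E S v ≤ 2 * C₁ with hA₁
  set A₂ := A.filter fun v => ¬ deg d E S v ≤ 2 * C₁ with hA₂
  have hsplit : A₁.card + A₂.card = A.card :=
    Finset.card_filter_add_card_filter_not _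
  have hA₁A : ∀ v ∈ A₁, v ∈ A := fun v hv => (Finset.mem_filter.1 hv).1
  set B := A₁.biUnion fun v => E ∩ star d S v with hB
  have hBcard : B.card = ∑ v ∈ A₁, deg d E S v :=
    Finset.card_biUnion (edges_pairwiseDisjoint fun v hv => hAS v (hA₁A v hv))
  have hBdisj : (B : Set (Finset V)).PairwiseDisjoint fun e => e ∩ L := by
    intro e he e' he' hne
    obtain ⟨u, hu, heu⟩ := Finset.mem_biUnion.1 (Finset.mem_coe.1 he)
    obtain ⟨v, hv, hev⟩ := Finset.mem_biUnion.1 (Finset.mem_coe.1 he')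
    have := hG.lightDisjoint u (hAS u (hA₁A u hu)) v (hAS v (hA₁A v hv))
      (Finset.mem_filter.1 hu).2 (Finset.mem_filter.1 hv).2 e heu e' hev hne
    exact this.mono (Finset.inter_subset_inter_left Finset.sdiff_subset)
      (Finset.inter_subset_inter_left Finset.sdiff_subset)
  set L₁ := B.biUnion fun e => e ∩ L with hL₁
  have hL₁card : L₁.card = ∑ e ∈ B, (e ∩ L).card := Finset.card_biUnion hBdisj
  have hL₁L : L₁ ⊆ L := Finset.biUnion_subset.2 fun e _ => Finset.inter_subset_right
  have hone : ∀ e ∈ B, 1 ≤ (e ∩ L).card := by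
    intro e he
    obtain ⟨v, hv, hev⟩ := Finset.mem_biUnion.1 he
    exact Finset.card_pos.2 (inter_sdiff_nonempty hS' (hA₁A v hv) hev)
  have hBL : B.card ≤ L₁.card := by
    rw [hL₁card, Finset.card_eq_sum_ones]
    exact Finset.sum_le_sum hone
  have hA₁B : A₁.card ≤ B.card := by
    rw [hBcard, Finset.card_eq_sum_ones]
    exact Finset.sum_le_sum fun v hv => hpos v (hAS v (hA₁A v hv))
  -- The edges of the light vertices are disjoint inside `S` and use up at least `A₁.card` of the
  -- lost vertices, so at most `A₂.card` lost vertices remain. Pad these to a set `L₂` of size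
  -- exactly `A₂.card`, as `NoDense` requires. Some heavy vertex then has fewer than `C₁` edges
  -- meeting `L₂`, and by `fewMeetLight` fewer than `C₁` meeting the vertices used by light ones.
  -- Each of its edges does one or the other, so it is not heavy.
  have hA₂e : A₂ = ∅ := by
    by_contra hne
    have hne' := Finset.nonempty_iff_ne_empty.2 hne
    have hsmall : (L \ L₁).card ≤ A₂.card := by
      rw [Finset.card_sdiff_of_subset hL₁L]; omega
    obtain ⟨L₂, h1, h2, h3⟩ := Finset.exists_subsuperset_card_eq
      (Finset.sdiff_subset.trans Finset.sdiff_subset : L \ L₁ ⊆ S) hsmall (by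
        have : L.card ≤ S.card := Finset.card_le_card Finset.sdiff_subset
        omega)
    obtain ⟨v, hv, hlt⟩ := hG.noDense A₂ L₂ (Finset.disjoint_left.2 fun v hv =>
      hAS v (Finset.mem_filter.1 hv).1) h2 hne' (by omega) h3
    obtain ⟨hvA, hheavy⟩ := Finset.mem_filter.1 hv
    have hfew := hG.fewMeetLight v (hAS v hvA)
    have hcover : E ∩ star d S v ⊆ edgesMeeting d E S v (lightCover d (2 * C₁) E S v) ∪
        edgesMeeting d E S v L₂ := by
      intro e he
      obtain ⟨x, hx⟩ := inter_sdiff_nonempty hS' hvA he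
      obtain ⟨hxe, hxL⟩ := Finset.mem_inter.1 hx
      rw [Finset.mem_union, edgesMeeting, edgesMeeting, Finset.mem_filter, Finset.mem_filter]
      by_cases hx1 : x ∈ L₁
      · left
        refine ⟨he, x, Finset.mem_inter.2 ⟨hxe, ?_⟩⟩
        obtain ⟨e', he', hxe'⟩ := Finset.mem_biUnion.1 hx1
        obtain ⟨u, hu, heu⟩ := Finset.mem_biUnion.1 he'
        obtain ⟨huA, hulight⟩ := Finset.mem_filter.1 hu
        refine Finset.mem_biUnion.2 ⟨u, ?_, Finset.mem_biUnion.2 ⟨e', heu, ?_⟩⟩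
        · refine Finset.mem_filter.2 ⟨Finset.mem_erase.2 ⟨?_, Finset.mem_compl.2 (hAS u huA)⟩,
            hulight⟩
          rintro rfl
          exact hheavy hulight
        · exact Finset.mem_inter.2 ⟨(Finset.mem_inter.1 hxe').1, (Finset.mem_sdiff.1 hxL).1⟩
      · right
        exact ⟨he, x, Finset.mem_inter.2 ⟨hxe, h1 (Finset.mem_sdiff.2 ⟨hxL, hx1⟩)⟩⟩
    have h4 := (Finset.card_le_card hcover).trans (Finset.card_union_le _ _)
    have h5 : (E ∩ star d S v).card = deg d E S v := rfl
    omega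
  -- All new vertices are light, and the chain `A₁.card ≤ B.card ≤ L₁.card ≤ L.card = A.card` closes
  -- up. Equality throughout gives the three claims.
  rw [hA₂e, Finset.card_empty, add_zero] at hsplit
  have hA₁eq : A₁ = A := Finset.eq_of_subset_of_card_le (Finset.filter_subset _ _) hsplit.ge
  have hLc : L₁.card ≤ L.card := Finset.card_le_card hL₁L
  have hL₁eq : L₁ = L := Finset.eq_of_subset_of_card_le hL₁L (by omega)
  have hdeg : ∀ v ∈ A₁, 1 = deg d E S v := by
    refine (Finset.sum_eq_sum_iff_of_le fun v hv => hpos v (hAS v (hA₁A v hv))).1 ?_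
    rw [← Finset.card_eq_sum_ones, ← hBcard]; omega
  have hint : ∀ e ∈ B, 1 = (e ∩ L).card := by
    refine (Finset.sum_eq_sum_iff_of_le hone).1 ?_
    rw [← Finset.card_eq_sum_ones, ← hL₁card]; omega
  refine ⟨fun v hv => (hdeg v (hA₁eq ▸ hv)).symm, fun v hv e he => (hint e ?_).symm,
    fun x hx => ?_⟩
  · exact Finset.mem_biUnion.2 ⟨v, hA₁eq ▸ hv, he⟩
  · rw [← hL₁eq] at hx
    obtain ⟨e, he, hxe⟩ := Finset.mem_biUnion.1 hx
    obtain ⟨v, hv, hev⟩ := Finset.mem_biUnion.1 he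
    exact ⟨v, hA₁A v hv, e, hev, (Finset.mem_inter.1 hxe).1⟩

/-- The vertices outside `S` that are in exactly one edge with vertices of `S`. -/
def onceVerts (d : ℕ) (E : Finset (Finset V)) (S : Finset V) : Finset V :=
  Sᶜ.filter fun v => deg d E S v = 1

theorem mem_onceVerts {v : V} : v ∈ onceVerts d E S ↔ v ∉ S ∧ deg d E S v = 1 := by
  rw [onceVerts, Finset.mem_filter, Finset.mem_compl]

/-- An edge inside the union has at most one vertex outside `S` by `noLightEdge`, and at least one
because `S` is independent. -/
theorem Good.inside_eq (hG : Good d C₁ l E S) (hS : Indep d E S) :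
    E ∩ (S ∪ onceVerts d E S).powersetCard (d + 1) =
      (onceVerts d E S).biUnion fun v => E ∩ star d S v := by
  ext e
  rw [mem_inside, Finset.mem_biUnion]
  constructor
  · rintro ⟨he, hsub, hc⟩
    have hR : ∀ x ∈ e \ S, x ∈ onceVerts d E S := fun x hx => by
      obtain ⟨hxe, hxS⟩ := Finset.mem_sdiff.1 hx
      exact (Finset.mem_union.1 (hsub hxe)).resolve_left hxS
    have h1 := hG.noLightEdge e he hc fun x hx => (mem_onceVerts.1 (hR x hx)).2
    obtain ⟨x, hxe, hxS⟩ := Finset.not_subset.1 (indep_iff.1 hS e he hc)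
    have hx : x ∈ e \ S := Finset.mem_sdiff.2 ⟨hxe, hxS⟩
    refine ⟨x, hR x hx, Finset.mem_inter.2 ⟨he, (mem_star_iff hxS).2 ⟨hxe, hc, ?_⟩⟩⟩
    intro y hy
    by_cases hyS : y ∈ S
    · exact Finset.mem_insert_of_mem hyS
    · exact Finset.mem_insert.2 (Or.inl (Finset.card_le_one.1 h1 y
        (Finset.mem_sdiff.2 ⟨hy, hyS⟩) x hx))
  · rintro ⟨v, hv, he⟩
    obtain ⟨heE, hes⟩ := Finset.mem_inter.1 he
    obtain ⟨-, hc, hsub⟩ := (mem_star_iff (mem_onceVerts.1 hv).1).1 hes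
    refine ⟨heE, hsub.trans (Finset.insert_subset ?_ Finset.subset_union_left), hc⟩
    exact Finset.mem_union_right _ hv

/-- Vertices of degree 1 are light, so `lightDisjoint` separates their edges inside `S`; outside `S`
the edges have one vertex each, and these differ. -/
theorem Good.isMatched (hG : Good d C₁ l E S) (hS : Indep d E S) (hC : 1 ≤ C₁) :
    IsMatched d E (S ∪ onceVerts d E S) (onceVerts d E S).card := by
  have hin := hG.inside_eq hS
  refine ⟨?_, ?_⟩
  · rw [hin, Finset.card_biUnion (edges_pairwiseDisjoint fun v hv => (mem_onceVerts.1 hv).1),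
      Finset.card_eq_sum_ones]
    exact Finset.sum_congr rfl fun v hv => (mem_onceVerts.1 hv).2
  · rw [hin]
    intro e he e' he' hne
    obtain ⟨u, hu, heu⟩ := Finset.mem_biUnion.1 (Finset.mem_coe.1 he)
    obtain ⟨v, hv, hev⟩ := Finset.mem_biUnion.1 (Finset.mem_coe.1 he')
    obtain ⟨huS, hdu⟩ := mem_onceVerts.1 hu
    obtain ⟨hvS, hdv⟩ := mem_onceVerts.1 hv
    have hd := hG.lightDisjoint u huS v hvS (by omega) (by omega) e heu e' hev hne
    have huv : u ≠ v := by
      rintro rfl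
      exact hne (Finset.card_le_one.1 (le_of_eq hdu) e heu e' hev)
    obtain ⟨hue, -, hse⟩ := (mem_star_iff huS).1 (Finset.mem_inter.1 heu).2
    obtain ⟨hve, -, hse'⟩ := (mem_star_iff hvS).1 (Finset.mem_inter.1 hev).2
    simp only [Function.onFun, id]
    rw [Finset.disjoint_left] at hd ⊢
    intro x hx hx'
    rcases Finset.mem_insert.1 (hse hx) with rfl | h
    · rcases Finset.mem_insert.1 (hse' hx') with h' | h'
      · exact huv h'
      · exact huS h'
    · exact hd (Finset.mem_inter.2 ⟨hx, h⟩) (Finset.mem_inter.2 ⟨hx', h⟩)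

/-- Let `e` be the matching edge of a once-vertex `v`. If `v ∈ S'`, then `e` loses exactly one
vertex of `S` by `near_structure`. If `v ∉ S'`, then `e` loses `v` and nothing else: a lost vertex
in `S` would lie on the edge of some new vertex `u`, by disjointness this edge is `e`, and then `u =
v`. -/
theorem Good.isTransversal_sdiff (hG : Good d C₁ l E S) (hC : 1 ≤ C₁)
    (hS : Indep d E S) (hpos : ∀ v ∉ S, 1 ≤ deg d E S v) (hS' : Indep d E S')
    (hc : S'.card = S.card) (hl : (S \ S').card ≤ l) :
    S' ⊆ S ∪ onceVerts d E S ∧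
      IsTransversal (E ∩ (S ∪ onceVerts d E S).powersetCard (d + 1))
        ((S ∪ onceVerts d E S) \ S') := by
  obtain ⟨h1, h2, h3⟩ := hG.near_structure hpos hS' hc hl
  have hM := hG.isMatched hS hC
  have hin := hG.inside_eq hS
  have hsub : S' ⊆ S ∪ onceVerts d E S := by
    intro x hx
    by_cases hxS : x ∈ S
    · exact Finset.mem_union_left _ hxS
    · exact Finset.mem_union_right _ (mem_onceVerts.2 ⟨hxS, h1 x (Finset.mem_sdiff.2 ⟨hx, hxS⟩)⟩)
  refine ⟨hsub, ?_, ?_⟩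
  · intro x hx
    obtain ⟨hxT, hxS'⟩ := Finset.mem_sdiff.1 hx
    rw [hin]
    rcases Finset.mem_union.1 hxT with hxS | hxR
    · obtain ⟨v, hv, e, he, hxe⟩ := h3 x (Finset.mem_sdiff.2 ⟨hxS, hxS'⟩)
      have hvR : v ∈ onceVerts d E S := mem_onceVerts.2 ⟨(Finset.mem_sdiff.1 hv).2, h1 v hv⟩
      exact Finset.mem_biUnion.2 ⟨e, Finset.mem_biUnion.2 ⟨v, hvR, he⟩, hxe⟩
    · obtain ⟨hxS, hdx⟩ := mem_onceVerts.1 hxR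
      obtain ⟨e, he⟩ := Finset.card_eq_one.1 hdx
      have he' : e ∈ E ∩ star d S x := by rw [he]; simp
      refine Finset.mem_biUnion.2 ⟨e, Finset.mem_biUnion.2 ⟨x, hxR, he'⟩, ?_⟩
      exact ((mem_star_iff hxS).1 (Finset.mem_inter.1 he').2).1
  · intro e he
    have heM := he
    rw [hin] at he
    obtain ⟨v, hvR, hev⟩ := Finset.mem_biUnion.1 he
    obtain ⟨hvS, hdv⟩ := mem_onceVerts.1 hvR
    obtain ⟨hve, -, hse⟩ := (mem_star_iff hvS).1 (Finset.mem_inter.1 hev).2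
    by_cases hvS' : v ∈ S'
    · have hvA : v ∈ S' \ S := Finset.mem_sdiff.2 ⟨hvS', hvS⟩
      obtain ⟨x, hx⟩ := Finset.card_eq_one.1 (h2 v hvA e hev)
      refine ⟨x, ?_⟩
      rw [← hx]
      ext y
      simp only [Finset.mem_inter, Finset.mem_sdiff, Finset.mem_union]
      constructor
      · rintro ⟨⟨-, hyS'⟩, hye⟩
        refine ⟨hye, ?_, hyS'⟩
        rcases Finset.mem_insert.1 (hse hye) with rfl | h
        · exact absurd hvS' hyS'
        · exact h
      · rintro ⟨hye, hyS, hyS'⟩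
        exact ⟨⟨Or.inl hyS, hyS'⟩, hye⟩
    · refine ⟨v, ?_⟩
      ext y
      simp only [Finset.mem_inter, Finset.mem_sdiff, Finset.mem_union, Finset.mem_singleton]
      constructor
      · rintro ⟨⟨-, hyS'⟩, hye⟩
        rcases Finset.mem_insert.1 (hse hye) with h | hyS
        · exact h
        · exfalso
          obtain ⟨u, hu, e', he', hye'⟩ := h3 y (Finset.mem_sdiff.2 ⟨hyS, hyS'⟩)
          obtain ⟨huS', huS⟩ := Finset.mem_sdiff.1 hu
          have huR : u ∈ onceVerts d E S := mem_onceVerts.2 ⟨huS, h1 u hu⟩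
          have he'M : e' ∈ E ∩ (S ∪ onceVerts d E S).powersetCard (d + 1) := by
            rw [hin]; exact Finset.mem_biUnion.2 ⟨u, huR, he'⟩
          have hee : e = e' := by
            by_contra hne
            exact Finset.disjoint_left.1 (hM.2 heM he'M hne) hye hye'
          subst hee
          have hue : u ∈ e := ((mem_star_iff huS).1 (Finset.mem_inter.1 he').2).1
          rcases Finset.mem_insert.1 (hse hue) with h | h
          · exact hvS' (h ▸ huS')
          · exact huS h
      · rintro rfl
        exact ⟨⟨Or.inr hvR, hvS'⟩, hve⟩

/-- The total weight of the sets close to a good independent set is at most 1. -/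
theorem Good.sum_setWt_le_one (hG : Good d C₁ l E S) (hC : 1 ≤ C₁)
    (hS : Indep d E S) (hpos : ∀ v ∉ S, 1 ≤ deg d E S v) :
    ∑ S' ∈ ((Finset.univ : Finset V).powersetCard S.card).filter (fun S' => (S \ S').card ≤ l),
      setWt d S' E ≤ 1 := by
  classical
  set T := S ∪ onceVerts d E S with hT
  set r := (onceVerts d E S).card with hr
  have hM := hG.isMatched hS hC
  have hdpos : (0 : ℝ) < d + 1 := by positivity
  -- A near set with positive weight is `T` minus a transversal. Each of the `r` removed vertices
  -- has degree 1 into it and contributes `1 / (d + 1)`; the other factors are at most 1.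
  have hwt : ∀ S' ∈ ((Finset.univ : Finset V).powersetCard S.card).filter
      (fun S' => (S \ S').card ≤ l), setWt d S' E ≤
        ind (S' ⊆ T ∧ IsTransversal (E ∩ T.powersetCard (d + 1)) (T \ S')) *
          (1 / ((d : ℝ) + 1)) ^ r := by
    intro S' hS'
    obtain ⟨hS'1, hl⟩ := Finset.mem_filter.1 hS'
    have hc := (Finset.mem_powersetCard.1 hS'1).2
    by_cases hind : Indep d E S'
    · obtain ⟨hsub, htr⟩ := hG.isTransversal_sdiff hC hS hpos hind hc hl
      rw [ind_of ⟨hsub, htr⟩, one_mul]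
      have hext := (hM.isExtension htr).2
      rw [Finset.sdiff_sdiff_eq_self hsub] at hext
      have hcard := htr.card_eq hM.2
      rw [hM.1] at hcard
      calc setWt d S' E ≤ ∏ v ∈ S'ᶜ, starWt d (deg d E S' v) :=
            mul_le_of_le_one_left (Finset.prod_nonneg fun _ _ => starWt_nonneg _ _) (ind_le_one _)
        _ ≤ ∏ v ∈ T \ S', starWt d (deg d E S' v) := by
            refine Finset.prod_le_prod_of_subset_of_le_one ?_ (fun _ _ => starWt_nonneg _ _)
              fun _ _ _ => starWt_le_one _ _
            intro x hx
            exact Finset.mem_compl.2 (Finset.mem_sdiff.1 hx).2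
        _ = ∏ v ∈ T \ S', (1 / ((d : ℝ) + 1)) := by
            refine Finset.prod_congr rfl fun v hv => ?_
            rw [hext v hv]; simp [starWt]
        _ = (1 / ((d : ℝ) + 1)) ^ r := by rw [Finset.prod_const, hcard]
    · rw [setWt, ind_of_not hind, zero_mul]
      exact mul_nonneg (ind_nonneg _) (by positivity)
  refine (Finset.sum_le_sum hwt).trans ?_
  rw [← Finset.sum_mul, sum_ind_eq_card]
  -- The map `S' ↦ T \ S'` is injective into the at most `(d + 1) ^ r` transversals, which
  -- compensates the weights.
  have hcount : ((((Finset.univ : Finset V).powersetCard S.card).filter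
      (fun S' => (S \ S').card ≤ l)).filter fun S' => S' ⊆ T ∧
        IsTransversal (E ∩ T.powersetCard (d + 1)) (T \ S')).card ≤ (d + 1) ^ r := by
    rw [hr, ← hM.1]
    refine le_trans ?_ (card_isTransversal_le fun e he => (mem_inside.1 he).2.2)
    refine Finset.card_le_card_of_injOn (fun S' => T \ S') ?_ ?_
    · intro S' hS'
      simpa using (Finset.mem_filter.1 (Finset.mem_coe.1 hS')).2.2
    · intro A hA B hB hAB
      have h1 := (Finset.mem_filter.1 (Finset.mem_coe.1 hA)).2.1
      have h2 := (Finset.mem_filter.1 (Finset.mem_coe.1 hB)).2.1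
      simp only at hAB
      rw [← Finset.sdiff_sdiff_eq_self h1, hAB, Finset.sdiff_sdiff_eq_self h2]
  calc _ ≤ (((d + 1) ^ r : ℕ) : ℝ) * (1 / ((d : ℝ) + 1)) ^ r := by gcongr
    _ = 1 := by
      push_cast
      rw [← mul_pow, mul_one_div_cancel hdpos.ne', one_pow]

end Near

end

/-! ### Conditioning in the weighted measure; disjointness of light edges. -/

section

theorem card_powersetCard_le_pow {α : Type*} (S : Finset α) (m : ℕ) :
    (S.powersetCard m).card ≤ S.card ^ m := by
  rw [Finset.card_powersetCard]
  exact Nat.choose_le_pow _ _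

section

variable {V : Type*} [DecidableEq V] {d : ℕ}

theorem card_star_le {S : Finset V} {v : V} : (star d S v).card ≤ S.card ^ d :=
  Finset.card_image_le.trans (card_powersetCard_le_pow _ _)

/-- Choose the vertex in `X`, then the remaining `d - 1` vertices in `S`. -/
theorem card_star_filter_meet_le {S X : Finset V} {v : V} (hv : v ∉ S) (hX : X ⊆ S) :
    ((star d S v).filter fun e => (e ∩ X).Nonempty).card ≤ X.card * S.card ^ (d - 1) := by
  have hsub : ((star d S v).filter fun e => (e ∩ X).Nonempty) ⊆
      X.biUnion fun x => (S.powersetCard (d - 1)).image fun f => insert v (insert x f) := by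
    intro e he
    obtain ⟨hes, x, hx⟩ := Finset.mem_filter.1 he
    obtain ⟨hxe, hxX⟩ := Finset.mem_inter.1 hx
    obtain ⟨f, hf, hc, rfl⟩ := mem_star.1 hes
    have hxv : x ≠ v := by rintro rfl; exact hv (hX hxX)
    have hxf : x ∈ f := (Finset.mem_insert.1 hxe).resolve_left hxv
    refine Finset.mem_biUnion.2 ⟨x, hxX, Finset.mem_image.2 ⟨f.erase x, ?_, ?_⟩⟩
    · exact Finset.mem_powersetCard.2 ⟨(Finset.erase_subset _ _).trans hf, by
        rw [Finset.card_erase_of_mem hxf, hc]⟩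
    · rw [Finset.insert_erase hxf]
  refine (Finset.card_le_card hsub).trans (Finset.card_biUnion_le_card_mul _ _ _ fun x _ => ?_)
  exact Finset.card_image_le.trans (card_powersetCard_le_pow _ _)

end

variable {V : Type*} [Fintype V] [DecidableEq V] {d : ℕ} {p : ℝ}

/-- Chernoff's bound: the indicator of degree at most `C` is at most `θ ^ C * θ⁻¹ ^ m`, where `m`
counts the edges outside `F`. These are independent of the event `F ⊆ E`. -/
theorem binExp_subset_mul_deg_le (hp : 0 ≤ p) (hp' : p ≤ 1) {θ : ℝ} (hθ : 1 ≤ θ) {S : Finset V}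
    {v : V} (hv : v ∉ S) (C : ℕ) {F : Finset (Finset V)} (hF : F ⊆ star d S v) :
    binExp p (edgeSpace V d) (fun E => ind (F ⊆ E) * ind (deg d E S v ≤ C)) ≤
      p ^ F.card * (θ ^ C * (p * θ⁻¹ + (1 - p)) ^ (S.card.choose d - F.card)) := by
  have hθ0 : 0 < θ := by linarith
  have hsE := star_subset_edgeSpace (d := d) hv
  have hle : ∀ E ⊆ edgeSpace V d, ind (F ⊆ E) * ind (deg d E S v ≤ C) ≤
      ind (F ⊆ E) * (θ ^ C * θ⁻¹ ^ (E ∩ (star d S v \ F)).card) := by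
    intro E _
    refine mul_le_mul_of_nonneg_left ?_ (ind_nonneg _)
    by_cases h : deg d E S v ≤ C
    · rw [ind_of h, inv_pow, ← div_eq_mul_inv, le_div_iff₀ (by positivity), one_mul]
      refine pow_le_pow_right₀ hθ (le_trans (Finset.card_le_card ?_) h)
      exact Finset.inter_subset_inter_left Finset.sdiff_subset
    · rw [ind_of_not h]; positivity
  refine (binExp_mono hp hp' hle).trans (le_of_eq ?_)
  have hloc : LocalOn (star d S v \ F) fun E => θ ^ C * θ⁻¹ ^ (E ∩ (star d S v \ F)).card :=
    localOn_inter _ fun E => θ ^ C * θ⁻¹ ^ E.card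
  rw [binExp_subset_mul (hF.trans hsE) _ (hloc.mono (Finset.sdiff_subset_sdiff hsE le_rfl)),
    binExp_const_mul, binExp_inter (Finset.sdiff_subset.trans hsE) (fun E => θ⁻¹ ^ E.card),
    binExp_pow_card, Finset.card_sdiff_of_subset hF, card_star hv]

/-- Each factor that is left out has mean at least `1 / 2`. -/
theorem binExp_partial_setWt_le (hp' : p ≤ 1) {S J : Finset V}
    (hJ : Disjoint J S) (hm : 1 / 2 ≤ meanWt d p (S.card.choose d)) :
    binExp p (edgeSpace V d)
      (fun E => ind (Indep d E S) * ∏ v ∈ Sᶜ \ J, starWt d (deg d E S v)) ≤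
      2 ^ J.card * binExp p (edgeSpace V d) (setWt d S) := by
  have hq : 0 ≤ 1 - p := by linarith
  have hJS : J ⊆ Sᶜ := fun v hv => Finset.mem_compl.2 (Finset.disjoint_left.1 hJ hv)
  rw [binExp_indep_mul_prod_starWt (disjoint_compl_left.mono_left Finset.sdiff_subset),
    binExp_setWt, ← Finset.card_compl, ← Finset.card_sdiff_add_card_eq_card hJS, pow_add]
  have h1 : 1 ≤ 2 ^ J.card * meanWt d p (S.card.choose d) ^ J.card := by
    rw [← mul_pow]; exact one_le_pow₀ (by linarith)
  have h2 : 0 ≤ (1 - p) ^ S.card.choose (d + 1) *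
      meanWt d p (S.card.choose d) ^ (Sᶜ \ J).card :=
    mul_nonneg (pow_nonneg hq _) (pow_nonneg (by linarith) _)
  calc _ ≤ ((1 - p) ^ S.card.choose (d + 1) *
        meanWt d p (S.card.choose d) ^ (Sᶜ \ J).card) *
        (2 ^ J.card * meanWt d p (S.card.choose d) ^ J.card) := le_mul_of_one_le_right h2 h1
    _ = _ := by ring

theorem partial_setWt_nonneg (E : Finset (Finset V)) (S A : Finset V) :
    0 ≤ ind (Indep d E S) * ∏ v ∈ A, starWt d (deg d E S v) :=
  mul_nonneg (ind_nonneg _) (Finset.prod_nonneg fun _ _ => starWt_nonneg _ _)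

theorem setWt_le_partial (E : Finset (Finset V)) (S J : Finset V) :
    setWt d S E ≤ ind (Indep d E S) * ∏ v ∈ Sᶜ \ J, starWt d (deg d E S v) :=
  mul_le_mul_of_nonneg_left (Finset.prod_le_prod_of_subset_of_le_one Finset.sdiff_subset
    (fun _ _ => starWt_nonneg _ _) fun _ _ _ => starWt_le_one _ _) (ind_nonneg _)

theorem localOn_partial_setWt (S J : Finset V) {W : Finset (Finset V)}
    (hW : S.powersetCard (d + 1) ⊆ W) (hWu : ∀ u ∉ S, u ∉ J → star d S u ⊆ W) :
    LocalOn W fun E => ind (Indep d E S) * ∏ v ∈ Sᶜ \ J, starWt d (deg d E S v) := by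
  refine LocalOn.mul (((localOn_indep d S).comp ind).mono hW) (LocalOn.prod fun u hu => ?_)
  rw [Finset.mem_sdiff, Finset.mem_compl] at hu
  exact (localOn_starWt d S u).mono (hWu u hu.1 hu.2)

/-- Conditions on the edges of a few vertices cost only a constant factor for each vertex. -/
theorem binExp_setWt_mul_le_of_localOn (hp : 0 ≤ p) (hp' : p ≤ 1) {S J : Finset V}
    (hJ : Disjoint J S) {W : Finset (Finset V)} (hW : W ⊆ edgeSpace V d)
    (hWS : Disjoint W (S.powersetCard (d + 1)))
    (hWu : ∀ u ∉ S, u ∉ J → Disjoint W (star d S u)) {g : Finset (Finset V) → ℝ}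
    (hg : ∀ E, 0 ≤ g E) (hgW : LocalOn W g) (hm : 1 / 2 ≤ meanWt d p (S.card.choose d)) :
    binExp p (edgeSpace V d) (fun E => setWt d S E * g E) ≤
      2 ^ J.card * binExp p (edgeSpace V d) (setWt d S) * binExp p (edgeSpace V d) g := by
  refine (binExp_mono hp hp' fun E _ =>
    mul_le_mul_of_nonneg_right (setWt_le_partial E S J) (hg E)).trans ?_
  rw [binExp_mul (U₁ := edgeSpace V d \ W) (U₂ := W) Finset.sdiff_disjoint Finset.sdiff_subset hW
    (localOn_partial_setWt S J ?_ ?_) hgW]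
  · exact mul_le_mul_of_nonneg_right (binExp_partial_setWt_le hp' hJ hm)
      (binExp_nonneg hp hp' fun E _ => hg E)
  · exact Finset.subset_sdiff.2 ⟨powersetCard_subset_edgeSpace _ _, hWS.symm⟩
  · exact fun u hu hu' => Finset.subset_sdiff.2 ⟨star_subset_edgeSpace hu, (hWu u hu hu').symm⟩

section Bad

variable {S : Finset V} {C : ℕ} {θ ψ : ℝ}

theorem localOn_subset_mul_deg_le {v : V} {F : Finset (Finset V)}
    (hF : F ⊆ star d S v) (C : ℕ) :
    LocalOn (star d S v) fun E => ind (F ⊆ E) * ind (deg d E S v ≤ C) := by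
  refine LocalOn.mul (f := fun E => ind (F ⊆ E)) (fun E => ?_)
    ((localOn_deg d S v).comp fun m => ind (m ≤ C))
  show ind (F ⊆ E) = ind (F ⊆ E ∩ star d S v)
  simp only [Finset.subset_inter_iff, hF, and_true]

/-- A bound for the probability of few edges at a vertex, given up to two edges. -/
theorem binExp_subset_mul_deg_le_of_card_le_two (hp : 0 ≤ p) (hp' : p ≤ 1) (hθ : 1 ≤ θ)
    (hψ : θ ^ C * (p * θ⁻¹ + (1 - p)) ^ (S.card.choose d - 2) ≤ ψ) {v : V} (hv : v ∉ S)
    {F : Finset (Finset V)} (hF : F ⊆ star d S v) (hFc : F.card ≤ 2) :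
    binExp p (edgeSpace V d) (fun E => ind (F ⊆ E) * ind (deg d E S v ≤ C)) ≤ p ^ F.card * ψ := by
  have hθ0 : 0 < θ := by linarith
  refine (binExp_subset_mul_deg_le hp hp' hθ hv C hF).trans ?_
  refine mul_le_mul_of_nonneg_left (le_trans ?_ hψ) (by positivity)
  refine mul_le_mul_of_nonneg_left ?_ (by positivity)
  have h1 : θ⁻¹ ≤ 1 := inv_le_one_of_one_le₀ hθ
  have h2 : 0 ≤ p * θ⁻¹ := by positivity
  exact pow_le_pow_of_le_one (by linarith) (by nlinarith) (by omega)

/-- Union bound over `u`, `v` and two edges that meet in `S`; there are at most `s ^ d * ((d + 1) *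
s ^ (d - 1))` choices of the edges. For `u = v` a single vertex is light with two prescribed edges,
for `u ≠ v` two independent vertices are light with one prescribed edge each. The factors 2 and 4
pay for removing the vertices from the weight. -/
theorem binExp_setWt_mul_not_lightDisjoint_le (hp : 0 ≤ p) (hp' : p ≤ 1) (hθ : 1 ≤ θ)
    (hψ : θ ^ C * (p * θ⁻¹ + (1 - p)) ^ (S.card.choose d - 2) ≤ ψ)
    (hm : 1 / 2 ≤ meanWt d p (S.card.choose d)) :
    binExp p (edgeSpace V d) (fun E => setWt d S E * ind (¬LightDisjoint d C E S)) ≤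
      binExp p (edgeSpace V d) (setWt d S) *
        ((S.card ^ d * (d + 1) * S.card ^ (d - 1)) *
          (Fintype.card V * (2 * (p ^ 2 * ψ)) + Fintype.card V ^ 2 * (4 * (p * ψ) ^ 2))) := by
  set w := binExp p (edgeSpace V d) (setWt d S) with hw
  have hw0 : 0 ≤ w := binExp_nonneg hp hp' fun E _ => setWt_nonneg _ _ _
  have hψ0 : 0 ≤ ψ := le_trans (mul_nonneg (by positivity) (pow_nonneg (add_nonneg
    (by positivity) (by linarith)) _)) hψ
  let pr : V → V → Finset V → Finset V → Finset (Finset V) → Prop := fun u v e e' E =>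
    e ≠ e' ∧ (({e} ⊆ E ∧ deg d E S u ≤ C) ∧ ({e'} ⊆ E ∧ deg d E S v ≤ C))
  have hle : ∀ E ⊆ edgeSpace V d, setWt d S E * ind (¬LightDisjoint d C E S) ≤
      ∑ u ∈ Sᶜ, ∑ v ∈ Sᶜ, ∑ e ∈ star d S u,
        ∑ e' ∈ (star d S v).filter (fun e' => (e' ∩ (e ∩ S)).Nonempty),
          setWt d S E * ind (pr u v e e' E) := by
    intro E _
    simp only [← Finset.mul_sum]
    refine mul_le_mul_of_nonneg_left ?_ (setWt_nonneg _ _ _)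
    refine (ind_mono (R := ∃ u ∈ Sᶜ, ∃ v ∈ Sᶜ, ∃ e ∈ star d S u,
      ∃ e' ∈ (star d S v).filter (fun e' => (e' ∩ (e ∩ S)).Nonempty), pr u v e e' E) ?_).trans ?_
    · intro h
      simp only [LightDisjoint] at h
      push Not at h
      obtain ⟨u, hu, v, hv, hdu, hdv, e, he, e', he', hne, hdis⟩ := h
      rw [Finset.not_disjoint_iff] at hdis
      obtain ⟨x, hx, hx'⟩ := hdis
      rw [Finset.mem_inter] at he he' hx hx'
      refine ⟨u, Finset.mem_compl.2 hu, v, Finset.mem_compl.2 hv, e, he.2, e',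
        Finset.mem_filter.2 ⟨he'.2, x, ?_⟩, hne, ⟨?_, hdu⟩, ?_, hdv⟩
      · exact Finset.mem_inter.2 ⟨hx'.1, Finset.mem_inter.2 hx⟩
      · exact Finset.singleton_subset_iff.2 he.1
      · exact Finset.singleton_subset_iff.2 he'.1
    · refine (ind_exists_le_sum _ _).trans (Finset.sum_le_sum fun u _ => ?_)
      refine (ind_exists_le_sum _ _).trans (Finset.sum_le_sum fun v _ => ?_)
      refine (ind_exists_le_sum _ _).trans (Finset.sum_le_sum fun e _ => ?_)
      exact ind_exists_le_sum _ _
  refine (binExp_mono hp hp' hle).trans ?_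
  simp only [binExp_sum]
  have hterm : ∀ u ∈ Sᶜ, ∀ v ∈ Sᶜ, ∀ e ∈ star d S u,
      ∀ e' ∈ (star d S v).filter (fun e' => (e' ∩ (e ∩ S)).Nonempty),
      binExp p (edgeSpace V d) (fun E => setWt d S E * ind (pr u v e e' E)) ≤
        w * (if u = v then 2 * (p ^ 2 * ψ) else 4 * (p * ψ) ^ 2) := by
    intro u hu v hv e he e' he'
    rw [Finset.mem_compl] at hu hv
    replace he' := (Finset.mem_filter.1 he').1
    by_cases hne : e = e'
    · simp only [pr, hne, ne_eq, not_true_eq_false, false_and]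
      rw [ind_of_not not_false]
      simp only [mul_zero, binExp_const]
      split_ifs <;> positivity
    by_cases huv : u = v
    · subst huv
      rw [if_pos rfl]
      have hF : ({e, e'} : Finset (Finset V)) ⊆ star d S u :=
        Finset.insert_subset he (Finset.singleton_subset_iff.2 he')
      have h1 := binExp_setWt_mul_le_of_localOn hp hp' (S := S) (J := {u}) (W := star d S u)
        (Finset.disjoint_singleton_left.2 hu) (star_subset_edgeSpace hu)
        (disjoint_star_powersetCard hu) (fun x _ hx => disjoint_star hu (fun h =>
          hx (Finset.mem_singleton.2 h.symm)))
        (g := fun E => ind ({e, e'} ⊆ E) * ind (deg d E S u ≤ C))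
        (fun E => mul_nonneg (ind_nonneg _) (ind_nonneg _)) (localOn_subset_mul_deg_le hF C) hm
      have h2 := binExp_subset_mul_deg_le_of_card_le_two hp hp' hθ hψ hu hF
        (Finset.card_le_two)
      rw [Finset.card_pair hne] at h2
      rw [Finset.card_singleton, pow_one] at h1
      refine (binExp_mono hp hp' fun E _ => mul_le_mul_of_nonneg_left (?_ :
        _ ≤ ind ({e, e'} ⊆ E) * ind (deg d E S u ≤ C)) (setWt_nonneg _ _ _)).trans (h1.trans ?_)
      · rw [← ind_and]
        refine ind_mono fun h => ⟨?_, h.2.1.2⟩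
        rw [Finset.insert_eq]
        exact Finset.union_subset h.2.1.1 h.2.2.1
      · calc _ ≤ 2 * w * (p ^ 2 * ψ) := mul_le_mul_of_nonneg_left h2 (by positivity)
          _ = _ := by ring
    · rw [if_neg huv]
      have hFe : ({e} : Finset (Finset V)) ⊆ star d S u := Finset.singleton_subset_iff.2 he
      have hFe' : ({e'} : Finset (Finset V)) ⊆ star d S v := Finset.singleton_subset_iff.2 he'
      have hl1 := localOn_subset_mul_deg_le (S := S) hFe C
      have hl2 := localOn_subset_mul_deg_le (S := S) hFe' C
      have h1 := binExp_setWt_mul_le_of_localOn hp hp' (S := S) (J := {u, v})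
        (W := star d S u ∪ star d S v)
        (Finset.disjoint_insert_left.2 ⟨hu, Finset.disjoint_singleton_left.2 hv⟩)
        (Finset.union_subset (star_subset_edgeSpace hu) (star_subset_edgeSpace hv))
        (Finset.disjoint_union_left.2 ⟨disjoint_star_powersetCard hu,
          disjoint_star_powersetCard hv⟩) (fun x _ hx => by
            rw [Finset.mem_insert, Finset.mem_singleton, not_or] at hx
            exact Finset.disjoint_union_left.2 ⟨disjoint_star hu (Ne.symm hx.1),
              disjoint_star hv (Ne.symm hx.2)⟩)
        (g := fun E => (ind ({e} ⊆ E) * ind (deg d E S u ≤ C)) *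
          (ind ({e'} ⊆ E) * ind (deg d E S v ≤ C)))
        (fun E => mul_nonneg (mul_nonneg (ind_nonneg _) (ind_nonneg _))
          (mul_nonneg (ind_nonneg _) (ind_nonneg _)))
        ((hl1.mono Finset.subset_union_left).mul (hl2.mono Finset.subset_union_right)) hm
      rw [binExp_mul (disjoint_star hu huv) (star_subset_edgeSpace hu) (star_subset_edgeSpace hv)
        hl1 hl2, Finset.card_pair huv] at h1
      have h2 := binExp_subset_mul_deg_le_of_card_le_two hp hp' hθ hψ hu hFe (by simp)
      have h3 := binExp_subset_mul_deg_le_of_card_le_two hp hp' hθ hψ hv hFe' (by simp)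
      rw [Finset.card_singleton, pow_one] at h2 h3
      have h4 := mul_le_mul h2 h3 (binExp_nonneg hp hp' fun E _ =>
        mul_nonneg (ind_nonneg ({e'} ⊆ E)) (ind_nonneg (deg d E S v ≤ C))) (by positivity)
      refine (binExp_mono hp hp' fun E _ => mul_le_mul_of_nonneg_left (?_ :
        _ ≤ (ind ({e} ⊆ E) * ind (deg d E S u ≤ C)) *
          (ind ({e'} ⊆ E) * ind (deg d E S v ≤ C))) (setWt_nonneg _ _ _)).trans (h1.trans ?_)
      · rw [← ind_and, ← ind_and, ← ind_and]
        exact ind_mono fun h => h.2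
      · calc _ ≤ 2 ^ 2 * w * (p * ψ * (p * ψ)) := mul_le_mul_of_nonneg_left h4 (by positivity)
          _ = _ := by ring
  have hinner : ∀ u ∈ Sᶜ, ∀ v ∈ Sᶜ, (∑ e ∈ star d S u,
      ∑ e' ∈ (star d S v).filter (fun e' => (e' ∩ (e ∩ S)).Nonempty),
        binExp p (edgeSpace V d) (fun E => setWt d S E * ind (pr u v e e' E))) ≤
      (S.card ^ d * (d + 1) * S.card ^ (d - 1)) *
        (w * (if u = v then 2 * (p ^ 2 * ψ) else 4 * (p * ψ) ^ 2)) := by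
    intro u hu v hv
    set a := w * (if u = v then 2 * (p ^ 2 * ψ) else 4 * (p * ψ) ^ 2) with ha
    have ha0 : 0 ≤ a := by rw [ha]; split_ifs <;> positivity
    have h1 : ∀ e ∈ star d S u,
        ∑ e' ∈ (star d S v).filter (fun e' => (e' ∩ (e ∩ S)).Nonempty),
        binExp p (edgeSpace V d) (fun E => setWt d S E * ind (pr u v e e' E)) ≤
        ((d + 1) * S.card ^ (d - 1)) * a := by
      intro e he
      refine (Finset.sum_le_card_nsmul _ _ _ (hterm u hu v hv e he)).trans ?_
      rw [nsmul_eq_mul]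
      refine mul_le_mul_of_nonneg_right ?_ ha0
      have h2 := card_star_filter_meet_le (d := d) (Finset.mem_compl.1 hv)
        (Finset.inter_subset_right : e ∩ S ⊆ S)
      have h3 : (e ∩ S).card ≤ d + 1 :=
        (Finset.card_le_card Finset.inter_subset_left).trans
          (le_of_eq ((mem_star_iff (Finset.mem_compl.1 hu)).1 he).2.1)
      exact_mod_cast h2.trans (Nat.mul_le_mul_right _ h3)
    refine (Finset.sum_le_card_nsmul _ _ _ h1).trans ?_
    have h2 : ((star d S u).card : ℝ) ≤ (S.card : ℝ) ^ d := by
      exact_mod_cast (card_star_le : (star d S u).card ≤ S.card ^ d)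
    rw [nsmul_eq_mul]
    calc _ ≤ (S.card : ℝ) ^ d * (((d : ℝ) + 1) * S.card ^ (d - 1) * a) := by gcongr
      _ = _ := by ring
  have hn : (Sᶜ.card : ℝ) ≤ Fintype.card V := by exact_mod_cast Finset.card_le_univ _
  calc _ ≤ ∑ u ∈ Sᶜ, ∑ v ∈ Sᶜ, (S.card ^ d * (d + 1) * S.card ^ (d - 1)) *
        (w * (if u = v then 2 * (p ^ 2 * ψ) else 4 * (p * ψ) ^ 2)) :=
        Finset.sum_le_sum fun u hu => Finset.sum_le_sum fun v hv => hinner u hu v hv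
    _ ≤ ∑ u ∈ Sᶜ, ∑ v ∈ Sᶜ, ((S.card ^ d * (d + 1) * S.card ^ (d - 1)) * w) *
        ((if u = v then 2 * (p ^ 2 * ψ) else 0) + 4 * (p * ψ) ^ 2) := by
        refine Finset.sum_le_sum fun u _ => Finset.sum_le_sum fun v _ => ?_
        rw [← mul_assoc]
        refine mul_le_mul_of_nonneg_left ?_ (by positivity)
        split_ifs
        · have : 0 ≤ 4 * (p * ψ) ^ 2 := by positivity
          linarith
        · linarith
    _ = ((S.card ^ d * (d + 1) * S.card ^ (d - 1)) * w) *
        (Sᶜ.card * (2 * (p ^ 2 * ψ)) + (Sᶜ.card) ^ 2 * (4 * (p * ψ) ^ 2)) := by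
        simp only [← Finset.mul_sum, Finset.sum_add_distrib, Finset.sum_ite_eq, Finset.sum_const,
          nsmul_eq_mul]
        rw [Finset.sum_congr rfl fun u hu => if_pos hu, Finset.sum_const, nsmul_eq_mul]
        ring
    _ ≤ _ := by
        rw [mul_comm _ w, mul_assoc]
        refine mul_le_mul_of_nonneg_left ?_ hw0
        gcongr

end Bad

end

/-! ### Rarity of the other obstacles to good surroundings. -/

section

variable {V : Type*} [Fintype V] [DecidableEq V] {d : ℕ} {p : ℝ} {S : Finset V} {C : ℕ} {θ ψ : ℝ}

theorem card_filter_sdiff_card_eq_le (S : Finset V) (j : ℕ) :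
    ((edgeSpace V d).filter fun e => (e \ S).card = j).card ≤
      Fintype.card V ^ j * S.card ^ (d + 1 - j) := by
  have h : ((edgeSpace V d).filter fun e => (e \ S).card = j).card ≤
      ((Finset.univ : Finset V).powersetCard j ×ˢ S.powersetCard (d + 1 - j)).card := by
    refine Finset.card_le_card_of_injOn (fun e => (e \ S, e ∩ S)) ?_ ?_
    · intro e he
      obtain ⟨he, hj⟩ := Finset.mem_filter.1 (Finset.mem_coe.1 he)
      have hc := mem_edgeSpace.1 he
      have := Finset.card_sdiff_add_card_inter e S
      rw [Finset.mem_coe, Finset.mem_product, Finset.mem_powersetCard, Finset.mem_powersetCard]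
      exact ⟨⟨Finset.subset_univ _, hj⟩, Finset.inter_subset_right, by simp only; omega⟩
    · intro e _ e' _ h
      simp only [Prod.mk.injEq] at h
      rw [← Finset.sdiff_union_inter e S, h.1, h.2, Finset.sdiff_union_inter]
  refine h.trans ?_
  rw [Finset.card_product]
  exact Nat.mul_le_mul (card_powersetCard_le_pow _ _) (card_powersetCard_le_pow _ _)

/-- Union bound over the edges with `j ≥ 2` vertices outside `S`. Such an edge lies in no star of
`S`, so its presence is independent of the degrees of these `j` vertices. -/
theorem binExp_setWt_mul_not_noLightEdge_le (hp : 0 ≤ p) (hp' : p ≤ 1)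
    (hm : 1 / 2 ≤ meanWt d p (S.card.choose d)) :
    binExp p (edgeSpace V d) (fun E => setWt d S E * ind (¬NoLightEdge d E S)) ≤
      binExp p (edgeSpace V d) (setWt d S) *
        ∑ j ∈ Finset.Icc 2 (d + 1), (Fintype.card V ^ j * S.card ^ (d + 1 - j)) *
          (p * (2 * prob₁ p (S.card.choose d)) ^ j) := by
  set w := binExp p (edgeSpace V d) (setWt d S) with hw
  have hw0 : 0 ≤ w := binExp_nonneg hp hp' fun E _ => setWt_nonneg _ _ _
  set q := prob₁ p (S.card.choose d) with hq
  have hq0 : 0 ≤ q := prob₁_nonneg hp hp' _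
  let g : Finset V → Finset (Finset V) → ℝ := fun e E =>
    ind ({e} ⊆ E) * ∏ x ∈ e \ S, ind (deg d E S x = 1)
  have hg : ∀ e E, 0 ≤ g e E := fun e E =>
    mul_nonneg (ind_nonneg _) (Finset.prod_nonneg fun _ _ => ind_nonneg _)
  have hle : ∀ E ⊆ edgeSpace V d, setWt d S E * ind (¬NoLightEdge d E S) ≤
      ∑ e ∈ (edgeSpace V d).filter (fun e => 2 ≤ (e \ S).card), setWt d S E * g e E := by
    intro E hE
    rw [← Finset.mul_sum]
    refine mul_le_mul_of_nonneg_left ?_ (setWt_nonneg _ _ _)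
    refine (ind_mono (R := ∃ e ∈ (edgeSpace V d).filter (fun e => 2 ≤ (e \ S).card),
      {e} ⊆ E ∧ ∀ x ∈ e \ S, deg d E S x = 1) ?_).trans ?_
    · intro h
      simp only [NoLightEdge] at h
      push Not at h
      obtain ⟨e, he, -, h1, h2⟩ := h
      exact ⟨e, Finset.mem_filter.2 ⟨hE he, h2⟩, Finset.singleton_subset_iff.2 he, h1⟩
    · refine (ind_exists_le_sum _ _).trans (Finset.sum_le_sum fun e _ => ?_)
      rw [ind_and, ind_forall_eq_prod]
  refine (binExp_mono hp hp' hle).trans ?_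
  rw [binExp_sum]
  have hterm : ∀ e ∈ (edgeSpace V d).filter (fun e => 2 ≤ (e \ S).card),
      binExp p (edgeSpace V d) (fun E => setWt d S E * g e E) ≤
        w * (p * (2 * q) ^ (e \ S).card) := by
    intro e he
    obtain ⟨heU, he2⟩ := Finset.mem_filter.1 he
    have hmem : ∀ x ∈ e \ S, x ∉ S := fun x hx => (Finset.mem_sdiff.1 hx).2
    have heS : e ∉ S.powersetCard (d + 1) := by
      intro h
      rw [Finset.sdiff_eq_empty_iff_subset.2 (Finset.mem_powersetCard.1 h).1] at he2
      simp at he2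
    have hestar : ∀ u ∉ S, e ∉ star d S u := by
      intro u hu h
      have h1 := ((mem_star_iff hu).1 h).2.2
      have h2 : e \ S ⊆ {u} := by
        intro x hx
        obtain ⟨hxe, hxS⟩ := Finset.mem_sdiff.1 hx
        exact Finset.mem_singleton.2 ((Finset.mem_insert.1 (h1 hxe)).resolve_right hxS)
      have h3 := Finset.card_le_card h2
      rw [Finset.card_singleton] at h3
      omega
    have hloc : ∀ x ∈ e \ S, LocalOn (star d S x) fun E => ind (deg d E S x = 1) :=
      fun x _ => (localOn_deg d S x).comp fun m => ind (m = 1)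
    have hsubU : (e \ S).biUnion (star d S) ⊆ edgeSpace V d :=
      Finset.biUnion_subset.2 fun x hx => star_subset_edgeSpace (hmem x hx)
    have hl1 : LocalOn {e} fun E => ind ({e} ⊆ E) := fun E => by
      show ind ({e} ⊆ E) = ind ({e} ⊆ E ∩ {e})
      simp only [Finset.subset_inter_iff, Finset.Subset.refl, and_true]
    have hl2 : LocalOn ((e \ S).biUnion (star d S))
        fun E => ∏ x ∈ e \ S, ind (deg d E S x = 1) :=
      LocalOn.prod fun x hx => (hloc x hx).mono (Finset.subset_biUnion_of_mem _ hx)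
    have h1 := binExp_setWt_mul_le_of_localOn hp hp' (S := S) (J := e \ S)
      (W := {e} ∪ (e \ S).biUnion (star d S)) Finset.sdiff_disjoint
      (Finset.union_subset (Finset.singleton_subset_iff.2 heU) hsubU)
      (by
        rw [Finset.disjoint_union_left, Finset.disjoint_singleton_left,
          Finset.disjoint_biUnion_left]
        exact ⟨heS, fun x hx => disjoint_star_powersetCard (hmem x hx)⟩)
      (by
        intro u hu hue
        rw [Finset.disjoint_union_left, Finset.disjoint_singleton_left,
          Finset.disjoint_biUnion_left]
        refine ⟨hestar u hu, fun x hx => disjoint_star (hmem x hx) ?_⟩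
        rintro rfl
        exact hue hx)
      (hg e) ((hl1.mono Finset.subset_union_left).mul (hl2.mono Finset.subset_union_right)) hm
    have h2 : binExp p (edgeSpace V d) (g e) = p * q ^ (e \ S).card := by
      rw [binExp_mul (U₁ := {e}) (U₂ := (e \ S).biUnion (star d S)) _
        (Finset.singleton_subset_iff.2 heU) hsubU hl1 hl2,
        binExp_subset (Finset.singleton_subset_iff.2 heU), Finset.card_singleton, pow_one,
        binExp_prod (e \ S) (star d S) (fun x hx => star_subset_edgeSpace (hmem x hx))
          (fun x hx y _ hxy => disjoint_star (hmem x hx) hxy) hloc,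
        Finset.prod_congr rfl fun x hx => binExp_deg_eq_one (hmem x hx), Finset.prod_const]
      rw [Finset.disjoint_singleton_left, Finset.mem_biUnion]
      rintro ⟨x, hx, h⟩
      exact hestar x (hmem x hx) h
    refine h1.trans (le_of_eq ?_)
    rw [h2, mul_pow]; ring
  refine (Finset.sum_le_sum hterm).trans ?_
  rw [← Finset.mul_sum]
  refine mul_le_mul_of_nonneg_left ?_ hw0
  have hmaps : ∀ e ∈ (edgeSpace V d).filter (fun e => 2 ≤ (e \ S).card),
      (e \ S).card ∈ Finset.Icc 2 (d + 1) := by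
    intro e he
    obtain ⟨heU, he2⟩ := Finset.mem_filter.1 he
    have := Finset.card_le_card (Finset.sdiff_subset : e \ S ⊆ e)
    rw [mem_edgeSpace.1 heU] at this
    exact Finset.mem_Icc.2 ⟨he2, this⟩
  rw [← Finset.sum_fiberwise_of_maps_to hmaps]
  refine Finset.sum_le_sum fun j _ => ?_
  rw [Finset.sum_congr rfl fun e he => by rw [(Finset.mem_filter.1 he).2], Finset.sum_const,
    nsmul_eq_mul]
  refine mul_le_mul_of_nonneg_right ?_ (by positivity)
  have h1 := (Finset.card_le_card (Finset.filter_subset_filter (fun e => (e \ S).card = j)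
    (Finset.filter_subset (fun e => 2 ≤ (e \ S).card) (edgeSpace V d)))).trans
      (card_filter_sdiff_card_eq_le S j)
  exact_mod_cast h1

/-- Few vertices have few edges into `S`. -/
theorem binExp_setWt_mul_lightVerts_le (hp : 0 ≤ p) (hp' : p ≤ 1) (hθ : 1 ≤ θ)
    (hψ : θ ^ C * (p * θ⁻¹ + (1 - p)) ^ (S.card.choose d - 2) ≤ ψ)
    (hm : 1 / 2 ≤ meanWt d p (S.card.choose d)) (m : ℕ) :
    binExp p (edgeSpace V d)
      (fun E => setWt d S E * ind (m < (Sᶜ.filter fun v => deg d E S v ≤ C).card)) ≤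
      binExp p (edgeSpace V d) (setWt d S) * (Fintype.card V * (2 * ψ) / (m + 1)) := by
  set w := binExp p (edgeSpace V d) (setWt d S) with hw
  have hw0 : 0 ≤ w := binExp_nonneg hp hp' fun E _ => setWt_nonneg _ _ _
  have hψ0 : 0 ≤ ψ := le_trans (mul_nonneg (by positivity) (pow_nonneg (add_nonneg
    (by positivity) (by linarith)) _)) hψ
  have hle : ∀ E ⊆ edgeSpace V d,
      setWt d S E * ind (m < (Sᶜ.filter fun v => deg d E S v ≤ C).card) ≤
      ∑ v ∈ Sᶜ, (setWt d S E * (ind (∅ ⊆ E) * ind (deg d E S v ≤ C))) * (1 / ((m : ℝ) + 1)) := by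
    intro E _
    rw [← Finset.sum_mul, ← Finset.mul_sum, mul_assoc]
    refine mul_le_mul_of_nonneg_left ?_ (setWt_nonneg _ _ _)
    simp only [ind_of (Finset.empty_subset E), one_mul]
    rw [sum_ind_eq_card, mul_one_div, le_div_iff₀ (by positivity)]
    by_cases h : m < (Sᶜ.filter fun v => deg d E S v ≤ C).card
    · rw [ind_of h, one_mul]; exact_mod_cast h
    · rw [ind_of_not h, zero_mul]; positivity
  refine (binExp_mono hp hp' hle).trans ?_
  rw [binExp_sum]
  have hterm : ∀ v ∈ Sᶜ, binExp p (edgeSpace V d)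
      (fun E => (setWt d S E * (ind (∅ ⊆ E) * ind (deg d E S v ≤ C))) * (1 / ((m : ℝ) + 1))) ≤
      2 * w * ψ * (1 / ((m : ℝ) + 1)) := by
    intro v hv
    rw [Finset.mem_compl] at hv
    rw [binExp_mul_const]
    refine mul_le_mul_of_nonneg_right ?_ (by positivity)
    have h1 := binExp_setWt_mul_le_of_localOn hp hp' (S := S) (J := {v}) (W := star d S v)
      (Finset.disjoint_singleton_left.2 hv) (star_subset_edgeSpace hv)
      (disjoint_star_powersetCard hv) (fun x _ hx => disjoint_star hv (fun h =>
        hx (Finset.mem_singleton.2 h.symm)))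
      (g := fun E => ind (∅ ⊆ E) * ind (deg d E S v ≤ C))
      (fun E => mul_nonneg (ind_nonneg _) (ind_nonneg _))
      (localOn_subset_mul_deg_le (Finset.empty_subset _) C) hm
    have h2 := binExp_subset_mul_deg_le_of_card_le_two hp hp' hθ hψ hv (Finset.empty_subset _)
      (by simp)
    rw [Finset.card_empty, pow_zero, one_mul] at h2
    rw [Finset.card_singleton, pow_one] at h1
    exact h1.trans (mul_le_mul_of_nonneg_left h2 (by positivity))
  refine (Finset.sum_le_card_nsmul _ _ _ hterm).trans ?_
  rw [nsmul_eq_mul]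
  have hn : (Sᶜ.card : ℝ) ≤ Fintype.card V := by exact_mod_cast Finset.card_le_univ _
  calc _ ≤ (Fintype.card V : ℝ) * (2 * w * ψ * (1 / ((m : ℝ) + 1))) := by gcongr
    _ = _ := by ring

theorem card_lightCover_le (E : Finset (Finset V)) (S : Finset V) (v : V) :
    (lightCover d C E S v).card ≤ (lightVerts d C E S v).card * (C * (d + 1)) := by
  refine Finset.card_biUnion_le_card_mul _ _ _ fun u hu => ?_
  obtain ⟨hu1, hu2⟩ := Finset.mem_filter.1 hu
  have huS : u ∉ S := Finset.mem_compl.1 (Finset.mem_of_mem_erase hu1)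
  refine (Finset.card_biUnion_le_card_mul _ _ (d + 1) fun e he => ?_).trans
    (Nat.mul_le_mul_right _ hu2)
  exact (Finset.card_le_card Finset.inter_subset_left).trans
    (le_of_eq ((mem_star_iff huS).1 (Finset.mem_inter.1 he).2).2.1)

theorem lightCover_subset (E : Finset (Finset V)) (S : Finset V) (v : V) :
    lightCover d C E S v ⊆ S :=
  Finset.biUnion_subset.2 fun _ _ => Finset.biUnion_subset.2 fun _ _ => Finset.inter_subset_right

/-- The vertex `v` is excluded from the light vertices for this purpose: the edges at `v` are still
fresh when the light vertices and their cover are known. -/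
theorem localOn_lightVerts (v : V) :
    LocalOn (edgeSpace V d \ star d S v) fun E => lightVerts d C E S v := by
  intro E
  refine Finset.filter_congr fun u hu => ?_
  have huS : u ∉ S := Finset.mem_compl.1 (Finset.mem_of_mem_erase hu)
  have hsub : star d S u ⊆ edgeSpace V d \ star d S v :=
    Finset.subset_sdiff.2 ⟨star_subset_edgeSpace huS, disjoint_star huS (Finset.ne_of_mem_erase hu)⟩
  have h := (localOn_deg d S u).mono hsub E
  rw [h]

theorem localOn_lightCover (v : V) :
    LocalOn (edgeSpace V d \ star d S v) fun E => lightCover d C E S v := by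
  intro E
  show lightCover d C E S v = lightCover d C (E ∩ (edgeSpace V d \ star d S v)) S v
  have h := localOn_lightVerts (S := S) (d := d) (C := C) v E
  simp only at h
  rw [lightCover, lightCover, ← h]
  refine Finset.biUnion_congr rfl fun u hu => ?_
  have hu1 := (Finset.mem_filter.1 hu).1
  have huS : u ∉ S := Finset.mem_compl.1 (Finset.mem_of_mem_erase hu1)
  have hsub : star d S u ⊆ edgeSpace V d \ star d S v :=
    Finset.subset_sdiff.2 ⟨star_subset_edgeSpace huS,
      disjoint_star huS (Finset.ne_of_mem_erase hu1)⟩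
  rw [Finset.inter_assoc, Finset.inter_eq_right.2 hsub]

theorem ind_le_sum_powersetCard {A B : Finset (Finset V)} (P : Finset V → Prop) [DecidablePred P]
    (hAB : A ⊆ B) (c : ℕ) :
    ind (c ≤ (A.filter P).card) ≤ ∑ F ∈ B.powersetCard c, ind (F ⊆ A) * ind (∀ e ∈ F, P e) := by
  refine (ind_mono (R := ∃ F ∈ B.powersetCard c, F ⊆ A ∧ ∀ e ∈ F, P e) fun h => ?_).trans
    ((ind_exists_le_sum _ _).trans (Finset.sum_le_sum fun F _ => (ind_and _ _).le))
  obtain ⟨F, hF, hc⟩ := Finset.exists_subset_card_eq h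
  have hFA := hF.trans (Finset.filter_subset _ _)
  exact ⟨F, Finset.mem_powersetCard.2 ⟨hFA.trans hAB, hc⟩, hFA,
    fun e he => (Finset.mem_filter.1 (hF he)).2⟩

theorem sum_powersetCard_ind_le (B : Finset (Finset V)) (P : Finset V → Prop) [DecidablePred P]
    (c : ℕ) : ∑ F ∈ B.powersetCard c, ind (∀ e ∈ F, P e) ≤ ((B.filter P).card : ℝ) ^ c := by
  classical
  rw [sum_ind_eq_card]
  have h : (B.powersetCard c).filter (fun F => ∀ e ∈ F, P e) ⊆ (B.filter P).powersetCard c := by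
    intro F hF
    obtain ⟨h1, h2⟩ := Finset.mem_filter.1 hF
    obtain ⟨h3, h4⟩ := Finset.mem_powersetCard.1 h1
    exact Finset.mem_powersetCard.2 ⟨fun e he => Finset.mem_filter.2 ⟨h3 he, h2 e he⟩, h4⟩
  exact_mod_cast (Finset.card_le_card h).trans (card_powersetCard_le_pow _ _)

theorem subset_inter_star_iff {E F : Finset (Finset V)} {v : V} (hF : F ⊆ star d S v) :
    F ⊆ E ∩ star d S v ↔ F ⊆ E := by
  simp only [Finset.subset_inter_iff, hF, and_true]

/-- With the factor at `v` removed from the weight, everything but the edges at `v` is independent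
of them. The cover has at most `m * (C * (d + 1))` vertices, which bounds the number of potential
edges at `v` that meet it; `C₁` of these have to be present. -/
theorem binExp_setWt_mul_meet_lightCover_le (hp : 0 ≤ p) (hp' : p ≤ 1)
    (hm : 1 / 2 ≤ meanWt d p (S.card.choose d)) (C₁ m : ℕ) {v : V} (hv : v ∉ S) :
    binExp p (edgeSpace V d) (fun E => setWt d S E *
      (ind (C₁ ≤ (edgesMeeting d E S v (lightCover d C E S v)).card) *
        ind ((lightVerts d C E S v).card ≤ m))) ≤
      binExp p (edgeSpace V d) (setWt d S) *
        (2 * (p * (m * (C * (d + 1)) * S.card ^ (d - 1))) ^ C₁) := by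
  set w := binExp p (edgeSpace V d) (setWt d S) with hw
  have hw0 : 0 ≤ w := binExp_nonneg hp hp' fun E _ => setWt_nonneg _ _ _
  let pw : Finset (Finset V) → ℝ := fun E =>
    ind (Indep d E S) * ∏ u ∈ Sᶜ \ {v}, starWt d (deg d E S u)
  have hpw : ∀ E, 0 ≤ pw E := fun E => partial_setWt_nonneg E S _
  let H : Finset (Finset V) → Finset (Finset V) → ℝ := fun F E =>
    pw E * (ind (∀ e ∈ F, (e ∩ lightCover d C E S v).Nonempty) *
      ind ((lightVerts d C E S v).card ≤ m))
  have hle : ∀ E ⊆ edgeSpace V d, setWt d S E *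
      (ind (C₁ ≤ (edgesMeeting d E S v (lightCover d C E S v)).card) *
        ind ((lightVerts d C E S v).card ≤ m)) ≤
      ∑ F ∈ (star d S v).powersetCard C₁, ind (F ⊆ E) * H F E := by
    intro E _
    have h1 := ind_le_sum_powersetCard (fun e => (e ∩ lightCover d C E S v).Nonempty)
      (Finset.inter_subset_right : E ∩ star d S v ⊆ star d S v) C₁
    calc _ ≤ pw E * ((∑ F ∈ (star d S v).powersetCard C₁, ind (F ⊆ E ∩ star d S v) *
          ind (∀ e ∈ F, (e ∩ lightCover d C E S v).Nonempty)) *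
            ind ((lightVerts d C E S v).card ≤ m)) := by
          refine mul_le_mul (setWt_le_partial E S {v}) ?_
            (mul_nonneg (ind_nonneg _) (ind_nonneg _)) (hpw E)
          exact mul_le_mul_of_nonneg_right h1 (ind_nonneg _)
      _ = _ := by
          rw [Finset.sum_mul, Finset.mul_sum]
          refine Finset.sum_congr rfl fun F hF => ?_
          rw [subset_inter_star_iff (Finset.mem_powersetCard.1 hF).1]
          simp only [H]; ring
  refine (binExp_mono hp hp' hle).trans ?_
  rw [binExp_sum]
  have hloc : ∀ F, LocalOn (edgeSpace V d \ star d S v) (H F) := by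
    intro F
    refine LocalOn.mul (localOn_partial_setWt S {v} ?_ ?_) (LocalOn.mul
      ((localOn_lightCover v).comp fun X => ind (∀ e ∈ F, (e ∩ X).Nonempty))
      ((localOn_lightVerts v).comp fun X => ind (X.card ≤ m)))
    · exact Finset.subset_sdiff.2 ⟨powersetCard_subset_edgeSpace _ _,
        (disjoint_star_powersetCard hv).symm⟩
    · exact fun u hu huv => Finset.subset_sdiff.2 ⟨star_subset_edgeSpace hu,
        disjoint_star hu fun h => huv (Finset.mem_singleton.2 h)⟩
  have hterm : ∀ F ∈ (star d S v).powersetCard C₁,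
      binExp p (edgeSpace V d) (fun E => ind (F ⊆ E) * H F E) =
        p ^ C₁ * binExp p (edgeSpace V d) (H F) := by
    intro F hF
    obtain ⟨hF1, hF2⟩ := Finset.mem_powersetCard.1 hF
    rw [binExp_subset_mul (hF1.trans (star_subset_edgeSpace hv)) _
      ((hloc F).mono (Finset.sdiff_subset_sdiff le_rfl hF1)), hF2]
  rw [Finset.sum_congr rfl hterm, ← Finset.mul_sum, ← binExp_sum]
  have hsum : ∀ E ⊆ edgeSpace V d, ∑ F ∈ (star d S v).powersetCard C₁, H F E ≤
      pw E * ((m * (C * (d + 1)) * S.card ^ (d - 1) : ℝ)) ^ C₁ := by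
    intro E _
    simp only [H, ← Finset.mul_sum, ← Finset.sum_mul]
    refine mul_le_mul_of_nonneg_left ?_ (hpw E)
    by_cases h : (lightVerts d C E S v).card ≤ m
    · rw [ind_of h, mul_one]
      refine (sum_powersetCard_ind_le _ _ _).trans (pow_le_pow_left₀ (Nat.cast_nonneg _) ?_ _)
      have h2 := (card_star_filter_meet_le (d := d) hv (lightCover_subset E S v)).trans
        (Nat.mul_le_mul_right _ ((card_lightCover_le (C := C) E S v).trans
          (Nat.mul_le_mul_right _ h)))
      exact_mod_cast h2
    · rw [ind_of_not h, mul_zero]; positivity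
  have h1 := binExp_partial_setWt_le (d := d) hp' (Finset.disjoint_singleton_left.2 hv) hm
  rw [Finset.card_singleton, pow_one] at h1
  calc _ ≤ p ^ C₁ * (binExp p (edgeSpace V d) pw *
        ((m * (C * (d + 1)) * S.card ^ (d - 1) : ℝ)) ^ C₁) := by
        rw [← binExp_mul_const]
        exact mul_le_mul_of_nonneg_left (binExp_mono hp hp' hsum) (by positivity)
    _ ≤ p ^ C₁ * ((2 * w) * ((m * (C * (d + 1)) * S.card ^ (d - 1) : ℝ)) ^ C₁) := by
        refine mul_le_mul_of_nonneg_left (mul_le_mul_of_nonneg_right h1 (by positivity))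
          (by positivity)
    _ = _ := by rw [mul_pow p]; ring

theorem localOn_edgesMeeting (S : Finset V) (v : V) (X : Finset V) :
    LocalOn (star d S v) fun E => edgesMeeting d E S v X :=
  localOn_inter _ fun A => A.filter fun e => (e ∩ X).Nonempty

/-- Union bound over the sets of `C₁` potential edges at `v` that meet `L`. -/
theorem binExp_edgesMeeting_le (hp : 0 ≤ p) (hp' : p ≤ 1) (C₁ : ℕ) {v : V} (hv : v ∉ S)
    {L : Finset V} (hL : L ⊆ S) :
    binExp p (edgeSpace V d) (fun E => ind (C₁ ≤ (edgesMeeting d E S v L).card)) ≤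
      (p * (L.card * S.card ^ (d - 1))) ^ C₁ := by
  refine (binExp_mono hp hp' fun E _ => ind_le_sum_powersetCard (fun e => (e ∩ L).Nonempty)
    (Finset.inter_subset_right : E ∩ star d S v ⊆ star d S v) C₁).trans ?_
  rw [binExp_sum, Finset.sum_congr rfl fun F hF => by
    obtain ⟨h1, h2⟩ := Finset.mem_powersetCard.1 hF
    simp only [subset_inter_star_iff h1]
    rw [binExp_mul_const, binExp_subset (h1.trans (star_subset_edgeSpace hv)), h2],
    ← Finset.mul_sum, mul_pow]
  refine mul_le_mul_of_nonneg_left ?_ (by positivity)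
  refine (sum_powersetCard_ind_le _ _ _).trans (pow_le_pow_left₀ (Nat.cast_nonneg _) ?_ _)
  exact_mod_cast card_star_filter_meet_le (d := d) hv hL

/-- Union bound over the pairs `J`, `L` of equal size `j`, at most `n ^ j * s ^ j` in number. The
stars of the vertices of `J` are disjoint, so their events are independent. -/
theorem binExp_setWt_mul_not_noDense_le (hp : 0 ≤ p) (hp' : p ≤ 1)
    (hm : 1 / 2 ≤ meanWt d p (S.card.choose d)) (C₁ l : ℕ) :
    binExp p (edgeSpace V d) (fun E => setWt d S E * ind (¬NoDense d C₁ l E S)) ≤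
      binExp p (edgeSpace V d) (setWt d S) * ∑ j ∈ Finset.Icc 1 l,
        (2 * Fintype.card V * S.card * (p * (l * S.card ^ (d - 1))) ^ C₁) ^ j := by
  set w := binExp p (edgeSpace V d) (setWt d S) with hw
  have hw0 : 0 ≤ w := binExp_nonneg hp hp' fun E _ => setWt_nonneg _ _ _
  let g : Finset V → Finset V → Finset (Finset V) → ℝ := fun J L E =>
    ∏ v ∈ J, ind (C₁ ≤ (edgesMeeting d E S v L).card)
  have hg : ∀ J L E, 0 ≤ g J L E := fun J L E => Finset.prod_nonneg fun _ _ => ind_nonneg _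
  have hle : ∀ E ⊆ edgeSpace V d, setWt d S E * ind (¬NoDense d C₁ l E S) ≤
      ∑ j ∈ Finset.Icc 1 l, ∑ J ∈ Sᶜ.powersetCard j, ∑ L ∈ S.powersetCard j,
        setWt d S E * g J L E := by
    intro E _
    simp only [← Finset.mul_sum]
    refine mul_le_mul_of_nonneg_left ?_ (setWt_nonneg _ _ _)
    refine (ind_mono (R := ∃ j ∈ Finset.Icc 1 l, ∃ J ∈ Sᶜ.powersetCard j,
      ∃ L ∈ S.powersetCard j, ∀ v ∈ J, C₁ ≤ (edgesMeeting d E S v L).card) ?_).trans ?_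
    · intro h
      simp only [NoDense] at h
      push Not at h
      obtain ⟨J, L, h1, h2, h3, h4, h5, h6⟩ := h
      exact ⟨J.card, Finset.mem_Icc.2 ⟨h3.card_pos, h4⟩, J, Finset.mem_powersetCard.2
        ⟨fun v hv => Finset.mem_compl.2 (Finset.disjoint_left.1 h1 hv), rfl⟩, L,
        Finset.mem_powersetCard.2 ⟨h2, h5⟩, h6⟩
    · refine (ind_exists_le_sum _ _).trans (Finset.sum_le_sum fun j _ => ?_)
      refine (ind_exists_le_sum _ _).trans (Finset.sum_le_sum fun J _ => ?_)
      refine (ind_exists_le_sum _ _).trans (Finset.sum_le_sum fun L _ => ?_)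
      exact (ind_forall_eq_prod _ _).le
  refine (binExp_mono hp hp' hle).trans ?_
  simp only [binExp_sum]
  rw [Finset.mul_sum]
  refine Finset.sum_le_sum fun j hj => ?_
  have hterm : ∀ J ∈ Sᶜ.powersetCard j, ∀ L ∈ S.powersetCard j,
      binExp p (edgeSpace V d) (fun E => setWt d S E * g J L E) ≤
        w * (2 * (p * (l * S.card ^ (d - 1))) ^ C₁) ^ j := by
    intro J hJ L hL
    obtain ⟨hJ1, hJ2⟩ := Finset.mem_powersetCard.1 hJ
    obtain ⟨hL1, hL2⟩ := Finset.mem_powersetCard.1 hL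
    have hmem : ∀ v ∈ J, v ∉ S := fun v hv => Finset.mem_compl.1 (hJ1 hv)
    have hloc : ∀ v ∈ J, LocalOn (star d S v)
        fun E => ind (C₁ ≤ (edgesMeeting d E S v L).card) := fun v _ =>
      (localOn_edgesMeeting S v L).comp fun A => ind (C₁ ≤ A.card)
    have h1 := binExp_setWt_mul_le_of_localOn hp hp' (S := S) (J := J) (W := J.biUnion (star d S))
      (Finset.disjoint_left.2 hmem)
      (Finset.biUnion_subset.2 fun v hv => star_subset_edgeSpace (hmem v hv))
      (by
        rw [Finset.disjoint_biUnion_left]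
        exact fun v hv => disjoint_star_powersetCard (hmem v hv))
      (by
        intro u hu huJ
        rw [Finset.disjoint_biUnion_left]
        refine fun v hv => disjoint_star (hmem v hv) ?_
        rintro rfl
        exact huJ hv)
      (hg J L)
      (LocalOn.prod fun v hv => (hloc v hv).mono (Finset.subset_biUnion_of_mem _ hv)) hm
    have h2 : binExp p (edgeSpace V d) (g J L) ≤ ((p * (l * S.card ^ (d - 1))) ^ C₁) ^ j := by
      rw [binExp_prod J (star d S) (fun v hv => star_subset_edgeSpace (hmem v hv))
        (fun v hv u _ hvu => disjoint_star (hmem v hv) hvu) hloc]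
      rw [← hJ2, ← Finset.prod_const]
      refine Finset.prod_le_prod (fun v _ => binExp_nonneg hp hp' fun E _ => ind_nonneg _)
        fun v hv => (binExp_edgesMeeting_le hp hp' C₁ (hmem v hv) hL1).trans ?_
      have : (L.card : ℝ) ≤ l := by
        rw [hL2]; exact_mod_cast (Finset.mem_Icc.1 hj).2
      gcongr
    refine h1.trans ?_
    rw [hJ2]
    calc _ ≤ 2 ^ j * w * ((p * (l * S.card ^ (d - 1))) ^ C₁) ^ j :=
          mul_le_mul_of_nonneg_left h2 (by positivity)
      _ = _ := by rw [mul_pow 2]; ring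
  set a := w * (2 * (p * (l * S.card ^ (d - 1))) ^ C₁) ^ j with ha
  have ha0 : 0 ≤ a := by positivity
  calc _ ≤ ∑ J ∈ Sᶜ.powersetCard j, ∑ L ∈ S.powersetCard j, a :=
        Finset.sum_le_sum fun J hJ => Finset.sum_le_sum fun L hL => hterm J hJ L hL
    _ = (Sᶜ.powersetCard j).card * ((S.powersetCard j).card * a) := by
        rw [Finset.sum_const, Finset.sum_const, nsmul_eq_mul, nsmul_eq_mul]
    _ ≤ (Fintype.card V : ℝ) ^ j * ((S.card : ℝ) ^ j * a) := by
        have h1 : ((Sᶜ.powersetCard j).card : ℝ) ≤ (Fintype.card V : ℝ) ^ j := by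
          exact_mod_cast (card_powersetCard_le_pow _ _).trans
            (Nat.pow_le_pow_left (Finset.card_le_univ _) _)
        have h2 : ((S.powersetCard j).card : ℝ) ≤ (S.card : ℝ) ^ j := by
          exact_mod_cast card_powersetCard_le_pow _ _
        gcongr
    _ = _ := by rw [ha, ← mul_assoc, ← mul_pow]; rw [mul_left_comm, ← mul_pow]; ring_nf

/-- The probability, in the weighted measure, that the surroundings of a set are not good. -/
theorem binExp_setWt_mul_not_good_le (hp : 0 ≤ p) (hp' : p ≤ 1) (hθ : 1 ≤ θ) (C₁ l m : ℕ)
    (hψ : θ ^ (2 * C₁) * (p * θ⁻¹ + (1 - p)) ^ (S.card.choose d - 2) ≤ ψ)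
    (hm : 1 / 2 ≤ meanWt d p (S.card.choose d)) :
    binExp p (edgeSpace V d) (fun E => setWt d S E * ind (¬Good d C₁ l E S)) ≤
      binExp p (edgeSpace V d) (setWt d S) *
        ((S.card ^ d * (d + 1) * S.card ^ (d - 1)) *
            (Fintype.card V * (2 * (p ^ 2 * ψ)) + Fintype.card V ^ 2 * (4 * (p * ψ) ^ 2)) +
          (∑ j ∈ Finset.Icc 2 (d + 1), (Fintype.card V ^ j * S.card ^ (d + 1 - j)) *
            (p * (2 * prob₁ p (S.card.choose d)) ^ j)) +
          Fintype.card V * (2 * ψ) / (m + 1) +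
          Fintype.card V *
            (2 * (p * (m * ((2 * C₁ : ℕ) * (d + 1)) * S.card ^ (d - 1))) ^ C₁) +
          ∑ j ∈ Finset.Icc 1 l,
            (2 * Fintype.card V * S.card * (p * (l * S.card ^ (d - 1))) ^ C₁) ^ j) := by
  set w := binExp p (edgeSpace V d) (setWt d S) with hw
  have hw0 : 0 ≤ w := binExp_nonneg hp hp' fun E _ => setWt_nonneg _ _ _
  have b1 := binExp_setWt_mul_not_lightDisjoint_le hp hp' hθ hψ hm
  have b2 := binExp_setWt_mul_not_noLightEdge_le hp hp' hm
  have b3 := binExp_setWt_mul_lightVerts_le hp hp' hθ hψ hm m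
  have b5 := binExp_setWt_mul_not_noDense_le hp hp' hm C₁ l
  have b4 : ∑ v ∈ Sᶜ, binExp p (edgeSpace V d) (fun E => setWt d S E *
      (ind (C₁ ≤ (edgesMeeting d E S v (lightCover d (2 * C₁) E S v)).card) *
        ind ((lightVerts d (2 * C₁) E S v).card ≤ m))) ≤
      w * (Fintype.card V *
        (2 * (p * (m * ((2 * C₁ : ℕ) * (d + 1)) * S.card ^ (d - 1))) ^ C₁)) := by
    refine (Finset.sum_le_card_nsmul _ _ _ fun v hv =>
      binExp_setWt_mul_meet_lightCover_le hp hp' hm C₁ m (Finset.mem_compl.1 hv)).trans ?_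
    rw [nsmul_eq_mul, mul_left_comm]
    have hn : (Sᶜ.card : ℝ) ≤ Fintype.card V := by exact_mod_cast Finset.card_le_univ _
    gcongr
  rw [mul_add, mul_add, mul_add, mul_add]
  refine le_trans ?_ (add_le_add (add_le_add (add_le_add (add_le_add b1 b2) b3) b4) b5)
  rw [← binExp_sum, ← binExp_add, ← binExp_add, ← binExp_add, ← binExp_add]
  refine binExp_mono hp hp' fun E _ => ?_
  rw [← Finset.mul_sum, ← mul_add, ← mul_add, ← mul_add, ← mul_add]
  refine mul_le_mul_of_nonneg_left ?_ (setWt_nonneg _ _ _)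
  have n1 := ind_nonneg (¬LightDisjoint d (2 * C₁) E S)
  have n2 := ind_nonneg (¬NoLightEdge d E S)
  have n3 := ind_nonneg (m < (Sᶜ.filter fun v => deg d E S v ≤ 2 * C₁).card)
  have n4 : 0 ≤ ∑ v ∈ Sᶜ, ind (C₁ ≤ (edgesMeeting d E S v (lightCover d (2 * C₁) E S v)).card) *
        ind ((lightVerts d (2 * C₁) E S v).card ≤ m) :=
    Finset.sum_nonneg fun v _ => mul_nonneg (ind_nonneg _) (ind_nonneg _)
  have n5 := ind_nonneg (¬NoDense d C₁ l E S)
  by_cases h1 : LightDisjoint d (2 * C₁) E S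
  swap
  · rw [ind_of h1] at n1 ⊢; linarith [ind_le_one (¬Good d C₁ l E S)]
  by_cases h2 : NoLightEdge d E S
  swap
  · rw [ind_of h2] at n2 ⊢; linarith [ind_le_one (¬Good d C₁ l E S)]
  by_cases h5 : NoDense d C₁ l E S
  swap
  · rw [ind_of h5] at n5 ⊢; linarith [ind_le_one (¬Good d C₁ l E S)]
  by_cases h4 : FewMeetLight d (2 * C₁) C₁ E S
  · rw [ind_of_not (not_not.2 ⟨h1, h2, h4, h5⟩)]; positivity
  -- The last failure is that some vertex has many edges meeting the light cover. Either there are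
  -- more than `m` light vertices, which the third term covers, or this vertex is counted in the
  -- fourth.
  by_cases h3 : m < (Sᶜ.filter fun v => deg d E S v ≤ 2 * C₁).card
  · rw [ind_of h3] at n3 ⊢; linarith [ind_le_one (¬Good d C₁ l E S)]
  simp only [FewMeetLight] at h4
  push Not at h4
  obtain ⟨v, hv, hv'⟩ := h4
  have hlv : (lightVerts d (2 * C₁) E S v).card ≤ m :=
    (Finset.card_le_card (Finset.filter_subset_filter _ (Finset.erase_subset _ _))).trans
      (not_lt.1 h3)
  have h6 := Finset.single_le_sum (f := fun v =>
    ind (C₁ ≤ (edgesMeeting d E S v (lightCover d (2 * C₁) E S v)).card) *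
      ind ((lightVerts d (2 * C₁) E S v).card ≤ m))
    (fun v _ => mul_nonneg (ind_nonneg _) (ind_nonneg _)) (Finset.mem_compl.2 hv)
  simp only [ind_of hv', ind_of hlv, mul_one] at h6
  linarith [ind_le_one (¬Good d C₁ l E S)]

end

/-! ### Second moment method, plain and weighted. -/

section

/-- The expected number of independent sets of size `s`. -/
noncomputable def expIndep (n d : ℕ) (p : ℝ) (s : ℕ) : ℝ :=
  n.choose s * (1 - p) ^ s.choose (d + 1)

theorem expIndep_nonneg {n d : ℕ} {p : ℝ} (hp' : p ≤ 1) (s : ℕ) : 0 ≤ expIndep n d p s :=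
  mul_nonneg (Nat.cast_nonneg _) (pow_nonneg (by linarith) _)

theorem expIndep_pos {n d : ℕ} {p : ℝ} (hp' : p < 1) {s : ℕ} (hs : s ≤ n) :
    0 < expIndep n d p s :=
  mul_pos (by exact_mod_cast Nat.choose_pos hs) (pow_pos (by linarith) _)

/-- Enlarge `n - s` to `n - i` in the second binomial and use `n.choose s * s.choose i = n.choose i
* (n - i).choose (s - i)`. -/
theorem choose_mul_choose_mul_le {n s i : ℕ} (hi : i ≤ s) (hs : s ≤ n) :
    s.choose i * (n - s).choose (s - i) * n.choose i ≤ s.choose i ^ 2 * n.choose s := by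
  have h1 : n.choose s * s.choose i = n.choose i * (n - i).choose (s - i) :=
    Nat.choose_mul hi
  have h2 : (n - s).choose (s - i) ≤ (n - i).choose (s - i) :=
    Nat.choose_le_choose _ (by omega)
  calc _ = s.choose i * (n.choose i * (n - s).choose (s - i)) := by ring
    _ ≤ s.choose i * (n.choose i * (n - i).choose (s - i)) := by gcongr
    _ = _ := by rw [← h1]; ring

/-- Relative to the squared mean, pairs with `i` common vertices contribute at most `s.choose i ^ 2
/ expIndep n d p i`, so these pairs are controlled by the expected number of small independent sets.
-/
theorem pair_term_le {n d s i : ℕ} {p : ℝ} (hp' : p < 1) (hi : i ≤ s) (hs : s ≤ n) :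
    (n.choose s * (s.choose i * (n - s).choose (s - i)) : ℝ) *
      (1 - p) ^ (2 * s.choose (d + 1) - i.choose (d + 1)) ≤
      expIndep n d p s ^ 2 * (s.choose i ^ 2 / expIndep n d p i) := by
  have hq : 0 < 1 - p := by linarith
  have hpos := expIndep_pos (d := d) hp' (hi.trans hs)
  have hle : i.choose (d + 1) ≤ 2 * s.choose (d + 1) :=
    (Nat.choose_le_choose _ hi).trans (by omega)
  have h1 : (s.choose i * (n - s).choose (s - i) * n.choose i : ℝ) ≤
      s.choose i ^ 2 * n.choose s := by exact_mod_cast choose_mul_choose_mul_le hi hs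
  rw [mul_div_assoc', le_div_iff₀ hpos]
  have h2 : (1 - p) ^ (2 * s.choose (d + 1) - i.choose (d + 1)) * (1 - p) ^ i.choose (d + 1) =
      ((1 - p) ^ s.choose (d + 1)) ^ 2 := by
    rw [← pow_add, Nat.sub_add_cancel hle, mul_comm 2, pow_mul]
  unfold expIndep
  calc _ = (n.choose s : ℝ) * (s.choose i * (n - s).choose (s - i) * n.choose i) *
        ((1 - p) ^ (2 * s.choose (d + 1) - i.choose (d + 1)) * (1 - p) ^ i.choose (d + 1)) := by
        ring
    _ ≤ (n.choose s : ℝ) * (s.choose i ^ 2 * n.choose s) * ((1 - p) ^ s.choose (d + 1)) ^ 2 := by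
        rw [h2]; gcongr
    _ = _ := by ring

section Pairs

variable {V : Type*} [Fintype V] [DecidableEq V] {d : ℕ} {p : ℝ}

theorem card_filter_inter_card_eq_le (S : Finset V) {s i : ℕ} (hS : S.card = s) :
    (((Finset.univ : Finset V).powersetCard s).filter fun S' => (S ∩ S').card = i).card ≤
      s.choose i * (Fintype.card V - s).choose (s - i) := by
  have h : (((Finset.univ : Finset V).powersetCard s).filter fun S' => (S ∩ S').card = i).card ≤
      (S.powersetCard i ×ˢ Sᶜ.powersetCard (s - i)).card := by
    refine Finset.card_le_card_of_injOn (fun S' => (S ∩ S', S' \ S)) ?_ ?_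
    · intro S' h
      obtain ⟨h1, h2⟩ := Finset.mem_filter.1 (Finset.mem_coe.1 h)
      have hc := (Finset.mem_powersetCard.1 h1).2
      rw [Finset.mem_coe, Finset.mem_product, Finset.mem_powersetCard, Finset.mem_powersetCard]
      refine ⟨⟨Finset.inter_subset_left, h2⟩, fun x hx => ?_, ?_⟩
      · exact Finset.mem_compl.2 (Finset.mem_sdiff.1 hx).2
      · have := Finset.card_sdiff_add_card_inter S' S
        rw [Finset.inter_comm] at this
        simp only; omega
    · intro A _ B _ hAB
      simp only [Prod.mk.injEq] at hAB
      rw [← Finset.sdiff_union_inter A S, ← Finset.sdiff_union_inter B S, hAB.2,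
        Finset.inter_comm A, hAB.1, Finset.inter_comm B]
  refine h.trans (le_of_eq ?_)
  rw [Finset.card_product, Finset.card_powersetCard, Finset.card_powersetCard, Finset.card_compl,
    hS]

/-- The expected number of pairs of independent sets with intersection of size `i`. -/
theorem sum_pair_indep_le (hp' : p < 1) {s i : ℕ} (hi : i ≤ s) (hs : s ≤ Fintype.card V) :
    ∑ S ∈ (Finset.univ : Finset V).powersetCard s,
      ∑ S' ∈ ((Finset.univ : Finset V).powersetCard s).filter (fun S' => (S ∩ S').card = i),
        binExp p (edgeSpace V d) (fun E => ind (Indep d E S ∧ Indep d E S')) ≤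
      expIndep (Fintype.card V) d p s ^ 2 *
        (s.choose i ^ 2 / expIndep (Fintype.card V) d p i) := by
  have hq : 0 < 1 - p := by linarith
  refine le_trans ?_ (pair_term_le hp' hi hs)
  have h : ∀ S ∈ (Finset.univ : Finset V).powersetCard s,
      ∑ S' ∈ ((Finset.univ : Finset V).powersetCard s).filter (fun S' => (S ∩ S').card = i),
        binExp p (edgeSpace V d) (fun E => ind (Indep d E S ∧ Indep d E S')) ≤
      (s.choose i * (Fintype.card V - s).choose (s - i) : ℝ) *
        (1 - p) ^ (2 * s.choose (d + 1) - i.choose (d + 1)) := by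
    intro S hS
    have hSc := (Finset.mem_powersetCard.1 hS).2
    rw [Finset.sum_congr rfl fun S' hS' => by
      obtain ⟨h1, h2⟩ := Finset.mem_filter.1 hS'
      rw [binExp_indep_and, h2, hSc, (Finset.mem_powersetCard.1 h1).2, ← two_mul],
      Finset.sum_const, nsmul_eq_mul]
    refine mul_le_mul_of_nonneg_right ?_ (by positivity)
    exact_mod_cast card_filter_inter_card_eq_le S hSc
  refine (Finset.sum_le_card_nsmul _ _ _ h).trans (le_of_eq ?_)
  rw [Finset.card_powersetCard, Finset.card_univ, nsmul_eq_mul]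
  ring

/-- The last step of the second moment method, with `y` the mean and `P` the probability of a
nonzero count: the hypotheses give `P ≥ (1 - a) ^ 2 / (1 + b)`. -/
theorem one_sub_le_of_sq_le {P x y a b : ℝ} (hx : 0 < x) (ha : a ≤ 1)
    (h1 : (1 - a) * x ≤ y) (h2 : y ^ 2 ≤ P * ((1 + b) * x ^ 2)) (hb : 0 ≤ b) :
    1 - (2 * a + b) ≤ P := by
  have h3 : ((1 - a) * x) ^ 2 ≤ y ^ 2 :=
    pow_le_pow_left₀ (mul_nonneg (by linarith) hx.le) h1 2
  have h4 : (1 - a) ^ 2 ≤ P * (1 + b) := by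
    have : (1 - a) ^ 2 * x ^ 2 ≤ P * (1 + b) * x ^ 2 := by nlinarith
    exact le_of_mul_le_mul_right this (by positivity)
  by_contra hlt
  push Not at hlt
  nlinarith [mul_lt_mul_of_pos_right hlt (show (0 : ℝ) < 1 + b by linarith), sq_nonneg (a + b)]

/-- The second moment method for independent sets. -/
theorem one_sub_le_binExp_exists_indep (hp : 0 ≤ p) (hp' : p < 1) {s : ℕ}
    (hs : s ≤ Fintype.card V) {ε : ℝ}
    (hε : ∑ i ∈ Finset.Icc (d + 1) s, (s.choose i : ℝ) ^ 2 / expIndep (Fintype.card V) d p i ≤ ε) :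
    1 - ε ≤
      binExp p (edgeSpace V d) (fun E => ind (∃ S : Finset V, Indep d E S ∧ S.card = s)) := by
  set N := (Finset.univ : Finset V).powersetCard s with hN
  set x := expIndep (Fintype.card V) d p s with hx
  have hx0 : 0 < x := expIndep_pos hp' hs
  have hq : 0 < 1 - p := by linarith
  let X : Finset (Finset V) → ℝ := fun E => ∑ S ∈ N, ind (Indep d E S)
  have hEX : binExp p (edgeSpace V d) X = x := by
    rw [binExp_sum, Finset.sum_congr rfl fun S hS => by
      rw [binExp_indep, (Finset.mem_powersetCard.1 hS).2], Finset.sum_const,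
      Finset.card_powersetCard, Finset.card_univ, nsmul_eq_mul]
    rfl
  have hE2 : binExp p (edgeSpace V d) (fun E => X E ^ 2) ≤ (1 + ε) * x ^ 2 := by
    have h1 : ∀ E, X E ^ 2 = ∑ S ∈ N, ∑ S' ∈ N, ind (Indep d E S ∧ Indep d E S') := by
      intro E
      simp only [ind_and, ← Finset.sum_mul, ← Finset.mul_sum]
      rw [sq]
    rw [funext h1]
    simp only [binExp_sum]
    have h2 : ∀ S ∈ N, ∑ S' ∈ N,
        binExp p (edgeSpace V d) (fun E => ind (Indep d E S ∧ Indep d E S')) ≤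
        N.card * ((1 - p) ^ s.choose (d + 1)) ^ 2 + ∑ i ∈ Finset.Icc (d + 1) s,
          ∑ S' ∈ N.filter (fun S' => (S ∩ S').card = i),
            binExp p (edgeSpace V d) (fun E => ind (Indep d E S ∧ Indep d E S')) := by
      intro S hS
      have hSc := (Finset.mem_powersetCard.1 hS).2
      have hnn : ∀ S', 0 ≤ binExp p (edgeSpace V d)
          (fun E => ind (Indep d E S ∧ Indep d E S')) := fun S' =>
        binExp_nonneg hp hp'.le fun E _ => ind_nonneg _
      -- Sets with at most `d` common vertices share no potential edge and are independent exactly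
      -- as a product.
      rw [← Finset.sum_filter_add_sum_filter_not N fun S' => (S ∩ S').card ≤ d]
      refine add_le_add ?_ ?_
      · refine (Finset.sum_le_card_nsmul _ _ (((1 - p) ^ s.choose (d + 1)) ^ 2) ?_).trans ?_
        · intro S' hS'
          obtain ⟨h3, h4⟩ := Finset.mem_filter.1 hS'
          rw [binExp_indep_and, hSc, (Finset.mem_powersetCard.1 h3).2,
            Nat.choose_eq_zero_of_lt (Nat.lt_succ_of_le h4), Nat.sub_zero, ← pow_mul, mul_two]
        · rw [nsmul_eq_mul]
          refine mul_le_mul_of_nonneg_right ?_ (by positivity)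
          exact_mod_cast Finset.card_filter_le _ _
      · have hmaps : ∀ S' ∈ N.filter (fun S' => ¬ (S ∩ S').card ≤ d),
            (S ∩ S').card ∈ Finset.Icc (d + 1) s := by
          intro S' hS'
          have h4 := (Finset.mem_filter.1 hS').2
          have h5 := Finset.card_le_card (Finset.inter_subset_left : S ∩ S' ⊆ S)
          exact Finset.mem_Icc.2 ⟨by omega, by omega⟩
        rw [← Finset.sum_fiberwise_of_maps_to hmaps]
        refine Finset.sum_le_sum fun i _ => Finset.sum_le_sum_of_subset_of_nonneg ?_
          fun S' _ _ => hnn S'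
        exact Finset.filter_subset_filter _ (Finset.filter_subset _ _)
    refine (Finset.sum_le_sum h2).trans ?_
    rw [Finset.sum_add_distrib, Finset.sum_comm]
    have h3 : ∑ S ∈ N, (N.card * ((1 - p) ^ s.choose (d + 1)) ^ 2 : ℝ) = x ^ 2 := by
      rw [Finset.sum_const, Finset.card_powersetCard, Finset.card_univ, nsmul_eq_mul, hx, expIndep]
      ring
    rw [h3, add_mul, one_mul]
    refine add_le_add le_rfl ?_
    calc _ ≤ ∑ i ∈ Finset.Icc (d + 1) s,
          x ^ 2 * ((s.choose i : ℝ) ^ 2 / expIndep (Fintype.card V) d p i) :=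
          Finset.sum_le_sum fun i hi => sum_pair_indep_le hp' (Finset.mem_Icc.1 hi).2 hs
      _ ≤ _ := by
          rw [← Finset.mul_sum, mul_comm]
          exact mul_le_mul_of_nonneg_right hε (by positivity)
  have hcs := sq_binExp_le (U := edgeSpace V d) hp hp'.le X
  have hP : binExp p (edgeSpace V d) (fun E => ind (X E ≠ 0)) ≤
      binExp p (edgeSpace V d) (fun E => ind (∃ S : Finset V, Indep d E S ∧ S.card = s)) := by
    refine binExp_mono hp hp'.le fun E _ => ind_mono fun h => ?_
    obtain ⟨S, hS, h1⟩ := Finset.exists_ne_zero_of_sum_ne_zero h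
    refine ⟨S, ?_, (Finset.mem_powersetCard.1 hS).2⟩
    by_contra h2
    exact h1 (ind_of_not h2)
  refine le_trans ?_ hP
  have hP0 : 0 ≤ binExp p (edgeSpace V d) (fun E => ind (X E ≠ 0)) :=
    binExp_nonneg hp hp'.le fun E _ => ind_nonneg _
  have hε0 : 0 ≤ ε := le_trans (Finset.sum_nonneg fun i hi => div_nonneg (by positivity)
    (expIndep_nonneg hp'.le i)) hε
  have := one_sub_le_of_sq_le (a := 0) (y := x) hx0 (by norm_num) (by simp)
    (by rw [hEX] at hcs; exact hcs.trans (mul_le_mul_of_nonneg_left hE2 hP0)) hε0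
  linarith

/-- The second moment method for weighted independent sets with good surroundings. -/
theorem one_sub_le_binExp_exists_indep_of_setWt (hp : 0 ≤ p) (hp' : p < 1) {s : ℕ}
    (hs : s ≤ Fintype.card V) {C₁ l I : ℕ} (hC : 1 ≤ C₁) {w ε₁ ε₂ ε₃ : ℝ}
    (hw : w = (1 - p) ^ s.choose (d + 1) * meanWt d p (s.choose d) ^ (Fintype.card V - s))
    (hw0 : 0 < w) (hε₁ : 0 ≤ ε₁) (hε₂ : 0 ≤ ε₂) (hε₃ : ε₃ ≤ 1)
    (hfar : ∀ i ≤ I, i ≤ s → (1 - p) ^ (2 * s.choose (d + 1) - i.choose (d + 1)) *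
      (meanWt d p (s.choose d) ^ 2 + probLe p (s.choose d) *
        probLe p (s.choose d - i.choose d)) ^ (Fintype.card V - (2 * s - i)) ≤ (1 + ε₁) * w ^ 2)
    (hmid : ∑ i ∈ (Finset.range (s + 1)).filter (fun i => I < i ∧ l < s - i),
      expIndep (Fintype.card V) d p s ^ 2 *
        ((s.choose i : ℝ) ^ 2 / expIndep (Fintype.card V) d p i) ≤
          ε₂ * ((Fintype.card V).choose s * w) ^ 2)
    (hgood : ∀ S : Finset V, S.card = s →
      binExp p (edgeSpace V d) (fun E => setWt d S E * ind (¬Good d C₁ l E S)) ≤ ε₃ * w) :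
    1 - (2 * ε₃ + (ε₁ + ε₂ + 1 / ((Fintype.card V).choose s * w))) ≤
      binExp p (edgeSpace V d) (fun E => ind (∃ S : Finset V, Indep d E S ∧ S.card = s)) := by
  set N := (Finset.univ : Finset V).powersetCard s with hN
  set x := ((Fintype.card V).choose s * w : ℝ) with hx
  have hx0 : 0 < x := mul_pos (by exact_mod_cast Nat.choose_pos hs) hw0
  have hq : 0 < 1 - p := by linarith
  have hNc : (N.card : ℝ) = (Fintype.card V).choose s := by
    rw [Finset.card_powersetCard, Finset.card_univ]
  have hwS : ∀ S ∈ N, binExp p (edgeSpace V d) (setWt d S) = w := fun S hS => by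
    rw [binExp_setWt, (Finset.mem_powersetCard.1 hS).2, hw]
  let f : Finset V → Finset (Finset V) → ℝ := fun S E => setWt d S E * ind (Good d C₁ l E S)
  have hf0 : ∀ S E, 0 ≤ f S E := fun S E => mul_nonneg (setWt_nonneg _ _ _) (ind_nonneg _)
  have hfle : ∀ S E, f S E ≤ setWt d S E := fun S E =>
    mul_le_of_le_one_right (setWt_nonneg _ _ _) (ind_le_one _)
  let X : Finset (Finset V) → ℝ := fun E => ∑ S ∈ N, f S E
  have hEX : (1 - ε₃) * x ≤ binExp p (edgeSpace V d) X := by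
    rw [binExp_sum]
    have h1 : ∀ S ∈ N, (1 - ε₃) * w ≤ binExp p (edgeSpace V d) (f S) := by
      intro S hS
      have h2 : binExp p (edgeSpace V d) (f S) = binExp p (edgeSpace V d) (setWt d S) -
          binExp p (edgeSpace V d) (fun E => setWt d S E * ind (¬Good d C₁ l E S)) := by
        rw [← binExp_sub]
        refine binExp_congr fun E _ => ?_
        rw [ind_not]; simp only [f]; ring
      rw [h2, hwS S hS]
      have := hgood S (Finset.mem_powersetCard.1 hS).2
      linarith
    refine le_trans (le_of_eq ?_) (Finset.card_nsmul_le_sum _ _ _ h1)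
    rw [nsmul_eq_mul, hNc, hx]; ring
  have hE2 : binExp p (edgeSpace V d) (fun E => X E ^ 2) ≤
      (1 + (ε₁ + ε₂ + 1 / x)) * x ^ 2 := by
    have h1 : ∀ E, X E ^ 2 = ∑ S ∈ N, ∑ S' ∈ N, f S E * f S' E := by
      intro E
      simp only [← Finset.sum_mul, ← Finset.mul_sum]
      rw [sq]
    rw [funext h1]
    simp only [binExp_sum]
    have hnn : ∀ S S', 0 ≤ binExp p (edgeSpace V d) (fun E => f S E * f S' E) := fun S S' =>
      binExp_nonneg hp hp'.le fun E _ => mul_nonneg (hf0 _ _) (hf0 _ _)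
    -- Far sets `S'` (at most `I` common vertices) are bounded by `hfar`, near ones (at most `l`
    -- vertices lost) by the cluster bound, and the rest by forgetting the weights.
    have hsplit : ∀ S ∈ N, ∑ S' ∈ N, binExp p (edgeSpace V d) (fun E => f S E * f S' E) ≤
        N.card * ((1 + ε₁) * w ^ 2) + w +
        ∑ i ∈ (Finset.range (s + 1)).filter (fun i => I < i ∧ l < s - i),
          ∑ S' ∈ N.filter (fun S' => (S ∩ S').card = i),
            binExp p (edgeSpace V d) (fun E => ind (Indep d E S ∧ Indep d E S')) := by
      intro S hS
      have hSc := (Finset.mem_powersetCard.1 hS).2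
      rw [← Finset.sum_filter_add_sum_filter_not N fun S' => (S ∩ S').card ≤ I,
        ← Finset.sum_filter_add_sum_filter_not (N.filter fun S' => ¬(S ∩ S').card ≤ I)
          fun S' => (S \ S').card ≤ l, ← add_assoc]
      refine add_le_add (add_le_add ?_ ?_) ?_
      · have h3 : ∀ S' ∈ N.filter (fun S' => (S ∩ S').card ≤ I),
            binExp p (edgeSpace V d) (fun E => f S E * f S' E) ≤ (1 + ε₁) * w ^ 2 := by
          intro S' hS'
          obtain ⟨h4, h5⟩ := Finset.mem_filter.1 hS'
          have hS'c := (Finset.mem_powersetCard.1 h4).2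
          have hi : (S ∩ S').card ≤ s :=
            (Finset.card_le_card Finset.inter_subset_left).trans hSc.le
          have hun : (S ∪ S').card = 2 * s - (S ∩ S').card := by
            have := Finset.card_union_add_card_inter S S'
            omega
          refine (binExp_mono hp hp'.le fun E _ => mul_le_mul (hfle S E) (hfle S' E) (hf0 _ _)
            (setWt_nonneg _ _ _)).trans ?_
          have h6 := binExp_setWt_mul_le (d := d) hp hp'.le (hSc.trans hS'c.symm)
          rw [hSc, hun] at h6
          exact h6.trans (hfar _ h5 hi)
        refine (Finset.sum_le_card_nsmul _ _ _ h3).trans ?_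
        rw [nsmul_eq_mul]
        refine mul_le_mul_of_nonneg_right ?_ (by positivity)
        exact_mod_cast Finset.card_filter_le _ _
      -- If `f S E ≠ 0`, then `S` is good, independent and without outside vertices of degree 0, so
      -- the weights of all near sets sum to at most 1. Near pairs thus contribute no more than the
      -- mean of `setWt d S`, which is the source of the error `1 / x`.
      · rw [← binExp_sum]
        refine le_trans (binExp_mono hp hp'.le fun E _ => ?_) (hwS S hS).le
        rw [← Finset.mul_sum]
        by_cases h0 : f S E = 0
        · rw [h0, zero_mul]; exact setWt_nonneg _ _ _
        have hG : Good d C₁ l E S := by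
          by_contra h
          exact h0 (by simp only [f, ind_of_not h, mul_zero])
        have hwt : setWt d S E ≠ 0 := left_ne_zero_of_mul h0
        have hind : Indep d E S := by
          by_contra h
          exact hwt (by simp only [setWt, ind_of_not h, zero_mul])
        have hpos : ∀ v ∉ S, 1 ≤ deg d E S v := by
          intro v hv
          by_contra h
          refine hwt ?_
          rw [setWt, Finset.prod_eq_zero (Finset.mem_compl.2 hv), mul_zero]
          rw [show deg d E S v = 0 by omega]; simp [starWt]
        have h7 := hG.sum_setWt_le_one hC hind hpos
        refine (mul_le_mul (hfle S E) (le_trans ?_ h7) (Finset.sum_nonneg fun _ _ => hf0 _ _)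
          (setWt_nonneg _ _ _)).trans (mul_one _).le
        rw [hSc]
        refine (Finset.sum_le_sum fun S' _ => hfle S' E).trans ?_
        refine Finset.sum_le_sum_of_subset_of_nonneg ?_ fun _ _ _ => setWt_nonneg _ _ _
        exact Finset.filter_subset_filter _ (Finset.filter_subset _ _)
      · have hmaps : ∀ S' ∈ (N.filter fun S' => ¬(S ∩ S').card ≤ I).filter
            (fun S' => ¬(S \ S').card ≤ l), (S ∩ S').card ∈
              (Finset.range (s + 1)).filter (fun i => I < i ∧ l < s - i) := by
          intro S' hS'
          obtain ⟨h3, h4⟩ := Finset.mem_filter.1 hS'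
          have h5 := (Finset.mem_filter.1 h3).2
          have h6 := Finset.card_sdiff_add_card_inter S S'
          exact Finset.mem_filter.2 ⟨Finset.mem_range.2 (by omega), by omega, by omega⟩
        rw [← Finset.sum_fiberwise_of_maps_to hmaps]
        refine Finset.sum_le_sum fun i _ => ?_
        refine le_trans (Finset.sum_le_sum_of_subset_of_nonneg (?_ : _ ⊆
          N.filter (fun S' => (S ∩ S').card = i)) fun S' _ _ => hnn S S') ?_
        · exact Finset.filter_subset_filter _
            ((Finset.filter_subset _ _).trans (Finset.filter_subset _ _))
        · refine Finset.sum_le_sum fun S' _ => binExp_mono hp hp'.le fun E _ => ?_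
          rw [ind_and]
          exact mul_le_mul ((hfle S E).trans (setWt_le_ind _ _ _))
            ((hfle S' E).trans (setWt_le_ind _ _ _)) (hf0 _ _) (ind_nonneg _)
    refine (Finset.sum_le_sum hsplit).trans ?_
    rw [Finset.sum_add_distrib, Finset.sum_comm, Finset.sum_const, nsmul_eq_mul, hNc]
    have h8 := (Finset.sum_le_sum fun i hi => sum_pair_indep_le (d := d) (V := V) hp'
      (show i ≤ s by
        have := Finset.mem_range.1 (Finset.mem_filter.1 hi).1
        omega) hs).trans hmid
    refine (add_le_add le_rfl h8).trans (le_of_eq ?_)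
    have hne := hx0.ne'
    have h9 : (1 + (ε₁ + ε₂ + 1 / x)) * x ^ 2 = (1 + ε₁) * x ^ 2 + x + ε₂ * x ^ 2 := by
      field_simp; ring
    rw [h9, hx]; ring
  have hcs := sq_binExp_le (U := edgeSpace V d) hp hp'.le X
  have hP : binExp p (edgeSpace V d) (fun E => ind (X E ≠ 0)) ≤
      binExp p (edgeSpace V d) (fun E => ind (∃ S : Finset V, Indep d E S ∧ S.card = s)) := by
    refine binExp_mono hp hp'.le fun E _ => ind_mono fun h => ?_
    obtain ⟨S, hS, h1⟩ := Finset.exists_ne_zero_of_sum_ne_zero h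
    refine ⟨S, ?_, (Finset.mem_powersetCard.1 hS).2⟩
    by_contra h2
    refine h1 ?_
    simp only [f, setWt, ind_of_not h2, zero_mul]
  refine le_trans ?_ hP
  have hP0 : 0 ≤ binExp p (edgeSpace V d) (fun E => ind (X E ≠ 0)) :=
    binExp_nonneg hp hp'.le fun E _ => ind_nonneg _
  exact one_sub_le_of_sq_le hx0 hε₃ hEX (hcs.trans (mul_le_mul_of_nonneg_left hE2 hP0))
    (by positivity)

end Pairs

end

/-! ### Estimates for degree probabilities and binomial coefficients. -/

section

section Estimates

variable {p : ℝ}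

theorem one_sub_pow_le_exp (hp' : p ≤ 1) (m : ℕ) : (1 - p) ^ m ≤ Real.exp (-(p * m)) := by
  have h : 1 - p ≤ Real.exp (-p) := by have := Real.add_one_le_exp (-p); linarith
  calc (1 - p) ^ m ≤ Real.exp (-p) ^ m := pow_le_pow_left₀ (by linarith) h m
    _ = _ := by rw [← Real.exp_nat_mul]; ring_nf

theorem exp_neg_two_mul_le {y : ℝ} (hy : 0 ≤ y) (hy' : y ≤ 1 / 2) :
    Real.exp (-(2 * y)) ≤ 1 - y := by
  have h := Real.add_one_le_exp (2 * y)
  rw [Real.exp_neg]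
  refine (inv_anti₀ (by linarith) h).trans ?_
  rw [inv_le_iff_one_le_mul₀ (by linarith)]
  nlinarith

theorem exp_le_one_sub_pow (hp : 0 ≤ p) (hp' : p ≤ 1 / 2) (m : ℕ) :
    Real.exp (-(2 * p * m)) ≤ (1 - p) ^ m := by
  calc Real.exp (-(2 * p * m)) = Real.exp (-(2 * p)) ^ m := by
        rw [← Real.exp_nat_mul]; ring_nf
    _ ≤ _ := pow_le_pow_left₀ (Real.exp_pos _).le (exp_neg_two_mul_le hp hp') m

theorem inv_one_sub_pow_le_exp (hp : 0 ≤ p) (hp' : p ≤ 1 / 2) (m : ℕ) :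
    ((1 - p) ^ m)⁻¹ ≤ Real.exp (2 * p * m) := by
  have := inv_anti₀ (Real.exp_pos _) (exp_le_one_sub_pow hp hp' m)
  rwa [← Real.exp_neg, neg_neg] at this

theorem prob₀_succ (m : ℕ) : prob₀ p (m + 1) = (1 - p) * prob₀ p m := by
  rw [prob₀, prob₀, pow_succ']

theorem prob₁_succ (m : ℕ) : prob₁ p (m + 1) = (1 - p) * prob₁ p m + p * prob₀ p m := by
  rcases m with _ | m
  · simp [prob₀, prob₁]
  · simp only [prob₀, prob₁, Nat.add_sub_cancel]
    push_cast
    ring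

/-- A further element spoils "at most one" exactly if one element was chosen before and the new one
is chosen too. -/
theorem probLe_succ (m : ℕ) : probLe p (m + 1) = probLe p m - p * prob₁ p m := by
  rw [probLe, probLe, prob₀_succ, prob₁_succ]; ring

theorem probLe_nonneg (hp : 0 ≤ p) (hp' : p ≤ 1) (m : ℕ) : 0 ≤ probLe p m :=
  add_nonneg (prob₀_nonneg hp' m) (prob₁_nonneg hp hp' m)

theorem probLe_antitone (hp : 0 ≤ p) (hp' : p ≤ 1) : Antitone (probLe p) :=
  antitone_nat_of_succ_le fun m => by
    rw [probLe_succ]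
    have := mul_nonneg hp (prob₁_nonneg hp hp' m)
    linarith

theorem probLe_le_add (hp : 0 ≤ p) (hp' : p ≤ 1) (m c : ℕ) :
    probLe p m ≤ probLe p (m + c) + c * (p * probLe p m) := by
  induction c with
  | zero => simp
  | succ c ih =>
    have h1 := prob₀_nonneg hp' (m + c)
    have h2 : probLe p (m + c) ≤ probLe p m := probLe_antitone hp hp' (Nat.le_add_right _ _)
    have h3 : p * prob₁ p (m + c) ≤ p * probLe p m :=
      mul_le_mul_of_nonneg_left (by rw [probLe] at h2; linarith) hp
    rw [← add_assoc, probLe_succ]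
    push_cast
    linarith

theorem one_sub_mul_probLe_le (hp : 0 ≤ p) (hp' : p ≤ 1) (m : ℕ) :
    (1 - p) * probLe p m ≤ probLe p (m + 1) := by
  rw [probLe, probLe, prob₀_succ, prob₁_succ]
  have := mul_nonneg hp (prob₀_nonneg hp' m)
  linarith

/-- It suffices that none of the `c` further elements is chosen. -/
theorem pow_mul_probLe_le (hp : 0 ≤ p) (hp' : p ≤ 1) (m c : ℕ) :
    (1 - p) ^ c * probLe p m ≤ probLe p (m + c) := by
  induction c with
  | zero => simp
  | succ c ih =>
    calc (1 - p) ^ (c + 1) * probLe p m = (1 - p) * ((1 - p) ^ c * probLe p m) := by ring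
      _ ≤ (1 - p) * probLe p (m + c) := mul_le_mul_of_nonneg_left ih (by linarith)
      _ ≤ _ := one_sub_mul_probLe_le hp hp' (m + c)

theorem probLe_le_exp (hp : 0 ≤ p) (hp' : p ≤ 1 / 2) (m : ℕ) :
    probLe p m ≤ (1 + 2 * (p * m)) * Real.exp (-(p * m)) := by
  have h0 := one_sub_pow_le_exp (p := p) (by linarith) m
  -- The exponent in `prob₁` is `m - 1`; restoring it to `m` costs the factor 2, as `1 - p ≥ 1 / 2`.
  have h1 : prob₁ p m ≤ 2 * (p * m) * (1 - p) ^ m := by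
    rcases m with _ | m
    · simp [prob₁]
    · rw [prob₁, Nat.add_sub_cancel, pow_succ]
      have h2 : 0 ≤ (1 - p) ^ m := pow_nonneg (by linarith) m
      have h3 : (0 : ℝ) ≤ ((m + 1 : ℕ) : ℝ) * p * (1 - p) ^ m := by positivity
      nlinarith
  have h2 : 2 * (p * m) * (1 - p) ^ m ≤ 2 * (p * m) * Real.exp (-(p * m)) :=
    mul_le_mul_of_nonneg_left h0 (by positivity)
  rw [probLe, prob₀]; linarith

theorem one_sub_probLe_le_meanWt (hp : 0 ≤ p) (hp' : p ≤ 1) (d m : ℕ) :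
    1 - probLe p m ≤ meanWt d p m := by
  have := div_nonneg (prob₁_nonneg hp hp' m) (show (0 : ℝ) ≤ d + 1 by positivity)
  rw [probLe, meanWt]; linarith

theorem meanWt_le_one (hp : 0 ≤ p) (hp' : p ≤ 1) (d m : ℕ) : meanWt d p m ≤ 1 := by
  have h1 : prob₁ p m / (d + 1) ≤ prob₁ p m :=
    div_le_self (prob₁_nonneg hp hp' m) (by linarith [Nat.cast_nonneg (α := ℝ) d])
  have := prob₀_nonneg hp' m
  rw [meanWt]; linarith

/-- A further element can raise the weight, by at most 1, only if it is chosen and at most one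
element was chosen before. -/
theorem meanWt_succ_le (hp : 0 ≤ p) (hp' : p ≤ 1) (d m : ℕ) :
    meanWt d p (m + 1) ≤ meanWt d p m + p * probLe p m := by
  have h0 := prob₀_nonneg hp' m
  have h1 := prob₁_nonneg hp hp' m
  have hd : (0 : ℝ) < d + 1 := by positivity
  have h2 : prob₀ p m / (d + 1) ≤ prob₀ p m :=
    div_le_self h0 (by linarith [Nat.cast_nonneg (α := ℝ) d])
  have h3 : 0 ≤ prob₁ p m / (d + 1) := by positivity
  have h4 : meanWt d p (m + 1) = meanWt d p m + p * (prob₁ p m + prob₀ p m / (d + 1) -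
      prob₁ p m / (d + 1)) := by
    rw [meanWt, meanWt, prob₀_succ, prob₁_succ]; ring
  rw [h4, probLe]
  have : p * (prob₁ p m + prob₀ p m / (d + 1) - prob₁ p m / (d + 1)) ≤
      p * (prob₀ p m + prob₁ p m) := mul_le_mul_of_nonneg_left (by linarith) hp
  linarith

theorem meanWt_add_le (hp : 0 ≤ p) (hp' : p ≤ 1) (d m c : ℕ) :
    meanWt d p (m + c) ≤ meanWt d p m + c * (p * probLe p m) := by
  induction c with
  | zero => simp
  | succ c ih =>
    have h1 := meanWt_succ_le hp hp' d (m + c)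
    have h2 : p * probLe p (m + c) ≤ p * probLe p m :=
      mul_le_mul_of_nonneg_left (probLe_antitone hp hp' (Nat.le_add_right _ _)) hp
    rw [← add_assoc]
    push_cast
    linarith

theorem choose_add_le_add_mul_pow (s r d : ℕ) :
    (s + r).choose d ≤ s.choose d + r * (s + r) ^ (d - 1) := by
  rcases d with _ | d
  · simp
  induction r with
  | zero => simp
  | succ r ih =>
    rw [← add_assoc, Nat.choose_succ_succ', Nat.add_sub_cancel]
    rw [Nat.add_sub_cancel] at ih
    have h1 : (s + r).choose d ≤ (s + r + 1) ^ d :=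
      (Nat.choose_le_pow _ _).trans (Nat.pow_le_pow_left (by omega) _)
    have h2 : r * (s + r) ^ d ≤ r * (s + r + 1) ^ d :=
      Nat.mul_le_mul_left _ (Nat.pow_le_pow_left (by omega) _)
    calc _ ≤ (s + r + 1) ^ d + (s.choose (d + 1) + r * (s + r + 1) ^ d) := by omega
      _ = _ := by ring

theorem choose_cast_le_exp_mul_div_pow (s i : ℕ) (hi : 1 ≤ i) :
    (s.choose i : ℝ) ≤ (Real.exp 1 * s / i) ^ i := by
  have h1 : (s.choose i : ℝ) ≤ (s : ℝ) ^ i / i.factorial := Nat.choose_le_pow_div i s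
  have h2 : ((i : ℝ) / Real.exp 1) ^ i ≤ i.factorial := by
    have h3 : (i : ℝ) ^ i / i.factorial ≤ Real.exp i := by
      have := Real.pow_div_factorial_le_exp (i : ℝ) (Nat.cast_nonneg i) i
      exact this
    rw [div_pow, ← Real.exp_nat_mul, mul_one, div_le_iff₀ (Real.exp_pos _)]
    rw [div_le_iff₀ (by positivity)] at h3
    linarith
  have hi0 : (0 : ℝ) < i := by exact_mod_cast hi
  calc (s.choose i : ℝ) ≤ (s : ℝ) ^ i / i.factorial := h1
    _ ≤ (s : ℝ) ^ i / ((i : ℝ) / Real.exp 1) ^ i := by gcongr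
    _ = _ := by rw [← div_pow]; congr 1; field_simp

theorem div_pow_le_choose_cast (n i : ℕ) (hi : i ≤ n) : ((n : ℝ) / i) ^ i ≤ n.choose i := by
  induction i generalizing n with
  | zero => simp
  | succ i ih =>
    obtain ⟨n, rfl⟩ : ∃ m, n = m + 1 := ⟨n - 1, by omega⟩
    have h1 : ((n + 1).choose (i + 1) : ℝ) = (n + 1) / (i + 1) * n.choose i := by
      rw [div_mul_eq_mul_div, eq_div_iff (by positivity)]
      exact_mod_cast (Nat.add_one_mul_choose_eq n i).symm
    have h2 : (((n : ℝ) + 1) / (i + 1)) ^ i ≤ ((n : ℝ) / i) ^ i := by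
      rcases Nat.eq_zero_or_pos i with rfl | h0
      · simp
      · have h3 : (0 : ℝ) < i := by exact_mod_cast h0
        have h4 : (i : ℝ) ≤ n := by exact_mod_cast (by omega : i ≤ n)
        refine pow_le_pow_left₀ (by positivity) ?_ i
        rw [div_le_div_iff₀ (by positivity) h3]
        nlinarith
    rw [h1]
    push_cast
    rw [pow_succ']
    exact mul_le_mul_of_nonneg_left (h2.trans (ih n (by omega))) (by positivity)

end Estimates

end

/-! ### The logarithm of the expected number of independent sets. -/

section

section ExpIndep

variable {n d : ℕ} {p : ℝ}

theorem neg_log_one_sub_le (hp : 0 ≤ p) (hp' : p ≤ 1 / 2) :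
    -Real.log (1 - p) ≤ p * (1 + 2 * p) := by
  have h1 := Real.one_sub_inv_le_log_of_pos (show (0 : ℝ) < 1 - p by linarith)
  have h2 : (1 - p)⁻¹ - 1 ≤ p * (1 + 2 * p) := by
    rw [sub_le_iff_le_add, inv_le_iff_one_le_mul₀ (by linarith)]
    nlinarith [mul_nonneg hp (mul_nonneg hp (show (0 : ℝ) ≤ 1 - 2 * p by linarith))]
  linarith

theorem le_neg_log_one_sub (hp' : p < 1) : p ≤ -Real.log (1 - p) := by
  have := Real.log_le_sub_one_of_pos (show (0 : ℝ) < 1 - p by linarith)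
  linarith

theorem succ_mul_choose_succ_eq (s : ℕ) (hs : 1 ≤ s) :
    (d + 1) * s.choose (d + 1) = s * (s - 1).choose d := by
  obtain ⟨s, rfl⟩ : ∃ m, s = m + 1 := ⟨s - 1, by omega⟩
  rw [Nat.add_sub_cancel, Nat.add_one_mul_choose_eq, mul_comm]

theorem choose_mul_sub_eq (s : ℕ) : s.choose d * (s - d) = s.choose (d + 1) * (d + 1) :=
  (Nat.choose_succ_right_eq s d).symm

/-- The quotient `i.choose (d + 1) / i` equals `(i - 1).choose d / (d + 1)`, which is monotone in
`i`. -/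
theorem mul_choose_le_mul_choose {i s : ℕ} (his : i ≤ s) :
    s * i.choose (d + 1) ≤ i * s.choose (d + 1) := by
  rcases Nat.eq_zero_or_pos i with rfl | hi
  · simp
  have h1 := succ_mul_choose_succ_eq (d := d) i hi
  have h2 := succ_mul_choose_succ_eq (d := d) s (by omega)
  have h3 : (i - 1).choose d ≤ (s - 1).choose d := Nat.choose_le_choose d (by omega)
  refine le_of_mul_le_mul_left (a := d + 1) ?_ (by omega)
  calc (d + 1) * (s * i.choose (d + 1)) = s * ((d + 1) * i.choose (d + 1)) := by ring
    _ = s * i * (i - 1).choose d := by rw [h1]; ring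
    _ ≤ s * i * (s - 1).choose d := Nat.mul_le_mul_left _ h3
    _ = i * ((d + 1) * s.choose (d + 1)) := by rw [h2]; ring
    _ = _ := by ring

/-- Since edges have at least two vertices, even `i.choose (d + 1) / i ^ 2` is monotone: extract one
factor `i` and apply the linear version to `i - 1`. The quadratic gain is what keeps `expIndep`
large between 0 and `s`. -/
theorem sq_mul_choose_le_sq_mul_choose {i s : ℕ} (hd : 1 ≤ d) (his : i ≤ s) :
    s ^ 2 * i.choose (d + 1) ≤ i ^ 2 * s.choose (d + 1) := by
  obtain ⟨d, rfl⟩ : ∃ e, d = e + 1 := ⟨d - 1, by omega⟩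
  rcases Nat.eq_zero_or_pos i with rfl | hi
  · simp
  have h1 := succ_mul_choose_succ_eq (d := d + 1) i hi
  have h2 := succ_mul_choose_succ_eq (d := d + 1) s (by omega)
  have h3 := mul_choose_le_mul_choose (d := d) (show i - 1 ≤ s - 1 by omega)
  have h4 : s * (i - 1).choose (d + 1) ≤ i * (s - 1).choose (d + 1) := by
    have h5 : (i - 1).choose (d + 1) ≤ (s - 1).choose (d + 1) :=
      Nat.choose_le_choose _ (by omega)
    obtain ⟨i, rfl⟩ : ∃ m, i = m + 1 := ⟨i - 1, by omega⟩
    obtain ⟨s, rfl⟩ : ∃ m, s = m + 1 := ⟨s - 1, by omega⟩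
    simp only [Nat.add_sub_cancel] at *
    linarith
  refine le_of_mul_le_mul_left (a := d + 1 + 1) ?_ (by omega)
  calc (d + 1 + 1) * (s ^ 2 * i.choose (d + 1 + 1))
      = s ^ 2 * ((d + 1 + 1) * i.choose (d + 1 + 1)) := by ring
    _ = s * i * (s * (i - 1).choose (d + 1)) := by rw [h1]; ring
    _ ≤ s * i * (i * (s - 1).choose (d + 1)) := Nat.mul_le_mul_left _ h4
    _ = i ^ 2 * ((d + 1 + 1) * s.choose (d + 1 + 1)) := by rw [h2]; ring
    _ = _ := by ring

theorem expIndep_succ {s : ℕ} (hs : s ≤ n) :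
    expIndep n d p (s + 1) = expIndep n d p s * (((n : ℝ) - s) / (s + 1) * (1 - p) ^ s.choose d) := by
  have h1 : (n.choose (s + 1) : ℝ) = n.choose s * (((n : ℝ) - s) / (s + 1)) := by
    rw [mul_div_assoc', eq_div_iff (by positivity)]
    have := Nat.choose_succ_right_eq n s
    have h2 : ((n.choose (s + 1) * (s + 1) : ℕ) : ℝ) = (n.choose s * (n - s) : ℕ) := by
      exact_mod_cast this
    push_cast [Nat.cast_sub hs] at h2
    exact h2
  rw [expIndep, expIndep, h1, Nat.choose_succ_succ', pow_add]
  ring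

theorem log_expIndep (hp' : p < 1) {s : ℕ} (hs : s ≤ n) :
    Real.log (expIndep n d p s) =
      Real.log (n.choose s) + s.choose (d + 1) * Real.log (1 - p) := by
  have h1 : (n.choose s : ℝ) ≠ 0 := by exact_mod_cast (Nat.choose_pos hs).ne'
  rw [expIndep, Real.log_mul h1 (pow_ne_zero _ (by linarith)), Real.log_pow]

theorem mul_log_div_le_log_choose {s : ℕ} (hs : s ≤ n) :
    s * Real.log ((n : ℝ) / s) ≤ Real.log (n.choose s) := by
  rcases Nat.eq_zero_or_pos s with rfl | h0
  · simp
  have h1 : (0 : ℝ) < s := by exact_mod_cast h0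
  have h2 : (0 : ℝ) < n := by exact_mod_cast h0.trans_le hs
  rw [← Real.log_pow]
  exact Real.log_le_log (by positivity) (div_pow_le_choose_cast n s hs)

theorem log_choose_le_mul_log {s : ℕ} (hs : s ≤ n) :
    Real.log (n.choose s) ≤ s * Real.log n := by
  have h1 : (0 : ℝ) < n.choose s := by exact_mod_cast Nat.choose_pos hs
  rw [← Real.log_pow]
  exact Real.log_le_log h1 (by exact_mod_cast Nat.choose_le_pow n s)

theorem log_choose_le_mul_one_add {s : ℕ} (hs : s ≤ n) :
    Real.log (n.choose s) ≤ s * (1 + Real.log ((n : ℝ) / s)) := by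
  rcases Nat.eq_zero_or_pos s with rfl | h0
  · simp
  have h1 : (0 : ℝ) < s := by exact_mod_cast h0
  have h2 : (0 : ℝ) < n := by exact_mod_cast h0.trans_le hs
  have h3 : (0 : ℝ) < n.choose s := by exact_mod_cast Nat.choose_pos hs
  have h4 := Real.log_le_log h3 (choose_cast_le_exp_mul_div_pow n s h0)
  rw [Real.log_pow, mul_div_assoc, Real.log_mul (Real.exp_pos _).ne' (by positivity),
    Real.log_exp] at h4
  exact h4

theorem mul_choose_le_mul_log_of_one_le_expIndep (hp' : p < 1) {s : ℕ} (hs : s ≤ n)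
    (hE : 1 ≤ expIndep n d p s) :
    s.choose (d + 1) * (-Real.log (1 - p)) ≤ Real.log (n.choose s) := by
  have := Real.log_nonneg hE
  rw [log_expIndep hp' hs] at this
  linarith

/-- A nonnegative logarithm forces `p * s.choose (d + 1) ≤ log (n.choose s) ≤ s * log n`; divide by
`s / (d + 1)`. This bounds the sizes that have to be considered. -/
theorem mul_choose_pred_le_of_one_le_expIndep (hp' : p < 1) {s : ℕ} (hs : s ≤ n)
    (hs0 : 1 ≤ s) (hE : 1 ≤ expIndep n d p s) :
    p * (s - 1).choose d ≤ (d + 1) * Real.log n := by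
  have h1 := mul_choose_le_mul_log_of_one_le_expIndep hp' hs hE
  have h2 := log_choose_le_mul_log hs
  have h3 : (s.choose (d + 1) : ℝ) * p ≤ s.choose (d + 1) * (-Real.log (1 - p)) :=
    mul_le_mul_of_nonneg_left (le_neg_log_one_sub hp') (Nat.cast_nonneg _)
  have h4 : ((d : ℝ) + 1) * s.choose (d + 1) = s * (s - 1).choose d := by
    exact_mod_cast succ_mul_choose_succ_eq (d := d) s hs0
  have h5 : (0 : ℝ) < s := by exact_mod_cast hs0
  refine le_of_mul_le_mul_left ?_ h5
  calc (s : ℝ) * (p * (s - 1).choose d) = (d + 1) * (s.choose (d + 1) * p) := by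
        rw [mul_left_comm, ← h4]; ring
    _ ≤ (d + 1) * (s * Real.log n) :=
        mul_le_mul_of_nonneg_left (by linarith) (by positivity)
    _ = _ := by ring

/-- If the expected number of independent `s`-sets is at least `1`, then the expected number of
independent `i`-sets is large for `i` between `0` and `s`. -/
theorem le_log_expIndep_of_one_le (hd : 1 ≤ d) (hp : 0 ≤ p) (hp' : p < 1) {i s : ℕ} (hi : i ≤ s)
    (hs : s ≤ n) (hE : 1 ≤ expIndep n d p s) :
    i * Real.log ((n : ℝ) / i) - ((i : ℝ) / s) ^ 2 * Real.log (n.choose s) ≤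
      Real.log (expIndep n d p i) := by
  rcases Nat.eq_zero_or_pos s with rfl | h0
  · obtain rfl : i = 0 := by omega
    simp [expIndep]
  have h1 : (0 : ℝ) < s := by exact_mod_cast h0
  have h2 := mul_choose_le_mul_log_of_one_le_expIndep hp' hs hE
  have h3 := mul_log_div_le_log_choose (hi.trans hs)
  rw [log_expIndep hp' (hi.trans hs)]
  have h4 : 0 ≤ -Real.log (1 - p) := hp.trans (le_neg_log_one_sub hp')
  have h5 : (i.choose (d + 1) : ℝ) ≤ ((i : ℝ) / s) ^ 2 * s.choose (d + 1) := by
    rw [div_pow, div_mul_eq_mul_div, le_div_iff₀ (by positivity), mul_comm]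
    exact_mod_cast sq_mul_choose_le_sq_mul_choose hd hi
  have h6 : (i.choose (d + 1) : ℝ) * (-Real.log (1 - p)) ≤
      ((i : ℝ) / s) ^ 2 * Real.log (n.choose s) :=
    calc _ ≤ ((i : ℝ) / s) ^ 2 * s.choose (d + 1) * (-Real.log (1 - p)) :=
          mul_le_mul_of_nonneg_right h5 h4
      _ = ((i : ℝ) / s) ^ 2 * (s.choose (d + 1) * (-Real.log (1 - p))) := by ring
      _ ≤ _ := mul_le_mul_of_nonneg_left h2 (by positivity)
  linarith

/-- A finite sequence with decreasing increments lies above its chords. -/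
theorem chord_le_of_antitone_increments (f Δ : ℕ → ℝ) {h i s : ℕ} (hhi : h ≤ i) (his : i ≤ s)
    (hf : ∀ j, h ≤ j → j < s → f (j + 1) = f j + Δ j)
    (hΔ : ∀ j k, h ≤ j → j ≤ k → k < s → Δ k ≤ Δ j) :
    ((s : ℝ) - i) * f h + ((i : ℝ) - h) * f s ≤ ((s : ℝ) - h) * f i := by
  rcases his.eq_or_lt with rfl | his'
  · linarith
  have h1 : ∀ j, h ≤ j → j ≤ i → ((j : ℝ) - h) * Δ i ≤ f j - f h := by
    intro j hj
    induction j, hj using Nat.le_induction with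
    | base => intro _; simp
    | succ j hj ih =>
      intro hji
      have := ih (by omega)
      have h3 := hf j hj (by omega)
      have h4 := hΔ j i hj (by omega) his'
      push_cast
      linarith
  have h2 : ∀ j, i ≤ j → j ≤ s → f j - f i ≤ ((j : ℝ) - i) * Δ i := by
    intro j hj
    induction j, hj using Nat.le_induction with
    | base => intro _; simp
    | succ j hj ih =>
      intro hji
      have := ih (by omega)
      have h3 := hf j (by omega) (by omega)
      have h4 := hΔ i j hhi hj (by omega)
      push_cast
      linarith
  have h3 := h1 i hhi le_rfl
  have h4 := h2 s his le_rfl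
  have h5 : (0 : ℝ) ≤ (s : ℝ) - i := by rw [sub_nonneg]; exact_mod_cast his
  have h6 : (0 : ℝ) ≤ (i : ℝ) - h := by rw [sub_nonneg]; exact_mod_cast hhi
  have h7 := mul_le_mul_of_nonneg_left h3 h5
  have h8 := mul_le_mul_of_nonneg_left h4 h6
  linarith

/-- Log-concavity: the ratio of consecutive values, `(n - j) / (j + 1) * (1 - p) ^ j.choose d`,
decreases in `j`. -/
theorem log_expIndep_chord_le (hp : 0 ≤ p) (hp' : p < 1) {h i s : ℕ} (hhi : h ≤ i) (his : i ≤ s)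
    (hs : s ≤ n) :
    ((s : ℝ) - i) * Real.log (expIndep n d p h) + ((i : ℝ) - h) * Real.log (expIndep n d p s) ≤
      ((s : ℝ) - h) * Real.log (expIndep n d p i) := by
  have hpos : ∀ j < s, 0 < ((n : ℝ) - j) / (j + 1) * (1 - p) ^ j.choose d := by
    intro j hj
    have : (0 : ℝ) < (n : ℝ) - j := by rw [sub_pos]; exact_mod_cast hj.trans_le hs
    have h2 : 0 < 1 - p := by linarith
    positivity
  refine chord_le_of_antitone_increments (fun j => Real.log (expIndep n d p j))
    (fun j => Real.log (((n : ℝ) - j) / (j + 1) * (1 - p) ^ j.choose d)) hhi his ?_ ?_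
  · intro j _ hj
    rw [expIndep_succ (by omega), Real.log_mul (expIndep_pos hp' (by omega)).ne' (hpos j hj).ne']
  · intro j k _ hjk hk
    refine Real.log_le_log (hpos k hk) ?_
    have h1 : (j : ℝ) ≤ k := by exact_mod_cast hjk
    have h2 : (k : ℝ) ≤ n := by exact_mod_cast hk.le.trans hs
    have h3 : (1 - p) ^ k.choose d ≤ (1 - p) ^ j.choose d :=
      pow_le_pow_of_le_one (by linarith) (by linarith) (Nat.choose_le_choose d hjk)
    have h4 : 0 ≤ (n : ℝ) - k := by linarith
    have h5 : 0 ≤ (n : ℝ) - j := by linarith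
    have h6 : (0 : ℝ) ≤ 1 - p := by linarith
    gcongr

end ExpIndep

end

/-! ### Dense edge probabilities, `p ≥ n ^ (-1/200)`. -/

section

section Dense

variable {n d : ℕ} {p : ℝ}

/-- The probability that there is an independent set of size `s`. -/
noncomputable def probSize (n d : ℕ) (p : ℝ) (s : ℕ) : ℝ :=
  binExp p (edgeSpace (Fin n) d) (fun E => ind (∃ S : Finset (Fin n), Indep d E S ∧ S.card = s))

theorem probSize_le_expIndep (hp : 0 ≤ p) (hp' : p ≤ 1) (s : ℕ) :
    probSize n d p s ≤ expIndep n d p s := by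
  have := binExp_exists_indep_le (V := Fin n) (d := d) hp hp' s
  rwa [Fintype.card_fin] at this

/-- Let `λ = -log (1 - p)`. As `expIndep ≤ n ^ (1/20)` and `s ≤ n ^ (1/100)`, the cost `λ * s.choose
(d + 1)` is at least `(0.99 - 0.05) * s * log n`. Multiplying by `(d + 1) / (s - d) ≥ 2 / s` gives
`λ * s.choose d ≥ 1.15 * log n`, so the next ratio is at most `n ^ (-0.15)`. -/
theorem log_expIndep_succ_le (hd : 1 ≤ d) (hp' : p < 1) {s : ℕ} (hds : d + 1 ≤ s)
    (hs : s + 1 ≤ n) (hsn : Real.log s ≤ Real.log n / 100)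
    (hE : Real.log (expIndep n d p s) ≤ Real.log n / 20) :
    Real.log (expIndep n d p (s + 1)) ≤ -(Real.log n / 10) := by
  have hn : (1 : ℝ) ≤ n := by exact_mod_cast (by omega : 1 ≤ n)
  have hl := Real.log_nonneg hn
  have hsr : (s : ℝ) + 1 ≤ n := by exact_mod_cast hs
  have hs0 : (0 : ℝ) < s := by exact_mod_cast (by omega : 0 < s)
  have hd0 : (1 : ℝ) ≤ d := by exact_mod_cast hd
  have hdsr : (d : ℝ) + 1 ≤ s := by exact_mod_cast hds
  have hq : 0 < 1 - p := by linarith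
  have hr : 0 < ((n : ℝ) - s) / (s + 1) := div_pos (by linarith) (by linarith)
  rw [expIndep_succ (by omega), Real.log_mul (expIndep_pos hp' (by omega)).ne' (by positivity),
    Real.log_mul hr.ne' (by positivity), Real.log_pow]
  have h1 : Real.log (((n : ℝ) - s) / (s + 1)) ≤ Real.log n := by
    refine Real.log_le_log hr ?_
    rw [div_le_iff₀ (by linarith)]
    nlinarith
  have h2 := log_expIndep (n := n) (d := d) hp' (show s ≤ n by omega)
  have h3 := mul_log_div_le_log_choose (show s ≤ n by omega)
  rw [Real.log_div (by linarith) hs0.ne'] at h3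
  set X := (s.choose d : ℝ) * -Real.log (1 - p) with hX
  have h4 : ((s : ℝ) - d) * X = (d + 1) * (s.choose (d + 1) * -Real.log (1 - p)) := by
    have h5 : ((s.choose d * (s - d) : ℕ) : ℝ) = (s.choose (d + 1) * (d + 1) : ℕ) := by
      exact_mod_cast choose_mul_sub_eq s
    push_cast [Nat.cast_sub (show d ≤ s by omega)] at h5
    rw [hX]
    linear_combination (-Real.log (1 - p)) * h5
  have h5 : (s : ℝ) * (94 / 100 * Real.log n) ≤ s.choose (d + 1) * -Real.log (1 - p) := by
    nlinarith
  have h6 : ((s : ℝ) - d) * (115 / 100 * Real.log n) ≤ ((s : ℝ) - d) * X := by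
    rw [h4]
    have h7 : (2 : ℝ) * (s * (94 / 100 * Real.log n)) ≤
        (d + 1) * (s.choose (d + 1) * -Real.log (1 - p)) :=
      mul_le_mul (by linarith) h5 (by positivity) (by linarith)
    nlinarith
  have h7 := le_of_mul_le_mul_left h6 (by linarith)
  rw [hX] at h7
  linarith

/-- For `i ≤ s / 2` the expected number of independent `i`-sets is at least `n ^ (0.49 * i)`,
whereas `s.choose i ≤ n ^ (i / 100)`. For larger `i`, log-concavity interpolates between `s / 2` and
`s`, and `s.choose i ≤ s ^ (s - i)`. -/
theorem two_mul_log_choose_sub_log_expIndep_le (hd : 1 ≤ d) (hp : 0 ≤ p) (hp' : p < 1) {i s : ℕ}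
    (hi : d + 1 ≤ i) (his : i ≤ s) (hs : s ≤ n) (hsn : Real.log s ≤ Real.log n / 100)
    (hE : Real.log n / 20 ≤ Real.log (expIndep n d p s)) :
    2 * Real.log (s.choose i) - Real.log (expIndep n d p i) ≤ -(Real.log n / 20) := by
  have hn : (1 : ℝ) ≤ n := by exact_mod_cast (by omega : 1 ≤ n)
  have hl := Real.log_nonneg hn
  have hE1 : 1 ≤ expIndep n d p s := by
    by_contra h
    have h0 := expIndep_pos (d := d) hp' hs
    have h1 := Real.log_neg h0 (by linarith)
    linarith
  have low : ∀ j : ℕ, 1 ≤ j → 2 * j ≤ s →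
      (j : ℝ) * (49 / 100 * Real.log n) ≤ Real.log (expIndep n d p j) := by
    intro j hj hjs
    have h1 := le_log_expIndep_of_one_le hd hp hp' (show j ≤ s by omega) hs hE1
    have h2 := log_choose_le_mul_log hs
    have hj0 : (1 : ℝ) ≤ j := by exact_mod_cast hj
    have hjs' : (2 : ℝ) * j ≤ s := by exact_mod_cast hjs
    have hs0 : (0 : ℝ) < s := by linarith
    have h3 : Real.log j ≤ Real.log s := Real.log_le_log (by linarith) (by linarith)
    rw [Real.log_div (by linarith) (by linarith)] at h1
    have h5 : ((j : ℝ) / s) ^ 2 * Real.log (n.choose s) ≤ j * (Real.log n / 2) :=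
      calc _ ≤ ((j : ℝ) / s) ^ 2 * (s * Real.log n) :=
            mul_le_mul_of_nonneg_left h2 (by positivity)
        _ = (j / s) * (j * Real.log n) := by field_simp
        _ ≤ (1 / 2) * (j * Real.log n) :=
            mul_le_mul_of_nonneg_right (by rw [div_le_iff₀ hs0]; linarith) (by positivity)
        _ = _ := by ring
    nlinarith
  by_cases h2i : 2 * i ≤ s
  · have h1 := low i (by omega) h2i
    have h2 := log_choose_le_mul_log his
    have h2' : Real.log (s.choose i) ≤ i * Real.log s := by
      rw [← Real.log_pow]
      exact Real.log_le_log (by exact_mod_cast Nat.choose_pos his)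
        (by exact_mod_cast Nat.choose_le_pow s i)
    have hi0 : (2 : ℝ) ≤ i := by exact_mod_cast (by omega : 2 ≤ i)
    nlinarith
  · set h := s / 2 with hh
    have hh1 : 1 ≤ h := by omega
    have h1 := low h hh1 (by omega)
    have h2 := log_expIndep_chord_le (d := d) hp hp' (show h ≤ i by omega) his hs
    have h3 : Real.log (s.choose i) ≤ ((s : ℝ) - i) * Real.log s := by
      rw [← Nat.choose_symm his, ← Nat.cast_sub his, ← Real.log_pow]
      exact Real.log_le_log (by exact_mod_cast Nat.choose_pos (by omega))
        (by exact_mod_cast Nat.choose_le_pow s (s - i))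
    have a1 : (1 : ℝ) ≤ h := by exact_mod_cast hh1
    have a2 : (s : ℝ) ≤ 2 * h + 1 := by exact_mod_cast (by omega : s ≤ 2 * h + 1)
    have a3 : (h : ℝ) ≤ i := by exact_mod_cast (by omega : h ≤ i)
    have a4 : (i : ℝ) ≤ s := by exact_mod_cast his
    have a5 : 2 * (h : ℝ) ≤ s := by exact_mod_cast (by omega : 2 * h ≤ s)
    have h4 : ((s : ℝ) - i) * (h * (49 / 100 * Real.log n)) ≤
        ((s : ℝ) - i) * Real.log (expIndep n d p h) :=
      mul_le_mul_of_nonneg_left h1 (by linarith)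
    have h5 : ((i : ℝ) - h) * (Real.log n / 20) ≤
        ((i : ℝ) - h) * Real.log (expIndep n d p s) :=
      mul_le_mul_of_nonneg_left hE (by linarith)
    have h6 : ((s : ℝ) - i) * Real.log s ≤ ((s : ℝ) - i) * (Real.log n / 100) :=
      mul_le_mul_of_nonneg_left hsn (by linarith)
    have a6 : (0 : ℝ) < (s : ℝ) - h := by linarith
    refine le_of_mul_le_mul_left ?_ a6
    have h7 : ((s : ℝ) - h) * (2 * Real.log (s.choose i)) ≤
        ((s : ℝ) - h) * (2 * (((s : ℝ) - i) * (Real.log n / 100))) :=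
      mul_le_mul_of_nonneg_left (by linarith) a6.le
    have h8 : 0 ≤ ((s : ℝ) - i) * Real.log n * (49 / 100 * h - 1 / 20 - 1 / 50 * ((s : ℝ) - h)) :=
      mul_nonneg (mul_nonneg (by linarith) hl) (by linarith)
    nlinarith

theorem exists_two_point_of_size_le (hd : 1 ≤ d) (hp : 0 ≤ p) (hp' : p < 1) {r : ℝ}
    (hrn : r ≤ n) (hr : Real.log r ≤ Real.log n / 100)
    (hT : ∀ s : ℕ, 1 ≤ s → p * (s - 1).choose d ≤ (d + 1) * Real.log n → (s : ℝ) + 2 ≤ r) :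
    ∃ t : ℕ, 1 - r * Real.exp (-(Real.log n / 20)) ≤ probSize n d p t ∧
      probSize n d p (t + 2) ≤ Real.exp (-(Real.log n / 10)) := by
  have hl : 0 ≤ Real.log n := Real.log_natCast_nonneg n
  have hdr : (d : ℝ) + 2 ≤ r := by
    refine hT d hd ?_
    rw [Nat.choose_eq_zero_of_lt (by omega), Nat.cast_zero, mul_zero]
    positivity
  have hdn : d + 2 ≤ n := by exact_mod_cast hdr.trans hrn
  have hd0 : (1 : ℝ) ≤ d := by exact_mod_cast hd
  have hP : Real.log n / 20 ≤ Real.log (expIndep n d p d) := by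
    rw [log_expIndep hp' (by omega), Nat.choose_eq_zero_of_lt (Nat.lt_succ_self d), Nat.cast_zero,
      zero_mul, add_zero]
    have h1 := mul_log_div_le_log_choose (show d ≤ n by omega)
    have hn0 : (0 : ℝ) < n := by exact_mod_cast (by omega : 0 < n)
    rw [Real.log_div hn0.ne' (by linarith)] at h1
    have h2 : Real.log d ≤ Real.log r := Real.log_le_log (by linarith) (by linarith)
    nlinarith
  classical
  -- Let `t` be the last size with expected number at least `n ^ (1/20)`. This suffices for the
  -- second moment at `t`; size `t + 1` is below the threshold, so one further step brings the
  -- expectation down to `n ^ (-1/10)`.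
  let P : ℕ → Prop := fun s => Real.log n / 20 ≤ Real.log (expIndep n d p s)
  set t := Nat.findGreatest P n with ht
  have htP : P t := Nat.findGreatest_spec (show d ≤ n by omega) hP
  have hdt : d ≤ t := Nat.le_findGreatest (by omega) hP
  have htn : t ≤ n := Nat.findGreatest_le n
  have hE1 : 1 ≤ expIndep n d p t := by
    by_contra h
    have h1 := Real.log_neg (expIndep_pos (d := d) hp' htn) (by linarith)
    have h2 : Real.log n / 20 ≤ Real.log (expIndep n d p t) := htP
    linarith
  have htr : (t : ℝ) + 2 ≤ r :=
    hT t (by omega) (mul_choose_pred_le_of_one_le_expIndep hp' htn (by omega) hE1)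
  have htn2 : t + 2 ≤ n := by exact_mod_cast htr.trans hrn
  have hlog : ∀ s : ℕ, 1 ≤ s → s ≤ t + 1 → Real.log s ≤ Real.log n / 100 := by
    intro s hs hst
    have h1 : (1 : ℝ) ≤ s := by exact_mod_cast hs
    have h2 : (s : ℝ) ≤ t + 1 := by exact_mod_cast hst
    exact (Real.log_le_log (by linarith) (by linarith)).trans hr
  refine ⟨t, ?_, ?_⟩
  · refine one_sub_le_binExp_exists_indep hp hp' (by rwa [Fintype.card_fin]) ?_
    rw [Fintype.card_fin]
    have h1 : ∀ i ∈ Finset.Icc (d + 1) t, (t.choose i : ℝ) ^ 2 / expIndep n d p i ≤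
        Real.exp (-(Real.log n / 20)) := by
      intro i hi
      rw [Finset.mem_Icc] at hi
      have h2 := two_mul_log_choose_sub_log_expIndep_le hd hp hp' hi.1 hi.2 htn
        (hlog t (by omega) (by omega)) htP
      have h3 : (0 : ℝ) < t.choose i := by exact_mod_cast Nat.choose_pos hi.2
      have h4 := expIndep_pos (d := d) hp' (hi.2.trans htn)
      rw [← Real.log_le_iff_le_exp (by positivity), Real.log_div (by positivity) h4.ne',
        Real.log_pow]
      exact_mod_cast h2
    refine (Finset.sum_le_card_nsmul _ _ _ h1).trans ?_
    rw [nsmul_eq_mul, Nat.card_Icc]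
    refine mul_le_mul_of_nonneg_right ?_ (Real.exp_pos _).le
    have : ((t + 1 - (d + 1) : ℕ) : ℝ) ≤ t := by exact_mod_cast (by omega : t + 1 - (d + 1) ≤ t)
    linarith
  · refine (probSize_le_expIndep hp hp'.le _).trans ?_
    rw [← Real.log_le_iff_le_exp (expIndep_pos hp' htn2)]
    refine log_expIndep_succ_le hd hp' (by omega) (by omega) (hlog _ (by omega) le_rfl) ?_
    have := Nat.findGreatest_is_greatest (show t < t + 1 by omega) (show t + 1 ≤ n by omega)
    exact (not_le.1 this).le

theorem eventually_dense_two_point (d : ℕ) (hd : 1 ≤ d) (η : ℝ) (hη : 0 < η) :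
    ∀ᶠ n : ℕ in atTop, ∀ p : ℝ, (n : ℝ) ^ (-(1 / 200) : ℝ) ≤ p → p < 1 →
      ∃ t : ℕ, 1 - η ≤ probSize n d p t ∧ probSize n d p (t + 2) ≤ η := by
  have hlim : Tendsto (fun n : ℕ => (n : ℝ)) atTop atTop := tendsto_natCast_atTop_atTop
  have e1 : ∀ᶠ n : ℕ in atTop, (1 : ℝ) ≤ n := hlim.eventually_ge_atTop 1
  have e2 : ∀ᶠ n : ℕ in atTop, ((n : ℝ) ^ (-(1 / 25) : ℝ)) ≤ η := by
    have := (tendsto_rpow_neg_atTop (show (0 : ℝ) < 1 / 25 by norm_num)).comp hlim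
    exact (this.eventually (eventually_le_nhds hη))
  have e3 : ∀ᶠ n : ℕ in atTop, (d : ℝ) + 3 ≤ (n : ℝ) ^ (1 / 100 : ℝ) / 2 := by
    have := (tendsto_rpow_atTop (show (0 : ℝ) < 1 / 100 by norm_num)).comp hlim
    filter_upwards [this.eventually_ge_atTop (2 * (d + 3))] with n hn
    simp only [Function.comp] at hn
    linarith
  have e4 : ∀ᶠ n : ℕ in atTop,
      (d : ℝ) * (d + 1) * Real.log n ≤ (n : ℝ) ^ (1 / 200 : ℝ) / 2 := by
    have h0 := (isLittleO_log_rpow_atTop (show (0 : ℝ) < 1 / 200 by norm_num))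
    have h1 := (h0.def (show (0 : ℝ) < 1 / (2 * (d * (d + 1) + 1)) by positivity))
    filter_upwards [hlim.eventually h1, e1] with n hn hn1
    rw [Real.norm_of_nonneg (Real.log_nonneg hn1), Real.norm_of_nonneg (by positivity)] at hn
    rw [div_mul_eq_mul_div, one_mul, le_div_iff₀ (by positivity)] at hn
    have := Real.log_nonneg hn1
    nlinarith
  filter_upwards [e1, e2, e3, e4] with n hn h2 h3 h4 p hp hp'
  have hn0 : (0 : ℝ) < n := by linarith
  have hp0 : 0 < p := (Real.rpow_pos_of_pos hn0 _).trans_le hp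
  set y := (n : ℝ) ^ (1 / 200 : ℝ) with hy
  have hy0 : 0 < y := Real.rpow_pos_of_pos hn0 _
  have hy2 : (n : ℝ) ^ (1 / 100 : ℝ) = y * y := by
    rw [hy, ← Real.rpow_add hn0]; norm_num
  have hpy : 1 ≤ p * y := by
    have : (n : ℝ) ^ (-(1 / 200) : ℝ) * y = 1 := by
      rw [hy, ← Real.rpow_add hn0]; norm_num
    nlinarith
  have hexp : ∀ c : ℝ, Real.exp (-(Real.log n * c)) = (n : ℝ) ^ (-c) := by
    intro c
    rw [Real.rpow_def_of_pos hn0]; ring_nf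
  have hl := Real.log_nonneg hn
  obtain ⟨t, ht1, ht2⟩ := exists_two_point_of_size_le (n := n) (d := d) hd hp0.le hp'
    -- Here `p * n ^ (1/200) ≥ 1` and `(s - 1).choose d ≥ (s - 1) / d`, so admissible sizes are of
    -- order at most `n ^ (1/200) * log n`, well below `n ^ (1/100)`.
    (r := (n : ℝ) ^ (1 / 100 : ℝ))
    (by
      calc (n : ℝ) ^ (1 / 100 : ℝ) ≤ (n : ℝ) ^ (1 : ℝ) :=
            Real.rpow_le_rpow_of_exponent_le hn (by norm_num)
        _ = n := Real.rpow_one _)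
    (by rw [Real.log_rpow hn0]; linarith)
    (by
      intro s hs hps
      have hd0 : (0 : ℝ) < d := by exact_mod_cast hd
      have hyy : y ≤ y * y := by
        rw [hy2] at h3
        nlinarith
      rw [hy2] at h3 ⊢
      by_cases hsd : s ≤ d
      · have : (s : ℝ) ≤ d := by exact_mod_cast hsd
        nlinarith
      · have h5 : ((s - 1 : ℕ) : ℝ) / d ≤ (s - 1).choose d := by
          refine le_trans ?_ (div_pow_le_choose_cast (s - 1) d (by omega))
          refine le_self_pow₀ ?_ (by omega)
          rw [le_div_iff₀ hd0, one_mul]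
          exact_mod_cast (by omega : d ≤ s - 1)
        rw [Nat.cast_sub hs, Nat.cast_one, div_le_iff₀ hd0] at h5
        have h6 : ((s - 1).choose d : ℝ) ≤ (d + 1) * Real.log n * y := by
          have h7 : ((s - 1).choose d : ℝ) * 1 ≤ (s - 1).choose d * (p * y) :=
            mul_le_mul_of_nonneg_left hpy (Nat.cast_nonneg _)
          have h8 := mul_le_mul_of_nonneg_right hps hy0.le
          linarith
        have h7 : (s : ℝ) - 1 ≤ (d * (d + 1) * Real.log n) * y := by nlinarith
        nlinarith)
  refine ⟨t, ?_, ?_⟩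
  · refine le_trans ?_ ht1
    have : (n : ℝ) ^ (1 / 100 : ℝ) * Real.exp (-(Real.log n / 20)) = (n : ℝ) ^ (-(1 / 25) : ℝ) := by
      rw [div_eq_mul_one_div (Real.log n), hexp, ← Real.rpow_add hn0]; norm_num
    rw [this]; linarith
  · refine ht2.trans (le_trans ?_ h2)
    rw [div_eq_mul_one_div (Real.log n), hexp]
    exact Real.rpow_le_rpow_of_exponent_le hn (by norm_num)

end Dense

end

/-! ### The sparse regime: assumptions and the number of light vertices. -/

section

/-- Quantitative assumptions on the size `s` of an independent set, for sparse edge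
probabilities; `z` is a small power of `n` and `θ` is of logarithmic order. -/
structure SparseRegime (d C₁ n s : ℕ) (p z θ β : ℝ) : Prop where
  one_le_d : 1 ≤ d
  one_le_C : 1 ≤ C₁
  p_pos : 0 < p
  p_le : p ≤ 1 / 2
  two_mul_le : 2 * s ≤ n
  one_le_θ : 1 ≤ θ
  const_le : 1000 * 4 ^ d * (C₁ + 1) * θ ^ (2 * C₁ + 2) ≤ z
  mul_pow_le : p * s ^ d ≤ θ
  -- Near the critical size, `p * s.choose d` is about `(d + 1) * log (n / s)`.
  exp_le : Real.exp (-(p * s.choose d)) ≤ z * ((s : ℝ) / n) ^ (d + 1)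
  -- This expresses the threshold for `p`.
  pow_mul_le : z ^ (20 * (d + 1)) * (n * ((s : ℝ) / n) ^ (d + 2)) ≤ 1
  pow_le : z ^ 20 ≤ s
  pow_mul_div_le : z ^ 20 * ((s : ℝ) / n) ≤ 1
  -- Events of probability `z ^ (-C₁)` survive a union bound over `n ^ 2` cases.
  sq_mul_le : (n : ℝ) ^ 2 * z ≤ z ^ C₁
  β_pos : 0 < β
  β_le : β ≤ 1 / 2
  -- Changing a set by `β * s` vertices alters `p * s.choose d` by at most `θ * β`, hence by at most
  -- half of `log z`.
  exp_β_le : Real.exp (2 * (θ * β)) ≤ z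
  le_β_mul_log : 40 ≤ β * Real.log ((n : ℝ) / s)

/-- An upper bound for the probability that a vertex has at most one edge into a set of size `s`,
with room for conditioning on boundedly many edges. -/
noncomputable def lightBound (d C₁ : ℕ) (p θ : ℝ) (s : ℕ) : ℝ :=
  θ ^ (2 * C₁) * Real.exp 2 * Real.exp (-(p * s.choose d))

theorem exp_two_le_eight : Real.exp 2 ≤ 8 := by
  have h := Real.exp_one_lt_d9
  have h1 : Real.exp 2 = Real.exp 1 * Real.exp 1 := by rw [← Real.exp_add]; norm_num
  rw [h1]
  nlinarith [Real.exp_pos 1]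

namespace SparseRegime

variable {d C₁ n s : ℕ} {p z θ β : ℝ}

theorem p_lt_one (h : SparseRegime d C₁ n s p z θ β) : p < 1 := by linarith [h.p_le]

theorem thousand_le (h : SparseRegime d C₁ n s p z θ β) : 1000 ≤ z := by
  refine le_trans ?_ h.const_le
  have h1 : (1 : ℝ) ≤ 4 ^ d := one_le_pow₀ (by norm_num)
  have h2 : (1 : ℝ) ≤ C₁ + 1 := by linarith [Nat.cast_nonneg (α := ℝ) C₁]
  have h3 : 1 ≤ θ ^ (2 * C₁ + 2) := one_le_pow₀ h.one_le_θ
  calc (1000 : ℝ) = 1000 * 1 * 1 * 1 := by norm_num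
    _ ≤ _ := by gcongr

theorem z_pos (h : SparseRegime d C₁ n s p z θ β) : 0 < z := by linarith [h.thousand_le]

theorem one_le_z (h : SparseRegime d C₁ n s p z θ β) : 1 ≤ z := by linarith [h.thousand_le]

theorem const_mul_θ_pow_le (h : SparseRegime d C₁ n s p z θ β) (j : ℕ) (hj : j ≤ 2 * C₁ + 2) :
    1000 * 4 ^ d * (C₁ + 1) * θ ^ j ≤ z := by
  refine le_trans ?_ h.const_le
  exact mul_le_mul_of_nonneg_left (pow_le_pow_right₀ h.one_le_θ hj) (by positivity)

theorem thousand_mul_θ_pow_le (h : SparseRegime d C₁ n s p z θ β) (j : ℕ)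
    (hj : j ≤ 2 * C₁ + 2) : 1000 * θ ^ j ≤ z := by
  refine le_trans ?_ (h.const_mul_θ_pow_le j hj)
  have h1 : (1 : ℝ) ≤ 4 ^ d := one_le_pow₀ (by norm_num)
  have h2 : (1 : ℝ) ≤ C₁ + 1 := by linarith [Nat.cast_nonneg (α := ℝ) C₁]
  have h0 := h.one_le_θ
  calc 1000 * θ ^ j = 1000 * 1 * 1 * θ ^ j := by ring
    _ ≤ _ := by gcongr

theorem s_pos (h : SparseRegime d C₁ n s p z θ β) : (0 : ℝ) < s :=
  (pow_pos h.z_pos 20).trans_le h.pow_le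

theorem one_le_s (h : SparseRegime d C₁ n s p z θ β) : 1 ≤ s := by exact_mod_cast h.s_pos

theorem s_le_n (h : SparseRegime d C₁ n s p z θ β) : s ≤ n := by have := h.two_mul_le; omega

theorem n_pos (h : SparseRegime d C₁ n s p z θ β) : (0 : ℝ) < n :=
  h.s_pos.trans_le (by exact_mod_cast h.s_le_n)

theorem n_mul_div (h : SparseRegime d C₁ n s p z θ β) : (n : ℝ) * ((s : ℝ) / n) = s :=
  mul_div_cancel₀ _ h.n_pos.ne'

theorem x_pos (h : SparseRegime d C₁ n s p z θ β) : 0 < (s : ℝ) / n := div_pos h.s_pos h.n_pos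

theorem x_le_one (h : SparseRegime d C₁ n s p z θ β) : (s : ℝ) / n ≤ 1 := by
  rw [div_le_one h.n_pos]; exact_mod_cast h.s_le_n

theorem pow_mul_le_one (h : SparseRegime d C₁ n s p z θ β) :
    z ^ 20 * (n * ((s : ℝ) / n) ^ (d + 2)) ≤ 1 := by
  refine le_trans ?_ h.pow_mul_le
  have h1 := h.n_pos
  have h2 := h.x_pos
  exact mul_le_mul_of_nonneg_right (pow_le_pow_right₀ h.one_le_z (by omega)) (by positivity)

theorem mul_choose_le (h : SparseRegime d C₁ n s p z θ β) : p * s.choose d ≤ θ := by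
  refine le_trans ?_ h.mul_pow_le
  exact mul_le_mul_of_nonneg_left (by exact_mod_cast Nat.choose_le_pow s d) h.p_pos.le

theorem mul_pow_pred_le (h : SparseRegime d C₁ n s p z θ β) : p * (s : ℝ) ^ (d - 1) ≤ θ / s := by
  rw [le_div_iff₀ h.s_pos, mul_assoc, ← pow_succ, Nat.sub_add_cancel h.one_le_d]
  exact h.mul_pow_le

theorem lightBound_pos (h : SparseRegime d C₁ n s p z θ β) : 0 < lightBound d C₁ p θ s := by
  have := h.one_le_θ
  rw [lightBound]; positivity

theorem probLe_le (h : SparseRegime d C₁ n s p z θ β) :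
    probLe p (s.choose d) ≤ lightBound d C₁ p θ s := by
  refine (probLe_le_exp h.p_pos.le h.p_le _).trans ?_
  refine mul_le_mul_of_nonneg_right ?_ (Real.exp_pos _).le
  have h1 := h.mul_choose_le
  have h2 := h.one_le_θ
  have h3 : θ ≤ θ ^ (2 * C₁) := le_self_pow₀ h2 (by have := h.one_le_C; omega)
  have h4 : (3 : ℝ) ≤ Real.exp 2 := by have := Real.add_one_le_exp (2 : ℝ); linarith
  nlinarith

theorem lightBound_le (h : SparseRegime d C₁ n s p z θ β) :
    lightBound d C₁ p θ s ≤ z ^ 2 * ((s : ℝ) / n) ^ (d + 1) := by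
  have h1 : θ ^ (2 * C₁) * Real.exp 2 ≤ z := by
    have h2 := h.thousand_mul_θ_pow_le (2 * C₁) (by omega)
    have h3 := exp_two_le_eight
    have h4 : 0 ≤ θ ^ (2 * C₁) := pow_nonneg (by linarith [h.one_le_θ]) _
    nlinarith
  calc _ ≤ z * (z * ((s : ℝ) / n) ^ (d + 1)) :=
        mul_le_mul h1 h.exp_le (Real.exp_pos _).le h.z_pos.le
    _ = _ := by ring

/-- Up to powers of `z`, `lightBound` is `(s / n) ^ (d + 1)`, so this is the threshold condition
again. In what follows `μ = n * lightBound` is the scale for the number of light vertices. -/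
theorem n_mul_lightBound_mul_le (h : SparseRegime d C₁ n s p z θ β) :
    z ^ 18 * (n * lightBound d C₁ p θ s * ((s : ℝ) / n)) ≤ 1 := by
  refine le_trans ?_ h.pow_mul_le_one
  have h0 := h.z_pos
  have h1 := h.x_pos
  have h2 := h.n_pos
  calc _ ≤ z ^ 18 * (n * (z ^ 2 * ((s : ℝ) / n) ^ (d + 1)) * ((s : ℝ) / n)) := by
        gcongr; exact h.lightBound_le
    _ = _ := by ring

theorem n_mul_lightBound_le_mul_sq (h : SparseRegime d C₁ n s p z θ β) :
    n * lightBound d C₁ p θ s ≤ z ^ 2 * ((s : ℝ) ^ 2 / n) := by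
  have h2 := h.n_pos
  calc (n : ℝ) * lightBound d C₁ p θ s ≤ n * (z ^ 2 * ((s : ℝ) / n) ^ (d + 1)) :=
        mul_le_mul_of_nonneg_left h.lightBound_le h2.le
    _ ≤ n * (z ^ 2 * ((s : ℝ) / n) ^ 2) := by
        have := pow_le_pow_of_le_one h.x_pos.le h.x_le_one
          (show 2 ≤ d + 1 by have := h.one_le_d; omega)
        have h0 := h.z_pos
        gcongr
    _ = _ := by field_simp

theorem n_mul_lightBound_le (h : SparseRegime d C₁ n s p z θ β) :
    z ^ 18 * (n * lightBound d C₁ p θ s) ≤ s := by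
  have h0 := h.z_pos
  have h2 := h.n_pos
  calc z ^ 18 * (n * lightBound d C₁ p θ s) ≤ z ^ 18 * (z ^ 2 * ((s : ℝ) ^ 2 / n)) := by
        have := h.n_mul_lightBound_le_mul_sq
        gcongr
    _ = z ^ 20 * ((s : ℝ) / n) * s := by ring
    _ ≤ 1 * s := mul_le_mul_of_nonneg_right h.pow_mul_div_le h.s_pos.le
    _ = s := one_mul _

/-- With `x = s / n`, the square of `n * x ^ (d + 1)` is `n * x ^ (d + 2)` times `n * x ^ d ≤ s`. So
light vertices have few pairs compared with `s`, which is why their edges rarely meet. -/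
theorem sq_n_mul_lightBound_le (h : SparseRegime d C₁ n s p z θ β) :
    z ^ 16 * (n * lightBound d C₁ p θ s) ^ 2 ≤ s := by
  have h0 := h.z_pos
  have h1 := h.x_pos
  have h2 := h.n_pos
  have h3 := h.lightBound_pos
  have h4 : ((s : ℝ) / n) ^ d ≤ (s : ℝ) / n :=
    pow_le_of_le_one h1.le h.x_le_one (by have := h.one_le_d; omega)
  calc _ ≤ z ^ 16 * (n * (z ^ 2 * ((s : ℝ) / n) ^ (d + 1))) ^ 2 := by
        gcongr; exact h.lightBound_le
    _ = z ^ 20 * (n * ((s : ℝ) / n) ^ (d + 2)) * (n * ((s : ℝ) / n) ^ d) := by ring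
    _ ≤ 1 * (n * ((s : ℝ) / n)) := by
        refine mul_le_mul h.pow_mul_le_one ?_ (by positivity) zero_le_one
        gcongr
    _ = s := by rw [one_mul, h.n_mul_div]

theorem lightBound_le_inv (h : SparseRegime d C₁ n s p z θ β) :
    z ^ 18 * lightBound d C₁ p θ s ≤ 1 := by
  have h3 : z ^ 18 * (n * lightBound d C₁ p θ s) ≤ n :=
    h.n_mul_lightBound_le.trans (by exact_mod_cast h.s_le_n)
  have h2 := h.n_pos
  nlinarith

theorem lightBound_le_half (h : SparseRegime d C₁ n s p z θ β) :
    lightBound d C₁ p θ s ≤ 1 / 2 := by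
  have h1 := h.lightBound_le_inv
  have h2 : z ≤ z ^ 18 := le_self_pow₀ h.one_le_z (by norm_num)
  have h3 := h.thousand_le
  have h4 := h.lightBound_pos
  nlinarith

theorem one_sub_le_meanWt (h : SparseRegime d C₁ n s p z θ β) :
    1 - lightBound d C₁ p θ s ≤ meanWt d p (s.choose d) := by
  have h1 := one_sub_probLe_le_meanWt h.p_pos.le (by linarith [h.p_le]) d (s.choose d)
  linarith [h.probLe_le]

theorem half_le_meanWt (h : SparseRegime d C₁ n s p z θ β) :
    1 / 2 ≤ meanWt d p (s.choose d) := by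
  linarith [h.one_sub_le_meanWt, h.lightBound_le_half]

theorem exp_le_meanWt_pow (h : SparseRegime d C₁ n s p z θ β) (k : ℕ) :
    Real.exp (-(2 * (k * lightBound d C₁ p θ s))) ≤ meanWt d p (s.choose d) ^ k := by
  have h1 := (exp_neg_two_mul_le h.lightBound_pos.le h.lightBound_le_half).trans
    h.one_sub_le_meanWt
  calc _ = Real.exp (-(2 * lightBound d C₁ p θ s)) ^ k := by rw [← Real.exp_nat_mul]; ring_nf
    _ ≤ _ := pow_le_pow_left₀ (Real.exp_pos _).le h1 k

/-- Passing from the plain to the weighted expectation costs at most `exp (2 * μ)`. -/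
theorem exp_le_meanWt_pow_sub (h : SparseRegime d C₁ n s p z θ β) :
    Real.exp (-(2 * (n * lightBound d C₁ p θ s))) ≤ meanWt d p (s.choose d) ^ (n - s) := by
  refine le_trans (Real.exp_le_exp.2 ?_) (h.exp_le_meanWt_pow (n - s))
  have h1 : ((n - s : ℕ) : ℝ) ≤ n := by exact_mod_cast Nat.sub_le n s
  have h2 := mul_le_mul_of_nonneg_right h1 h.lightBound_pos.le
  linarith

end SparseRegime

end

/-! ### Good surroundings are likely in the sparse regime. -/

section

theorem sum_pow_le_two_mul {r : ℝ} (hr : 0 ≤ r) (hr' : r ≤ 1 / 2) (T : Finset ℕ)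
    (hT : ∀ j ∈ T, 1 ≤ j) : ∑ j ∈ T, r ^ j ≤ 2 * r := by
  have h1 : ∀ N : ℕ, ∑ j ∈ Finset.range N, r ^ (j + 1) ≤ 2 * r - 2 * r ^ (N + 1) := by
    intro N
    induction N with
    | zero => simp
    | succ N ih =>
      rw [Finset.sum_range_succ]
      have h2 : r ^ (N + 1 + 1) ≤ r ^ (N + 1) * (1 / 2) := by
        rw [pow_succ]; exact mul_le_mul_of_nonneg_left hr' (by positivity)
      linarith
  have h2 : T ⊆ (Finset.range (T.sup id)).image (· + 1) := by
    intro j hj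
    rw [Finset.mem_image]
    have h3 : j ≤ T.sup id := Finset.le_sup (f := id) hj
    exact ⟨j - 1, Finset.mem_range.2 (by have := hT j hj; omega), by have := hT j hj; omega⟩
  refine (Finset.sum_le_sum_of_subset_of_nonneg h2 fun _ _ _ => by positivity).trans ?_
  rw [Finset.sum_image (by intro a _ b _ h; simpa using h)]
  have : 0 ≤ r ^ (T.sup id + 1) := by positivity
  linarith [h1 (T.sup id)]

/-- The number of light vertices that is allowed around a good set. -/
noncomputable def lightCount (z μ : ℝ) : ℕ := ⌈z * (μ + 1)⌉₊

/-- Two sets at distance at most `nearDist` count as near. -/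
noncomputable def nearDist (z μ : ℝ) (s : ℕ) : ℕ := ⌈√(z ^ 3 * (1 + μ * s))⌉₊

namespace SparseRegime

variable {d C₁ n s : ℕ} {p z θ β : ℝ}

theorem succ_d_le (d : ℕ) : (d : ℝ) + 1 ≤ 4 ^ d := by
  have h : d + 1 ≤ 4 ^ d := Nat.lt_pow_self (by norm_num)
  exact_mod_cast h

theorem mul_θ_le (h : SparseRegime d C₁ n s p z θ β) (j : ℕ) (hj : j ≤ 2 * C₁ + 2) :
    1000 * ((d + 1) * (C₁ + 1) * θ ^ j) ≤ z := by
  refine le_trans ?_ (h.const_mul_θ_pow_le j hj)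
  have h1 := succ_d_le d
  have h2 := h.one_le_θ
  calc _ = 1000 * ((d : ℝ) + 1) * (C₁ + 1) * θ ^ j := by ring
    _ ≤ _ := by gcongr

theorem mul_θ_le' (h : SparseRegime d C₁ n s p z θ β) (j : ℕ) (hj : j ≤ 2 * C₁ + 2) :
    1000 * ((d + 1) * θ ^ j) ≤ z := by
  refine le_trans ?_ (h.mul_θ_le j hj)
  have h2 := h.one_le_θ
  have h1 : 0 ≤ ((d : ℝ) + 1) * θ ^ j := by positivity
  nlinarith [mul_nonneg h1 (Nat.cast_nonneg (α := ℝ) C₁)]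

theorem le_lightCount (z : ℝ) (d C₁ n s : ℕ) (p θ : ℝ) :
    z * (n * lightBound d C₁ p θ s + 1) ≤ lightCount z (n * lightBound d C₁ p θ s) :=
  Nat.le_ceil _

theorem lightCount_le (h : SparseRegime d C₁ n s p z θ β) :
    (lightCount z (n * lightBound d C₁ p θ s) : ℝ) ≤
      2 * (z * (n * lightBound d C₁ p θ s + 1)) := by
  have h0 := h.thousand_le
  have h1 := mul_pos h.n_pos h.lightBound_pos
  exact Nat.ceil_le_two_mul (by nlinarith)

theorem pow_mul_lightCount_le (h : SparseRegime d C₁ n s p z θ β) :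
    z ^ 8 * lightCount z (n * lightBound d C₁ p θ s) ≤ s := by
  have h0 := h.thousand_le
  have h1 := h.n_mul_lightBound_le
  have h2 := h.pow_le
  have h3 : 4 ≤ z ^ 9 := by
    have := le_self_pow₀ h.one_le_z (show 9 ≠ 0 by norm_num)
    linarith
  have h4 : 4 ≤ z ^ 11 := by
    have := le_self_pow₀ h.one_le_z (show 11 ≠ 0 by norm_num)
    linarith
  have h5 := mul_pos h.n_pos h.lightBound_pos
  have hz := h.z_pos
  have h6 : 4 * (z ^ 9 * (n * lightBound d C₁ p θ s)) ≤ s :=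
    calc _ ≤ z ^ 9 * (z ^ 9 * (n * lightBound d C₁ p θ s)) := by gcongr
      _ = z ^ 18 * (n * lightBound d C₁ p θ s) := by ring
      _ ≤ _ := h1
  have h7 : 4 * z ^ 9 ≤ s :=
    calc _ ≤ z ^ 11 * z ^ 9 := by gcongr
      _ = z ^ 20 := by ring
      _ ≤ _ := h2
  have h8 := mul_le_mul_of_nonneg_left h.lightCount_le (pow_nonneg hz.le 8)
  have h9 : z ^ 8 * (2 * (z * (n * lightBound d C₁ p θ s + 1))) =
    2 * (z ^ 9 * (n * lightBound d C₁ p θ s)) + 2 * z ^ 9 := by ring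
  linarith

/-- The reason for the square root: sets at distance `j` from `S` contribute about `(s * μ / j ^ 2)
^ j` to the plain pair count, which becomes small once `j` exceeds `√(s * μ)`. -/
theorem le_sq_nearDist (h : SparseRegime d C₁ n s p z θ β) :
    z ^ 3 * (1 + n * lightBound d C₁ p θ s * s) ≤
      (nearDist z (n * lightBound d C₁ p θ s) s : ℝ) ^ 2 := by
  have h1 := mul_pos h.n_pos h.lightBound_pos
  have h2 : 0 ≤ z ^ 3 * (1 + n * lightBound d C₁ p θ s * s) := by
    have := h.z_pos; have := h.s_pos; positivity
  calc _ = √(z ^ 3 * (1 + n * lightBound d C₁ p θ s * s)) ^ 2 := (Real.sq_sqrt h2).symm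
    _ ≤ _ := pow_le_pow_left₀ (Real.sqrt_nonneg _) (Nat.le_ceil _) 2

theorem pow_mul_nearDist_le (h : SparseRegime d C₁ n s p z θ β) :
    z ^ 6 * nearDist z (n * lightBound d C₁ p θ s) s ≤ s := by
  set μ := n * lightBound d C₁ p θ s with hμ
  have hμ0 : 0 < μ := mul_pos h.n_pos h.lightBound_pos
  have hz := h.z_pos
  have hs := h.s_pos
  have h1 := h.thousand_le
  have h2 : 0 ≤ z ^ 3 * (1 + μ * s) := by positivity
  have h3 : 1 ≤ √(z ^ 3 * (1 + μ * s)) := by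
    rw [Real.one_le_sqrt]
    have : 1 ≤ z ^ 3 := one_le_pow₀ h.one_le_z
    nlinarith [mul_pos hμ0 hs]
  have h4 : (nearDist z μ s : ℝ) ≤ 2 * √(z ^ 3 * (1 + μ * s)) :=
    Nat.ceil_le_two_mul (by linarith)
  refine (mul_le_mul_of_nonneg_left h4 (by positivity)).trans ?_
  have h5 : √(z ^ 3 * (1 + μ * s)) ≤ s / (2 * z ^ 6) := by
    refine Real.sqrt_le_iff.2 ⟨by positivity, ?_⟩
    rw [div_pow, le_div_iff₀ (by positivity)]
    have h6 : 8 * z ^ 15 ≤ s ^ 2 := by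
      have h7 : 8 * z ^ 15 ≤ z ^ 20 := by
        have : 8 ≤ z ^ 5 := by linarith [le_self_pow₀ h.one_le_z (show 5 ≠ 0 by norm_num)]
        calc 8 * z ^ 15 ≤ z ^ 5 * z ^ 15 := by gcongr
          _ = _ := by ring
      have h8 := h.pow_le
      have h9 : 1 ≤ (s : ℝ) := by exact_mod_cast h.one_le_s
      nlinarith
    have h7 : 8 * (z ^ 15 * μ) ≤ s := by
      have : 8 ≤ z ^ 3 := by linarith [le_self_pow₀ h.one_le_z (show 3 ≠ 0 by norm_num)]
      calc 8 * (z ^ 15 * μ) ≤ z ^ 3 * (z ^ 15 * μ) := by gcongr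
        _ = z ^ 18 * μ := by ring
        _ ≤ s := h.n_mul_lightBound_le
    have h8 : 8 * (z ^ 15 * μ) * s ≤ s * s := mul_le_mul_of_nonneg_right h7 hs.le
    have h9 : z ^ 3 * (1 + μ * s) * (2 * z ^ 6) ^ 2 =
      (8 * z ^ 15 + 8 * (z ^ 15 * μ) * s) / 2 := by ring
    rw [h9]
    linarith [sq (s : ℝ)]
  rw [le_div_iff₀ (by positivity)] at h5
  linarith

theorem four_mul_lightBound_le_nearDist (h : SparseRegime d C₁ n s p z θ β) :
    4 * (n * lightBound d C₁ p θ s) ≤ nearDist z (n * lightBound d C₁ p θ s) s := by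
  set μ := n * lightBound d C₁ p θ s with hμ
  have hμ0 : 0 < μ := mul_pos h.n_pos h.lightBound_pos
  refine (pow_le_pow_iff_left₀ (by positivity) (Nat.cast_nonneg _) two_ne_zero).1 ?_
  refine le_trans ?_ h.le_sq_nearDist
  have h1 := h.thousand_le
  have h2 : 16 ≤ z ^ 3 := by linarith [le_self_pow₀ h.one_le_z (show 3 ≠ 0 by norm_num)]
  have h3 : μ ≤ s := by
    have h4 := h.n_mul_lightBound_le
    have h5 : 1 ≤ z ^ 18 := one_le_pow₀ h.one_le_z
    nlinarith
  calc (4 * μ) ^ 2 = 16 * (μ * μ) := by ring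
    _ ≤ z ^ 3 * (1 + μ * s) := by
        refine mul_le_mul h2 ?_ (by positivity) (by positivity)
        nlinarith

/-- The Chernoff parameter is `θ`. As `p * s.choose d ≤ θ`, the part with `θ⁻¹` costs at most `exp
1`, and the two prescribed edges cost at most another `exp 1`; hence `exp 2` in `lightBound`. -/
theorem pow_mul_le_lightBound (h : SparseRegime d C₁ n s p z θ β) :
    θ ^ (2 * C₁) * (p * θ⁻¹ + (1 - p)) ^ (s.choose d - 2) ≤ lightBound d C₁ p θ s := by
  have hp := h.p_pos
  have hp1 := h.p_lt_one
  have hθ := h.one_le_θ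
  have hθ0 : 0 < θ := by linarith
  have hn := h.n_pos
  set ψ := lightBound d C₁ p θ s with hψdef
  have hψ0 : 0 < ψ := h.lightBound_pos
  set μ := n * ψ with hμ
  rw [hψdef, lightBound, mul_assoc]
  refine mul_le_mul_of_nonneg_left ?_ (by positivity)
  have h1 : p * θ⁻¹ + (1 - p) = 1 - p * (1 - θ⁻¹) := by ring
  have hi0 : 0 < θ⁻¹ := by positivity
  have hi1 : θ⁻¹ ≤ 1 := inv_le_one_of_one_le₀ hθ
  have h2 : p * (1 - θ⁻¹) ≤ 1 := by nlinarith
  rw [h1, ← Real.exp_add]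
  refine (one_sub_pow_le_exp h2 _).trans (Real.exp_le_exp.2 ?_)
  have h3 : (s.choose d : ℝ) - 2 ≤ ((s.choose d - 2 : ℕ) : ℝ) := by
    have : s.choose d ≤ s.choose d - 2 + 2 := by omega
    have : (s.choose d : ℝ) ≤ ((s.choose d - 2 : ℕ) : ℝ) + 2 := by exact_mod_cast this
    linarith
  have h4 : 0 ≤ p * (1 - θ⁻¹) := mul_nonneg hp.le (by linarith)
  have h6 : p * s.choose d * θ⁻¹ ≤ 1 := by
    calc _ ≤ θ * θ⁻¹ := mul_le_mul_of_nonneg_right h.mul_choose_le hi0.le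
      _ = 1 := mul_inv_cancel₀ hθ0.ne'
  have h7 : p * (1 - θ⁻¹) ≤ 1 / 2 := by nlinarith [h.p_le]
  nlinarith

theorem lightBound_bounds (h : SparseRegime d C₁ n s p z θ β) :
    1000 * (z ^ 2 * (n * lightBound d C₁ p θ s)) ≤ s ∧ 1000 * (z ^ 2 * (n * lightBound d C₁ p θ s) ^ 2) ≤ s ∧
      2 * (n * lightBound d C₁ p θ s) ≤ s := by
  have hθ := h.one_le_θ
  have hn := h.n_pos
  have hz1 := h.thousand_le
  set ψ := lightBound d C₁ p θ s with hψdef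
  have hψ0 : 0 < ψ := h.lightBound_pos
  set μ := n * ψ with hμ
  have hμ0 : 0 < μ := mul_pos hn hψ0
  have hμ18 := h.n_mul_lightBound_le
  have hμ16 := h.sq_n_mul_lightBound_le
  rw [← hψdef, ← hμ] at hμ18 hμ16
  have hz2 : 1000 * z ^ 2 ≤ z ^ 16 := by
    have : 1000 ≤ z ^ 14 := by linarith [le_self_pow₀ h.one_le_z (show 14 ≠ 0 by norm_num)]
    calc 1000 * z ^ 2 ≤ z ^ 14 * z ^ 2 := by gcongr
      _ = _ := by ring
  have hz3 : z ^ 16 ≤ z ^ 18 := pow_le_pow_right₀ h.one_le_z (by norm_num)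
  have hμa : 1000 * (z ^ 2 * μ) ≤ s := by nlinarith
  have hμb : 1000 * (z ^ 2 * μ ^ 2) ≤ s := by nlinarith [sq_nonneg μ]
  have hμs : 2 * μ ≤ s := by nlinarith [one_le_pow₀ (n := 2) h.one_le_z]
  exact ⟨hμa, hμb, hμs⟩

/-- Since `p * s ^ d ≤ θ` and `p * s ^ (d - 1) ≤ θ / s`, the bound is of order `θ ^ 2 * (μ + μ ^ 2)
/ s`. -/
theorem sum_lightDisjoint_le (h : SparseRegime d C₁ n s p z θ β) :
    (s : ℝ) ^ d * (d + 1) * s ^ (d - 1) * (n * (2 * (p ^ 2 * lightBound d C₁ p θ s)) +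
      n ^ 2 * (4 * (p * lightBound d C₁ p θ s) ^ 2)) ≤ 1 / z := by
  have hp := h.p_pos
  have hθ := h.one_le_θ
  have hz := h.z_pos
  have hs := h.s_pos
  have hn := h.n_pos
  set ψ := lightBound d C₁ p θ s with hψdef
  have hψ0 : 0 < ψ := h.lightBound_pos
  set μ := n * ψ with hμ
  have hps := h.mul_pow_pred_le
  have hpd := h.mul_pow_le
  obtain ⟨hμa, hμb, hμs⟩ := h.lightBound_bounds
  rw [← hψdef, ← hμ] at hμa hμb hμs
  have e1 : (s : ℝ) ^ d * (d + 1) * s ^ (d - 1) * (n * (2 * (p ^ 2 * ψ)) +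
      n ^ 2 * (4 * (p * ψ) ^ 2)) =
      (p * s ^ d) * (p * s ^ (d - 1)) * ((d + 1) * (2 * μ + 4 * μ ^ 2)) := by
    rw [hμ]; ring
  rw [e1]
  calc _ ≤ θ * (θ / s) * ((d + 1) * (2 * μ + 4 * μ ^ 2)) := by gcongr
    _ = ((d + 1) * θ ^ 2) * (2 * μ + 4 * μ ^ 2) / s := by ring
    _ ≤ z * (2 * μ + 4 * μ ^ 2) / s := by
        have := h.mul_θ_le' 2 (by omega)
        gcongr
        nlinarith [show 0 ≤ ((d : ℝ) + 1) * θ ^ 2 by positivity]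
    _ ≤ 1 / z := by
        rw [div_le_div_iff₀ hs hz]
        nlinarith

theorem sum_noLightEdge_le (h : SparseRegime d C₁ n s p z θ β) :
    ∑ j ∈ Finset.Icc 2 (d + 1), ((n : ℝ) ^ j * s ^ (d + 1 - j)) *
      (p * (2 * prob₁ p (s.choose d)) ^ j) ≤ 1 / z := by
  have hp := h.p_pos
  have hp1 := h.p_lt_one
  have hθ := h.one_le_θ
  have hz := h.z_pos
  have hs := h.s_pos
  have hn := h.n_pos
  set ψ := lightBound d C₁ p θ s with hψdef
  have hψ0 : 0 < ψ := h.lightBound_pos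
  set μ := n * ψ with hμ
  have hps := h.mul_pow_pred_le
  obtain ⟨hμa, hμb, hμs⟩ := h.lightBound_bounds
  rw [← hψdef, ← hμ] at hμa hμb hμs
  have hq : prob₁ p (s.choose d) ≤ ψ := by
    have := h.probLe_le
    rw [probLe] at this
    linarith [prob₀_nonneg hp1.le (s.choose d)]
  have hq0 := prob₁_nonneg hp.le hp1.le (s.choose d)
  -- As `2 * μ ≤ s`, trading light vertices for vertices of `S` only increases the bound, so `j = 2`
  -- is the worst case.
  have e1 : ∀ j ∈ Finset.Icc 2 (d + 1), ((n : ℝ) ^ j * s ^ (d + 1 - j)) *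
      (p * (2 * prob₁ p (s.choose d)) ^ j) ≤ θ / s * (2 * μ) ^ 2 := by
    intro j hj
    rw [Finset.mem_Icc] at hj
    calc _ ≤ ((n : ℝ) ^ j * s ^ (d + 1 - j)) * (p * (2 * ψ) ^ j) := by gcongr
      _ = (2 * μ) ^ j * (p * s ^ (d + 1 - j)) := by rw [hμ]; ring
      _ = (2 * μ) ^ 2 * (2 * μ) ^ (j - 2) * (p * s ^ (d + 1 - j)) := by
          rw [← pow_add, Nat.add_sub_cancel' hj.1]
      _ ≤ (2 * μ) ^ 2 * (s : ℝ) ^ (j - 2) * (p * s ^ (d + 1 - j)) := by gcongr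
      _ = (2 * μ) ^ 2 * (p * s ^ (d - 1)) := by
          rw [show d - 1 = (j - 2) + (d + 1 - j) by omega, pow_add]; ring
      _ ≤ (2 * μ) ^ 2 * (θ / s) := by gcongr
      _ = _ := by ring
  refine (Finset.sum_le_card_nsmul _ _ _ e1).trans ?_
  rw [Nat.card_Icc, nsmul_eq_mul, show d + 1 + 1 - 2 = d by omega]
  calc (d : ℝ) * (θ / s * (2 * μ) ^ 2) = (4 * (d * θ)) * μ ^ 2 / s := by ring
    _ ≤ z * μ ^ 2 / s := by
        have := h.mul_θ_le' 1 (by omega)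
        gcongr
        nlinarith
    _ ≤ 1 / z := by
        rw [div_le_div_iff₀ hs hz]
        nlinarith

theorem lightVerts_term_le (h : SparseRegime d C₁ n s p z θ β) :
    n * (2 * lightBound d C₁ p θ s) / ((lightCount z (n * lightBound d C₁ p θ s) : ℝ) + 1) ≤ 2 / z := by
  have hθ := h.one_le_θ
  have hz := h.z_pos
  have hn := h.n_pos
  set ψ := lightBound d C₁ p θ s with hψdef
  have hψ0 : 0 < ψ := h.lightBound_pos
  set μ := n * ψ with hμ
  set m := lightCount z μ with hm
  have e1 := le_lightCount z d C₁ n s p θ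
  rw [div_le_div_iff₀ (by positivity) hz]
  nlinarith

theorem n_mul_pow_mul_le (h : SparseRegime d C₁ n s p z θ β) :
    (n : ℝ) * (1 / z) ^ C₁ * n ≤ 1 / z := by
  have hz := h.z_pos
  rw [div_pow, one_pow, mul_one_div, div_mul_eq_mul_div, div_le_div_iff₀ (by positivity) hz]
  have := h.sq_mul_le
  nlinarith

theorem lightCover_term_le (h : SparseRegime d C₁ n s p z θ β) :
    n * (2 * (p * (lightCount z (n * lightBound d C₁ p θ s) * ((2 * C₁ : ℕ) * (d + 1)) * (s : ℝ) ^ (d - 1))) ^ C₁) ≤ 2 / z := by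
  have hp := h.p_pos
  have hθ := h.one_le_θ
  have hz := h.z_pos
  have hs := h.s_pos
  have hn := h.n_pos
  set ψ := lightBound d C₁ p θ s with hψdef
  have hψ0 : 0 < ψ := h.lightBound_pos
  set μ := n * ψ with hμ
  have hps := h.mul_pow_pred_le
  have hC := h.n_mul_pow_mul_le
  have hn1 : (1 : ℝ) ≤ n := by exact_mod_cast h.one_le_s.trans h.s_le_n
  set m := lightCount z μ with hm
  have e1 : p * (m * ((2 * C₁ : ℕ) * (d + 1)) * (s : ℝ) ^ (d - 1)) ≤ 1 / z := by
    push_cast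
    calc p * (m * (2 * C₁ * (d + 1)) * (s : ℝ) ^ (d - 1))
        = (p * s ^ (d - 1)) * (2 * C₁ * (d + 1) * m) := by ring
      _ ≤ (θ / s) * (2 * C₁ * (d + 1) * m) := by gcongr
      _ = (2 * ((d + 1) * C₁ * θ)) * m / s := by ring
      _ ≤ z * m / s := by
          have := h.mul_θ_le 1 (by omega)
          gcongr
          have h1 : 0 ≤ ((d : ℝ) + 1) * θ := by positivity
          have h2 : 0 ≤ ((d : ℝ) + 1) * C₁ * θ := by positivity
          nlinarith
      _ ≤ 1 / z := by
          rw [div_le_div_iff₀ hs hz]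
          have e2 := h.pow_mul_lightCount_le
          have e3 : z ^ 2 ≤ z ^ 8 := pow_le_pow_right₀ h.one_le_z (by norm_num)
          have e4 : z ^ 2 * m ≤ z ^ 8 * m := mul_le_mul_of_nonneg_right e3 (Nat.cast_nonneg _)
          linarith
  calc _ ≤ n * (2 * (1 / z) ^ C₁) := by gcongr
    _ ≤ 2 * ((n : ℝ) * (1 / z) ^ C₁ * n) := by
        have e2 : 0 ≤ n * (1 / z) ^ C₁ := by positivity
        nlinarith
    _ ≤ 2 * (1 / z) := by linarith
    _ = _ := by ring

theorem sum_noDense_le (h : SparseRegime d C₁ n s p z θ β) :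
    ∑ j ∈ Finset.Icc 1 (nearDist z (n * lightBound d C₁ p θ s) s), (2 * (n : ℝ) * s * (p * (nearDist z (n * lightBound d C₁ p θ s) s * (s : ℝ) ^ (d - 1))) ^ C₁) ^ j ≤
      2 / z := by
  have hp := h.p_pos
  have hθ := h.one_le_θ
  have hz := h.z_pos
  have hs := h.s_pos
  have hn := h.n_pos
  have hz1 := h.thousand_le
  set ψ := lightBound d C₁ p θ s with hψdef
  have hψ0 : 0 < ψ := h.lightBound_pos
  set μ := n * ψ with hμ
  have hps := h.mul_pow_pred_le
  have hC := h.n_mul_pow_mul_le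
  set l := nearDist z μ s with hl
  have e1 : p * (l * (s : ℝ) ^ (d - 1)) ≤ 1 / z := by
    calc p * (l * (s : ℝ) ^ (d - 1)) = (p * s ^ (d - 1)) * l := by ring
      _ ≤ (θ / s) * l := by gcongr
      _ = θ * l / s := by ring
      _ ≤ z * l / s := by
          have := h.thousand_mul_θ_pow_le 1 (by omega)
          gcongr
          linarith
      _ ≤ 1 / z := by
          rw [div_le_div_iff₀ hs hz]
          have e2 := h.pow_mul_nearDist_le
          have e3 : z ^ 2 ≤ z ^ 6 := pow_le_pow_right₀ h.one_le_z (by norm_num)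
          have e4 : z ^ 2 * l ≤ z ^ 6 * l := mul_le_mul_of_nonneg_right e3 (Nat.cast_nonneg _)
          linarith
  have e2 : 2 * (n : ℝ) * s * (p * (l * (s : ℝ) ^ (d - 1))) ^ C₁ ≤ 1 / z := by
    have e3 : 2 * (s : ℝ) ≤ n := by exact_mod_cast h.two_mul_le
    calc _ ≤ 2 * (n : ℝ) * s * (1 / z) ^ C₁ := by gcongr
      _ = (n : ℝ) * (1 / z) ^ C₁ * (2 * s) := by ring
      _ ≤ (n : ℝ) * (1 / z) ^ C₁ * n := by gcongr
      _ ≤ _ := hC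
  calc _ ≤ ∑ j ∈ Finset.Icc 1 l, (1 / z) ^ j := by gcongr
    _ ≤ 2 * (1 / z) := by
        refine sum_pow_le_two_mul (by positivity) ?_ _ fun j hj => (Finset.mem_Icc.1 hj).1
        rw [div_le_div_iff₀ hz (by norm_num)]
        linarith
    _ = _ := by ring

theorem binExp_setWt_mul_not_good_le (h : SparseRegime d C₁ n s p z θ β) (S : Finset (Fin n))
    (hS : S.card = s) :
    binExp p (edgeSpace (Fin n) d) (fun E => setWt d S E *
        ind (¬Good d C₁ (nearDist z (n * lightBound d C₁ p θ s) s) E S)) ≤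
      8 / z * ((1 - p) ^ s.choose (d + 1) * meanWt d p (s.choose d) ^ (n - s)) := by
  have hp := h.p_pos
  have hp1 := h.p_lt_one
  have key := BinomialHypergraph.binExp_setWt_mul_not_good_le (V := Fin n) (d := d) (S := S)
    (ψ := lightBound d C₁ p θ s) hp.le hp1.le h.one_le_θ C₁
    (nearDist z (n * lightBound d C₁ p θ s) s) (lightCount z (n * lightBound d C₁ p θ s))
    (by rw [hS]; exact h.pow_mul_le_lightBound) (by rw [hS]; exact h.half_le_meanWt)
  rw [binExp_setWt, hS, Fintype.card_fin] at key
  refine key.trans ?_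
  rw [mul_comm (8 / z)]
  refine mul_le_mul_of_nonneg_left ?_ ?_
  swap
  · have h1 : 0 ≤ meanWt d p (s.choose d) := by linarith [h.half_le_meanWt]
    have h2 : 0 ≤ 1 - p := by linarith
    positivity
  have t1 := h.sum_lightDisjoint_le
  have t2 := h.sum_noLightEdge_le
  have t3 := h.lightVerts_term_le
  have t4 := h.lightCover_term_le
  have t5 := h.sum_noDense_le
  have : 8 / z = 1 / z + 1 / z + 2 / z + 2 / z + 2 / z := by ring
  rw [this]
  linarith

end SparseRegime

end

/-! ### Far pairs of sets are nearly independent. -/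

section

/-- The expected total weight of the independent sets of size `s`. -/
noncomputable def expWeight (n d : ℕ) (p : ℝ) (s : ℕ) : ℝ :=
  expIndep n d p s * meanWt d p (s.choose d) ^ (n - s)

/-- Two sets with at most `farBound` common vertices count as far. -/
noncomputable def farBound (z : ℝ) (n s : ℕ) : ℕ := ⌊z ^ 4 * (1 + (s : ℝ) ^ 2 / n)⌋₊

namespace SparseRegime

variable {d C₁ n s : ℕ} {p z θ β : ℝ}

/-- Two sets with `i` common vertices share at most `i ^ (d + 1)` potential edges, and `p * i ^ (d +
1) ≤ θ * i * (i / s) ^ d`. If `s ^ 2 / n ≤ 1`, then `i ≤ z ^ 5`, which is tiny compared with `s ≥ z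
^ 20`. Otherwise `i ≤ z ^ 5 * s ^ 2 / n`, and the bound is `z ^ (5 * (d + 1)) * n * (s / n) ^ (d +
2)`, small by the threshold condition. -/
theorem mul_pow_succ_le_of_le_farBound (h : SparseRegime d C₁ n s p z θ β) {i : ℕ}
    (hi : i ≤ farBound z n s) : 2 * (p * (i : ℝ) ^ (d + 1)) ≤ 1 / z := by
  have hz := h.z_pos
  have hs := h.s_pos
  have hn := h.n_pos
  have hx := h.x_pos
  have hz1 := h.thousand_le
  have hp := h.p_pos
  have hθ0 : 0 < θ := by linarith [h.one_le_θ]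
  have hθz : 1000 * θ ≤ z := by simpa using h.thousand_mul_θ_pow_le 1 (by omega)
  set x := (s : ℝ) / n with hxdef
  have hi' : (i : ℝ) ≤ z ^ 4 * (1 + s * x) := by
    have h1 : (i : ℝ) ≤ farBound z n s := by exact_mod_cast hi
    have h2 : (farBound z n s : ℝ) ≤ z ^ 4 * (1 + (s : ℝ) ^ 2 / n) := Nat.floor_le (by positivity)
    calc (i : ℝ) ≤ z ^ 4 * (1 + (s : ℝ) ^ 2 / n) := h1.trans h2
      _ = _ := by rw [hxdef]; ring
  have hps : p ≤ θ / (s : ℝ) ^ d := by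
    rw [le_div_iff₀ (by positivity)]; exact h.mul_pow_le
  have e1 : p * (i : ℝ) ^ (d + 1) ≤ θ * (i * ((i : ℝ) / s) ^ d) := by
    calc p * (i : ℝ) ^ (d + 1) ≤ θ / (s : ℝ) ^ d * (i : ℝ) ^ (d + 1) := by gcongr
      _ = _ := by rw [div_pow, pow_succ]; ring
  have key : i * ((i : ℝ) / s) ^ d ≤ 1 / z ^ 2 := by
    rcases le_total (s * x) 1 with h1 | h1
    · have h2 : (i : ℝ) ≤ z ^ 5 := by
        calc (i : ℝ) ≤ z ^ 4 * (1 + s * x) := hi'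
          _ ≤ z ^ 4 * z := by gcongr; linarith
          _ = _ := by ring
      have h3 : (i : ℝ) / s ≤ 1 / z ^ 15 := by
        rw [div_le_div_iff₀ hs (by positivity), one_mul]
        calc (i : ℝ) * z ^ 15 ≤ z ^ 5 * z ^ 15 := by gcongr
          _ = z ^ 20 := by ring
          _ ≤ s := h.pow_le
      have h5 : (1 : ℝ) / z ^ 15 ≤ 1 := by
        rw [div_le_one (by positivity)]; exact one_le_pow₀ h.one_le_z
      have h4 : ((i : ℝ) / s) ^ d ≤ (i : ℝ) / s :=
        pow_le_of_le_one (by positivity) (h3.trans h5) (by have := h.one_le_d; omega)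
      calc i * ((i : ℝ) / s) ^ d ≤ z ^ 5 * (1 / z ^ 15) := by
            gcongr; exact h4.trans h3
        _ = 1 / z ^ 10 := by field_simp
        _ ≤ 1 / z ^ 2 := by gcongr; exacts [h.one_le_z, by norm_num]
    · have h2 : (i : ℝ) ≤ z ^ 5 * (s * x) := by
        calc (i : ℝ) ≤ z ^ 4 * (1 + s * x) := hi'
          _ ≤ z ^ 4 * (z * (s * x)) := by gcongr; nlinarith
          _ = _ := by ring
      have h3 : (i : ℝ) / s ≤ z ^ 5 * x := by
        rw [div_le_iff₀ hs]; linarith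
      have h4 : z ^ (5 * (d + 1)) * (n * x ^ (d + 2)) ≤ 1 / z ^ 2 := by
        rw [le_div_iff₀ (by positivity)]
        refine le_trans ?_ h.pow_mul_le
        calc _ = z ^ (5 * (d + 1) + 2) * (n * x ^ (d + 2)) := by rw [pow_add]; ring
          _ ≤ _ := by
            refine mul_le_mul_of_nonneg_right ?_ (by positivity)
            exact pow_le_pow_right₀ h.one_le_z (by omega)
      refine le_trans ?_ h4
      calc i * ((i : ℝ) / s) ^ d ≤ z ^ 5 * (s * x) * (z ^ 5 * x) ^ d := by gcongr
        _ = z ^ (5 * (d + 1)) * (n * x ^ (d + 2)) := by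
          have : (s : ℝ) = n * x := h.n_mul_div.symm
          rw [this, mul_pow, ← pow_mul]; ring
  calc 2 * (p * (i : ℝ) ^ (d + 1)) ≤ 2 * (θ * (1 / z ^ 2)) := by
        have := mul_le_mul_of_nonneg_left key hθ0.le
        linarith
    _ = (2 * θ) * (1 / z ^ 2) := by ring
    _ ≤ z * (1 / z ^ 2) := by gcongr; linarith
    _ = 1 / z := by field_simp

theorem n_mul_sq_lightBound_le (h : SparseRegime d C₁ n s p z θ β) :
    n * lightBound d C₁ p θ s * lightBound d C₁ p θ s ≤ 1 / z ^ 16 := by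
  have hz := h.z_pos
  have hn := h.n_pos
  have h1 := h.n_mul_lightBound_mul_le
  have h2 : lightBound d C₁ p θ s ≤ z ^ 2 * ((s : ℝ) / n) := by
    refine h.lightBound_le.trans ?_
    have := pow_le_of_le_one h.x_pos.le h.x_le_one (show d + 1 ≠ 0 by omega)
    gcongr
  have h3 := h.lightBound_pos
  rw [le_div_iff₀ (by positivity)]
  calc _ ≤ n * lightBound d C₁ p θ s * (z ^ 2 * ((s : ℝ) / n)) * z ^ 16 := by gcongr
    _ = z ^ 18 * (n * lightBound d C₁ p θ s * ((s : ℝ) / n)) := by ring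
    _ ≤ 1 := h1

theorem s_mul_lightBound_le (h : SparseRegime d C₁ n s p z θ β) :
    s * lightBound d C₁ p θ s ≤ 1 / z ^ 18 := by
  have h0 := h.z_pos
  have h1 := h.n_mul_lightBound_mul_le
  rw [le_div_iff₀ (by positivity)]
  calc s * lightBound d C₁ p θ s * z ^ 18
      = z ^ 18 * (n * lightBound d C₁ p θ s * ((s : ℝ) / n)) := by
        have := h.n_mul_div
        linear_combination (-(lightBound d C₁ p θ s * z ^ 18)) * this
    _ ≤ 1 := h1

/-- Three deviations from independence are each negligible: the shared potential edges, the
covariance of the two weights at each outside vertex (of order `lightBound ^ 2`, summed over at most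
`n` vertices), and the missing weight factors at the vertices that belong to just one of the sets.
-/
theorem far_pair_le (h : SparseRegime d C₁ n s p z θ β) {i : ℕ} (hi : i ≤ farBound z n s)
    (his : i ≤ s) :
    (1 - p) ^ (2 * s.choose (d + 1) - i.choose (d + 1)) *
      (meanWt d p (s.choose d) ^ 2 + probLe p (s.choose d) *
        probLe p (s.choose d - i.choose d)) ^ (n - (2 * s - i)) ≤
      (1 + 6 / z) * ((1 - p) ^ s.choose (d + 1) * meanWt d p (s.choose d) ^ (n - s)) ^ 2 := by
  have hz := h.z_pos
  have hs := h.s_pos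
  have hn := h.n_pos
  have hz1 := h.thousand_le
  have hp := h.p_pos
  have hp1 := h.p_lt_one
  have hsn2 := h.two_mul_le
  have hψ0 := h.lightBound_pos
  have hh := h.half_le_meanWt
  have hq0 := probLe_nonneg hp.le hp1.le (s.choose d)
  have hqψ := h.probLe_le
  have hpi := h.mul_pow_succ_le_of_le_farBound hi
  have hμψ := h.n_mul_sq_lightBound_le
  have hsψ := h.s_mul_lightBound_le
  have hpow := h.exp_le_meanWt_pow (2 * (s - i))
  set ψ := lightBound d C₁ p θ s with hψdef
  set H := meanWt d p (s.choose d) with hH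
  set q := probLe p (s.choose d) with hq
  have hH0 : 0 < H := by linarith
  have hiz : 1 / z ≤ 1 := by rw [div_le_one hz]; linarith
  have hiz16 : 12 * (1 / z ^ 16) ≤ 1 / z := by
    rw [mul_one_div, div_le_div_iff₀ (by positivity) hz, one_mul]
    have : 12 ≤ z ^ 15 := by linarith [le_self_pow₀ h.one_le_z (show 15 ≠ 0 by norm_num)]
    calc 12 * z ≤ z ^ 15 * z := by gcongr
      _ = _ := by ring
  have hiz18 : 1 / z ^ 18 ≤ 1 / z ^ 16 := by
    gcongr; exacts [h.one_le_z, by norm_num]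
  have f1 : (1 - p) ^ (2 * s.choose (d + 1) - i.choose (d + 1)) ≤
      ((1 - p) ^ s.choose (d + 1)) ^ 2 * Real.exp (1 / z) := by
    have h1 : i.choose (d + 1) ≤ s.choose (d + 1) := Nat.choose_le_choose _ his
    have h2 : (1 - p) ^ (2 * s.choose (d + 1) - i.choose (d + 1)) =
        ((1 - p) ^ s.choose (d + 1)) ^ 2 * ((1 - p) ^ i.choose (d + 1))⁻¹ := by
      rw [← pow_mul, mul_comm _ 2, eq_mul_inv_iff_mul_eq₀ (pow_ne_zero _ (by linarith)), ← pow_add]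
      congr 1; omega
    rw [h2]
    refine mul_le_mul_of_nonneg_left ?_ (by positivity)
    refine (inv_one_sub_pow_le_exp hp.le h.p_le _).trans (Real.exp_le_exp.2 ?_)
    have h3 : (i.choose (d + 1) : ℝ) ≤ (i : ℝ) ^ (d + 1) := by
      exact_mod_cast Nat.choose_le_pow i (d + 1)
    have := mul_le_mul_of_nonneg_left h3 hp.le
    linarith
  -- Leaving out the shared part of a star costs `(1 - p) ^ (-i.choose d)`, which is at most `exp
  -- 1`.
  have f2 : probLe p (s.choose d - i.choose d) ≤ 3 * ψ := by
    have h1 : i.choose d ≤ s.choose d := Nat.choose_le_choose _ his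
    have h2 := pow_mul_probLe_le hp.le hp1.le (s.choose d - i.choose d) (i.choose d)
    rw [Nat.sub_add_cancel h1] at h2
    have h3 : probLe p (s.choose d - i.choose d) ≤ ((1 - p) ^ i.choose d)⁻¹ * q := by
      rw [inv_mul_eq_div, le_div_iff₀ (pow_pos (by linarith) _), mul_comm]
      exact h2
    refine h3.trans ?_
    have h4 : ((1 - p) ^ i.choose d)⁻¹ ≤ 3 := by
      refine (inv_one_sub_pow_le_exp hp.le h.p_le _).trans ?_
      have h5 : (i.choose d : ℝ) ≤ (i : ℝ) ^ (d + 1) := by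
        have h6 : i.choose d ≤ i ^ (d + 1) := by
          refine (Nat.choose_le_pow i d).trans ?_
          rcases Nat.eq_zero_or_pos i with rfl | h0
          · simp [show d ≠ 0 by have := h.one_le_d; omega]
          · exact Nat.pow_le_pow_right h0 (by omega)
        exact_mod_cast h6
      have := mul_le_mul_of_nonneg_left h5 hp.le
      have h7 : Real.exp (2 * p * i.choose d) ≤ Real.exp 1 := Real.exp_le_exp.2 (by linarith)
      linarith [Real.exp_one_lt_d9]
    exact mul_le_mul h4 hqψ hq0 (by norm_num)
  have hq2 := probLe_nonneg hp.le hp1.le (s.choose d - i.choose d)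
  have f3 : H ^ 2 + q * probLe p (s.choose d - i.choose d) ≤ H ^ 2 * Real.exp (12 * (ψ * ψ)) := by
    have h1 : q * probLe p (s.choose d - i.choose d) ≤ ψ * (3 * ψ) :=
      mul_le_mul hqψ f2 hq2 hψ0.le
    have h2 := Real.add_one_le_exp (12 * (ψ * ψ))
    have h3 : (1 : ℝ) / 4 ≤ H ^ 2 := by nlinarith
    have h4 := mul_le_mul_of_nonneg_left h2 (sq_nonneg H)
    nlinarith [mul_pos hψ0 hψ0]
  set k := n - (2 * s - i) with hk
  have f4 : (H ^ 2 + q * probLe p (s.choose d - i.choose d)) ^ k ≤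
      (H ^ (n - s)) ^ 2 * Real.exp (2 / z) := by
    -- Here `2 * (n - s) = 2 * k + 2 * (s - i)`; the surplus factors are close to 1 because `s *
    -- lightBound` is small.
    have h1 : (H ^ (n - s)) ^ 2 = (H ^ 2) ^ k * H ^ (2 * (s - i)) := by
      rw [← pow_mul, ← pow_mul, ← pow_add]; congr 1; omega
    have h2 : (1 : ℝ) ≤ H ^ (2 * (s - i)) * Real.exp (1 / z) := by
      refine le_trans ?_ (mul_le_mul_of_nonneg_right hpow (Real.exp_pos _).le)
      rw [← Real.exp_add, Real.one_le_exp_iff]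
      push_cast [Nat.cast_sub his]
      have h5 : 0 ≤ 1 / z ^ 16 := by positivity
      have h3 : ((s : ℝ) - i) * ψ ≤ s * ψ :=
        mul_le_mul_of_nonneg_right (by linarith [Nat.cast_nonneg (α := ℝ) i]) hψ0.le
      linarith
    calc _ ≤ (H ^ 2 * Real.exp (12 * (ψ * ψ))) ^ k := by gcongr
      _ = (H ^ 2) ^ k * Real.exp (k * (12 * (ψ * ψ))) := by rw [mul_pow, ← Real.exp_nat_mul]
      _ ≤ (H ^ 2) ^ k * Real.exp (1 / z) := by
          have h3 : (k : ℝ) ≤ n := by exact_mod_cast (by omega : k ≤ n)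
          have h4 : (k : ℝ) * (ψ * ψ) ≤ n * (ψ * ψ) :=
            mul_le_mul_of_nonneg_right h3 (by positivity)
          gcongr
          linarith
      _ ≤ (H ^ 2) ^ k * Real.exp (1 / z) * (H ^ (2 * (s - i)) * Real.exp (1 / z)) :=
          le_mul_of_one_le_right (by positivity) h2
      _ = (H ^ 2) ^ k * H ^ (2 * (s - i)) * (Real.exp (1 / z) * Real.exp (1 / z)) := by ring
      _ = _ := by rw [h1, ← Real.exp_add]; congr 2; ring
  have f5 : Real.exp (1 / z) * Real.exp (2 / z) ≤ 1 + 6 / z := by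
    rw [← Real.exp_add]
    have h1 : 1 / z + 2 / z = 3 / z := by ring
    have h3 : 3 / z ≤ 3 / 1000 := by gcongr
    have h4 : 0 ≤ 3 / z := by positivity
    have h2 := Real.exp_bound_div_one_sub_of_interval h4 (by linarith : 3 / z < 1)
    rw [h1]
    refine h2.trans ?_
    rw [div_le_iff₀ (by linarith)]
    have : 6 / z = 2 * (3 / z) := by ring
    rw [this]
    nlinarith
  calc _ ≤ ((1 - p) ^ s.choose (d + 1)) ^ 2 * Real.exp (1 / z) *
        ((H ^ (n - s)) ^ 2 * Real.exp (2 / z)) :=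
        mul_le_mul f1 f4 (by positivity) (by positivity)
    _ = (Real.exp (1 / z) * Real.exp (2 / z)) * ((1 - p) ^ s.choose (d + 1) * H ^ (n - s)) ^ 2 := by
        ring
    _ ≤ _ := mul_le_mul_of_nonneg_right f5 (sq_nonneg _)

end SparseRegime

end

/-! ### Intermediate pairs, and the existence of independent sets. -/

section

theorem log_choose_le_mul_one_add_log_div {s i : ℕ} (hi : 1 ≤ i) (his : i ≤ s) :
    Real.log (s.choose i) ≤ i * (1 + Real.log s - Real.log i) := by
  have h0 := log_choose_le_mul_one_add his
  have h1 : (i : ℝ) ≠ 0 := by exact_mod_cast (by omega : i ≠ 0)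
  have h2 : (s : ℝ) ≠ 0 := by exact_mod_cast (by omega : s ≠ 0)
  rw [Real.log_div h2 h1] at h0
  linarith

theorem choose_sub_choose_le {j s d : ℕ} (hjs : j ≤ s) :
    (s.choose d : ℝ) - j.choose d ≤ ((s : ℝ) - j) * (s : ℝ) ^ (d - 1) := by
  have h := choose_add_le_add_mul_pow j (s - j) d
  rw [Nat.add_sub_cancel' hjs] at h
  have h1 : (s.choose d : ℝ) ≤ j.choose d + ((s - j : ℕ) : ℝ) * (s : ℝ) ^ (d - 1) := by
    exact_mod_cast h
  rw [Nat.cast_sub hjs] at h1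
  linarith

namespace SparseRegime

variable {d C₁ n s : ℕ} {p z θ β : ℝ}

theorem one_le_log_z (h : SparseRegime d C₁ n s p z θ β) : 1 ≤ Real.log z := by
  rw [Real.le_log_iff_exp_le h.z_pos]
  linarith [Real.exp_one_lt_d9, h.thousand_le]

theorem z_le_s (h : SparseRegime d C₁ n s p z θ β) : z ≤ s :=
  (le_self_pow₀ h.one_le_z (by norm_num)).trans h.pow_le

theorem two_mul_θ_mul_β_le (h : SparseRegime d C₁ n s p z θ β) :
    2 * (θ * β) ≤ Real.log z := by
  rw [Real.le_log_iff_exp_le h.z_pos]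
  exact h.exp_β_le

/-- For `i ≤ β * s` the edge cost per vertex, `2 * p * i ^ d`, is at most `log z`, so `expIndep` is
at least `(n / i) ^ i * z ^ (-i)`. Against `(e * s / i) ^ (2 * i)` the quotient has base about `s ^
2 * z / (n * i)`, small as `i` exceeds `z ^ 4 * s ^ 2 / n`. -/
theorem mid_small (h : SparseRegime d C₁ n s p z θ β) {i : ℕ} (hi : farBound z n s < i)
    (his : i ≤ s) (hiβ : (i : ℝ) ≤ β * s) :
    2 * Real.log (s.choose i) - Real.log (expIndep n d p i) +
      4 * (n * lightBound d C₁ p θ s) ≤ i * (1 - Real.log z) := by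
  have hz := h.z_pos
  have hs := h.s_pos
  have hn := h.n_pos
  have hz1 := h.thousand_le
  have hZ := h.one_le_log_z
  have hp := h.p_pos
  have hi0 : (0 : ℝ) < i := by exact_mod_cast (by omega : 0 < i)
  have hi' : z ^ 4 * (1 + (s : ℝ) ^ 2 / n) < i := (Nat.floor_lt' (by omega)).1 hi
  have h1 := mul_log_div_le_log_choose (his.trans h.s_le_n)
  rw [Real.log_div hn.ne' hi0.ne'] at h1
  have h2 := log_choose_le_mul_one_add_log_div (by omega : 1 ≤ i) his
  have h3 : Real.log (expIndep n d p i) ≥ Real.log (n.choose i) - 2 * (p * (i : ℝ) ^ (d + 1)) := by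
    rw [log_expIndep h.p_lt_one (his.trans h.s_le_n)]
    have h4 := neg_log_one_sub_le hp.le h.p_le
    have h5 : -Real.log (1 - p) ≤ 2 * p := by nlinarith [h.p_le]
    have h6 : (i.choose (d + 1) : ℝ) ≤ (i : ℝ) ^ (d + 1) := by
      exact_mod_cast Nat.choose_le_pow i (d + 1)
    have h7 : (i.choose (d + 1) : ℝ) * -Real.log (1 - p) ≤ (i : ℝ) ^ (d + 1) * (2 * p) :=
      mul_le_mul h6 h5 (hp.le.trans (le_neg_log_one_sub h.p_lt_one)) (by positivity)
    linarith
  have h4 : p * (i : ℝ) ^ (d + 1) ≤ i * (θ * β) := by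
    have h5 : (i : ℝ) ^ d ≤ β * (s : ℝ) ^ d := by
      calc (i : ℝ) ^ d ≤ (β * s) ^ d := by gcongr
        _ = β ^ d * (s : ℝ) ^ d := mul_pow _ _ _
        _ ≤ β * (s : ℝ) ^ d := by
          have := pow_le_of_le_one h.β_pos.le (by linarith [h.β_le] : β ≤ 1)
            (show d ≠ 0 by have := h.one_le_d; omega)
          gcongr
    calc p * (i : ℝ) ^ (d + 1) = i * (p * (i : ℝ) ^ d) := by ring
      _ ≤ i * (p * (β * (s : ℝ) ^ d)) := by gcongr
      _ = i * (p * (s : ℝ) ^ d * β) := by ring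
      _ ≤ i * (θ * β) := by
        have := h.mul_pow_le
        have := h.β_pos
        gcongr
  have h5 := h.two_mul_θ_mul_β_le
  have h6 : 4 * Real.log z ≤ Real.log i + Real.log n - 2 * Real.log s := by
    have h7 : z ^ 4 * (s : ℝ) ^ 2 ≤ i * n := by
      have h8 : z ^ 4 * ((s : ℝ) ^ 2 / n) ≤ i := by
        have : 0 < z ^ 4 := by positivity
        linarith
      rwa [← mul_div_assoc, div_le_iff₀ hn] at h8
    have h8 := Real.log_le_log (by positivity) h7
    rw [Real.log_mul (by positivity) (by positivity), Real.log_mul (by positivity) (by positivity),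
      Real.log_pow, Real.log_pow] at h8
    push_cast at h8
    linarith
  have h7 : 4 * (n * lightBound d C₁ p θ s) ≤ i := by
    have h8 := h.n_mul_lightBound_le_mul_sq
    have h9 : 4 * z ^ 2 ≤ z ^ 4 := by
      have h10 : 4 ≤ z ^ 2 := by nlinarith
      nlinarith
    have h10 : 0 ≤ (s : ℝ) ^ 2 / n := by positivity
    nlinarith [mul_le_mul_of_nonneg_right h9 h10, pow_pos hz 4]
  have h8 : (i : ℝ) * (4 * Real.log z) ≤ i * (Real.log i + Real.log n - 2 * Real.log s) :=
    mul_le_mul_of_nonneg_left h6 hi0.le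
  have h9 : (i : ℝ) * (2 * (θ * β)) ≤ i * Real.log z := mul_le_mul_of_nonneg_left h5 hi0.le
  have h10 : (i : ℝ) * 1 ≤ i * Real.log z := mul_le_mul_of_nonneg_left hZ hi0.le
  nlinarith

/-- The expected number at `i` has logarithm at least of order `β * s * log (n / s)`, by
`le_log_expIndep_of_one_le`, while `log (s.choose i) ≤ s`. The constant 40 in `le_β_mul_log` makes
the first term win. -/
theorem mid_medium (h : SparseRegime d C₁ n s p z θ β) (hE : 1 ≤ expIndep n d p s) {i : ℕ}
    (hi : β * s ≤ i) (hi' : (i : ℝ) ≤ (1 - β) * s) :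
    2 * Real.log (s.choose i) - Real.log (expIndep n d p i) +
      4 * (n * lightBound d C₁ p θ s) ≤ -(16 * s) := by
  have hs := h.s_pos
  have hn := h.n_pos
  have hβ := h.β_pos
  have hβ' := h.β_le
  have hi0 : (0 : ℝ) < i := (mul_pos hβ hs).trans_le hi
  have his : i ≤ s := by
    have : (i : ℝ) ≤ s := by nlinarith
    exact_mod_cast this
  have h1 := le_log_expIndep_of_one_le h.one_le_d h.p_pos.le h.p_lt_one his h.s_le_n hE
  have h2 := log_choose_le_mul_one_add h.s_le_n
  have h3 := h.le_β_mul_log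
  set L := Real.log ((n : ℝ) / s) with hL
  have hL0 : 0 < L := by
    by_contra hcon
    push Not at hcon
    nlinarith
  have h4 : L ≤ Real.log ((n : ℝ) / i) := by
    refine Real.log_le_log (by positivity) ?_
    have : (i : ℝ) ≤ s := by exact_mod_cast his
    gcongr
  have h5 : ((i : ℝ) / s) ^ 2 * Real.log (n.choose s) ≤ (i : ℝ) ^ 2 / s * (1 + L) :=
    calc _ ≤ ((i : ℝ) / s) ^ 2 * (s * (1 + L)) := by gcongr
      _ = _ := by field_simp
  have h6 : β / 2 * s ≤ i - (i : ℝ) ^ 2 / s := by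
    rw [le_sub_iff_add_le, ← le_sub_iff_add_le', div_le_iff₀ hs]
    nlinarith [mul_nonneg (show 0 ≤ i - β * s by linarith)
      (show 0 ≤ (1 - β) * s - i by linarith),
      mul_nonneg (mul_nonneg hβ.le (show 0 ≤ 1 / 2 - β by linarith)) (sq_nonneg (s : ℝ))]
  have h7 : 20 * s ≤ L * (i - (i : ℝ) ^ 2 / s) := by
    calc (20 : ℝ) * s ≤ (β * L / 2) * s := by gcongr; linarith
      _ = L * (β / 2 * s) := by ring
      _ ≤ _ := by gcongr
  have h8 : (i : ℝ) ^ 2 / s ≤ s := by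
    rw [div_le_iff₀ hs]
    have : (i : ℝ) ≤ s := by exact_mod_cast his
    nlinarith
  have h9 : (i : ℝ) * L ≤ i * Real.log ((n : ℝ) / i) := by gcongr
  have h10 : Real.log (s.choose i) ≤ s := by
    have h11 : (s.choose i : ℝ) ≤ 2 ^ s := by exact_mod_cast Nat.choose_le_two_pow s i
    have h12 : (0 : ℝ) < s.choose i := by exact_mod_cast Nat.choose_pos his
    have h13 := Real.log_le_log h12 h11
    rw [Real.log_pow] at h13
    have : Real.log 2 ≤ 1 := by linarith [Real.log_two_lt_d9]
    nlinarith
  have h11 : 4 * (n * lightBound d C₁ p θ s) ≤ s := by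
    have h12 := h.n_mul_lightBound_le
    have h13 : 4 ≤ z ^ 18 := by
      linarith [h.thousand_le, le_self_pow₀ h.one_le_z (show 18 ≠ 0 by norm_num)]
    nlinarith [mul_pos hn h.lightBound_pos]
  nlinarith

/-- Descend from `s` to `i = s - l`. Each step changes `log expIndep` by at most `R`, about `log (n
/ s) - p * s.choose d`, so `expIndep ≥ exp (-l * R)` at `i`. With `s.choose l ≤ (e * s / l) ^ l` the
quotient has base about `s * n * exp (-p * s.choose d) / l ^ 2`, small beyond `nearDist`. -/
theorem mid_large (h : SparseRegime d C₁ n s p z θ β) (hE : 1 ≤ expIndep n d p s) {i : ℕ}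
    (his : i ≤ s) (hi : (1 - β) * s ≤ i)
    (hil : nearDist z (n * lightBound d C₁ p θ s) s < s - i) :
    2 * Real.log (s.choose i) - Real.log (expIndep n d p i) +
      4 * (n * lightBound d C₁ p θ s) ≤ ((s - i : ℕ) : ℝ) * (1 - Real.log z) := by
  have hz := h.z_pos
  have hs := h.s_pos
  have hn := h.n_pos
  have hβ := h.β_pos
  have hβ' := h.β_le
  have hp := h.p_pos
  have hp1 := h.p_lt_one
  have hZ := h.one_le_log_z
  have hθ0 : 0 < θ := by linarith [h.one_le_θ]
  have hψ0 := h.lightBound_pos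
  set l := s - i with hl
  have hl0 : (0 : ℝ) < l := by exact_mod_cast (by omega : 0 < l)
  set R := Real.log n - Real.log s + 1 - p * s.choose d + Real.log z / 2 with hR
  have step : ∀ j, i ≤ j → j ≤ s →
      Real.log (expIndep n d p j) ≤ Real.log (expIndep n d p i) + ((j : ℝ) - i) * R := by
    intro j hij
    induction j, hij using Nat.le_induction with
    | base => intro _; simp
    | succ j hij ih =>
      intro hjs
      have h1 := ih (by omega)
      have hjn : j < n := by have := h.s_le_n; omega
      have hjn' : (j : ℝ) < n := by exact_mod_cast hjn
      have hjs' : (j : ℝ) + 1 ≤ s := by exact_mod_cast hjs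
      have hij' : (i : ℝ) ≤ j := by exact_mod_cast hij
      have hj0 : (0 : ℝ) < (j : ℝ) + 1 := by positivity
      have hr : 0 < ((n : ℝ) - j) / (j + 1) := div_pos (by linarith) hj0
      rw [expIndep_succ hjn.le, Real.log_mul (expIndep_pos hp1 hjn.le).ne'
        (mul_pos hr (pow_pos (by linarith) _)).ne', Real.log_mul hr.ne'
        (pow_pos (by linarith) _).ne', Real.log_pow]
      have h2 : Real.log (((n : ℝ) - j) / (j + 1)) ≤ Real.log n - Real.log s + 1 := by
        have h3 : ((n : ℝ) - j) / (j + 1) ≤ n / s * 2 := by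
          rw [div_mul_eq_mul_div, div_le_div_iff₀ hj0 hs]
          have h4 : (s : ℝ) ≤ 2 * j := by nlinarith
          calc ((n : ℝ) - j) * s ≤ n * (2 * (j + 1)) := by
                gcongr <;> linarith [Nat.cast_nonneg (α := ℝ) j]
            _ = _ := by ring
        have h4 := Real.log_le_log hr h3
        rw [Real.log_mul (by positivity) (by norm_num), Real.log_div hn.ne' hs.ne'] at h4
        linarith [Real.log_two_lt_d9]
      have h3 : (j.choose d : ℝ) * Real.log (1 - p) ≤ -(p * j.choose d) := by
        have := mul_le_mul_of_nonneg_left (le_neg_log_one_sub hp1) (Nat.cast_nonneg (j.choose d))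
        linarith
      have h4 : p * s.choose d - p * j.choose d ≤ Real.log z / 2 := by
        have h5 := choose_sub_choose_le (d := d) (show j ≤ s by omega)
        have h6 : (s : ℝ) - j ≤ β * s := by linarith
        calc p * s.choose d - p * j.choose d = p * (s.choose d - j.choose d) := by ring
          _ ≤ p * (((s : ℝ) - j) * (s : ℝ) ^ (d - 1)) := by gcongr
          _ ≤ p * ((β * s) * (s : ℝ) ^ (d - 1)) := by gcongr
          _ = β * (p * (s : ℝ) ^ (d - 1 + 1)) := by ring
          _ ≤ β * θ := by
            rw [Nat.sub_add_cancel h.one_le_d]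
            have := h.mul_pow_le
            gcongr
          _ ≤ _ := by linarith [h.two_mul_θ_mul_β_le]
      push_cast
      rw [hR] at h1 ⊢
      linarith
  have h1 := step s his le_rfl
  have h2 := Real.log_nonneg hE
  have hls : (l : ℝ) = s - i := by rw [hl, Nat.cast_sub his]
  rw [← hls] at h1
  have h3 : Real.log (s.choose i) ≤ l * (1 + Real.log s - Real.log l) := by
    rw [← Nat.choose_symm his]
    exact log_choose_le_mul_one_add_log_div (by omega) (by omega)
  have hnear : (nearDist z (n * lightBound d C₁ p θ s) s : ℝ) ≤ l := by exact_mod_cast hil.le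
  have h4 : 3 * Real.log z + (Real.log n + (2 - p * s.choose d)) + Real.log s ≤
      2 * Real.log l := by
    have h5 : z ^ 3 * (n * Real.exp (2 - p * s.choose d)) * s ≤ (l : ℝ) ^ 2 := by
      have h6 : Real.exp (2 - p * s.choose d) ≤ lightBound d C₁ p θ s := by
        rw [lightBound, mul_assoc, ← Real.exp_add, ← sub_eq_add_neg]
        exact le_mul_of_one_le_left (Real.exp_pos _).le (one_le_pow₀ h.one_le_θ)
      calc _ ≤ z ^ 3 * (n * lightBound d C₁ p θ s) * s := by gcongr
        _ ≤ z ^ 3 * (1 + n * lightBound d C₁ p θ s * s) := by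
          have : 0 < z ^ 3 := by positivity
          linarith
        _ ≤ _ := h.le_sq_nearDist
        _ ≤ _ := by gcongr
    have h6 := Real.log_le_log (by positivity) h5
    rw [Real.log_mul (by positivity) hs.ne', Real.log_mul (by positivity) (by positivity),
      Real.log_mul hn.ne' (Real.exp_pos _).ne', Real.log_exp, Real.log_pow, Real.log_pow] at h6
    push_cast at h6
    linarith
  have h5 := h.four_mul_lightBound_le_nearDist
  have h6 : (l : ℝ) * (3 * Real.log z + (Real.log n + (2 - p * s.choose d)) + Real.log s) ≤
      l * (2 * Real.log l) := mul_le_mul_of_nonneg_left h4 hl0.le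
  have h7 : (l : ℝ) * 1 ≤ l * Real.log z := mul_le_mul_of_nonneg_left hZ hl0.le
  rw [hR] at h1
  nlinarith

theorem mid_term_le (h : SparseRegime d C₁ n s p z θ β) (hE : 1 ≤ expIndep n d p s) {i : ℕ}
    (his : i ≤ s) (hi : farBound z n s < i)
    (hil : nearDist z (n * lightBound d C₁ p θ s) s < s - i) :
    (s.choose i : ℝ) ^ 2 / expIndep n d p i ≤
      ((Real.exp 1 / z) ^ i + (Real.exp 1 / z) ^ (s - i) + Real.exp (-(16 * s))) *
        (meanWt d p (s.choose d) ^ (n - s)) ^ 2 := by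
  have hz := h.z_pos
  have hE0 := expIndep_pos (d := d) h.p_lt_one (his.trans h.s_le_n)
  have hc0 : (0 : ℝ) < s.choose i := by exact_mod_cast Nat.choose_pos his
  -- The term `4 * μ` buys the factor `(meanWt ^ (n - s)) ^ 2 ≥ exp (-4 * μ)`, so that plain counts
  -- can be compared with the square of the weighted mean.
  have key : ∀ y : ℝ, 2 * Real.log (s.choose i) - Real.log (expIndep n d p i) +
      4 * (n * lightBound d C₁ p θ s) ≤ y →
      (s.choose i : ℝ) ^ 2 / expIndep n d p i ≤
        Real.exp y * (meanWt d p (s.choose d) ^ (n - s)) ^ 2 := by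
    intro y hy
    have h1 : (s.choose i : ℝ) ^ 2 / expIndep n d p i ≤
        Real.exp y * Real.exp (-(2 * (n * lightBound d C₁ p θ s))) ^ 2 := by
      rw [← Real.exp_nat_mul, ← Real.exp_add, ← Real.log_le_iff_le_exp (by positivity),
        Real.log_div (by positivity) hE0.ne', Real.log_pow]
      push_cast
      linarith
    refine h1.trans ?_
    have := h.exp_le_meanWt_pow_sub
    gcongr
  have hpow : ∀ j : ℕ, Real.exp (j * (1 - Real.log z)) = (Real.exp 1 / z) ^ j := by
    intro j
    rw [Real.exp_nat_mul, Real.exp_sub, Real.exp_log hz]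
  have hnn : ∀ j : ℕ, 0 ≤ (Real.exp 1 / z) ^ j := fun j => by positivity
  have he := (Real.exp_pos (-(16 * s) : ℝ)).le
  rcases le_total (i : ℝ) (β * s) with hc | hc
  · refine (key _ (h.mid_small hi his hc)).trans ?_
    rw [hpow]
    refine mul_le_mul_of_nonneg_right ?_ (sq_nonneg _)
    linarith [hnn (s - i)]
  rcases le_total (i : ℝ) ((1 - β) * s) with hc' | hc'
  · refine (key _ (h.mid_medium hE hc hc')).trans ?_
    refine mul_le_mul_of_nonneg_right ?_ (sq_nonneg _)
    linarith [hnn (s - i), hnn i]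
  · refine (key _ (h.mid_large hE his hc' hil)).trans ?_
    rw [hpow]
    refine mul_le_mul_of_nonneg_right ?_ (sq_nonneg _)
    linarith [hnn i]

theorem sum_mid_le (h : SparseRegime d C₁ n s p z θ β) (hE : 1 ≤ expIndep n d p s) :
    ∑ i ∈ (Finset.range (s + 1)).filter (fun i => farBound z n s < i ∧
        nearDist z (n * lightBound d C₁ p θ s) s < s - i),
      ((s.choose i : ℝ) ^ 2 / expIndep n d p i) ≤
        13 / z * (meanWt d p (s.choose d) ^ (n - s)) ^ 2 := by
  have hz := h.z_pos
  set T := (Finset.range (s + 1)).filter (fun i => farBound z n s < i ∧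
        nearDist z (n * lightBound d C₁ p θ s) s < s - i) with hT
  have hmem : ∀ i ∈ T, i ≤ s ∧ farBound z n s < i ∧
      nearDist z (n * lightBound d C₁ p θ s) s < s - i := by
    intro i hi
    rw [hT, Finset.mem_filter, Finset.mem_range] at hi
    exact ⟨by omega, hi.2⟩
  refine (Finset.sum_le_sum fun i hi => h.mid_term_le hE (hmem i hi).1 (hmem i hi).2.1
    (hmem i hi).2.2).trans ?_
  rw [← Finset.sum_mul]
  refine mul_le_mul_of_nonneg_right ?_ (sq_nonneg _)
  rw [Finset.sum_add_distrib, Finset.sum_add_distrib]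
  have hr : Real.exp 1 / z ≤ 3 / z := by gcongr; linarith [Real.exp_one_lt_d9]
  have hr0 : 0 ≤ Real.exp 1 / z := by positivity
  have hr1 : Real.exp 1 / z ≤ 1 / 2 := by
    rw [div_le_div_iff₀ hz (by norm_num)]
    linarith [Real.exp_one_lt_d9, h.thousand_le]
  have h1 : ∑ i ∈ T, (Real.exp 1 / z) ^ i ≤ 2 * (Real.exp 1 / z) :=
    sum_pow_le_two_mul hr0 hr1 T fun j hj => by have := (hmem j hj).2.1; omega
  have h2 : ∑ i ∈ T, (Real.exp 1 / z) ^ (s - i) ≤ 2 * (Real.exp 1 / z) := by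
    have h3 : ∑ i ∈ T, (Real.exp 1 / z) ^ (s - i) =
        ∑ j ∈ T.image (fun i => s - i), (Real.exp 1 / z) ^ j := by
      rw [Finset.sum_image]
      intro a ha b hb hab
      have := (hmem a ha).1
      have := (hmem b hb).1
      simp only at hab
      omega
    rw [h3]
    refine sum_pow_le_two_mul hr0 hr1 _ fun j hj => ?_
    obtain ⟨i, hi, rfl⟩ := Finset.mem_image.1 hj
    have := (hmem i hi).2.2
    omega
  have h3 : ∑ _i ∈ T, Real.exp (-(16 * s) : ℝ) ≤ 1 / z := by
    rw [Finset.sum_const, nsmul_eq_mul]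
    have h4 : (T.card : ℝ) ≤ s + 1 := by
      have := Finset.card_filter_le (Finset.range (s + 1)) (fun i => farBound z n s < i ∧
        nearDist z (n * lightBound d C₁ p θ s) s < s - i)
      rw [Finset.card_range] at this
      exact_mod_cast this
    have hs1 : (1 : ℝ) ≤ s := by exact_mod_cast h.one_le_s
    have h5 : (s : ℝ) * (s + 1) ≤ Real.exp (16 * s) := by
      have h6 := Real.add_one_le_exp (s : ℝ)
      calc (s : ℝ) * (s + 1) ≤ Real.exp s * Real.exp s := by gcongr; linarith
        _ = Real.exp (s + s) := (Real.exp_add _ _).symm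
        _ ≤ _ := Real.exp_le_exp.2 (by linarith)
    calc (T.card : ℝ) * Real.exp (-(16 * s)) ≤ (s + 1) * Real.exp (-(16 * s)) := by gcongr
      _ ≤ 1 / s := by
        rw [Real.exp_neg, ← div_eq_mul_inv, div_le_div_iff₀ (Real.exp_pos _) h.s_pos]
        linarith
      _ ≤ 1 / z := by
        gcongr
        exact h.z_le_s
  have h4 : 13 / z = 4 * (3 / z) + 1 / z := by ring
  rw [h4]
  linarith

/-- In the sparse regime there is an independent set of size `s` with high probability as soon as
the expected total weight is large. -/
theorem one_sub_le_probSize (h : SparseRegime d C₁ n s p z θ β) (hW : z ≤ expWeight n d p s) :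
    1 - 36 / z ≤ probSize n d p s := by
  have hz := h.z_pos
  have hp1 := h.p_lt_one
  have hH : 0 < meanWt d p (s.choose d) := by linarith [h.half_le_meanWt]
  have hE0 := expIndep_nonneg (n := n) (d := d) hp1.le s
  have hE : 1 ≤ expIndep n d p s := by
    have h1 : expWeight n d p s ≤ expIndep n d p s :=
      mul_le_of_le_one_right hE0
        (pow_le_one₀ hH.le (meanWt_le_one h.p_pos.le hp1.le _ _))
    linarith [h.thousand_le]
  set w := (1 - p) ^ s.choose (d + 1) * meanWt d p (s.choose d) ^ (n - s) with hw
  have hw0 : 0 < w := mul_pos (pow_pos (by linarith) _) (pow_pos hH _)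
  have hnw : (n.choose s : ℝ) * w = expIndep n d p s * meanWt d p (s.choose d) ^ (n - s) := by
    rw [hw, expIndep]; ring
  have key := one_sub_le_binExp_exists_indep_of_setWt (V := Fin n) (d := d) h.p_pos.le hp1 (s := s)
    (by rw [Fintype.card_fin]; exact h.s_le_n) (C₁ := C₁)
    (l := nearDist z (n * lightBound d C₁ p θ s) s) (I := farBound z n s) h.one_le_C (w := w)
    (ε₁ := 6 / z) (ε₂ := 13 / z) (ε₃ := 8 / z) (by rw [Fintype.card_fin]) hw0 (by positivity)
    (by positivity) (by rw [div_le_one hz]; linarith [h.thousand_le])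
    (fun i hi his => by rw [Fintype.card_fin]; exact h.far_pair_le hi his)
    (by
      rw [Fintype.card_fin, ← Finset.mul_sum, hnw, mul_pow, mul_left_comm]
      exact mul_le_mul_of_nonneg_left (h.sum_mid_le hE) (sq_nonneg _))
    (fun S hS => h.binExp_setWt_mul_not_good_le S hS)
  rw [Fintype.card_fin] at key
  refine le_trans ?_ key
  have h1 : 1 / (n.choose s * w) ≤ 1 / z := by
    rw [hnw]
    exact one_div_le_one_div_of_le hz hW
  have h2 : 36 / z = 2 * (8 / z) + 6 / z + 13 / z + 1 / z := by ring
  linarith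

end SparseRegime

end

/-! ### Upper bound on the independence number in the sparse regime. -/

section

/-- Climbing from an independent set of size `a`, either size `b` is reached or some size `s` occurs
while `s + 1` does not. -/
theorem probSize_le_sum_add {n d : ℕ} {p : ℝ} (hp : 0 ≤ p) (hp' : p ≤ 1) {a b : ℕ} (hab : a ≤ b) :
    probSize n d p a ≤ ∑ s ∈ Finset.Ico a b, binExp p (edgeSpace (Fin n) d) (fun E =>
      ind ((∃ S : Finset (Fin n), Indep d E S ∧ S.card = s) ∧
        ∀ S : Finset (Fin n), Indep d E S → S.card ≠ s + 1)) + probSize n d p b := by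
  induction b, hab using Nat.le_induction with
  | base => simp
  | succ b hab ih =>
    rw [Finset.sum_Ico_succ_top hab]
    have h1 : probSize n d p b ≤ binExp p (edgeSpace (Fin n) d) (fun E =>
        ind ((∃ S : Finset (Fin n), Indep d E S ∧ S.card = b) ∧
          ∀ S : Finset (Fin n), Indep d E S → S.card ≠ b + 1)) + probSize n d p (b + 1) := by
      rw [probSize, probSize, ← binExp_add]
      refine binExp_mono hp hp' fun E _ => ?_
      refine le_trans (ind_mono fun h => ?_) (ind_or_le _ _)
      by_cases h2 : ∃ S : Finset (Fin n), Indep d E S ∧ S.card = b + 1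
      · exact Or.inr h2
      · push Not at h2
        exact Or.inl ⟨h, h2⟩
    linarith

namespace SparseRegime

variable {d C₁ n s : ℕ} {p z θ β : ℝ}

/-- A bound for the change of `probLe` and `meanWt` when up to `lightCount` vertices are added to a
set. -/
noncomputable def growthBound (d C₁ n s : ℕ) (p z θ : ℝ) : ℝ :=
  lightCount z (n * lightBound d C₁ p θ s) * (4 ^ d * θ / s * lightBound d C₁ p θ s)

theorem growthBound_nonneg (h : SparseRegime d C₁ n s p z θ β) :
    0 ≤ growthBound d C₁ n s p z θ := by
  have h1 := h.lightBound_pos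
  have h2 := h.one_le_θ
  rw [growthBound]
  positivity

/-- The left side is about `θ * z * (μ + μ ^ 2) / s`. Hence a change of `meanWt` by `growthBound`
alters its powers up to `n` only by a constant factor. -/
theorem n_mul_growthBound_le (h : SparseRegime d C₁ n s p z θ β) :
    2 * (n * growthBound d C₁ n s p z θ) ≤ 1 := by
  obtain ⟨hμa, hμb, hμs⟩ := h.lightBound_bounds
  have hz := h.z_pos
  have hs := h.s_pos
  have hm := h.lightCount_le
  have hμ0 := mul_pos h.n_pos h.lightBound_pos
  have hθ := h.one_le_θ
  set ψ := lightBound d C₁ p θ s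
  set μ := n * ψ with hμ
  have hθz : 1000 * (4 ^ d * θ) ≤ z := by
    refine le_trans ?_ (h.const_mul_θ_pow_le 1 (by omega))
    have h1 : (0 : ℝ) ≤ 4 ^ d * θ := by positivity
    nlinarith [mul_nonneg h1 (Nat.cast_nonneg (α := ℝ) C₁)]
  have e1 : 2 * (n * growthBound d C₁ n s p z θ) =
      2 * (4 ^ d * θ) * lightCount z μ * μ / s := by
    rw [growthBound, hμ]; ring
  rw [e1, div_le_one hs]
  calc 2 * (4 ^ d * θ) * lightCount z μ * μ ≤ z * (2 * (z * (μ + 1))) * μ := by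
        gcongr
        linarith [show (0 : ℝ) ≤ 4 ^ d * θ by positivity]
    _ = 2 * (z ^ 2 * μ ^ 2) + 2 * (z ^ 2 * μ) := by ring
    _ ≤ s := by linarith

theorem choose_sub_mul_probLe_le (h : SparseRegime d C₁ n s p z θ β) {r : ℕ}
    (hr : r ≤ lightCount z (n * lightBound d C₁ p θ s)) :
    ((s + r).choose d - s.choose d : ℕ) * (p * probLe p (s.choose d)) ≤
      growthBound d C₁ n s p z θ := by
  have hs := h.s_pos
  have hp := h.p_pos
  have hψ := h.probLe_le
  have hq := probLe_nonneg hp.le h.p_lt_one.le (s.choose d)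
  have hms : (lightCount z (n * lightBound d C₁ p θ s) : ℝ) ≤ s := by
    have h1 := h.pow_mul_lightCount_le
    have h2 : 1 ≤ z ^ 8 := one_le_pow₀ h.one_le_z
    nlinarith [Nat.cast_nonneg (α := ℝ) (lightCount z (n * lightBound d C₁ p θ s))]
  have hrs : r ≤ s := by exact_mod_cast (Nat.cast_le (α := ℝ).2 hr).trans hms
  have h1 : (((s + r).choose d - s.choose d : ℕ) : ℝ) ≤ r * (s + r) ^ (d - 1) := by
    have := choose_add_le_add_mul_pow s r d
    exact_mod_cast (by omega : (s + r).choose d - s.choose d ≤ r * (s + r) ^ (d - 1))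
  have hrm : (r : ℝ) ≤ lightCount z (n * lightBound d C₁ p θ s) := by exact_mod_cast hr
  have hrs' : (r : ℝ) ≤ s := by exact_mod_cast hrs
  have hps := h.mul_pow_pred_le
  have hθ := h.one_le_θ
  calc _ ≤ (r * ((s : ℝ) + r) ^ (d - 1)) * (p * lightBound d C₁ p θ s) := by gcongr
    _ ≤ (lightCount z (n * lightBound d C₁ p θ s) * ((2 : ℝ) * s) ^ (d - 1)) *
        (p * lightBound d C₁ p θ s) := by
        have := h.lightBound_pos
        gcongr
        linarith
    _ = lightCount z (n * lightBound d C₁ p θ s) * (2 ^ (d - 1) * (p * s ^ (d - 1)) *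
        lightBound d C₁ p θ s) := by rw [mul_pow]; ring
    _ ≤ lightCount z (n * lightBound d C₁ p θ s) * (4 ^ d * (θ / s) *
        lightBound d C₁ p θ s) := by
        have := h.lightBound_pos
        have h2 : (2 : ℝ) ^ (d - 1) ≤ 4 ^ d :=
          calc (2 : ℝ) ^ (d - 1) ≤ 4 ^ (d - 1) := by gcongr; norm_num
            _ ≤ 4 ^ d := pow_le_pow_right₀ (by norm_num) (Nat.sub_le d 1)
        gcongr
    _ = _ := by rw [growthBound]; ring

theorem add_growthBound_pow_le (h : SparseRegime d C₁ n s p z θ β) {k : ℕ} (hk : k ≤ n) :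
    (meanWt d p (s.choose d) + growthBound d C₁ n s p z θ) ^ k ≤
      3 * meanWt d p (s.choose d) ^ k := by
  have hh := h.half_le_meanWt
  have h0 := h.growthBound_nonneg
  have h1 := h.n_mul_growthBound_le
  set H := meanWt d p (s.choose d)
  set δ := growthBound d C₁ n s p z θ
  have h2 : H + δ ≤ Real.exp (2 * δ) * H := by
    have := Real.add_one_le_exp (2 * δ)
    nlinarith
  have hk' : (k : ℝ) ≤ n := by exact_mod_cast hk
  calc (H + δ) ^ k ≤ (Real.exp (2 * δ) * H) ^ k := by gcongr
    _ = Real.exp (k * (2 * δ)) * H ^ k := by rw [mul_pow, ← Real.exp_nat_mul]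
    _ ≤ Real.exp 1 * H ^ k := by
        gcongr
        nlinarith
    _ ≤ 3 * H ^ k := by
        gcongr
        linarith [Real.exp_one_lt_d9]

/-- Let `a = prob₁ / (d + 1)`. Up to `growthBound`, the terms with `r < m` are terms of the binomial
expansion of `(a + (1 - probLe)) ^ (n - s)`, and `a + (1 - probLe)` is `meanWt`. The cut-off term is
at most `exp (-2 * m)` and `m` exceeds `μ`, so it is below `meanWt ^ (n - s)` as well. -/
theorem binExp_indepNum_eq_le (h : SparseRegime d C₁ n s p z θ β) :
    binExp p (edgeSpace (Fin n) d) (fun E =>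
      ind ((∃ S : Finset (Fin n), Indep d E S ∧ S.card = s) ∧
        ∀ S : Finset (Fin n), Indep d E S → S.card ≠ s + 1)) ≤ 4 * expWeight n d p s := by
  have hp := h.p_pos
  have hp1 := h.p_lt_one
  have hz := h.z_pos
  have hn := h.n_pos
  set m := lightCount z (n * lightBound d C₁ p θ s) with hm
  have key := BinomialHypergraph.binExp_indepNum_eq_le (V := Fin n) (d := d) hp.le hp1.le s m
  rw [Fintype.card_fin] at key
  refine key.trans ?_
  have e1 : 4 * expWeight n d p s = n.choose s * (1 - p) ^ s.choose (d + 1) *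
      (4 * meanWt d p (s.choose d) ^ (n - s)) := by
    rw [expWeight, expIndep]; ring
  rw [e1]
  refine mul_le_mul_of_nonneg_left ?_ (expIndep_nonneg hp1.le s)
  have hq1 := prob₁_nonneg hp.le hp1.le (s.choose d)
  have hψ := h.probLe_le
  have hψ2 := h.lightBound_le_half
  have hq0 := prob₀_nonneg hp1.le (s.choose d)
  have hδ := h.growthBound_nonneg
  set a := prob₁ p (s.choose d) / (d + 1) with ha
  have ha0 : 0 ≤ a := by positivity
  have haψ : a ≤ lightBound d C₁ p θ s := by
    have h1 : a ≤ prob₁ p (s.choose d) :=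
      div_le_self hq1 (by linarith [Nat.cast_nonneg (α := ℝ) d])
    rw [probLe] at hψ
    linarith
  have b1 : ∑ r ∈ Finset.range m, ((n - s).choose r : ℝ) * a ^ r *
      (1 - prob₀ p ((s + r).choose d) - prob₁ p ((s + r).choose d)) ^ (n - s - r) ≤
      3 * meanWt d p (s.choose d) ^ (n - s) := by
    refine le_trans ?_ (h.add_growthBound_pow_le (Nat.sub_le n s))
    set g := 1 - probLe p (s.choose d) + growthBound d C₁ n s p z θ with hg
    have hg0 : 0 ≤ g := by linarith
    have e2 : meanWt d p (s.choose d) + growthBound d C₁ n s p z θ = a + g := by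
      rw [hg, ha, meanWt, probLe]; ring
    rw [e2, add_pow]
    have e3 : ∀ r ∈ Finset.range m, ((n - s).choose r : ℝ) * a ^ r *
        (1 - prob₀ p ((s + r).choose d) - prob₁ p ((s + r).choose d)) ^ (n - s - r) ≤
        a ^ r * g ^ (n - s - r) * (n - s).choose r := by
      intro r hr
      rw [Finset.mem_range] at hr
      have h1 : s.choose d ≤ (s + r).choose d := Nat.choose_le_choose d (Nat.le_add_right _ _)
      have h2 := probLe_le_add hp.le hp1.le (s.choose d) ((s + r).choose d - s.choose d)
      rw [Nat.add_sub_cancel' h1] at h2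
      have h3 := h.choose_sub_mul_probLe_le hr.le
      have h4 : probLe p ((s + r).choose d) ≤ probLe p (s.choose d) :=
        probLe_antitone hp.le hp1.le h1
      have h5 : 1 - prob₀ p ((s + r).choose d) - prob₁ p ((s + r).choose d) =
        1 - probLe p ((s + r).choose d) := by rw [probLe]; ring
      rw [h5]
      calc _ ≤ ((n - s).choose r : ℝ) * a ^ r * g ^ (n - s - r) := by
            refine mul_le_mul_of_nonneg_left ?_ (by positivity)
            refine pow_le_pow_left₀ (by linarith) ?_ _
            rw [hg]; linarith
        _ = _ := by ring
    refine (Finset.sum_le_sum e3).trans ?_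
    rw [← Finset.sum_subset (Finset.inter_subset_left : Finset.range m ∩
      Finset.range (n - s + 1) ⊆ _)]
    · exact Finset.sum_le_sum_of_subset_of_nonneg Finset.inter_subset_right
        fun _ _ _ => by positivity
    · intro r hr hr'
      rw [Finset.mem_inter, not_and] at hr'
      have := hr' hr
      rw [Finset.mem_range] at this
      rw [Nat.choose_eq_zero_of_lt (by omega), Nat.cast_zero, mul_zero]
  have b2 : ((n - s).choose m : ℝ) * a ^ m ≤ meanWt d p (s.choose d) ^ (n - s) := by
    have hzm : z * (n * lightBound d C₁ p θ s + 1) ≤ m := le_lightCount z d C₁ n s p θ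
    have hμ0 := mul_pos hn h.lightBound_pos
    set μ := n * lightBound d C₁ p θ s with hμ
    have hz1 := h.thousand_le
    have hm0 : (0 : ℝ) < m := lt_of_lt_of_le (by positivity) hzm
    have hm1 : 1 ≤ m := by exact_mod_cast hm0
    refine le_trans ?_ h.exp_le_meanWt_pow_sub
    have h1 := choose_cast_le_exp_mul_div_pow (n - s) m hm1
    have h2 : ((n - s : ℕ) : ℝ) ≤ n := by exact_mod_cast Nat.sub_le n s
    have he : Real.exp 1 * Real.exp 2 ≤ 1000 := by
      have h3 := Real.exp_one_lt_d9
      have h4 := exp_two_le_eight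
      calc Real.exp 1 * Real.exp 2 ≤ 3 * 8 := by gcongr; linarith
        _ ≤ _ := by norm_num
    calc ((n - s).choose m : ℝ) * a ^ m ≤ (Real.exp 1 * (n - s : ℕ) / m) ^ m * a ^ m := by gcongr
      _ = (Real.exp 1 * ((n - s : ℕ) * a) / m) ^ m := by rw [← mul_pow]; ring
      _ ≤ (Real.exp (-2)) ^ m := by
          refine pow_le_pow_left₀ (by positivity) ?_ m
          have h3 : ((n - s : ℕ) : ℝ) * a ≤ μ := by rw [hμ]; gcongr
          rw [div_le_iff₀ hm0, Real.exp_neg, inv_mul_eq_div, le_div_iff₀ (Real.exp_pos 2)]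
          calc Real.exp 1 * ((n - s : ℕ) * a) * Real.exp 2 ≤ Real.exp 1 * μ * Real.exp 2 := by
                gcongr
            _ = (Real.exp 1 * Real.exp 2) * μ := by ring
            _ ≤ z * (μ + 1) := by gcongr <;> linarith
            _ ≤ m := hzm
      _ = Real.exp (m * (-2)) := by rw [← Real.exp_nat_mul]
      _ ≤ Real.exp (-(2 * μ)) := Real.exp_le_exp.2 (by nlinarith)
  linarith

theorem expIndep_succ_le (h : SparseRegime d C₁ n s p z θ β) :
    expIndep n d p (s + 1) ≤ z * ((s : ℝ) / n) ^ d * expIndep n d p s := by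
  have hp1 := h.p_lt_one
  have hs := h.s_pos
  have hn := h.n_pos
  rw [expIndep_succ h.s_le_n, mul_comm]
  refine mul_le_mul_of_nonneg_right ?_ (expIndep_nonneg hp1.le s)
  have h1 : ((n : ℝ) - s) / (s + 1) ≤ n / s := by
    rw [div_le_div_iff₀ (by positivity) hs]
    nlinarith
  have h2 : (1 - p) ^ s.choose d ≤ z * ((s : ℝ) / n) ^ (d + 1) :=
    (one_sub_pow_le_exp hp1.le _).trans h.exp_le
  calc ((n : ℝ) - s) / (s + 1) * (1 - p) ^ s.choose d ≤
        n / s * (z * ((s : ℝ) / n) ^ (d + 1)) :=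
        mul_le_mul h1 h2 (pow_nonneg (by linarith) _) (by positivity)
    _ = _ := by rw [pow_succ]; field_simp

/-- The plain expectation drops by `z * (s / n) ^ d`. In the weights, the growth of `meanWt` costs a
factor 3 and the loss of one outside vertex a factor 2. -/
theorem expWeight_succ_le (h : SparseRegime d C₁ n s p z θ β) :
    expWeight n d p (s + 1) ≤ 6 * (z * ((s : ℝ) / n) ^ d) * expWeight n d p s := by
  have hp := h.p_pos
  have hp1 := h.p_lt_one
  have hz := h.z_pos
  have hh := h.half_le_meanWt
  have h1 : 1 ≤ lightCount z (n * lightBound d C₁ p θ s) := by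
    have h2 := le_lightCount z d C₁ n s p θ
    have h3 := mul_pos h.n_pos h.lightBound_pos
    have : (0 : ℝ) < lightCount z (n * lightBound d C₁ p θ s) :=
      lt_of_lt_of_le (by positivity) h2
    exact_mod_cast this
  have h2 := h.choose_sub_mul_probLe_le h1
  have h3 := meanWt_add_le hp.le hp1.le d (s.choose d) ((s + 1).choose d - s.choose d)
  rw [Nat.add_sub_cancel' (Nat.choose_le_choose d (Nat.le_succ s))] at h3
  have h4 : 0 ≤ meanWt d p ((s + 1).choose d) := by
    have h5 := one_sub_probLe_le_meanWt hp.le hp1.le d ((s + 1).choose d)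
    have h6 : probLe p ((s + 1).choose d) ≤ probLe p (s.choose d) :=
      probLe_antitone hp.le hp1.le (Nat.choose_le_choose d (Nat.le_succ s))
    linarith [h.probLe_le, h.lightBound_le_half]
  have h5 : meanWt d p ((s + 1).choose d) ^ (n - (s + 1)) ≤
      6 * meanWt d p (s.choose d) ^ (n - s) := by
    have hsn : n - s = n - (s + 1) + 1 := by
      have := h.two_mul_le; have := h.one_le_s; omega
    calc _ ≤ (meanWt d p (s.choose d) + growthBound d C₁ n s p z θ) ^ (n - (s + 1)) :=
          pow_le_pow_left₀ h4 (by linarith) _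
      _ ≤ 3 * meanWt d p (s.choose d) ^ (n - (s + 1)) :=
          h.add_growthBound_pow_le (Nat.sub_le _ _)
      _ ≤ _ := by
          rw [hsn, pow_succ]
          have : 0 ≤ meanWt d p (s.choose d) ^ (n - (s + 1)) := by positivity
          nlinarith
  have h6 := h.x_pos
  rw [expWeight, expWeight]
  calc _ ≤ (z * ((s : ℝ) / n) ^ d * expIndep n d p s) *
        (6 * meanWt d p (s.choose d) ^ (n - s)) :=
        mul_le_mul h.expIndep_succ_le h5 (by positivity)
          (mul_nonneg (by positivity) (expIndep_nonneg hp1.le s))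
    _ = _ := by ring

theorem six_mul_z_mul_le (h : SparseRegime d C₁ n s p z θ β) :
    6 * (z * ((s : ℝ) / n) ^ d) ≤ 1 / z ^ 3 := by
  have hz := h.z_pos
  have h1 : ((s : ℝ) / n) ^ d ≤ (s : ℝ) / n :=
    pow_le_of_le_one h.x_pos.le h.x_le_one (by have := h.one_le_d; omega)
  have h2 := h.pow_mul_div_le
  rw [le_div_iff₀ (by positivity)]
  have h3 : 6 ≤ z ^ 16 := by
    linarith [h.thousand_le, le_self_pow₀ h.one_le_z (show 16 ≠ 0 by norm_num)]
  calc 6 * (z * ((s : ℝ) / n) ^ d) * z ^ 3 ≤ z ^ 16 * (z * ((s : ℝ) / n)) * z ^ 3 := by gcongr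
    _ = z ^ 20 * ((s : ℝ) / n) := by ring
    _ ≤ 1 := h2

end SparseRegime

section Upper

variable {d C₁ n t : ℕ} {p z θ β : ℝ}

theorem expWeight_le_of_lt (hreg : ∀ s, t ≤ s → s ≤ 2 * t → SparseRegime d C₁ n s p z θ β)
    (hW : expWeight n d p (t + 1) ≤ z) {j : ℕ} (hj : t + 1 + j ≤ 2 * t) :
    expWeight n d p (t + 1 + j) ≤ z * (1 / z ^ 3) ^ j := by
  induction j with
  | zero => simpa using hW
  | succ j ih =>
    have h := hreg (t + 1 + j) (by omega) (by omega)
    have hz := h.z_pos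
    have h0 : 0 ≤ expWeight n d p (t + 1 + j) :=
      mul_nonneg (expIndep_nonneg h.p_lt_one.le _) (pow_nonneg (by linarith [h.half_le_meanWt]) _)
    calc expWeight n d p (t + 1 + j + 1) ≤ _ := h.expWeight_succ_le
      _ ≤ (1 / z ^ 3) * (z * (1 / z ^ 3) ^ j) :=
          mul_le_mul h.six_mul_z_mul_le (ih (by omega)) h0 (by positivity)
      _ = _ := by ring

/-- The climb through the sizes needs an end, and there the plain first moment is enough. At `t + 1`
the plain count exceeds the weighted one by at most `exp (2 * μ) ≤ exp t`; each of the following `t`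
steps gains a factor `exp 2`. -/
theorem expIndep_two_mul_succ_le
    (hreg : ∀ s, t ≤ s → s ≤ 2 * t → SparseRegime d C₁ n s p z θ β) (ht : 1 ≤ t)
    (hW : expWeight n d p (t + 1) ≤ z) : expIndep n d p (2 * t + 1) ≤ 1 / z := by
  have h := hreg (t + 1) (by omega) (by omega)
  have hz := h.z_pos
  have hz1 := h.thousand_le
  have e1 : ∀ j, t + 1 + j ≤ 2 * t + 1 →
      expIndep n d p (t + 1 + j) ≤ expIndep n d p (t + 1) * Real.exp (-2) ^ j := by
    intro j
    induction j with
    | zero => intro _; simp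
    | succ j ih =>
      intro hj
      have h' := hreg (t + 1 + j) (by omega) (by omega)
      have h0 := expIndep_nonneg (n := n) (d := d) h'.p_lt_one.le (t + 1 + j)
      have h2 : z * (((t + 1 + j : ℕ) : ℝ) / n) ^ d ≤ Real.exp (-2) := by
        have h3 := h'.six_mul_z_mul_le
        have h4 : 1 / z ^ 3 ≤ Real.exp (-2) * 6 := by
          rw [Real.exp_neg, div_le_iff₀ (by positivity)]
          have h5 : 8 ≤ z ^ 3 := by
            linarith [le_self_pow₀ h.one_le_z (show 3 ≠ 0 by norm_num)]
          have h6 : (1 : ℝ) / 8 ≤ (Real.exp 2)⁻¹ := by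
            rw [one_div]; exact inv_anti₀ (Real.exp_pos _) exp_two_le_eight
          nlinarith
        linarith
      calc expIndep n d p (t + 1 + j + 1) ≤ _ := h'.expIndep_succ_le
        _ ≤ Real.exp (-2) * (expIndep n d p (t + 1) * Real.exp (-2) ^ j) :=
            mul_le_mul h2 (ih (by omega)) h0 (Real.exp_pos _).le
        _ = _ := by ring
  have e2 := e1 t (by omega)
  rw [show t + 1 + t = 2 * t + 1 by ring] at e2
  refine e2.trans ?_
  obtain ⟨-, -, hμ⟩ := h.lightBound_bounds
  obtain ⟨hμa, -, -⟩ := h.lightBound_bounds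
  set μ := n * lightBound d C₁ p θ (t + 1) with hμdef
  have hμ0 : 0 < μ := mul_pos h.n_pos h.lightBound_pos
  have ht1 : (1 : ℝ) ≤ t := by exact_mod_cast ht
  push_cast at hμa
  have hμt : 2 * μ ≤ t := by
    have : 1 ≤ z ^ 2 := one_le_pow₀ h.one_le_z
    nlinarith
  have e3 : expIndep n d p (t + 1) ≤ z * Real.exp (2 * μ) := by
    rw [expWeight] at hW
    have h3 := h.exp_le_meanWt_pow_sub
    rw [← hμdef] at h3
    have h4 := (mul_le_mul_of_nonneg_left h3 (expIndep_nonneg h.p_lt_one.le _)).trans hW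
    rwa [Real.exp_neg, ← div_eq_mul_inv, div_le_iff₀ (Real.exp_pos _)] at h4
  have h5 : z * z ≤ Real.exp t := by
    have h6 := h.pow_le
    push_cast at h6
    have h7 : z * z ≤ z ^ 20 := by
      rw [← sq]; exact pow_le_pow_right₀ h.one_le_z (by norm_num)
    linarith [Real.add_one_le_exp (t : ℝ)]
  calc expIndep n d p (t + 1) * Real.exp (-2) ^ t ≤ z * Real.exp (2 * μ) * Real.exp (-2) ^ t := by
        gcongr
    _ = z * Real.exp (2 * μ + t * (-2)) := by rw [← Real.exp_nat_mul, Real.exp_add]; ring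
    _ ≤ z * Real.exp (-t) := by gcongr; linarith
    _ ≤ 1 / z := by
        rw [Real.exp_neg, ← div_eq_mul_inv, div_le_div_iff₀ (Real.exp_pos _) hz]
        linarith

/-- In the sparse regime there is no independent set of size `t + 2` with high probability, once
the expected total weight at size `t + 1` is small. -/
theorem probSize_add_two_le (hreg : ∀ s, t ≤ s → s ≤ 2 * t → SparseRegime d C₁ n s p z θ β)
    (ht : 1 ≤ t) (hW : expWeight n d p (t + 1) ≤ z) : probSize n d p (t + 2) ≤ 9 / z := by
  have h := hreg t le_rfl (by omega)
  have hz := h.z_pos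
  have hz1 := h.thousand_le
  have h1 := probSize_le_sum_add (n := n) (d := d) h.p_pos.le h.p_lt_one.le
    (show t + 2 ≤ 2 * t + 1 by omega)
  have h2 := (probSize_le_expIndep h.p_pos.le h.p_lt_one.le (2 * t + 1)).trans
    (expIndep_two_mul_succ_le hreg ht hW)
  have h3 : ∑ s ∈ Finset.Ico (t + 2) (2 * t + 1), binExp p (edgeSpace (Fin n) d) (fun E =>
      ind ((∃ S : Finset (Fin n), Indep d E S ∧ S.card = s) ∧
        ∀ S : Finset (Fin n), Indep d E S → S.card ≠ s + 1)) ≤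
      ∑ s ∈ Finset.Ico (t + 2) (2 * t + 1), 4 * (z * (1 / z ^ 3) ^ (s - (t + 1))) := by
    refine Finset.sum_le_sum fun s hs => ?_
    rw [Finset.mem_Ico] at hs
    refine (hreg s (by omega) (by omega)).binExp_indepNum_eq_le.trans ?_
    have h4 := expWeight_le_of_lt hreg hW (j := s - (t + 1)) (by omega)
    rw [show t + 1 + (s - (t + 1)) = s by omega] at h4
    linarith
  have h4 : ∑ s ∈ Finset.Ico (t + 2) (2 * t + 1), (1 / z ^ 3) ^ (s - (t + 1)) ≤
      2 * (1 / z ^ 3) := by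
    have h5 : ∑ s ∈ Finset.Ico (t + 2) (2 * t + 1), (1 / z ^ 3) ^ (s - (t + 1)) =
        ∑ j ∈ (Finset.Ico (t + 2) (2 * t + 1)).image (fun s => s - (t + 1)),
          (1 / z ^ 3) ^ j := by
      rw [Finset.sum_image]
      intro a ha b hb hab
      simp only [Finset.coe_Ico, Set.mem_Ico] at ha hb hab
      omega
    rw [h5]
    refine sum_pow_le_two_mul (by positivity) ?_ _ fun j hj => ?_
    · rw [div_le_div_iff₀ (by positivity) (by norm_num)]
      linarith [le_self_pow₀ h.one_le_z (show 3 ≠ 0 by norm_num)]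
    · obtain ⟨s, hs, rfl⟩ := Finset.mem_image.1 hj
      rw [Finset.mem_Ico] at hs
      omega
  rw [← Finset.mul_sum, ← Finset.mul_sum] at h3
  have h5 : 4 * (z * (2 * (1 / z ^ 3))) ≤ 8 / z := by
    rw [show 4 * (z * (2 * (1 / z ^ 3))) = 8 / z * (1 / z) by field_simp; norm_num]
    refine mul_le_of_le_one_right (by positivity) ?_
    rw [div_le_one hz]; linarith
  have h6 : 4 * (z * ∑ s ∈ Finset.Ico (t + 2) (2 * t + 1), (1 / z ^ 3) ^ (s - (t + 1))) ≤
      4 * (z * (2 * (1 / z ^ 3))) := by gcongr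
  have h7 : 9 / z = 8 / z + 1 / z := by ring
  linarith

end Upper

end

/-! ### Choice of parameters and of the size in the sparse case. -/

section

section Sparse

variable {d C₁ n : ℕ} {p a ε K : ℝ}

/-- The properties of a large number of vertices `n` on which the analysis of sparse edge
probabilities relies; the parameter `z` of `SparseRegime` is `n ^ a`, and `θ` is `K * log n`. -/
structure LargeEnough (d C₁ n : ℕ) (a ε K : ℝ) : Prop where
  one_le_d : 1 ≤ d
  one_le_C : 1 ≤ C₁
  a_pos : 0 < a
  -- That is, `20 * d * a ≤ 1 / 200`, so that `p * s ^ d ≤ 1` for all `s ≤ z ^ 20` when `p < n ^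
  -- (-1/200)`.
  a_le : 4000 * d * a ≤ 1
  two_le_C_mul : 2 + a ≤ C₁ * a
  -- For `s ≤ 2 * t ≤ 4 * (t - 1)` one has `s ^ d ≤ (4 * d) ^ d * (t - 1).choose d`; the factor `d +
  -- 1` is that of `mul_choose_pred_le_of_one_le_expIndep`.
  K_eq : K = (4 * d) ^ d * (d + 1)
  one_lt_n : (1 : ℝ) < n
  one_le_θ : 1 ≤ K * Real.log n
  const_le : 1000 * 4 ^ d * (C₁ + 1) * (K * Real.log n) ^ (2 * C₁ + 2) ≤ (n : ℝ) ^ a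
  pow_mul_le : ((n : ℝ) ^ a) ^ (20 * (d + 1)) * (K * Real.log n) ≤ (n : ℝ) ^ ε
  β_mul_le : 40 ≤ a / (2 * K) * (20 * (a * Real.log n))
  log_le : 4 ≤ a / (2 * (d + 1)) * (20 * (a * Real.log n))
  rpow_le_half : (n : ℝ) ^ (-(1 / 200) : ℝ) ≤ 1 / 2
  rpow_le_div : (n : ℝ) ^ (-(1 / 200) : ℝ) ≤ a / (4 * (d + 1))

namespace LargeEnough

theorem n_pos (h : LargeEnough d C₁ n a ε K) : (0 : ℝ) < n := by linarith [h.one_lt_n]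

theorem d_real (h : LargeEnough d C₁ n a ε K) : (1 : ℝ) ≤ d := by exact_mod_cast h.one_le_d

theorem a_le_one (h : LargeEnough d C₁ n a ε K) : 4000 * a ≤ 1 := by
  have := h.a_le; have := h.d_real; have := h.a_pos; nlinarith

theorem K_one_le (h : LargeEnough d C₁ n a ε K) : 1 ≤ K := by
  have h1 := h.d_real
  rw [h.K_eq]
  have : (1 : ℝ) ≤ (4 * d) ^ d := one_le_pow₀ (by linarith)
  nlinarith

theorem log_pos (h : LargeEnough d C₁ n a ε K) : 0 < Real.log n := Real.log_pos h.one_lt_n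

theorem two_le_log (h : LargeEnough d C₁ n a ε K) : 2 < Real.log n := by
  have h1 := h.log_le
  have h2 := h.a_le_one
  have h3 := h.a_pos
  have h4 := h.d_real
  have h5 := h.log_pos
  have h6 : a / (2 * (d + 1)) ≤ a := div_le_self h3.le (by linarith)
  have h7 : a / (2 * (d + 1)) * (20 * (a * Real.log n)) ≤ a * (20 * (a * Real.log n)) :=
    mul_le_mul_of_nonneg_right h6 (by positivity)
  have h8 : a * (20 * (a * Real.log n)) ≤ Real.log n := by
    have : a * a * 20 ≤ 1 := by nlinarith
    nlinarith
  linarith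

theorem z_pos (h : LargeEnough d C₁ n a ε K) : 0 < (n : ℝ) ^ a := Real.rpow_pos_of_pos h.n_pos _

theorem thousand_mul_le_z (h : LargeEnough d C₁ n a ε K) : 1000 * ((d : ℝ) + 1) ≤ (n : ℝ) ^ a := by
  refine le_trans ?_ h.const_le
  have h1 := SparseRegime.succ_d_le d
  have h2 : (1 : ℝ) ≤ C₁ + 1 := by linarith [Nat.cast_nonneg (α := ℝ) C₁]
  have h3 := one_le_pow₀ (n := 2 * C₁ + 2) h.one_le_θ
  calc 1000 * ((d : ℝ) + 1) = 1000 * ((d : ℝ) + 1) * 1 * 1 := by ring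
    _ ≤ _ := by gcongr

theorem log_z (h : LargeEnough d C₁ n a ε K) : Real.log ((n : ℝ) ^ a) = a * Real.log n :=
  Real.log_rpow h.n_pos a

/-- Sizes in the right range satisfy the assumptions of `SparseRegime`. -/
theorem sparseRegime (h : LargeEnough d C₁ n a ε K)
    (hp : (n : ℝ) ^ (-((d : ℝ) * (d + 1) / (d + 2)) + ε) ≤ p)
    (hp' : p < (n : ℝ) ^ (-(1 / 200) : ℝ)) {s : ℕ} (hs : ((n : ℝ) ^ a) ^ 20 ≤ s)
    (hps : p * (s : ℝ) ^ d ≤ K * Real.log n)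
    (hexp : Real.exp (-(p * s.choose d)) ≤ (n : ℝ) ^ a * ((s : ℝ) / n) ^ (d + 1)) :
    SparseRegime d C₁ n s p ((n : ℝ) ^ a) (K * Real.log n) (a / (2 * K)) := by
  have hn := h.n_pos
  have hz := h.z_pos
  have hd := h.d_real
  have ha := h.a_pos
  have hK := h.K_one_le
  have hL := h.log_pos
  have hz1 : 1 ≤ (n : ℝ) ^ a := by linarith [h.thousand_mul_le_z]
  have hp0 : 0 < p := (Real.rpow_pos_of_pos hn _).trans_le hp
  have hs0 : (0 : ℝ) < s := (pow_pos hz 20).trans_le hs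
  set z := (n : ℝ) ^ a with hzdef
  set θ := K * Real.log n with hθ
  set x := (s : ℝ) / n with hx
  have hx0 : 0 < x := div_pos hs0 hn
  have hθ1 := h.one_le_θ
  -- This is `p * s ^ d ≤ θ` with the lower bound for `p` inserted, as `d - d * (d + 1) / (d + 2) =
  -- d / (d + 2)`.
  have hmain : x ^ d * (n : ℝ) ^ ((d : ℝ) / (d + 2) + ε) ≤ θ := by
    have h1 : (s : ℝ) ^ d = x ^ d * (n : ℝ) ^ (d : ℝ) := by
      rw [Real.rpow_natCast, ← mul_pow, hx, div_mul_cancel₀ _ hn.ne']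
    have h2 : (n : ℝ) ^ ((d : ℝ) / (d + 2) + ε) =
        (n : ℝ) ^ (-((d : ℝ) * (d + 1) / (d + 2)) + ε) * (n : ℝ) ^ (d : ℝ) := by
      rw [← Real.rpow_add hn]
      congr 1
      field_simp
      ring
    calc x ^ d * (n : ℝ) ^ ((d : ℝ) / (d + 2) + ε)
        = (n : ℝ) ^ (-((d : ℝ) * (d + 1) / (d + 2)) + ε) * (s : ℝ) ^ d := by rw [h2, h1]; ring
      _ ≤ p * (s : ℝ) ^ d := by gcongr
      _ ≤ θ := hps
  have hnε : 0 < (n : ℝ) ^ ε := Real.rpow_pos_of_pos hn _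
  have hzθ : z ^ (20 * (d + 1)) * θ / (n : ℝ) ^ ε ≤ 1 := by
    rw [div_le_one hnε]; exact h.pow_mul_le
  have hxd : x ^ d ≤ θ / (n : ℝ) ^ ε / (n : ℝ) ^ ((d : ℝ) / (d + 2)) := by
    rw [div_div, le_div_iff₀ (by positivity), ← Real.rpow_add hn, add_comm ε]
    exact hmain
  have hd0 : d ≠ 0 := by have := h.one_le_d; omega
  have hzx : z ^ 20 * x ≤ 1 := by
    refine (pow_le_one_iff_of_nonneg (by positivity) hd0).1 ?_
    have h1 : (1 : ℝ) ≤ (n : ℝ) ^ ((d : ℝ) / (d + 2)) :=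
      Real.one_le_rpow h.one_lt_n.le (by positivity)
    calc (z ^ 20 * x) ^ d = z ^ (20 * d) * x ^ d := by rw [mul_pow, ← pow_mul]
      _ ≤ z ^ (20 * (d + 1)) * (θ / (n : ℝ) ^ ε) := by
          have h2 : x ^ d ≤ θ / (n : ℝ) ^ ε := hxd.trans (div_le_self (by positivity) h1)
          have h3 : z ^ (20 * d) ≤ z ^ (20 * (d + 1)) := pow_le_pow_right₀ hz1 (by omega)
          gcongr
      _ = z ^ (20 * (d + 1)) * θ / (n : ℝ) ^ ε := by ring
      _ ≤ 1 := hzθ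
  refine
    { one_le_d := h.one_le_d
      one_le_C := h.one_le_C
      p_pos := hp0
      p_le := by linarith [h.rpow_le_half]
      two_mul_le := ?_
      one_le_θ := hθ1
      const_le := h.const_le
      mul_pow_le := hps
      exp_le := hexp
      pow_mul_le := ?_
      pow_le := hs
      pow_mul_div_le := hzx
      sq_mul_le := ?_
      β_pos := by positivity
      β_le := ?_
      exp_β_le := ?_
      le_β_mul_log := ?_ }
  · have h2 : 2 ≤ z ^ 20 := by
      linarith [h.thousand_mul_le_z, le_self_pow₀ hz1 (show 20 ≠ 0 by norm_num)]
    have h3 : 2 * x ≤ 1 := le_trans (by gcongr) hzx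
    rw [hx, ← mul_div_assoc, div_le_one hn] at h3
    exact_mod_cast h3
  -- Only `x ^ d` is controlled, so the claim is raised to the power `d`; the factors `n ^ d` then
  -- cancel and the margin `n ^ ε` absorbs `z` and `θ`.
  · refine (pow_le_one_iff_of_nonneg (by positivity) hd0).1 ?_
    set y := z ^ (20 * (d + 1)) with hy
    have hy1 : 1 ≤ y := one_le_pow₀ hz1
    have h1 : ((n : ℝ) ^ ((d : ℝ) / (d + 2))) ^ (d + 2) = (n : ℝ) ^ d := by
      rw [← Real.rpow_natCast, ← Real.rpow_mul hn.le, ← Real.rpow_natCast]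
      congr 1
      push_cast
      field_simp
    calc (y * (n * x ^ (d + 2))) ^ d = y ^ d * ((n : ℝ) ^ d * (x ^ d) ^ (d + 2)) := by
          rw [mul_pow, mul_pow, ← pow_mul x, ← pow_mul x, mul_comm d]
      _ ≤ y ^ (d + 2) * ((n : ℝ) ^ d *
            (θ / (n : ℝ) ^ ε / (n : ℝ) ^ ((d : ℝ) / (d + 2))) ^ (d + 2)) := by
          have h3 : y ^ d ≤ y ^ (d + 2) := pow_le_pow_right₀ hy1 (by omega)
          gcongr
      _ = (y * θ / (n : ℝ) ^ ε) ^ (d + 2) := by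
          rw [div_pow _ ((n : ℝ) ^ ((d : ℝ) / (d + 2))), h1, mul_div_cancel₀ _ (by positivity),
            ← mul_pow, mul_div_assoc y]
      _ ≤ 1 := pow_le_one₀ (by positivity) hzθ
  · have h1 := h.two_le_C_mul
    rw [hzdef, ← Real.rpow_natCast ((n : ℝ) ^ a) C₁, ← Real.rpow_mul hn.le,
      ← Real.rpow_natCast (n : ℝ) 2, ← Real.rpow_add hn]
    exact Real.rpow_le_rpow_of_exponent_le h.one_lt_n.le (by push_cast; linarith)
  · rw [div_le_div_iff₀ (by positivity) (by norm_num)]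
    linarith [h.a_le_one]
  · rw [← Real.le_log_iff_exp_le hz, h.log_z, hθ]
    refine le_of_eq ?_
    field_simp
  · refine h.β_mul_le.trans ?_
    refine mul_le_mul_of_nonneg_left ?_ (by positivity)
    have h1 := Real.log_le_log (by positivity) hzx
    rw [Real.log_one, Real.log_mul (by positivity) hx0.ne', Real.log_pow, h.log_z, hx,
      Real.log_div hs0.ne' hn.ne'] at h1
    rw [Real.log_div hn.ne' hs0.ne']
    push_cast at h1
    linarith

theorem pow_bound (h : LargeEnough d C₁ n a ε K) (hp0 : 0 ≤ p) {t s : ℕ}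
    (ht : ((n : ℝ) ^ a) ^ 20 ≤ t) (hst : s ≤ 2 * t)
    (hpt : p * (t - 1).choose d ≤ (d + 1) * Real.log n) :
    p * (s : ℝ) ^ d ≤ K * Real.log n := by
  have hd := h.d_real
  have hz1 := h.thousand_mul_le_z
  have hzt : (n : ℝ) ^ a ≤ t := (le_self_pow₀ (by linarith) (by norm_num)).trans ht
  have hdt : d + 2 ≤ t := by
    have : (d : ℝ) + 2 ≤ t := by linarith
    exact_mod_cast this
  have h1 := div_pow_le_choose_cast (t - 1) d (by omega)
  have h2 : (s : ℝ) ≤ 4 * d * (((t - 1 : ℕ) : ℝ) / d) := by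
    rw [mul_assoc, mul_div_cancel₀ _ (by linarith)]
    exact_mod_cast (by omega : s ≤ 4 * (t - 1))
  calc p * (s : ℝ) ^ d ≤ p * (4 * d * (((t - 1 : ℕ) : ℝ) / d)) ^ d := by gcongr
    _ = (4 * d) ^ d * (p * (((t - 1 : ℕ) : ℝ) / d) ^ d) := by rw [mul_pow]; ring
    _ ≤ (4 * d) ^ d * (p * (t - 1).choose d) := by gcongr
    _ ≤ (4 * d) ^ d * ((d + 1) * Real.log n) := by gcongr
    _ = _ := by rw [h.K_eq]; ring

/-- Take the first size at which `p * s.choose d` reaches `(d + 1 - a) * log (n / s)`. The deficit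
`a` places it slightly below the critical size, so that the expected weight is still large there.
Minimality gives the upper bound at `s₀ - 1`, with `log 2 ≤ 1` paying for the shift inside the
logarithm. -/
theorem exists_start (h : LargeEnough d C₁ n a ε K) (hp0 : 0 < p)
    (hp' : p < (n : ℝ) ^ (-(1 / 200) : ℝ)) :
    ∃ s₀ : ℕ, s₀ ≤ n ∧ ((n : ℝ) ^ a) ^ 20 ≤ s₀ ∧
      ((d : ℝ) + 1 - a) * Real.log (n / s₀) ≤ p * s₀.choose d ∧
      p * (s₀ - 1).choose d ≤ ((d : ℝ) + 1 - a) * (Real.log (n / s₀) + 1) := by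
  classical
  have hn := h.n_pos
  have hd := h.d_real
  have ha := h.a_pos
  have ha1 := h.a_le_one
  have hex : ∃ s : ℕ, 1 ≤ s ∧ ((d : ℝ) + 1 - a) * Real.log (n / s) ≤ p * s.choose d := by
    refine ⟨n, by exact_mod_cast h.one_lt_n.le, ?_⟩
    rw [div_self hn.ne', Real.log_one, mul_zero]
    positivity
  set s₀ := Nat.find hex with hs₀
  obtain ⟨h1, h2⟩ := Nat.find_spec hex
  rw [← hs₀] at h1 h2
  have hs0 : (0 : ℝ) < s₀ := by exact_mod_cast h1
  have hle : s₀ ≤ n := by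
    refine Nat.find_min' hex ⟨by exact_mod_cast h.one_lt_n.le, ?_⟩
    rw [div_self hn.ne', Real.log_one, mul_zero]
    positivity
  -- For smaller sizes `p * s.choose d ≤ 1`, whereas `log (n / s)` is at least half of `log n`.
  have hbig : ((n : ℝ) ^ a) ^ 20 ≤ s₀ := by
    by_contra hcon
    push Not at hcon
    have h3 : p * s₀.choose d ≤ 1 := by
      have h4 : (s₀.choose d : ℝ) ≤ (s₀ : ℝ) ^ d := by exact_mod_cast Nat.choose_le_pow s₀ d
      calc p * s₀.choose d ≤ (n : ℝ) ^ (-(1 / 200) : ℝ) * (((n : ℝ) ^ a) ^ 20) ^ d := by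
            have := h4.trans (pow_le_pow_left₀ hs0.le hcon.le d)
            gcongr
        _ = (n : ℝ) ^ (-(1 / 200) + a * (20 * d) : ℝ) := by
            rw [← pow_mul, ← Real.rpow_natCast ((n : ℝ) ^ a), ← Real.rpow_mul hn.le,
              ← Real.rpow_add hn]
            push_cast
            rfl
        _ ≤ 1 := Real.rpow_le_one_of_one_le_of_nonpos h.one_lt_n.le (by
            have := h.a_le; linarith)
    have h4 : Real.log n / 2 ≤ Real.log (n / s₀) := by
      rw [Real.log_div hn.ne' hs0.ne']
      have h5 := Real.log_le_log hs0 hcon.le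
      rw [Real.log_pow, h.log_z] at h5
      push_cast at h5
      have := h.log_pos
      nlinarith
    have := h.two_le_log
    nlinarith
  have h2s : 2 ≤ s₀ := by
    have h3 := h.thousand_mul_le_z
    have h4 : (n : ℝ) ^ a ≤ ((n : ℝ) ^ a) ^ 20 := le_self_pow₀ (by linarith) (by norm_num)
    have : (2 : ℝ) ≤ s₀ := by linarith
    exact_mod_cast this
  refine ⟨s₀, hle, hbig, h2, ?_⟩
  have h3 := Nat.find_min hex (show s₀ - 1 < s₀ by omega)
  rw [not_and, not_le] at h3
  refine (h3 (by omega)).le.trans (mul_le_mul_of_nonneg_left ?_ (by linarith))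
  have hs1 : (0 : ℝ) < ((s₀ - 1 : ℕ) : ℝ) := by exact_mod_cast (by omega : 0 < s₀ - 1)
  have h4 : (s₀ : ℝ) ≤ 2 * ((s₀ - 1 : ℕ) : ℝ) := by exact_mod_cast (by omega : s₀ ≤ 2 * (s₀ - 1))
  have h5 := Real.log_le_log hs0 h4
  rw [Real.log_mul (by norm_num) hs1.ne'] at h5
  rw [Real.log_div hn.ne' hs1.ne', Real.log_div hn.ne' hs0.ne']
  linarith [Real.log_two_lt_d9]

/-- The left side decreases in `s` and the right side increases, so the bound at `s₀` persists. The
factor `n ^ a` covers the deficit `a`. -/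
theorem exp_bound (h : LargeEnough d C₁ n a ε K) (hp0 : 0 ≤ p) {s₀ s : ℕ} (hs₀ : 1 ≤ s₀)
    (hss : s₀ ≤ s)
    (hps : ((d : ℝ) + 1 - a) * Real.log (n / s₀) ≤ p * s₀.choose d) :
    Real.exp (-(p * s.choose d)) ≤ (n : ℝ) ^ a * ((s : ℝ) / n) ^ (d + 1) := by
  have hn := h.n_pos
  have hd := h.d_real
  have ha := h.a_pos
  have ha1 := h.a_le_one
  have hs0 : (1 : ℝ) ≤ s₀ := by exact_mod_cast hs₀
  have hss' : (s₀ : ℝ) ≤ s := by exact_mod_cast hss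
  have hs : (0 : ℝ) < s := by linarith
  rw [← Real.le_log_iff_exp_le (mul_pos h.z_pos (by positivity)),
    Real.log_mul h.z_pos.ne' (by positivity), h.log_z, Real.log_pow, Real.log_div hs.ne' hn.ne']
  have h1 : (s₀.choose d : ℝ) ≤ s.choose d := by exact_mod_cast Nat.choose_le_choose d hss
  have h2 := mul_le_mul_of_nonneg_left h1 hp0
  rw [Real.log_div hn.ne' (by linarith)] at hps
  have h3 := Real.log_le_log (by linarith) hss'
  have h4 := Real.log_nonneg hs0
  have h5 : ((d : ℝ) + 1 - a) * Real.log s₀ ≤ ((d : ℝ) + 1 - a) * Real.log s :=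
    mul_le_mul_of_nonneg_left h3 (by linarith)
  have h6 : 0 ≤ a * Real.log s := mul_nonneg ha.le (by linarith)
  push_cast
  nlinarith

/-- With `L = log (n / s₀)`, half of the deficit `a` absorbs the correction `1 + 2 * p` in `-log (1
- p)`. The other half leaves `log expIndep ≥ 2 * s₀`, since `a * L / (2 * (d + 1)) ≥ 4`. The weights
cost at most `exp (2 * μ) ≤ exp s₀`. -/
theorem le_expWeight_start (h : LargeEnough d C₁ n a ε K) {s₀ : ℕ}
    (hp' : p < (n : ℝ) ^ (-(1 / 200) : ℝ))
    (hreg : SparseRegime d C₁ n s₀ p ((n : ℝ) ^ a) (K * Real.log n) (a / (2 * K)))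
    (hps : p * (s₀ - 1).choose d ≤ ((d : ℝ) + 1 - a) * (Real.log (n / s₀) + 1)) :
    (n : ℝ) ^ a ≤ expWeight n d p s₀ := by
  have hn := h.n_pos
  have hd := h.d_real
  have ha := h.a_pos
  have ha1 := h.a_le_one
  have hz := h.z_pos
  have hs := hreg.s_pos
  have hp0 := hreg.p_pos
  have hL : 20 * (a * Real.log n) ≤ Real.log (n / s₀) := by
    have h1 := Real.log_le_log (mul_pos (pow_pos hz 20) hreg.x_pos) hreg.pow_mul_div_le
    rw [Real.log_one, Real.log_mul (by positivity) hreg.x_pos.ne', Real.log_pow, h.log_z,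
      Real.log_div hs.ne' hn.ne'] at h1
    rw [Real.log_div hn.ne' hs.ne']
    push_cast at h1
    linarith
  set L := Real.log (n / s₀) with hLdef
  have hL4 : 4 ≤ a / (2 * (d + 1)) * L :=
    h.log_le.trans (mul_le_mul_of_nonneg_left hL (by positivity))
  have hL0 : 0 < L := by
    have := h.log_pos
    have : 0 < 20 * (a * Real.log n) := by positivity
    linarith
  have h1 : (s₀.choose (d + 1) : ℝ) * -Real.log (1 - p) ≤
      s₀ * ((1 - a / (2 * (d + 1))) * (L + 1)) := by
    have h2 := neg_log_one_sub_le hp0.le hreg.p_le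
    have h3 : ((d : ℝ) + 1) * s₀.choose (d + 1) = s₀ * (s₀ - 1).choose d := by
      exact_mod_cast succ_mul_choose_succ_eq (d := d) s₀ hreg.one_le_s
    have h4 : (s₀.choose (d + 1) : ℝ) * -Real.log (1 - p) ≤
        s₀.choose (d + 1) * (p * (1 + 2 * p)) :=
      mul_le_mul_of_nonneg_left h2 (Nat.cast_nonneg _)
    refine h4.trans ?_
    have hv : 2 * p ≤ a / (2 * (d + 1)) := by
      have h5 := h.rpow_le_div
      have h6 : a / (2 * ((d : ℝ) + 1)) = 2 * (a / (4 * (d + 1))) := by field_simp; ring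
      linarith
    have hd1 : (0 : ℝ) < d + 1 := by positivity
    refine le_of_mul_le_mul_left ?_ hd1
    calc ((d : ℝ) + 1) * (s₀.choose (d + 1) * (p * (1 + 2 * p)))
        = s₀ * ((p * (s₀ - 1).choose d) * (1 + 2 * p)) := by linear_combination (p * (1 + 2 * p)) * h3
      _ ≤ s₀ * ((((d : ℝ) + 1 - a) * (L + 1)) * (1 + a / (2 * (d + 1)))) := by
          have h7 : 0 ≤ ((d : ℝ) + 1 - a) * (L + 1) :=
            mul_nonneg (by linarith) (by linarith)
          gcongr
      _ = s₀ * (((d : ℝ) + 1) * ((1 - a / (2 * (d + 1))) * (L + 1))) -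
          s₀ * ((L + 1) * (a ^ 2 / (2 * (d + 1)))) := by field_simp; ring
      _ ≤ _ := by
          have h8 : 0 ≤ s₀ * ((L + 1) * (a ^ 2 / (2 * ((d : ℝ) + 1)))) := by positivity
          linarith
  have h2 := mul_log_div_le_log_choose hreg.s_le_n
  have h3 : 2 * (s₀ : ℝ) ≤ Real.log (expIndep n d p s₀) := by
    rw [log_expIndep hreg.p_lt_one hreg.s_le_n]
    have h4 : (s₀ : ℝ) * ((1 - a / (2 * (d + 1))) * (L + 1)) ≤ s₀ * (L - 3 + 1) := by
      refine mul_le_mul_of_nonneg_left ?_ hs.le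
      have : 0 < a / (2 * ((d : ℝ) + 1)) := by positivity
      nlinarith
    rw [← hLdef] at h2
    linarith
  have hE := expIndep_pos (d := d) hreg.p_lt_one hreg.s_le_n
  obtain ⟨-, -, hμ⟩ := hreg.lightBound_bounds
  have h4 := hreg.exp_le_meanWt_pow_sub
  rw [Real.le_log_iff_exp_le hE] at h3
  have h5 := hreg.z_le_s
  calc (n : ℝ) ^ a ≤ s₀ + 1 := by linarith
    _ ≤ Real.exp s₀ := Real.add_one_le_exp _
    _ ≤ Real.exp (2 * s₀ + -(2 * (n * lightBound d C₁ p (K * Real.log n) s₀))) :=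
        Real.exp_le_exp.2 (by linarith)
    _ = Real.exp (2 * s₀) * Real.exp (-(2 * (n * lightBound d C₁ p (K * Real.log n) s₀))) :=
        Real.exp_add _ _
    _ ≤ _ := by rw [expWeight]; gcongr

theorem expWeight_le_expIndep (hp0 : 0 ≤ p) (hp1 : p ≤ 1) (n d s : ℕ) :
    expWeight n d p s ≤ expIndep n d p s := by
  refine mul_le_of_le_one_right (expIndep_nonneg hp1 s)
    (pow_le_one₀ ?_ (meanWt_le_one hp0 hp1 _ _))
  have h1 := one_sub_probLe_le_meanWt hp0 hp1 d (s.choose d)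
  have h2 := probLe_antitone hp0 hp1 (Nat.zero_le (s.choose d))
  have h3 : probLe p 0 = 1 := by simp [probLe, prob₀, prob₁]
  linarith

theorem exists_two_point (h : LargeEnough d C₁ n a ε K)
    (hp : (n : ℝ) ^ (-((d : ℝ) * (d + 1) / (d + 2)) + ε) ≤ p)
    (hp' : p < (n : ℝ) ^ (-(1 / 200) : ℝ)) :
    ∃ t : ℕ, 1 - 36 / (n : ℝ) ^ a ≤ probSize n d p t ∧
      probSize n d p (t + 2) ≤ 9 / (n : ℝ) ^ a := by
  classical
  have hn := h.n_pos
  have hz := h.z_pos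
  have hz1 := h.thousand_mul_le_z
  have hd := h.d_real
  have ha := h.a_pos
  have hp0 : 0 < p := (Real.rpow_pos_of_pos hn _).trans_le hp
  have hp1 : p < 1 := by linarith [h.rpow_le_half]
  obtain ⟨s₀, hs₀n, hs₀z, hs₀1, hs₀2⟩ := h.exists_start hp0 hp'
  have hs₀pos : 1 ≤ s₀ := by
    have : (0 : ℝ) < s₀ := (pow_pos hz 20).trans_le hs₀z
    exact_mod_cast this
  have hs₀p : p * (s₀ - 1).choose d ≤ (d + 1) * Real.log n := by
    refine hs₀2.trans ?_
    have h1 : Real.log (n / s₀) + 1 ≤ Real.log n := by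
      have hs0 : (0 : ℝ) < s₀ := by exact_mod_cast hs₀pos
      rw [Real.log_div hn.ne' hs0.ne']
      have h2 : 1 ≤ Real.log s₀ := by
        rw [Real.le_log_iff_exp_le hs0]
        have : (n : ℝ) ^ a ≤ ((n : ℝ) ^ a) ^ 20 := le_self_pow₀ (by linarith) (by norm_num)
        linarith [Real.exp_one_lt_d9]
      linarith
    exact mul_le_mul (by linarith) h1 (by
      have : 0 ≤ Real.log ((n : ℝ) / s₀) := by
        refine Real.log_nonneg ?_
        rw [one_le_div (by exact_mod_cast hs₀pos)]
        exact_mod_cast hs₀n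
      linarith) (by linarith)
  have reg : ∀ t s : ℕ, s₀ ≤ t → t ≤ s → s ≤ 2 * t → s ≤ n →
      p * (t - 1).choose d ≤ (d + 1) * Real.log n →
      SparseRegime d C₁ n s p ((n : ℝ) ^ a) (K * Real.log n) (a / (2 * K)) := by
    intro t s hst hts hs2 hsn hpt
    have h1 : (s₀ : ℝ) ≤ t := by exact_mod_cast hst
    have h2 : (t : ℝ) ≤ s := by exact_mod_cast hts
    exact h.sparseRegime hp hp' (hs₀z.trans (h1.trans h2))
      (h.pow_bound hp0.le (hs₀z.trans h1) hs2 hpt)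
      (h.exp_bound hp0.le hs₀pos (hst.trans hts) hs₀1)
  have hW₀ : (n : ℝ) ^ a ≤ expWeight n d p s₀ :=
    h.le_expWeight_start hp' (reg s₀ s₀ le_rfl le_rfl (by omega) hs₀n hs₀p) hs₀2
  have hnW : s₀ ≤ n ∧ expWeight n d p (n + 1) < (n : ℝ) ^ a := by
    refine ⟨hs₀n, ?_⟩
    rw [expWeight, expIndep, Nat.choose_eq_zero_of_lt (Nat.lt_succ_self n)]
    simpa using hz
  have hex : ∃ t, s₀ ≤ t ∧ expWeight n d p (t + 1) < (n : ℝ) ^ a := ⟨n, hnW⟩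
  -- The first size from `s₀` on whose successor has expected weight below `z`; minimality, or `hW₀`
  -- if `t = s₀`, gives weight at least `z` at `t` itself.
  set t := Nat.find hex with ht
  obtain ⟨ht1, ht2⟩ := Nat.find_spec hex
  rw [← ht] at ht1 ht2
  have htn : t ≤ n := Nat.find_min' hex hnW
  have htW : (n : ℝ) ^ a ≤ expWeight n d p t := by
    rcases ht1.eq_or_lt with h1 | h1
    · rwa [← h1]
    · have h2 := Nat.find_min hex (show t - 1 < t by omega)
      rw [not_and, not_lt, Nat.sub_add_cancel (by omega)] at h2
      exact h2 (by omega)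
  have hE : 1 ≤ expIndep n d p t := by
    have := expWeight_le_expIndep hp0.le hp1.le n d t
    linarith
  have htp := mul_choose_pred_le_of_one_le_expIndep hp1 htn (by omega) hE
  have hregt := reg t t ht1 le_rfl (by omega) htn htp
  refine ⟨t, hregt.one_sub_le_probSize htW, ?_⟩
  have := hregt.two_mul_le
  exact probSize_add_two_le (fun s hs hs' => reg t s ht1 hs hs' (by omega) htp) (by omega) ht2.le

end LargeEnough

theorem eventually_largeEnough (d : ℕ) (hd : 1 ≤ d) (ε : ℝ) (hε : 0 < ε) :
    ∃ (C₁ : ℕ) (a K : ℝ), 0 < a ∧ ∀ᶠ n : ℕ in atTop, LargeEnough d C₁ n a ε K := by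
  have hd0 : (1 : ℝ) ≤ d := by exact_mod_cast hd
  -- The second bound makes `z ^ (20 * (d + 1))` at most `n ^ (ε / 2)`, leaving another `n ^ (ε /
  -- 2)` for the logarithm.
  set a : ℝ := min (1 / (4000 * d)) (ε / (40 * (d + 1))) with ha
  have ha0 : 0 < a := lt_min (by positivity) (by positivity)
  have ha1 : 4000 * d * a ≤ 1 := by
    have : a ≤ 1 / (4000 * d) := min_le_left _ _
    rwa [le_div_iff₀ (by positivity), mul_comm] at this
  have ha2 : 40 * (d + 1) * a ≤ ε := by
    have : a ≤ ε / (40 * (d + 1)) := min_le_right _ _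
    rwa [le_div_iff₀ (by positivity), mul_comm] at this
  set C₁ : ℕ := ⌈2 / a⌉₊ + 1 with hC
  have hC1 : 2 + a ≤ C₁ * a := by
    have h1 : 2 / a ≤ ⌈2 / a⌉₊ := Nat.le_ceil _
    rw [div_le_iff₀ ha0] at h1
    rw [hC]; push_cast; linarith
  set K : ℝ := (4 * d) ^ d * (d + 1) with hK
  have hK0 : 0 < K := by positivity
  refine ⟨C₁, a, K, ha0, ?_⟩
  have hlim : Tendsto (fun n : ℕ => (n : ℝ)) atTop atTop := tendsto_natCast_atTop_atTop
  have hlog : Tendsto (fun n : ℕ => Real.log n) atTop atTop := Real.tendsto_log_atTop.comp hlim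
  have e1 : ∀ᶠ n : ℕ in atTop, (1 : ℝ) < n := hlim.eventually_gt_atTop 1
  have e2 : ∀ᶠ n : ℕ in atTop, 1 ≤ K * Real.log n :=
    (hlog.const_mul_atTop hK0).eventually_ge_atTop 1
  have poly : ∀ (c b : ℝ) (j : ℕ), 0 < c → 0 < b →
      ∀ᶠ n : ℕ in atTop, c * (K * Real.log n) ^ j ≤ (n : ℝ) ^ b := by
    intro c b j hc hb
    have h1 := (isLittleO_log_rpow_rpow_atTop (j : ℝ) hb).def
      (show (0 : ℝ) < 1 / (c * K ^ j) by positivity)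
    filter_upwards [hlim.eventually h1, e1] with n hn hn1
    have hl := Real.log_pos hn1
    rw [Real.norm_of_nonneg (by positivity), Real.norm_of_nonneg (by positivity),
      Real.rpow_natCast, div_mul_eq_mul_div, one_mul, le_div_iff₀ (by positivity)] at hn
    rw [mul_pow]
    linarith
  have e3 := poly (1000 * 4 ^ d * (C₁ + 1)) a (2 * C₁ + 2) (by positivity) ha0
  have e4 := poly 1 (ε / 2) 1 one_pos (by positivity)
  have e5 : ∀ᶠ n : ℕ in atTop, 40 ≤ a / (2 * K) * (20 * (a * Real.log n)) := by
    have h1 : (0 : ℝ) < a / (2 * K) * (20 * a) := by positivity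
    filter_upwards [(hlog.const_mul_atTop h1).eventually_ge_atTop 40] with n hn
    linarith
  have e6 : ∀ᶠ n : ℕ in atTop, 4 ≤ a / (2 * (d + 1)) * (20 * (a * Real.log n)) := by
    have h1 : (0 : ℝ) < a / (2 * (d + 1)) * (20 * a) := by positivity
    filter_upwards [(hlog.const_mul_atTop h1).eventually_ge_atTop 4] with n hn
    linarith
  have e7 : ∀ c : ℝ, 0 < c → ∀ᶠ n : ℕ in atTop, (n : ℝ) ^ (-(1 / 200) : ℝ) ≤ c := by
    intro c hc
    have h1 := (tendsto_rpow_neg_atTop (show (0 : ℝ) < 1 / 200 by norm_num)).comp hlim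
    exact h1.eventually (eventually_le_nhds hc)
  filter_upwards [e1, e2, e3, e4, e5, e6, e7 (1 / 2) (by norm_num),
    e7 (a / (4 * (d + 1))) (by positivity)] with n h1 h2 h3 h4 h5 h6 h7 h8
  have hn0 : (0 : ℝ) < n := by linarith
  refine ⟨hd, by omega, ha0, ha1, hC1, rfl, h1, h2, h3, ?_, h5, h6, h7, h8⟩
  rw [one_mul, pow_one] at h4
  have h9 : ((n : ℝ) ^ a) ^ (20 * (d + 1)) ≤ (n : ℝ) ^ (ε / 2) := by
    rw [← Real.rpow_natCast ((n : ℝ) ^ a), ← Real.rpow_mul hn0.le]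
    refine Real.rpow_le_rpow_of_exponent_le h1.le ?_
    push_cast
    linarith
  calc _ ≤ (n : ℝ) ^ (ε / 2) * (n : ℝ) ^ (ε / 2) := by gcongr
    _ = (n : ℝ) ^ ε := by rw [← Real.rpow_add hn0]; ring_nf

theorem eventually_sparse_two_point (d : ℕ) (hd : 1 ≤ d) (ε : ℝ) (hε : 0 < ε) (η : ℝ)
    (hη : 0 < η) :
    ∀ᶠ n : ℕ in atTop, ∀ p : ℝ, (n : ℝ) ^ (-((d : ℝ) * (d + 1) / (d + 2)) + ε) ≤ p →
      p < (n : ℝ) ^ (-(1 / 200) : ℝ) →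
      ∃ t : ℕ, 1 - η ≤ probSize n d p t ∧ probSize n d p (t + 2) ≤ η := by
  obtain ⟨C₁, a, K, ha, hL⟩ := eventually_largeEnough d hd ε hε
  have hlim : Tendsto (fun n : ℕ => (n : ℝ)) atTop atTop := tendsto_natCast_atTop_atTop
  have e1 : ∀ᶠ n : ℕ in atTop, 36 / η ≤ (n : ℝ) ^ a :=
    ((tendsto_rpow_atTop ha).comp hlim).eventually_ge_atTop _
  filter_upwards [hL, e1] with n h1 h2 p hp hp'
  obtain ⟨t, ht1, ht2⟩ := h1.exists_two_point hp hp'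
  have hz := h1.z_pos
  rw [div_le_iff₀ hη] at h2
  have h3 : 36 / (n : ℝ) ^ a ≤ η := by rw [div_le_iff₀ hz]; linarith
  have h4 : 9 / (n : ℝ) ^ a ≤ 36 / (n : ℝ) ^ a := by gcongr; norm_num
  exact ⟨t, by linarith, by linarith⟩

end Sparse

end

/-! ### Assembly: from two-point estimates to a sequence `t`. -/

section

theorem eventually_two_point (d : ℕ) (hd : 1 ≤ d) (ε : ℝ) (hε : 0 < ε) (η : ℝ) (hη : 0 < η) :
    ∀ᶠ n : ℕ in atTop, ∀ p : ℝ, (n : ℝ) ^ (-((d : ℝ) * (d + 1) / (d + 2)) + ε) ≤ p → p < 1 →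
      ∃ t : ℕ, 1 - η ≤ probSize n d p t ∧ probSize n d p (t + 2) ≤ η := by
  filter_upwards [eventually_sparse_two_point d hd ε hε η hη,
    eventually_dense_two_point d hd η hη] with n h1 h2 p hp hp'
  rcases lt_or_ge p ((n : ℝ) ^ (-(1 / 200) : ℝ)) with h | h
  · exact h1 p hp h
  · exact h2 p h hp'

theorem probSize_sub_le_binomialHypergraphProb {n d : ℕ} {p : ℝ} (hp : 0 ≤ p) (hp' : p ≤ 1)
    (t : ℕ) :
    probSize n d p t - probSize n d p (t + 2) ≤
      binomialHypergraphProb n (d + 1) p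
        {H | H.weakIndepNum (d + 1) ∈ Set.Ico t (t + 2)} := by
  rw [binomialHypergraphProb_eq, sub_le_iff_le_add, probSize, probSize, ← binExp_add]
  refine binExp_mono hp hp' fun E hE => ?_
  refine le_trans (ind_mono fun h => ?_) (ind_or_le _ _)
  rw [← le_weakIndepNum_iff hE] at h ⊢
  rw [Set.mem_Ico]
  omega

theorem binomialHypergraphProb_le_one {n d : ℕ} {p : ℝ} (hp : 0 ≤ p) (hp' : p ≤ 1)
    (P : Hypergraph (Fin n) → Prop) : binomialHypergraphProb n (d + 1) p {H | P H} ≤ 1 := by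
  rw [binomialHypergraphProb_eq]
  refine (binExp_mono hp hp' (g := fun _ => 1) fun E _ => ind_le_one _).trans (le_of_eq ?_)
  exact binExp_const _

/-- The estimates give a value of `t` depending on `η`. Choosing `t n` within `1 / (n + 1)` of the
supremum over all values yields one sequence that serves every `η`. -/
theorem tendsto_of_forall_eventually_exists {f : ℕ → ℕ → ℝ} (hf : ∀ᶠ n in atTop, ∀ t, f n t ≤ 1)
    (h : ∀ η > 0, ∀ᶠ n in atTop, ∃ t, 1 - η ≤ f n t) :
    ∃ t : ℕ → ℕ, Tendsto (fun n => f n (t n)) atTop (𝓝 1) := by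
  have hex : ∀ n, ∃ t, (∀ t', f n t' ≤ 1) → ∀ t', f n t' - 1 / ((n : ℝ) + 1) ≤ f n t := by
    intro n
    by_cases hn : ∀ t', f n t' ≤ 1
    · have hb : BddAbove (Set.range (f n)) := ⟨1, by rintro _ ⟨t, rfl⟩; exact hn t⟩
      have hpos : (0 : ℝ) < 1 / ((n : ℝ) + 1) := by positivity
      obtain ⟨t, ht⟩ := exists_lt_of_lt_ciSup
        (show (⨆ t, f n t) - 1 / ((n : ℝ) + 1) < ⨆ t, f n t by linarith)
      exact ⟨t, fun _ t' => by linarith [le_ciSup hb t']⟩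
    -- For the `n` without the bound 1 any value will do.
    · exact ⟨0, fun h => absurd h hn⟩
  choose t ht using hex
  refine ⟨t, ?_⟩
  rw [tendsto_order]
  refine ⟨fun a ha => ?_, fun a ha => ?_⟩
  · have h1 : ∀ᶠ n : ℕ in atTop, 1 / ((n : ℝ) + 1) < (1 - a) / 2 :=
      (tendsto_one_div_add_atTop_nhds_zero_nat (𝕜 := ℝ)).eventually_lt_const (by linarith)
    filter_upwards [hf, h ((1 - a) / 2) (by linarith), h1] with n hn h2 h3
    obtain ⟨t', ht'⟩ := h2
    linarith [ht n hn t']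
  · filter_upwards [hf] with n hn
    exact (hn _).trans_lt ha

theorem exists_tendsto_binomialHypergraphProb (d : ℕ) (hd : 1 ≤ d) (ε : ℝ) (hε : 0 < ε)
    (p : ℕ → ℝ) (hp01 : ∀ᶠ n : ℕ in atTop, p n ∈ Set.Ioo (0 : ℝ) 1)
    (hp : ∀ᶠ n : ℕ in atTop, (n : ℝ) ^ (-((d : ℝ) * (d + 1) / (d + 2)) + ε) ≤ p n) :
    ∃ t : ℕ → ℕ, Tendsto (fun n => binomialHypergraphProb n (d + 1) (p n)
      {H | H.weakIndepNum (d + 1) ∈ Set.Ico (t n) (t n + 2)}) atTop (𝓝 1) := by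
  refine tendsto_of_forall_eventually_exists (f := fun n t => binomialHypergraphProb n (d + 1) (p n)
    {H | H.weakIndepNum (d + 1) ∈ Set.Ico t (t + 2)}) ?_ fun η hη => ?_
  · filter_upwards [hp01] with n hn t
    exact binomialHypergraphProb_le_one hn.1.le hn.2.le _
  · filter_upwards [hp01, hp, eventually_two_point d hd ε hε (η / 2) (by positivity)]
      with n h1 h2 h3
    obtain ⟨t, ht1, ht2⟩ := h3 (p n) h2 h1.2
    refine ⟨t, le_trans ?_ (probSize_sub_le_binomialHypergraphProb h1.1.le h1.2.le t)⟩
    linarith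

end

end BinomialHypergraph

theorem mainTheorem1 (k : ℕ) (hk : 2 ≤ k) (ε : ℝ) (hε : 0 < ε) (p : ℕ → ℝ)
    (hp01 : ∀ᶠ n : ℕ in atTop, p n ∈ Set.Ioo (0 : ℝ) 1)
    (hp : ∀ᶠ n : ℕ in atTop, (n : ℝ) ^ (-(((k : ℝ) - 1) * (k : ℝ) / ((k : ℝ) + 1)) + ε) ≤ p n) :
    IsConcentratedOnValues k p (fun _ H => H.weakIndepNum k) (fun _ => 2) := by
  obtain ⟨d, rfl⟩ : ∃ d, k = d + 1 := ⟨k - 1, by omega⟩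
  refine BinomialHypergraph.exists_tendsto_binomialHypergraphProb d (by omega) ε hε p hp01 ?_
  filter_upwards [hp] with n hn
  have h1 : (((d + 1 : ℕ) : ℝ) - 1) * ((d + 1 : ℕ) : ℝ) / (((d + 1 : ℕ) : ℝ) + 1) =
      (d : ℝ) * (d + 1) / (d + 2) := by
    push_cast
    congr 1 <;> ring
  rwa [h1] at hn
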